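/- Let $m,\ell\ge 1$ be integers with $N=m+\ell\ge 3$, let $\gamma\ge 0$ be real, write $z=(x,y)\in\mathbb R^m\times\mathbb R^\ell=\mathbb R^N$, and put $N_\gamma=m+(1+\gamma)\ell$. Let $\Delta_\gamma=\Delta_x+|x|^{2\gamma}\Delta_y$ be the Grushin operator, $\nabla_\gamma u=(\nabla_x u,|x|^\gamma\nabla_y u)$ the Grushin gradient (in the weak sense), and $d(z)=(|x|^{2(\gamma+1)}+|y|^2)^{1/(2(\gamma+1))}$ the Grushin distance. Let $H^1_\gamma(\mathbb R^N)$ be the space of all $u\in L^2(\mathbb R^N)$ with $\nabla_\gamma u\in L^2(\mathbb R^N)$, normed by $\|u\|_\gamma^2=\int_{\mathbb R^N}(|\nabla_\gamma u|^2+|u|^2)\,dz$, and let $H_{\mathrm{rad}}$ be its subspace of functions that are radial separately in $x$ and in $y$, i.e. that depend only on $(|x|,|y|)$. Let $0<\mu<N_\gamma$ and let $p$ satisfy $$\frac{N_\gamma-2}{2N_\gamma-\mu}<\frac1p<\frac{N_\gamma}{2N_\gamma-\mu}.$$ Then the energy $$\mathcal E_\gamma(u)=\frac12\int_{\mathbb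 R^N}\left(|\nabla_\gamma u|^2+|u|^2\right)dz-\frac1{2p}\int_{\mathbb R^N}(d^{-\mu}*|u|^p)\,|u|^p\,dz$$ is finite (its integrals converge absolutely) for every $u\in H^1_\gamma(\mathbb R^N)$, and the Grushin–Choquard equation $$-\Delta_\gamma u+u=(d^{-\mu}*|u|^p)\,|u|^{p-2}u\quad\text{in }\mathbb R^N$$ has a nontrivial weak solution $u\in H^1_\gamma(\mathbb R^N)$, that is, $u\neq0$ and $$\int_{\mathbb R^N}\left(\nabla_\gamma u\cdot\nabla_\gamma v+uv\right)dz-\int_{\mathbb R^N}(d^{-\mu}*|u|^p)\,|u|^{p-2}uv\,dz=0\quad\text{for every }v\in H^1_\gamma(\mathbb R^N)$$ (the convolution being finite almost everywhere and the integrals absolutely convergent). Moreover, $u$ can be chosen as a mountain-pass critical point of $\mathcal E_\gamma$ in $H_{\mathrm{rad}}$ which is a critical point on the whole space: there are $R>0$, $a>0$ and $v_0\in H_{\mathrm{rad}}$ with $\mathcal E_\gamma(w)\ge a$ for all $w\in H_{\mathrm{rad}}$ with $\|w\|_\gamma=R$, $\|v_0\|_\gamma>R$ and $\mathcal E_\gamma(v_0)<0$,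 such that $u\in H_{\mathrm{rad}}$, the Fréchet derivative of $\mathcal E_\gamma:H^1_\gamma(\mathbb R^N)\to\mathbb R$ at $u$ exists and is $0$, and $$\mathcal E_\gamma(u)=\inf_{\sigma}\max_{t\in[0,1]}\mathcal E_\gamma(\sigma(t))\ge a,$$ where $\sigma$ runs over the continuous paths $[0,1]\to H_{\mathrm{rad}}$ with $\sigma(0)=0$ and $\sigma(1)=v_0$. -/

import Mathlib

open MeasureTheory Filter Topology
open scoped ENNReal NNReal ContDiff

noncomputable section

namespace Grushin

/-- The space `ℝ^N = ℝ^m × ℝ^ℓ`, with points `z = (x, y)`. Both factors carry the Euclidean norm,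
and `volume` is Lebesgue measure on the product. (The norm of the product is never used.) -/
abbrev Pt (m ℓ : ℕ) : Type := EuclideanSpace ℝ (Fin m) × EuclideanSpace ℝ (Fin ℓ)

/-- The space `ℝ^m × ℝ^ℓ` with the Euclidean norm, in which Grushin gradients take their values. -/
abbrev Vec (m ℓ : ℕ) : Type :=
  WithLp 2 (EuclideanSpace ℝ (Fin m) × EuclideanSpace ℝ (Fin ℓ))

/-- The homogeneous dimension `N_γ = m + (1 + γ) ℓ`. -/
def homDim (m ℓ : ℕ) (γ : ℝ≥0) : ℝ := m + (1 + γ) * ℓ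

/-- The Grushin distance `d(z) = (|x|^{2(γ+1)} + |y|^2)^{1/(2(γ+1))}` (of `z` from the origin). -/
def gauge {m ℓ : ℕ} (γ : ℝ≥0) (z : Pt m ℓ) : ℝ :=
  (‖z.1‖ ^ (2 * ((γ : ℝ) + 1)) + ‖z.2‖ ^ 2) ^ (1 / (2 * ((γ : ℝ) + 1)))

/-- The vector field `X_i = ∂/∂x_i`, applied to a smooth function. -/
def derivX {m ℓ : ℕ} (i : Fin m) (φ : Pt m ℓ → ℝ) (z : Pt m ℓ) : ℝ :=
  fderiv ℝ φ z (EuclideanSpace.single i 1, 0)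

/-- The vector field `X_{m+j} = |x|^γ ∂/∂y_j`, applied to a smooth function. -/
def derivY {m ℓ : ℕ} (γ : ℝ≥0) (j : Fin ℓ) (φ : Pt m ℓ → ℝ) (z : Pt m ℓ) : ℝ :=
  ‖z.1‖ ^ (γ : ℝ) * fderiv ℝ φ z (0, EuclideanSpace.single j 1)

/-- `G` is the weak (distributional) Grushin gradient `(∇_x u, |x|^γ ∇_y u)` of `u`: the fields
`X_1, …, X_N` are formally skew-adjoint, because the weight `|x|^γ` does not depend on `y`. -/
def IsWeakGrad {m ℓ : ℕ} (γ : ℝ≥0) (u : Pt m ℓ → ℝ) (G : Pt m ℓ → Vec m ℓ) : Prop :=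
  ∀ φ : Pt m ℓ → ℝ, ContDiff ℝ ∞ φ → HasCompactSupport φ →
    (∀ i : Fin m, ∫ z, u z * derivX i φ z = - ∫ z, (G z).fst i * φ z) ∧
    (∀ j : Fin ℓ, ∫ z, u z * derivY γ j φ z = - ∫ z, (G z).snd j * φ z)

theorem memLp_test {m ℓ : ℕ} {f : Pt m ℓ → ℝ} (hc : Continuous f) (hs : HasCompactSupport f) :
    MemLp f 2 (volume : Measure (Pt m ℓ)) :=
  hc.memLp_of_hasCompactSupport hs

theorem memLp_derivX {m ℓ : ℕ} (i : Fin m) {φ : Pt m ℓ → ℝ} (h : ContDiff ℝ ∞ φ)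
    (hs : HasCompactSupport φ) : MemLp (derivX i φ) 2 (volume : Measure (Pt m ℓ)) := by
  refine memLp_test ?_ ?_
  · exact (h.continuous_fderiv (by simp)).clm_apply continuous_const
  · exact hs.fderiv_apply (𝕜 := ℝ) _

theorem memLp_derivY {m ℓ : ℕ} (γ : ℝ≥0) (j : Fin ℓ) {φ : Pt m ℓ → ℝ}
    (h : ContDiff ℝ ∞ φ) (hs : HasCompactSupport φ) :
    MemLp (derivY γ j φ) 2 (volume : Measure (Pt m ℓ)) := by
  refine memLp_test ?_ ?_
  · exact (continuous_fst.norm.rpow_const fun _ => Or.inr γ.2).mul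
      ((h.continuous_fderiv (by simp)).clm_apply continuous_const)
  · exact (hs.fderiv_apply (𝕜 := ℝ) _).mul_left

theorem memLp_fst {m ℓ : ℕ} (G : Lp (Vec m ℓ) 2 (volume : Measure (Pt m ℓ))) (i : Fin m) :
    MemLp (fun z => (G z).fst i) 2 (volume : Measure (Pt m ℓ)) := by
  let L : Vec m ℓ →L[ℝ] ℝ := (EuclideanSpace.proj (𝕜 := ℝ) i).comp (WithLp.fstL 2 ℝ _ _)
  exact L.comp_memLp' (Lp.memLp G)

theorem memLp_snd {m ℓ : ℕ} (G : Lp (Vec m ℓ) 2 (volume : Measure (Pt m ℓ))) (j : Fin ℓ) :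
    MemLp (fun z => (G z).snd j) 2 (volume : Measure (Pt m ℓ)) := by
  let L : Vec m ℓ →L[ℝ] ℝ := (EuclideanSpace.proj (𝕜 := ℝ) j).comp (WithLp.sndL 2 ℝ _ _)
  exact L.comp_memLp' (Lp.memLp G)

theorem integral_pair_add {m ℓ : ℕ} {f g h φ : Pt m ℓ → ℝ}
    (hf : MemLp f 2 (volume : Measure (Pt m ℓ))) (hg : MemLp g 2 (volume : Measure (Pt m ℓ)))
    (hφ : MemLp φ 2 (volume : Measure (Pt m ℓ))) (hh : h =ᵐ[volume] f + g) :
    ∫ z, h z * φ z = (∫ z, f z * φ z) + ∫ z, g z * φ z := by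
  refine Eq.trans ?_ (integral_add (hf.integrable_mul hφ) (hg.integrable_mul hφ))
  refine integral_congr_ae ?_
  filter_upwards [hh] with z hz
  simp [hz, add_mul]

/-- The Grushin-Sobolev space `H^1_γ(ℝ^N)`: all `u ∈ L^2` whose weak Grushin gradient `∇_γ u` is
in `L^2`. An element is the pair `(u, ∇_γ u)`, in which the second entry is determined by the
first. The inner product and the norm are those that the Hilbert sum `L^2 ⊕ L^2` induces, that is,
`(u, v)_γ = ∫ (∇_γ u · ∇_γ v + u v)` and `‖u‖_γ^2 = ∫ (|∇_γ u|^2 + |u|^2)`. -/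
def H1 (m ℓ : ℕ) (γ : ℝ≥0) : Submodule ℝ
    (WithLp 2 (Lp ℝ 2 (volume : Measure (Pt m ℓ)) × Lp (Vec m ℓ) 2 (volume : Measure (Pt m ℓ))))
    where
  carrier := {U | IsWeakGrad γ U.fst U.snd}
  zero_mem' := by
    intro φ _ _
    have h1 := Lp.coeFn_zero ℝ 2 (volume : Measure (Pt m ℓ))
    have h2 := Lp.coeFn_zero (Vec m ℓ) 2 (volume : Measure (Pt m ℓ))
    have e1 (f : Pt m ℓ → ℝ) : ∫ z, (0 : Lp ℝ 2 (volume : Measure (Pt m ℓ))) z * f z = 0 := by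
      refine integral_eq_zero_of_ae ?_
      filter_upwards [h1] with z hz
      rw [hz]
      simp
    refine ⟨fun i => (e1 _).trans ?_, fun j => (e1 _).trans ?_⟩
    all_goals
      refine (neg_eq_zero.2 (integral_eq_zero_of_ae ?_)).symm
      filter_upwards [h2] with z hz
      rw [WithLp.zero_snd, hz]
      simp
  add_mem' := by
    intro U V hU hV φ hφ hs
    have h1 := Lp.coeFn_add U.fst V.fst
    have h2 := Lp.coeFn_add U.snd V.snd
    have hφ2 := memLp_test hφ.continuous hs
    refine ⟨fun i => ?_, fun j => ?_⟩
    · have e2 := integral_pair_add (memLp_fst U.snd i) (memLp_fst V.snd i) hφ2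
        (h := fun z => ((U + V).snd z).fst i) (by
          filter_upwards [h2] with z hz
          rw [WithLp.add_snd, hz]
          rfl)
      have e1 := integral_pair_add (Lp.memLp U.fst) (Lp.memLp V.fst) (memLp_derivX i hφ hs) h1
      have hu := (hU φ hφ hs).1 i
      have hv := (hV φ hφ hs).1 i
      rw [e2, WithLp.add_fst, e1, hu, hv]
      ring
    · have e2 := integral_pair_add (memLp_snd U.snd j) (memLp_snd V.snd j) hφ2
        (h := fun z => ((U + V).snd z).snd j) (by
          filter_upwards [h2] with z hz
          rw [WithLp.add_snd, hz]
          rfl)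
      have e1 := integral_pair_add (Lp.memLp U.fst) (Lp.memLp V.fst) (memLp_derivY γ j hφ hs) h1
      have hu := (hU φ hφ hs).2 j
      have hv := (hV φ hφ hs).2 j
      rw [e2, WithLp.add_fst, e1, hu, hv]
      ring
  smul_mem' := by
    intro c U hU φ hφ hs
    have h1 := Lp.coeFn_smul c U.fst
    have h2 := Lp.coeFn_smul c U.snd
    have e1 (f : Pt m ℓ → ℝ) : ∫ z, (c • U).fst z * f z = c * ∫ z, U.fst z * f z := by
      rw [← integral_const_mul]
      refine integral_congr_ae ?_
      filter_upwards [h1] with z hz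
      simp [hz, mul_assoc]
    refine ⟨fun i => ?_, fun j => ?_⟩
    · have e2 : ∫ z, ((c • U).snd z).fst i * φ z = c * ∫ z, (U.snd z).fst i * φ z := by
        rw [← integral_const_mul]
        refine integral_congr_ae ?_
        filter_upwards [h2] with z hz
        simp [hz, mul_assoc]
      rw [e1, e2, (hU φ hφ hs).1 i]
      ring
    · have e2 : ∫ z, ((c • U).snd z).snd j * φ z = c * ∫ z, (U.snd z).snd j * φ z := by
        rw [← integral_const_mul]
        refine integral_congr_ae ?_
        filter_upwards [h2] with z hz
        simp [hz, mul_assoc]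
      rw [e1, e2, (hU φ hφ hs).2 j]
      ring

variable {m ℓ : ℕ} {γ : ℝ≥0}

/-- The function `u` underlying an element of `H^1_γ(ℝ^N)`. -/
def H1.fn (u : H1 m ℓ γ) : Pt m ℓ → ℝ := u.1.fst

/-- The weak Grushin gradient `∇_γ u` of an element of `H^1_γ(ℝ^N)`. -/
def H1.grad (u : H1 m ℓ γ) : Pt m ℓ → Vec m ℓ := u.1.snd

/-- The subspace of the functions in `H^1_γ(ℝ^N)` that are radial separately in `x` and in `y`:
`u(x, y) = f(|x|, |y|)` almost everywhere. -/
def H1rad (m ℓ : ℕ) (γ : ℝ≥0) : Submodule ℝ (H1 m ℓ γ) where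
  carrier := {u | ∃ f : ℝ → ℝ → ℝ, ∀ᵐ z : Pt m ℓ, H1.fn u z = f ‖z.1‖ ‖z.2‖}
  zero_mem' := by
    refine ⟨fun _ _ => 0, ?_⟩
    filter_upwards [Lp.coeFn_zero ℝ 2 (volume : Measure (Pt m ℓ))] with z hz
    exact hz
  add_mem' := by
    rintro u v ⟨f, hf⟩ ⟨g, hg⟩
    refine ⟨fun s t => f s t + g s t, ?_⟩
    filter_upwards [hf, hg, Lp.coeFn_add u.1.fst v.1.fst] with z h1 h2 h3
    rw [← h1, ← h2]
    simpa [H1.fn] using h3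
  smul_mem' := by
    rintro c u ⟨f, hf⟩
    refine ⟨fun s t => c * f s t, ?_⟩
    filter_upwards [hf, Lp.coeFn_smul c u.1.fst] with z h1 h2
    rw [← h1]
    simpa [H1.fn] using h2

/-- The convolution `(d^{-μ} ∗ |u|^p)(z) = ∫ d(z - w)^{-μ} |u(w)|^p dw`. -/
def choquard (γ : ℝ≥0) (μ p : ℝ) (u : Pt m ℓ → ℝ) (z : Pt m ℓ) : ℝ :=
  ∫ w, gauge γ (z - w) ^ (-μ) * |u w| ^ p

/-- The energy
`E_γ(u) = 1/2 ∫ (|∇_γ u|^2 + |u|^2) dz - 1/(2p) ∫ (d^{-μ} ∗ |u|^p) |u|^p dz`. -/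
def energy (μ p : ℝ) (u : H1 m ℓ γ) : ℝ :=
  1 / 2 * (∫ z, (‖H1.grad u z‖ ^ 2 + |H1.fn u z| ^ 2)) -
    1 / (2 * p) * ∫ z, choquard γ μ p (H1.fn u) z * |H1.fn u z| ^ p

/-- All integrals in `E_γ(u)` converge absolutely. (The quadratic part does on all of `H^1_γ`.) -/
def FiniteEnergy (μ p : ℝ) (u : H1 m ℓ γ) : Prop :=
  Integrable (fun q : Pt m ℓ × Pt m ℓ =>
    gauge γ (q.1 - q.2) ^ (-μ) * |H1.fn u q.2| ^ p * |H1.fn u q.1| ^ p)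

/-- `u` is a weak solution of `-Δ_γ u + u = (d^{-μ} ∗ |u|^p) |u|^{p-2} u` in `ℝ^N`: the right side
is well defined, and the equation holds when it is tested with any `v ∈ H^1_γ(ℝ^N)`. -/
def IsWeakSolution (μ p : ℝ) (u : H1 m ℓ γ) : Prop :=
  (∀ᵐ z : Pt m ℓ, Integrable fun w => gauge γ (z - w) ^ (-μ) * |H1.fn u w| ^ p) ∧
  ∀ v : H1 m ℓ γ,
    Integrable (fun z =>
      choquard γ μ p (H1.fn u) z * |H1.fn u z| ^ (p - 2) * H1.fn u z * H1.fn v z) ∧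
    (∫ z, (inner ℝ (H1.grad u z) (H1.grad v z) + H1.fn u z * H1.fn v z)) -
      (∫ z, choquard γ μ p (H1.fn u) z * |H1.fn u z| ^ (p - 2) * H1.fn u z * H1.fn v z) = 0

/-- `c = inf_σ max_{t ∈ [0,1]} E_γ(σ(t))`, where `σ` runs over the continuous paths from `0` to `v`
in the space of functions that are radial separately in `x` and in `y`. -/
def IsMountainPassLevel (μ p : ℝ) (v : H1rad m ℓ γ) (c : ℝ) : Prop :=
  IsGLB {M : ℝ | ∃ σ : Path (0 : H1rad m ℓ γ) v,
    IsGreatest (Set.range fun t => energy μ p (σ t : H1 m ℓ γ)) M} c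

end Grushin

end

open MeasureTheory Filter Topology
open scoped ENNReal NNReal ContDiff

noncomputable section

namespace Grushin

variable {m ℓ : ℕ} {γ : ℝ≥0}

/-! ### Hölder and Young inequalities -/

/-! Write $Q = N_\gamma$, $D(u)=\int(d^{-\mu}*|u|^p)|u|^p$, and let $N(u)$ be the Riesz
representative of $\varphi\mapsto\int(d^{-\mu}*|u|^p)|u|^{p-2}u\varphi$, so that $D'(u)=2p\langle
N(u),\cdot\rangle$. The solution is a multiple of a minimiser of $\|u\|^2$ among invariant $u$ with
$D(u)=1$.

Analytic input. Since $p$ is strictly inside its range, the Hardy-Littlewood-Sobolev inequality is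
not needed: $d^{-\mu}$ is cut at $d=1$, and each piece is treated by Young's inequality with its own
exponent (`exists_exps`, `Exps.double_le`). The subcritical Sobolev embedding comes from
translations. An $L^2$ weak derivative along $\rho\,\partial_e$ bounds the $L^2$ norm of
$\rho(u(\cdot+te)-u)$ by a multiple of $|t|$, and conversely. Hence shifts inside the box
$|x|<\tau$, $|y|<\tau^{1+\gamma}$ cost at most $7\tau\|u\|$ (`H1.eLpNorm_shift_le`). Averages over
these boxes are therefore close to $u$ in $L^2$, and they are bounded pointwise. Interpolating
between dyadic scales gives convergence in $L^q$ at a geometric rate exactly in the subcritical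
range (`exists_eLpNorm_dyadic_sub_le`). The same averages yield local compactness and a
non-vanishing lemma, and the difference quotients show that $|u|$ has norm at most $\|u\|$.

Minimisation. Let $I>0$ be the infimum. As $N$ commutes with symmetries, $u_n-I\,N(u_n)$ is an
invariant variation, and testing with it shows that it tends to $0$ along a minimising sequence
(`Model.Minimizing.tendsto_residual`). This also makes constrained criticality hold on the whole
space. The map $N$ is weakly continuous (`Exps.tendsto_inner_nonlin`), so a weak limit $v$ satisfies
$I\,N(v)=v$, whence $\|v\|^2=I\,D(v)$. If $v\ne0$, weak lower semicontinuity gives $D(v)\le1$, while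
$I\,D(v)^{1/p}\le\|v\|^2$ gives $D(v)\ge1$; so $v$ is a minimiser (`Model.Minimizing.extremal`).

Non-vanishing provides balls of fixed radius and centres $z_n$ on which $u_n$ keeps a fixed mass;
$v\ne0$ follows once $z_n$ is bounded. In a factor of dimension at least two, rotations would create
arbitrarily many disjoint copies of a distant ball. If $\gamma>0$, far out in $x$ the large weight
makes $u_n$ almost constant in $y$, and translates in $y$ give the copies. What remains is $\ell=1$
in the direction of $y$, and $m=1$, $\gamma=0$ in the direction of $x$. There invariance alone gives
no compactness, but translations are symmetries (`Direction`).

In such a direction, escape is excluded by comparison (`Direction.not_tendsto_atTop`). The recentred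
sequence has a weak limit $v\ne0$ with $\|v\|^2=I\,D(v)$, and reflection produces a second bump far
away, so $2\|v\|^2\le I$. Let $a$ be a suitable translate of $|v|$ and $b$ its reflection. Then
$M=\max(a,b)$ and $m=\min(a,b)$ are invariant and nonzero, $\|M\|^2+\|m\|^2\le2\|v\|^2$ and
$D(M)+D(m)\ge2D(v)$. Since $2D(v)\le1$, this contradicts $I\,D^{1/p}\le\|\cdot\|^2$ for $M$ and $m$,
because $s<s^{1/p}$ for $0<s<1$.

Mountain pass. Scale the minimiser to $u$ with $N(u)=u$. On the sphere of radius $R=\|u\|$ in the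
invariant subspace the energy is at least that of $u$; every admissible path meets this sphere, and
the energy on the segment through $u$ has its maximum at $u$. So the level is exactly the energy of
$u$ (`Exps.Extremal.mountain_pass`). -/

theorem eLpNorm_ofReal_eq {α : Type*} [MeasurableSpace α] {ν : Measure α} {f : α → ℝ} {t : ℝ}
    (ht : 0 < t) :
    eLpNorm f (ENNReal.ofReal t) ν = (∫⁻ z, ‖f z‖ₑ ^ t ∂ν) ^ (1 / t) := by
  rw [eLpNorm_eq_lintegral_rpow_enorm_toReal (by simpa using ht) ENNReal.ofReal_ne_top,
    ENNReal.toReal_ofReal ht.le]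

theorem enorm_abs_rpow (x : ℝ) {r : ℝ} (hr : 0 ≤ r) : ‖|x| ^ r‖ₑ = ‖x‖ₑ ^ r := by
  rw [Real.enorm_rpow_of_nonneg (abs_nonneg x) hr, ← Real.norm_eq_abs, enorm_norm]

/-- Hölder with weights $r/p$ and $(p-r)/p$. Every nonlinear expression met later is dominated by
such a product of total degree $p$, so one estimate serves them all. -/
theorem eLpNorm_rpow_mul_rpow_le {α : Type*} [MeasurableSpace α] {ν : Measure α} {f g : α → ℝ}
    (hf : AEStronglyMeasurable f ν) (hg : AEStronglyMeasurable g ν) {p r t : ℝ} (hp : 0 < p)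
    (hr : 0 ≤ r) (hrp : r ≤ p) (ht : 0 < t) :
    eLpNorm (fun z => |f z| ^ r * |g z| ^ (p - r)) (ENNReal.ofReal t) ν ≤
      eLpNorm f (ENNReal.ofReal (p * t)) ν ^ r * eLpNorm g (ENNReal.ofReal (p * t)) ν ^ (p - r) := by
  have hpt : 0 < p * t := by positivity
  have hpr : 0 ≤ p - r := by linarith
  rw [eLpNorm_ofReal_eq ht, eLpNorm_ofReal_eq hpt, eLpNorm_ofReal_eq hpt]
  have key := ENNReal.lintegral_mul_norm_pow_le (μ := ν)
    (f := fun z => ‖f z‖ₑ ^ (p * t)) (g := fun z => ‖g z‖ₑ ^ (p * t))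
    (hf.enorm.pow_const _) (hg.enorm.pow_const _) (p := r / p) (q := (p - r) / p)
    (by positivity) (by positivity) (by field_simp; ring)
  have e : ∀ z, ‖|f z| ^ r * |g z| ^ (p - r)‖ₑ ^ t
      = (‖f z‖ₑ ^ (p * t)) ^ (r / p) * (‖g z‖ₑ ^ (p * t)) ^ ((p - r) / p) := by
    intro z
    rw [enorm_mul, enorm_abs_rpow _ hr, enorm_abs_rpow _ hpr,
      ENNReal.mul_rpow_of_nonneg _ _ ht.le, ← ENNReal.rpow_mul, ← ENNReal.rpow_mul,
      ← ENNReal.rpow_mul, ← ENNReal.rpow_mul]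
    congr 2 <;> field_simp
  simp_rw [e]
  refine (ENNReal.rpow_le_rpow key (by positivity)).trans (le_of_eq ?_)
  rw [ENNReal.mul_rpow_of_nonneg _ _ (by positivity), ← ENNReal.rpow_mul, ← ENNReal.rpow_mul,
    ← ENNReal.rpow_mul, ← ENNReal.rpow_mul]
  congr 2 <;> field_simp

/-- Three-factor Hölder for $\kappa fg=(\kappa^af^t)^{1-1/t}(\kappa^ag^t)^{1-1/t}(f^tg^t)^{1-1/a}$.
The relation `hat` says that the weights add up to one, and by invariance of the measure each of the
three double integrals factors. -/
theorem lintegral_young {E : Type*} [MeasurableSpace E] [AddCommGroup E] [MeasurableAdd₂ E]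
    [MeasurableNeg E] [MeasurableSub₂ E] (ν : Measure E) [SFinite ν] [ν.IsAddLeftInvariant]
    [ν.IsAddRightInvariant] [ν.IsNegInvariant]
    {κ f g : E → ℝ≥0∞} (hκ : Measurable κ) (hf : AEMeasurable f ν) (hg : AEMeasurable g ν)
    {a t : ℝ} (ha : 1 ≤ a) (ht : 1 ≤ t) (hat : 1 / a + 2 / t = 2) :
    ∫⁻ q : E × E, κ (q.1 - q.2) * f q.2 * g q.1 ∂(ν.prod ν) ≤
      (∫⁻ z, κ z ^ a ∂ν) ^ (1 / a) * ((∫⁻ z, f z ^ t ∂ν) ^ (1 / t) * (∫⁻ z, g z ^ t ∂ν) ^ (1 / t)) := by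
  have ha0 : 0 < a := by linarith
  have ht0 : 0 < t := by linarith
  have hw1 : 0 ≤ 1 - 1 / t := by
    rw [sub_nonneg, div_le_one ht0]; exact ht
  have hw2 : 0 ≤ 1 - 1 / a := by
    rw [sub_nonneg, div_le_one ha0]; exact ha
  have h2t : 2 / t = 2 * (1 / t) := by ring
  have hm1 : AEMeasurable (fun q : E × E => f q.2) (ν.prod ν) :=
    hf.comp_quasiMeasurePreserving Measure.quasiMeasurePreserving_snd
  have hm2 : AEMeasurable (fun q : E × E => g q.1) (ν.prod ν) :=
    hg.comp_quasiMeasurePreserving Measure.quasiMeasurePreserving_fst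
  have hm0 : AEMeasurable (fun q : E × E => κ (q.1 - q.2)) (ν.prod ν) :=
    (hκ.comp (measurable_fst.sub measurable_snd)).aemeasurable
  let F : Fin 3 → E × E → ℝ≥0∞ := ![fun q => κ (q.1 - q.2) ^ a * f q.2 ^ t,
    fun q => κ (q.1 - q.2) ^ a * g q.1 ^ t, fun q => g q.1 ^ t * f q.2 ^ t]
  let w : Fin 3 → ℝ := ![1 - 1 / t, 1 - 1 / t, 1 - 1 / a]
  have key := ENNReal.lintegral_prod_norm_pow_le (μ := ν.prod ν) (Finset.univ : Finset (Fin 3))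
    (f := F) (p := w)
    (by
      intro i _
      fin_cases i
      · exact (hm0.pow_const _).mul (hm1.pow_const _)
      · exact (hm0.pow_const _).mul (hm2.pow_const _)
      · exact (hm2.pow_const _).mul (hm1.pow_const _))
    (by simp [Fin.sum_univ_three, w]; field_simp at hat ⊢; linarith)
    (by
      intro i _
      fin_cases i
      · exact hw1
      · exact hw1
      · exact hw2)
  rw [Fin.prod_univ_three] at key
  have i0 : ∫⁻ q, F 0 q ∂(ν.prod ν) = (∫⁻ z, κ z ^ a ∂ν) * ∫⁻ z, f z ^ t ∂ν := by
    change ∫⁻ q : E × E, ((fun q : E × E => κ (q.1 - q.2) ^ a) *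
      fun q : E × E => f q.2 ^ t) q ∂(ν.prod ν) = _
    rw [lintegral_prod_symm _ ((hm0.pow_const _).mul (hm1.pow_const _))]
    have : ∀ y, ∫⁻ x, κ (x - y) ^ a * f y ^ t ∂ν = (∫⁻ z, κ z ^ a ∂ν) * f y ^ t := by
      intro y
      rw [lintegral_mul_const _ (show Measurable fun x => κ (x - y) ^ a from
        (hκ.comp (measurable_id.sub_const y)).pow_const _)]
      congr 1
      exact lintegral_sub_right_eq_self (fun x => κ x ^ a) y
    simp only [Pi.mul_apply]
    simp_rw [this]
    rw [lintegral_const_mul'' _ (hf.pow_const _)]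
  have i1 : ∫⁻ q, F 1 q ∂(ν.prod ν) = (∫⁻ z, κ z ^ a ∂ν) * ∫⁻ z, g z ^ t ∂ν := by
    change ∫⁻ q : E × E, ((fun q : E × E => κ (q.1 - q.2) ^ a) *
      fun q : E × E => g q.1 ^ t) q ∂(ν.prod ν) = _
    rw [lintegral_prod _ ((hm0.pow_const _).mul (hm2.pow_const _))]
    have : ∀ x, ∫⁻ y, κ (x - y) ^ a * g x ^ t ∂ν = (∫⁻ z, κ z ^ a ∂ν) * g x ^ t := by
      intro x
      rw [lintegral_mul_const _ (show Measurable fun y => κ (x - y) ^ a from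
        (hκ.comp (measurable_id.const_sub x)).pow_const _)]
      congr 1
      exact lintegral_sub_left_eq_self (fun x => κ x ^ a) x
    simp only [Pi.mul_apply]
    simp_rw [this]
    rw [lintegral_const_mul'' _ (hg.pow_const _)]
  have i2 : ∫⁻ q, F 2 q ∂(ν.prod ν) = (∫⁻ z, g z ^ t ∂ν) * ∫⁻ z, f z ^ t ∂ν := by
    exact lintegral_prod_mul (hg.pow_const _) (hf.pow_const _)
  rw [i0, i1, i2] at key
  simp only [w, Matrix.cons_val_zero, Matrix.cons_val_one, Matrix.cons_val] at key
  have e1 : ∀ X : ℝ≥0∞, (X ^ a) ^ (1 - 1 / t) * (X ^ a) ^ (1 - 1 / t) = X := by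
    intro X
    rw [← ENNReal.rpow_add_of_nonneg _ _ hw1 hw1, ← ENNReal.rpow_mul]
    have : a * (1 - 1 / t + (1 - 1 / t)) = 1 := by
      have : 1 - 1 / t + (1 - 1 / t) = 1 / a := by linarith
      rw [this]; field_simp
    rw [this, ENNReal.rpow_one]
  have e2 : ∀ X : ℝ≥0∞, (X ^ t) ^ (1 - 1 / t) * (X ^ t) ^ (1 - 1 / a) = X := by
    intro X
    rw [← ENNReal.rpow_add_of_nonneg _ _ hw1 hw2, ← ENNReal.rpow_mul]
    have : t * (1 - 1 / t + (1 - 1 / a)) = 1 := by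
      have : 1 - 1 / t + (1 - 1 / a) = 1 / t := by linarith
      rw [this]; field_simp
    rw [this, ENNReal.rpow_one]
  have e1' : ∀ X : ℝ≥0∞, X ^ (1 - 1 / t) * X ^ (1 - 1 / t) = X ^ (1 / a) := by
    intro X
    rw [← ENNReal.rpow_add_of_nonneg _ _ hw1 hw1]
    congr 1; linarith
  have e2' : ∀ X : ℝ≥0∞, X ^ (1 - 1 / t) * X ^ (1 - 1 / a) = X ^ (1 / t) := by
    intro X
    rw [← ENNReal.rpow_add_of_nonneg _ _ hw1 hw2]
    congr 1; linarith
  refine le_trans (le_of_eq ?_) (key.trans (le_of_eq ?_))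
  · refine lintegral_congr fun q => ?_
    rw [Fin.prod_univ_three]
    simp only [F, Matrix.cons_val_zero, Matrix.cons_val_one, Matrix.cons_val]
    rw [ENNReal.mul_rpow_of_nonneg _ _ hw1, ENNReal.mul_rpow_of_nonneg _ _ hw1,
      ENNReal.mul_rpow_of_nonneg _ _ hw2]
    conv_lhs => rw [← e1 (κ (q.1 - q.2)), ← e2 (f q.2), ← e2 (g q.1)]
    ring
  · rw [ENNReal.mul_rpow_of_nonneg _ _ hw1, ENNReal.mul_rpow_of_nonneg _ _ hw1,
      ENNReal.mul_rpow_of_nonneg _ _ hw2, ← e1' (∫⁻ z, κ z ^ a ∂ν), ← e2' (∫⁻ z, f z ^ t ∂ν),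
      ← e2' (∫⁻ z, g z ^ t ∂ν)]
    ring

/-! ### The gauge -/

theorem gauge_nonneg (z : Pt m ℓ) : 0 ≤ gauge γ z := by
  unfold gauge; positivity

theorem gauge_neg (z : Pt m ℓ) : gauge γ (-z) = gauge γ z := by
  simp [gauge]

theorem gauge_sub_comm (z w : Pt m ℓ) : gauge γ (z - w) = gauge γ (w - z) := by
  rw [← gauge_neg, neg_sub]

theorem norm_fst_le_gauge (z : Pt m ℓ) : ‖z.1‖ ≤ gauge γ z := by
  have h : 0 < 2 * ((γ : ℝ) + 1) := by positivity
  calc ‖z.1‖ = (‖z.1‖ ^ (2 * ((γ : ℝ) + 1))) ^ (1 / (2 * ((γ : ℝ) + 1))) := by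
        rw [← Real.rpow_mul (norm_nonneg _), mul_one_div_cancel h.ne', Real.rpow_one]
    _ ≤ _ := by
        unfold gauge
        gcongr
        nlinarith [sq_nonneg ‖z.2‖]

theorem gauge_rpow (z : Pt m ℓ) :
    gauge γ z ^ (2 * ((γ : ℝ) + 1)) = ‖z.1‖ ^ (2 * ((γ : ℝ) + 1)) + ‖z.2‖ ^ 2 := by
  have h : 0 < 2 * ((γ : ℝ) + 1) := by positivity
  rw [gauge, ← Real.rpow_mul (by positivity), one_div_mul_cancel h.ne', Real.rpow_one]

theorem norm_snd_le_gauge (z : Pt m ℓ) : ‖z.2‖ ≤ gauge γ z ^ (1 + (γ : ℝ)) := by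
  refine le_of_sq_le_sq ?_ (Real.rpow_nonneg (gauge_nonneg z) _)
  rw [← Real.rpow_natCast (gauge γ z ^ (1 + (γ : ℝ))), ← Real.rpow_mul (gauge_nonneg z)]
  have : (1 + (γ : ℝ)) * ((2 : ℕ) : ℝ) = 2 * ((γ : ℝ) + 1) := by push_cast; ring
  rw [this, gauge_rpow]
  have : 0 ≤ ‖z.1‖ ^ (2 * ((γ : ℝ) + 1)) := by positivity
  linarith

theorem gauge_pos {z : Pt m ℓ} (hz : z ≠ 0) : 0 < gauge γ z := by
  rcases (gauge_nonneg (γ := γ) z).eq_or_lt with h | h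
  · exfalso
    apply hz
    have h1 := norm_fst_le_gauge (γ := γ) z
    have h2 := norm_snd_le_gauge (γ := γ) z
    rw [← h] at h1 h2
    rw [Real.zero_rpow (by positivity)] at h2
    exact Prod.ext (norm_le_zero_iff.1 h1) (norm_le_zero_iff.1 h2)
  · exact h

theorem continuous_gauge : Continuous (gauge γ : Pt m ℓ → ℝ) := by
  unfold gauge
  refine Continuous.rpow_const ?_ fun _ => Or.inr (by positivity)
  exact (continuous_fst.norm.rpow_const fun _ => Or.inr (by positivity)).add
    (continuous_snd.norm.pow 2)

theorem measurable_gauge_rpow (s : ℝ) : Measurable fun z : Pt m ℓ => gauge γ z ^ s :=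
  continuous_gauge.measurable.pow_const s

theorem homDim_pos (hm : 1 ≤ m) : 0 < homDim m ℓ γ := by
  have : (1 : ℝ) ≤ m := by exact_mod_cast hm
  unfold homDim
  positivity

/-- Since $|x|\le d$ and $|y|\le d^{1+\gamma}$, splitting the exponent in the proportion
$m:(1+\gamma)\ell$ gives $d^{-\alpha}\le|x|^{-\alpha m/Q}|y|^{-\alpha\ell/Q}$. Both factors are
integrable near the origin precisely when $\alpha<Q$, so no polar coordinates are needed. -/
theorem integrableOn_gauge_near (hm : 1 ≤ m) (hℓ : 1 ≤ ℓ) {α : ℝ} (hα0 : 0 ≤ α)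
    (hα : α < homDim m ℓ γ) :
    IntegrableOn (fun z : Pt m ℓ => gauge γ z ^ (-α)) {z | gauge γ z ≤ 1} := by
  have hm' : (1 : ℝ) ≤ m := by exact_mod_cast hm
  have hℓ' : (1 : ℝ) ≤ ℓ := by exact_mod_cast hℓ
  have hQ := homDim_pos (ℓ := ℓ) (γ := γ) hm
  set Q := homDim m ℓ γ with hQd
  have h1 : IntegrableOn (fun x : EuclideanSpace ℝ (Fin m) => ‖x‖ ^ (-(α * m / Q)))
      (Metric.ball 0 2) := by
    refine integrableOn_ball_of_norm_le_rpow (by simpa using hm) (C := 1) (α := α * m / Q) ?_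
      (ae_of_all _ fun x => ?_) ?_
    · simp only [finrank_euclideanSpace, Fintype.card_fin]
      rw [div_lt_iff₀ hQ]; nlinarith
    · rw [one_mul, Real.norm_of_nonneg (by positivity)]
    · exact (measurable_norm.pow_const _).aestronglyMeasurable
  have h2 : IntegrableOn (fun y : EuclideanSpace ℝ (Fin ℓ) => ‖y‖ ^ (-(α * ℓ / Q)))
      (Metric.ball 0 2) := by
    refine integrableOn_ball_of_norm_le_rpow (by simpa using hℓ) (C := 1) (α := α * ℓ / Q) ?_
      (ae_of_all _ fun x => ?_) ?_
    · simp only [finrank_euclideanSpace, Fintype.card_fin]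
      rw [div_lt_iff₀ hQ]; nlinarith
    · rw [one_mul, Real.norm_of_nonneg (by positivity)]
    · exact (measurable_norm.pow_const _).aestronglyMeasurable
  have h3 := Integrable.mul_prod h1 h2
  rw [Measure.prod_restrict] at h3
  have hsub : {z : Pt m ℓ | gauge γ z ≤ 1} ⊆ Metric.ball 0 2 ×ˢ Metric.ball 0 2 := by
    intro z hz
    have a1 := (norm_fst_le_gauge (γ := γ) z).trans hz
    have a2 := (norm_snd_le_gauge (γ := γ) z).trans
      (Real.rpow_le_one (gauge_nonneg z) hz (by positivity))
    refine ⟨?_, ?_⟩ <;> simp only [mem_ball_zero_iff] <;> linarith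
  refine Integrable.mono' (IntegrableOn.mono_set h3 hsub)
    (measurable_gauge_rpow _).aestronglyMeasurable ?_
  have ne1 : ∀ᵐ z : Pt m ℓ, z.1 ≠ 0 := by
    have : Nonempty (Fin m) := ⟨⟨0, hm⟩⟩
    exact Measure.quasiMeasurePreserving_fst.ae (Measure.ae_ne volume 0)
  have ne2 : ∀ᵐ z : Pt m ℓ, z.2 ≠ 0 := by
    have : Nonempty (Fin ℓ) := ⟨⟨0, hℓ⟩⟩
    exact Measure.quasiMeasurePreserving_snd.ae (Measure.ae_ne volume 0)
  refine ae_restrict_of_ae ?_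
  filter_upwards [ne1, ne2] with z z1 z2
  have p1 : 0 < ‖z.1‖ := norm_pos_iff.2 z1
  have p2 : 0 < ‖z.2‖ := norm_pos_iff.2 z2
  have pd : 0 < gauge γ z := p1.trans_le (norm_fst_le_gauge z)
  rw [Real.norm_of_nonneg (by positivity)]
  have : gauge γ z ^ (-α) =
      gauge γ z ^ (-(α * m / Q)) * (gauge γ z ^ (1 + (γ : ℝ))) ^ (-(α * ℓ / Q)) := by
    rw [← Real.rpow_mul pd.le, ← Real.rpow_add pd]
    congr 1
    field_simp
    rw [hQd, homDim]; ring
  rw [this]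
  refine mul_le_mul ?_ ?_ (by positivity) (by positivity)
  · exact Real.rpow_le_rpow_of_nonpos p1 (norm_fst_le_gauge z) (by simp; positivity)
  · exact Real.rpow_le_rpow_of_nonpos p2 (norm_snd_le_gauge z) (by simp; positivity)

/-- The same splitting of the exponent; since $d>1$ one may use $1+|x|\le2d$ and
$1+|y|\le2d^{1+\gamma}$. -/
theorem integrableOn_gauge_far (hm : 1 ≤ m) (hℓ : 1 ≤ ℓ) {α : ℝ}
    (hα : homDim m ℓ γ < α) :
    IntegrableOn (fun z : Pt m ℓ => gauge γ z ^ (-α)) {z | 1 < gauge γ z} := by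
  have hm' : (1 : ℝ) ≤ m := by exact_mod_cast hm
  have hℓ' : (1 : ℝ) ≤ ℓ := by exact_mod_cast hℓ
  have hQ := homDim_pos (ℓ := ℓ) (γ := γ) hm
  set Q := homDim m ℓ γ with hQd
  have hα0 : 0 < α := hQ.trans hα
  have h1 : Integrable (fun x : EuclideanSpace ℝ (Fin m) => (1 + ‖x‖) ^ (-(α * m / Q))) := by
    refine integrable_one_add_norm ?_
    simp only [finrank_euclideanSpace, Fintype.card_fin]
    rw [lt_div_iff₀ hQ]; nlinarith
  have h2 : Integrable (fun y : EuclideanSpace ℝ (Fin ℓ) => (1 + ‖y‖) ^ (-(α * ℓ / Q))) := by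
    refine integrable_one_add_norm ?_
    simp only [finrank_euclideanSpace, Fintype.card_fin]
    rw [lt_div_iff₀ hQ]; nlinarith
  have h3 := (Integrable.mul_prod h1 h2).const_mul
    ((1 / 2) ^ (-(α * m / Q)) * (1 / 2) ^ (-(α * ℓ / Q)))
  refine Integrable.mono' h3.integrableOn (measurable_gauge_rpow _).aestronglyMeasurable ?_
  refine (ae_restrict_iff' (continuous_gauge.measurable measurableSet_Ioi)).2 (ae_of_all _ ?_)
  intro z (hz : 1 < gauge γ z)
  have pd : 0 < gauge γ z := by linarith
  rw [Real.norm_of_nonneg (by positivity)]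
  have : gauge γ z ^ (-α) =
      gauge γ z ^ (-(α * m / Q)) * (gauge γ z ^ (1 + (γ : ℝ))) ^ (-(α * ℓ / Q)) := by
    rw [← Real.rpow_mul pd.le, ← Real.rpow_add pd]
    congr 1
    field_simp
    rw [hQd, homDim]; ring
  rw [this]
  have b1 := norm_fst_le_gauge (γ := γ) z
  have b2 := norm_snd_le_gauge (γ := γ) z
  have b3 : 1 ≤ gauge γ z ^ (1 + (γ : ℝ)) := Real.one_le_rpow hz.le (by positivity)
  have c1 : gauge γ z ^ (-(α * m / Q)) ≤ (1 / 2) ^ (-(α * m / Q)) * (1 + ‖z.1‖) ^ (-(α * m / Q)) := by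
    rw [← Real.mul_rpow (by norm_num) (by positivity)]
    exact Real.rpow_le_rpow_of_nonpos (by positivity) (by linarith) (by simp; positivity)
  have c2 : (gauge γ z ^ (1 + (γ : ℝ))) ^ (-(α * ℓ / Q)) ≤
      (1 / 2) ^ (-(α * ℓ / Q)) * (1 + ‖z.2‖) ^ (-(α * ℓ / Q)) := by
    rw [← Real.mul_rpow (by norm_num) (by positivity)]
    exact Real.rpow_le_rpow_of_nonpos (by positivity) (by linarith) (by simp; positivity)
  calc _ ≤ _ := mul_le_mul c1 c2 (by positivity) (by positivity)
    _ = _ := by ring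

section

instance : (volume : Measure (Pt m ℓ)).IsAddHaarMeasure :=
  inferInstanceAs (((volume : Measure (EuclideanSpace ℝ (Fin m))).prod
    (volume : Measure (EuclideanSpace ℝ (Fin ℓ)))).IsAddHaarMeasure)

instance : (volume : Measure (Pt m ℓ)).IsNegInvariant :=
  ⟨(((LinearIsometryEquiv.neg ℝ (E := EuclideanSpace ℝ (Fin m))).measurePreserving.prod
    (LinearIsometryEquiv.neg ℝ (E := EuclideanSpace ℝ (Fin ℓ))).measurePreserving).map_eq :)⟩

instance : Fact ((2 : ℝ≥0∞) ≠ ⊤) := ⟨by simp⟩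

/-! ### Admissible exponents and the double integral -/

/-- Exponents `t₁, t₂`, slightly above and slightly below `2Q/(2Q - μ)`, for which the parts of the
kernel `d^{-μ}` near `0` and near infinity act between Lebesgue spaces, while `p t₁` and `p t₂` are
strictly subcritical. -/
structure Exps (m ℓ : ℕ) (γ : ℝ≥0) (μ p t₁ t₂ : ℝ) : Prop where
  hm : 1 ≤ m
  hℓ : 1 ≤ ℓ
  dim : 2 < homDim m ℓ γ
  p_gt : 1 < p
  μ_pos : 0 < μ
  t₁_gt : 1 < t₁
  t₂_gt : 1 < t₂
  lo₁ : 2 < p * t₁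
  lo₂ : 2 < p * t₂
  hi₁ : (homDim m ℓ γ - 2) * (p * t₁) < 2 * homDim m ℓ γ
  hi₂ : (homDim m ℓ γ - 2) * (p * t₂) < 2 * homDim m ℓ γ
  near : μ < homDim m ℓ γ * (2 - 2 / t₁)
  near' : t₁ < 2
  far : homDim m ℓ γ * (2 - 2 / t₂) < μ
  far' : t₂ < 2

theorem exists_between_max {a b c d x : ℝ} (h1 : a < x) (h2 : b < x) (h3 : x < c) (h4 : x < d) :
    (∃ y, a < y ∧ b < y ∧ y < x) ∧ ∃ y, x < y ∧ y < c ∧ y < d := by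
  obtain ⟨y, hy1, hy2⟩ := exists_between (max_lt h1 h2)
  obtain ⟨y', hy1', hy2'⟩ := exists_between (lt_min h3 h4)
  exact ⟨⟨y, (max_lt_iff.1 hy1).1, (max_lt_iff.1 hy1).2, hy2⟩,
    ⟨y', hy1', (lt_min_iff.1 hy2').1, (lt_min_iff.1 hy2').2⟩⟩

/-- At $t=2Q/(2Q-\mu)$ the two bounds on `p` say exactly $2<pt$ and $(Q-2)pt<2Q$, while $0<\mu<Q$
says $1<t<2$. These conditions are open, so they survive a small move of `t` upwards (`t₁`) and
downwards (`t₂`); the moves make the two integrability conditions on the kernel strict. -/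
theorem exists_exps (hm : 1 ≤ m) (hℓ : 1 ≤ ℓ) (hN : 3 ≤ m + ℓ) {μ p : ℝ} (hμ0 : 0 < μ)
    (hμ : μ < homDim m ℓ γ)
    (hp1 : (homDim m ℓ γ - 2) / (2 * homDim m ℓ γ - μ) < 1 / p)
    (hp2 : 1 / p < homDim m ℓ γ / (2 * homDim m ℓ γ - μ)) :
    ∃ t₁ t₂, Exps m ℓ γ μ p t₁ t₂ := by
  have hQ2 : 2 < homDim m ℓ γ := by
    have h1 : (3 : ℝ) ≤ m + ℓ := by exact_mod_cast hN
    have h2 : 0 ≤ (γ : ℝ) * ℓ := by positivity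
    unfold homDim; nlinarith
  set Q := homDim m ℓ γ with hQd
  have hd : 0 < 2 * Q - μ := by linarith
  have hp0 : 0 < p := by
    have : 0 < 1 / p := lt_of_le_of_lt (div_nonneg (by linarith) hd.le) hp1
    exact one_div_pos.1 this
  have hp1' : (Q - 2) * p < 2 * Q - μ := by
    rw [div_lt_div_iff₀ hd hp0] at hp1; linarith
  have hp2' : 2 * Q - μ < Q * p := by
    rw [div_lt_div_iff₀ hp0 hd] at hp2; linarith
  have hpg : 1 < p := by nlinarith
  -- work with `θ = 1 / t`, near `(2Q - μ) / (2Q)`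
  obtain ⟨⟨θ₁, a1, a2, a3⟩, ⟨θ₂, b1, b2, b3⟩⟩ := exists_between_max
    (a := 1 / 2) (b := (Q - 2) * p / (2 * Q)) (x := (2 * Q - μ) / (2 * Q)) (c := 1) (d := p / 2)
    (by rw [div_lt_div_iff₀ (by norm_num) (by linarith)]; linarith)
    (by rw [div_lt_div_iff₀ (by linarith) (by linarith)]; nlinarith)
    (by rw [div_lt_one (by linarith)]; linarith)
    (by rw [div_lt_div_iff₀ (by linarith) (by linarith)]; nlinarith)
  have hθ₁ : 0 < θ₁ := by linarith
  have hθ₂ : 0 < θ₂ := by linarith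
  have ub : (2 * Q - μ) / (2 * Q) < 1 := by rw [div_lt_one (by linarith)]; linarith
  have ub2 : (2 * Q - μ) / (2 * Q) < p / 2 := by
    rw [div_lt_div_iff₀ (by linarith) (by linarith)]; nlinarith
  have a3' := a3
  have b1' := b1
  rw [lt_div_iff₀ (by linarith)] at a3'
  rw [div_lt_iff₀ (by linarith)] at b1'
  rw [div_lt_iff₀ (by linarith)] at a2
  refine ⟨1 / θ₁, 1 / θ₂, hm, hℓ, hQ2, hpg, hμ0, ?_, ?_, ?_, ?_, ?_, ?_, ?_, ?_, ?_, ?_⟩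
  · rw [lt_div_iff₀ hθ₁]; linarith
  · rw [lt_div_iff₀ hθ₂]; linarith
  · rw [mul_one_div, lt_div_iff₀ hθ₁]; linarith
  · rw [mul_one_div, lt_div_iff₀ hθ₂]; linarith
  · rw [mul_one_div, mul_div_assoc', div_lt_iff₀ hθ₁]; linarith
  · rw [mul_one_div, mul_div_assoc', div_lt_iff₀ hθ₂]; nlinarith
  · rw [div_div_eq_mul_div, div_one]; nlinarith
  · rw [div_lt_iff₀ hθ₁]; linarith
  · rw [div_div_eq_mul_div, div_one]; nlinarith
  · rw [div_lt_iff₀ hθ₂]; linarith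

/-- The sum of the norms in `L^{t₁}` and `L^{t₂}`. -/
def nX (t₁ t₂ : ℝ) (f : Pt m ℓ → ℝ) : ℝ≥0∞ :=
  eLpNorm f (ENNReal.ofReal t₁) volume + eLpNorm f (ENNReal.ofReal t₂) volume

/-- The kernel `d^{-μ}`, with values in `[0, ∞]`. -/
def kern (γ : ℝ≥0) (μ : ℝ) (z : Pt m ℓ) : ℝ≥0∞ := ENNReal.ofReal (gauge γ z ^ (-μ))

theorem measurable_kern (μ : ℝ) : Measurable (kern γ μ : Pt m ℓ → ℝ≥0∞) :=
  (measurable_gauge_rpow _).ennreal_ofReal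

theorem kern_rpow {μ a : ℝ} (ha : 0 ≤ a) (z : Pt m ℓ) :
    kern γ μ z ^ a = ENNReal.ofReal (gauge γ z ^ (-(μ * a))) := by
  rw [kern, ENNReal.ofReal_rpow_of_nonneg (Real.rpow_nonneg (gauge_nonneg z) _) ha,
    ← Real.rpow_mul (gauge_nonneg z), neg_mul]

theorem measurableSet_gauge_le (M : ℝ) : MeasurableSet {z : Pt m ℓ | gauge γ z ≤ M} :=
  measurableSet_le continuous_gauge.measurable measurable_const

theorem measurableSet_lt_gauge (M : ℝ) : MeasurableSet {z : Pt m ℓ | M < gauge γ z} :=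
  measurableSet_lt measurable_const continuous_gauge.measurable

theorem lintegral_kern_near_lt_top (hm : 1 ≤ m) (hℓ : 1 ≤ ℓ) {μ a : ℝ} (hμ : 0 ≤ μ) (ha : 0 < a)
    (h : μ * a < homDim m ℓ γ) :
    ∫⁻ z, ({z : Pt m ℓ | gauge γ z ≤ 1}.indicator (kern γ μ) z) ^ a < ⊤ := by
  have hi := integrableOn_gauge_near (γ := γ) hm hℓ (by positivity) h
  have e : ∀ z, ({z : Pt m ℓ | gauge γ z ≤ 1}.indicator (kern γ μ) z) ^ a =
      {z : Pt m ℓ | gauge γ z ≤ 1}.indicator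
        (fun z => ENNReal.ofReal (gauge γ z ^ (-(μ * a)))) z := by
    intro z
    by_cases hz : z ∈ {z : Pt m ℓ | gauge γ z ≤ 1}
    · rw [Set.indicator_of_mem hz, Set.indicator_of_mem hz, kern_rpow ha.le]
    · rw [Set.indicator_of_notMem hz, Set.indicator_of_notMem hz, ENNReal.zero_rpow_of_pos ha]
  simp_rw [e]
  rw [lintegral_indicator (measurableSet_gauge_le 1)]
  exact hi.lintegral_lt_top

theorem lintegral_kern_far_lt_top (hm : 1 ≤ m) (hℓ : 1 ≤ ℓ) {μ a : ℝ} (ha : 0 < a)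
    (h : homDim m ℓ γ < μ * a) :
    ∫⁻ z in {z : Pt m ℓ | 1 < gauge γ z}, (kern γ μ z) ^ a < ⊤ := by
  simp_rw [kern_rpow ha.le]
  exact (integrableOn_gauge_far (γ := γ) hm hℓ h).lintegral_lt_top

/-- The part of the kernel `d^{-μ}` far from `0` has small norm. -/
theorem exists_kern_tail_le (hm : 1 ≤ m) (hℓ : 1 ≤ ℓ) {μ a : ℝ} (ha : 0 < a)
    (h : homDim m ℓ γ < μ * a) {ε : ℝ≥0∞} (hε : 0 < ε) :
    ∃ M : ℝ, (∫⁻ z, ({z : Pt m ℓ | M < gauge γ z}.indicator (kern γ μ) z) ^ a) ^ (1 / a) ≤ ε := by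
  have hfin := lintegral_kern_far_lt_top (γ := γ) hm hℓ ha h
  set ν : Measure (Pt m ℓ) := (volume.withDensity fun z => (kern γ μ z) ^ a).restrict
    {z : Pt m ℓ | 1 < gauge γ z} with hν
  -- Continuity from above of the finite measure $d^{-\mu a}\,dz$ on $\{d>1\}$, along sets with
  -- empty intersection.
  have hT : Tendsto (fun n : ℕ => ν {z : Pt m ℓ | (n : ℝ) < gauge γ z}) atTop (𝓝 0) := by
    have hinter : ⋂ n : ℕ, {z : Pt m ℓ | (n : ℝ) < gauge γ z} = ∅ := by
      ext z
      simp only [Set.mem_iInter, Set.mem_ofPred_eq, Set.mem_empty_iff_false, iff_false, not_forall,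
        not_lt]
      exact exists_nat_ge _
    rw [← measure_empty (μ := ν), ← hinter]
    refine tendsto_measure_iInter_atTop
      (fun n => (measurableSet_lt_gauge _).nullMeasurableSet) ?_ ⟨0, ?_⟩
    · intro i j hij z (hz : (j : ℝ) < gauge γ z)
      exact lt_of_le_of_lt (by exact_mod_cast hij) hz
    · refine ne_of_lt (lt_of_le_of_lt (measure_mono (Set.subset_univ _)) ?_)
      rw [hν, Measure.restrict_apply_univ, withDensity_apply _ (measurableSet_lt_gauge _)]
      exact hfin
  have hε' : 0 < ε ^ a := ENNReal.rpow_pos_of_nonneg hε ha.le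
  obtain ⟨n, hn, hn1⟩ := ((hT.eventually (gt_mem_nhds hε')).and (eventually_ge_atTop 1)).exists
  refine ⟨n, ?_⟩
  rw [← ENNReal.rpow_le_rpow_iff ha, ← ENNReal.rpow_mul, one_div_mul_cancel ha.ne',
    ENNReal.rpow_one]
  refine le_trans (le_of_eq ?_) hn.le
  have e : ∀ z, ({z : Pt m ℓ | (n : ℝ) < gauge γ z}.indicator (kern γ μ) z) ^ a =
      {z : Pt m ℓ | (n : ℝ) < gauge γ z}.indicator (fun z => kern γ μ z ^ a) z := by
    intro z
    by_cases hz : z ∈ {z : Pt m ℓ | (n : ℝ) < gauge γ z}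
    · rw [Set.indicator_of_mem hz, Set.indicator_of_mem hz]
    · rw [Set.indicator_of_notMem hz, Set.indicator_of_notMem hz, ENNReal.zero_rpow_of_pos ha]
  simp_rw [e]
  rw [lintegral_indicator (measurableSet_lt_gauge _), hν,
    Measure.restrict_apply (measurableSet_lt_gauge _), Set.inter_eq_left.2,
    withDensity_apply _ (measurableSet_lt_gauge _)]
  intro z (hz : (n : ℝ) < gauge γ z)
  exact lt_of_le_of_lt (by exact_mod_cast hn1) hz

section Exps

variable {μ p t₁ t₂ : ℝ}

/-- The exponent $a=1/(2-2/t)$ is the one that Young's inequality requires for equal exponents on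
`f` and `g`; `t < 2` makes it at least $1$. -/
theorem young_pair {κ : Pt m ℓ → ℝ≥0∞} (hκ : Measurable κ) {f g : Pt m ℓ → ℝ}
    (hf : AEStronglyMeasurable f volume) (hg : AEStronglyMeasurable g volume) {t : ℝ}
    (ht : 1 < t) (ht2 : t < 2) :
    ∫⁻ q : Pt m ℓ × Pt m ℓ, κ (q.1 - q.2) * ‖f q.2‖ₑ * ‖g q.1‖ₑ ≤
      (∫⁻ z, κ z ^ (1 / (2 - 2 / t))) ^ (1 / (1 / (2 - 2 / t))) *
        (eLpNorm f (ENNReal.ofReal t) volume * eLpNorm g (ENNReal.ofReal t) volume) := by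
  have ht0 : 0 < t := by linarith
  have h1 : 2 / t < 2 := by rw [div_lt_iff₀ ht0]; linarith
  have h2 : 1 < 2 / t := by rw [lt_div_iff₀ ht0]; linarith
  rw [eLpNorm_ofReal_eq ht0, eLpNorm_ofReal_eq ht0]
  refine lintegral_young (volume : Measure (Pt m ℓ)) hκ hf.enorm hg.enorm ?_ ht.le ?_
  · rw [le_div_iff₀ (by linarith)]; linarith
  · rw [one_div_one_div]; ring

theorem Exps.aux (h : Exps m ℓ γ μ p t₁ t₂) : 0 < 2 - 2 / t₁ ∧ 0 < 2 - 2 / t₂ := by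
  refine ⟨?_, ?_⟩
  · have : 2 / t₁ < 2 := by rw [div_lt_iff₀ (by linarith [h.t₁_gt])]; linarith [h.t₁_gt]
    linarith
  · have : 2 / t₂ < 2 := by rw [div_lt_iff₀ (by linarith [h.t₂_gt])]; linarith [h.t₂_gt]
    linarith

/-- Smallness of the distant part of the kernel is what makes the nonlocal term nearly local in
`Exps.exists_abs_bil_le_local`. -/
theorem Exps.tail_le (h : Exps m ℓ γ μ p t₁ t₂) {ε : ℝ≥0∞} (hε : 0 < ε) :
    ∃ M : ℝ, ∀ f g : Pt m ℓ → ℝ, AEStronglyMeasurable f volume → AEStronglyMeasurable g volume →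
      ∫⁻ q : Pt m ℓ × Pt m ℓ,
        {z : Pt m ℓ | M < gauge γ z}.indicator (kern γ μ) (q.1 - q.2) * ‖f q.2‖ₑ * ‖g q.1‖ₑ ≤
        ε * (nX t₁ t₂ f * nX t₁ t₂ g) := by
  obtain ⟨-, a2⟩ := h.aux
  obtain ⟨M, hM⟩ := exists_kern_tail_le (γ := γ) h.hm h.hℓ (μ := μ) (one_div_pos.2 a2)
    (by rw [mul_one_div, lt_div_iff₀ a2]; exact h.far) hε
  refine ⟨M, fun f g hf hg => ?_⟩
  refine (young_pair ((measurable_kern μ).indicator (measurableSet_lt_gauge M)) hf hg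
    h.t₂_gt h.far').trans ?_
  refine mul_le_mul' hM (mul_le_mul' ?_ ?_) <;> exact le_add_self

theorem Exps.near_le (h : Exps m ℓ γ μ p t₁ t₂) :
    ∃ C : ℝ≥0∞, C ≠ ⊤ ∧ ∀ f g : Pt m ℓ → ℝ, AEStronglyMeasurable f volume →
      AEStronglyMeasurable g volume →
      ∫⁻ q : Pt m ℓ × Pt m ℓ,
        {z : Pt m ℓ | gauge γ z ≤ 1}.indicator (kern γ μ) (q.1 - q.2) * ‖f q.2‖ₑ * ‖g q.1‖ₑ ≤
        C * (nX t₁ t₂ f * nX t₁ t₂ g) := by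
  obtain ⟨a1, -⟩ := h.aux
  have n1 := lintegral_kern_near_lt_top (γ := γ) h.hm h.hℓ h.μ_pos.le (one_div_pos.2 a1)
    (by rw [mul_one_div, div_lt_iff₀ a1]; exact h.near)
  have ha := one_div_pos.2 a1
  refine ⟨_, (ENNReal.rpow_lt_top_of_nonneg (one_div_pos.2 ha).le n1.ne).ne,
    fun f g hf hg => ?_⟩
  refine (young_pair ((measurable_kern μ).indicator (measurableSet_gauge_le 1)) hf hg
    h.t₁_gt h.near').trans ?_
  refine mul_le_mul' le_rfl (mul_le_mul' ?_ ?_) <;> exact le_self_add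

theorem Exps.far_le (h : Exps m ℓ γ μ p t₁ t₂) :
    ∃ C : ℝ≥0∞, C ≠ ⊤ ∧ ∀ f g : Pt m ℓ → ℝ, AEStronglyMeasurable f volume →
      AEStronglyMeasurable g volume →
      ∫⁻ q : Pt m ℓ × Pt m ℓ,
        {z : Pt m ℓ | 1 < gauge γ z}.indicator (kern γ μ) (q.1 - q.2) * ‖f q.2‖ₑ * ‖g q.1‖ₑ ≤
        C * (nX t₁ t₂ f * nX t₁ t₂ g) := by
  obtain ⟨-, a2⟩ := h.aux
  have ha := one_div_pos.2 a2
  have n2 := lintegral_kern_far_lt_top (γ := γ) h.hm h.hℓ (μ := μ) ha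
    (by rw [mul_one_div, lt_div_iff₀ a2]; exact h.far)
  refine ⟨(∫⁻ z in {z : Pt m ℓ | 1 < gauge γ z}, (kern γ μ z) ^ (1 / (2 - 2 / t₂))) ^
    (1 / (1 / (2 - 2 / t₂))), (ENNReal.rpow_lt_top_of_nonneg (by positivity) n2.ne).ne,
    fun f g hf hg => ?_⟩
  refine (young_pair ((measurable_kern μ).indicator (measurableSet_lt_gauge 1)) hf hg
    h.t₂_gt h.far').trans ?_
  refine mul_le_mul' ?_ (mul_le_mul' le_add_self le_add_self)
  refine ENNReal.rpow_le_rpow ?_ (by positivity)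
  rw [← lintegral_indicator (measurableSet_lt_gauge _)]
  refine lintegral_mono fun z => ?_
  by_cases hz : z ∈ {z : Pt m ℓ | 1 < gauge γ z}
  · rw [Set.indicator_of_mem hz, Set.indicator_of_mem hz]
  · rw [Set.indicator_of_notMem hz, Set.indicator_of_notMem hz, ENNReal.zero_rpow_of_pos ha]

/-- The substitute for the Hardy-Littlewood-Sobolev inequality: the kernel is cut at $d=1$, the near
part uses `t₁` and the far part uses `t₂`. -/
theorem Exps.double_le (h : Exps m ℓ γ μ p t₁ t₂) :
    ∃ C : ℝ≥0∞, C ≠ ⊤ ∧ ∀ f g : Pt m ℓ → ℝ, AEStronglyMeasurable f volume →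
      AEStronglyMeasurable g volume →
      ∫⁻ q : Pt m ℓ × Pt m ℓ, kern γ μ (q.1 - q.2) * ‖f q.2‖ₑ * ‖g q.1‖ₑ ≤
        C * (nX t₁ t₂ f * nX t₁ t₂ g) := by
  obtain ⟨C₁, hC₁, h₁⟩ := h.near_le
  obtain ⟨C₂, hC₂, h₂⟩ := h.far_le
  refine ⟨C₁ + C₂, ENNReal.add_ne_top.2 ⟨hC₁, hC₂⟩, fun f g hf hg => ?_⟩
  rw [add_mul]
  refine le_trans (le_trans (lintegral_mono fun q => ?_)
    (le_of_eq (lintegral_add_left' ?_ _)))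
    (add_le_add (h₁ f g hf hg) (h₂ f g hf hg))
  · rw [← add_mul, ← add_mul]
    gcongr
    by_cases hz : gauge γ (q.1 - q.2) ≤ 1
    · rw [Set.indicator_of_mem (by exact hz)]; exact le_self_add
    · rw [Set.indicator_of_mem (s := {z | 1 < gauge γ z}) (by exact not_le.1 hz)]
      exact le_add_self
  · exact ((((measurable_kern μ).indicator (measurableSet_gauge_le 1)).comp
      (measurable_fst.sub measurable_snd)).aemeasurable.mul
      (hf.enorm.comp_quasiMeasurePreserving Measure.quasiMeasurePreserving_snd)).mul
      (hg.enorm.comp_quasiMeasurePreserving Measure.quasiMeasurePreserving_fst)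

end Exps

end

section

/-! ### Weak derivatives along weighted directions -/

instance : IsSeparable (volume : Measure (Pt m ℓ)) := by
  have h1 : MeasurableSpace.CountablyGenerated (Pt m ℓ) := inferInstance
  have h2 : SigmaFinite (volume : Measure (Pt m ℓ)) := inferInstance
  exact isSeparable_of_sigmaFinite volume

/-- The test functions `C_c^∞`. -/
def Test (m ℓ : ℕ) : Submodule ℝ (Pt m ℓ → ℝ) where
  carrier := {φ | ContDiff ℝ ∞ φ ∧ HasCompactSupport φ}
  zero_mem' := ⟨contDiff_const, HasCompactSupport.zero⟩
  add_mem' := fun h1 h2 => ⟨h1.1.add h2.1, h1.2.add h2.2⟩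
  smul_mem' := fun c _ h => ⟨contDiff_const.smul h.1, h.2.smul_left (f := fun _ => c)⟩

theorem Test.memLp (φ : Test m ℓ) : MemLp (φ : Pt m ℓ → ℝ) 2 (volume : Measure (Pt m ℓ)) :=
  memLp_test φ.2.1.continuous φ.2.2

/-- Test functions as elements of `L^2`. -/
def Test.toLp : Test m ℓ →ₗ[ℝ] Lp ℝ 2 (volume : Measure (Pt m ℓ)) where
  toFun φ := (Test.memLp φ).toLp
  map_add' φ ψ := MemLp.toLp_add (Test.memLp φ) (Test.memLp ψ)
  map_smul' c φ := MemLp.toLp_const_smul c (Test.memLp φ)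

theorem Test.denseRange_toLp : DenseRange (Test.toLp : Test m ℓ → _) := by
  refine (Lp.dense_hasCompactSupport_contDiff (F := ℝ) (μ := (volume : Measure (Pt m ℓ)))
    (p := 2) (by simp)).mono ?_
  rintro f ⟨g, hg, h1, h2⟩
  refine ⟨⟨g, h2, h1⟩, ?_⟩
  refine Lp.ext ?_
  exact (MemLp.coeFn_toLp (Test.memLp ⟨g, h2, h1⟩)).trans hg.symm

/-- A linear functional on test functions that is bounded in `L^2` is given by an `L^2` function. -/
theorem exists_riesz (L : Test m ℓ →ₗ[ℝ] ℝ) {C : ℝ} (hC : 0 ≤ C)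
    (hL : ∀ φ, |L φ| ≤ C * ‖Test.toLp φ‖) :
    ∃ g : Lp ℝ 2 (volume : Measure (Pt m ℓ)), ‖g‖ ≤ C ∧
      ∀ φ : Test m ℓ, L φ = ∫ z, g z * φ.1 z := by
  set T := L.extendOfNorm (Test.toLp (m := m) (ℓ := ℓ)) with hT
  refine ⟨(InnerProductSpace.toDual ℝ _).symm T, ?_, fun φ => ?_⟩
  · rw [LinearIsometryEquiv.norm_map]
    exact LinearMap.opNorm_extendOfNorm_le Test.denseRange_toLp hC hL
  · rw [← LinearMap.extendOfNorm_eq Test.denseRange_toLp ⟨C, hL⟩ φ, ← hT,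
      ← InnerProductSpace.toDual_symm_apply, L2.inner_def]
    refine integral_congr_ae ?_
    filter_upwards [MemLp.coeFn_toLp (Test.memLp φ)] with z hz
    have : (Test.toLp φ : Lp ℝ 2 (volume : Measure (Pt m ℓ))) z = φ.1 z := hz
    simp [this, mul_comm]

/-- The shift sits on the test function, so local integrability of `f` is enough to differentiate
under the integral. -/
theorem hasDerivAt_integral_translate {f φ : Pt m ℓ → ℝ} (hf : LocallyIntegrable f)
    (hφ : ContDiff ℝ ∞ φ) (hs : HasCompactSupport φ) (e : Pt m ℓ) (t : ℝ) :
    HasDerivAt (fun t : ℝ => ∫ z, f z * φ (z - t • e))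
      (-∫ z, f z * fderiv ℝ φ (z - t • e) e) t := by
  obtain ⟨R, hR⟩ := hs.isCompact.isBounded.subset_closedBall 0
  have hdc : Continuous fun z => fderiv ℝ φ z e :=
    (hφ.continuous_fderiv (by simp)).clm_apply continuous_const
  have hds : HasCompactSupport fun z => fderiv ℝ φ z e := hs.fderiv_apply (𝕜 := ℝ) e
  obtain ⟨S, hS⟩ := hds.exists_bound_of_continuous hdc
  -- Contains the supports of all shifts `φ (· - s • e)` with $|s|\le|t|+1$; this localises the
  -- dominating function.
  set K : Set (Pt m ℓ) := Metric.closedBall 0 (R + (|t| + 1) * ‖e‖) with hK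
  have hKc : IsCompact K := isCompact_closedBall _ _
  have hsupp : ∀ s : ℝ, |s| ≤ |t| + 1 → ∀ z, z ∉ K → z - s • e ∉ tsupport φ := by
    intro s hs z hz hmem
    apply hz
    have h1 : ‖z - s • e‖ ≤ R := by simpa using hR hmem
    rw [hK, mem_closedBall_zero_iff]
    calc ‖z‖ = ‖(z - s • e) + s • e‖ := by rw [sub_add_cancel]
      _ ≤ ‖z - s • e‖ + ‖s • e‖ := norm_add_le _ _
      _ ≤ R + (|t| + 1) * ‖e‖ := by
        rw [norm_smul, Real.norm_eq_abs]; gcongr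
  have hshift : ∀ s : ℝ, Continuous fun z : Pt m ℓ => z - s • e := fun s => by fun_prop
  rw [← integral_neg]
  refine (hasDerivAt_integral_of_dominated_loc_of_deriv_le
    (F := fun s z => f z * φ (z - s • e)) (F' := fun s z => -(f z * fderiv ℝ φ (z - s • e) e))
    (bound := K.indicator fun z => ‖f z‖ * S) (Metric.ball_mem_nhds t one_pos) ?_ ?_ ?_ ?_ ?_ ?_).2
  · exact Eventually.of_forall fun s => hf.aestronglyMeasurable.mul
      (hφ.continuous.comp (hshift s)).aestronglyMeasurable
  · have hc : Continuous fun z => φ (z - t • e) := hφ.continuous.comp (hshift t)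
    have : HasCompactSupport fun z => φ (z - t • e) := by
      refine HasCompactSupport.intro hKc fun z hz => ?_
      exact image_eq_zero_of_notMem_tsupport (hsupp t (by linarith) z hz)
    simpa [mul_comm] using hf.integrable_smul_left_of_hasCompactSupport hc this
  · exact (hf.aestronglyMeasurable.mul (hdc.comp (hshift t)).aestronglyMeasurable).neg
  · refine ae_of_all _ fun z s hs => ?_
    have hs' : |s| ≤ |t| + 1 := by
      rw [Metric.mem_ball, Real.dist_eq] at hs
      have := abs_sub_abs_le_abs_sub s t
      linarith
    by_cases hz : z ∈ K
    · rw [Set.indicator_of_mem hz, norm_neg, norm_mul]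
      gcongr
      exact hS _
    · rw [Set.indicator_of_notMem hz]
      have : fderiv ℝ φ (z - s • e) = 0 := by
        by_contra hne
        exact hsupp s hs' z hz (support_fderiv_subset ℝ hne)
      simp [this]
  · rw [integrable_indicator_iff hKc.measurableSet]
    exact (hf.integrableOn_isCompact hKc).norm.mul_const S
  · refine ae_of_all _ fun z s _ => ?_
    have h1 : HasDerivAt (fun s : ℝ => z - s • e) (-e) s := by
      simpa using ((hasDerivAt_id s).smul_const e).const_sub z
    have h2 := ((hφ.differentiable (by simp)) (z - s • e)).hasFDerivAt.comp_hasDerivAt s h1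
    have h3 := h2.const_mul (f z)
    simpa using h3

theorem abs_integral_mul_le {f g : Pt m ℓ → ℝ} (hf : MemLp f 2 (volume : Measure (Pt m ℓ)))
    (hg : MemLp g 2 (volume : Measure (Pt m ℓ))) :
    |∫ z, f z * g z| ≤ (eLpNorm f 2 volume).toReal * (eLpNorm g 2 volume).toReal := by
  have h := abs_real_inner_le_norm (hf.toLp) (hg.toLp)
  rw [Lp.norm_toLp, Lp.norm_toLp, L2.inner_def] at h
  refine le_trans (le_of_eq ?_) h
  congr 1
  refine integral_congr_ae ?_
  filter_upwards [hf.coeFn_toLp, hg.coeFn_toLp] with z h1 h2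
  simp [h1, h2, mul_comm]

theorem Test.norm_toLp_eq (φ : Test m ℓ) :
    ‖Test.toLp φ‖ = (eLpNorm φ.1 2 (volume : Measure (Pt m ℓ))).toReal :=
  Lp.norm_toLp _ (Test.memLp φ)

/-- `g` is the weak derivative of `u` along the field `ρ ∂_e`. -/
def WeakDeriv (ρ : Pt m ℓ → ℝ) (e : Pt m ℓ) (u g : Pt m ℓ → ℝ) : Prop :=
  ∀ φ : Pt m ℓ → ℝ, ContDiff ℝ ∞ φ → HasCompactSupport φ →
    ∫ z, u z * (ρ z * fderiv ℝ φ z e) = -∫ z, g z * φ z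

theorem measurePreserving_add (e : Pt m ℓ) : MeasurePreserving (fun z : Pt m ℓ => z + e) :=
  measurePreserving_add_right volume e

theorem eLpNorm_comp_add {F : Type*} [NormedAddCommGroup F] {u : Pt m ℓ → F} {q : ℝ≥0∞}
    (hu : AEStronglyMeasurable u volume) (e : Pt m ℓ) :
    eLpNorm (fun z => u (z + e)) q volume = eLpNorm u q volume :=
  eLpNorm_comp_measurePreserving hu (measurePreserving_add e)

theorem memLp_comp_add {F : Type*} [NormedAddCommGroup F] {u : Pt m ℓ → F} {q : ℝ≥0∞}
    (hu : MemLp u q volume) (e : Pt m ℓ) : MemLp (fun z => u (z + e)) q volume :=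
  hu.comp_measurePreserving (measurePreserving_add e)

/-- The translate `φ(· - t e)` of a test function. -/
theorem test_translate {φ : Pt m ℓ → ℝ} (hφ : ContDiff ℝ ∞ φ) (hs : HasCompactSupport φ)
    (e : Pt m ℓ) :
    ContDiff ℝ ∞ (fun z => φ (z - e)) ∧ HasCompactSupport fun z => φ (z - e) :=
  ⟨hφ.comp (contDiff_id.sub contDiff_const),
    hs.comp_homeomorph (Homeomorph.subRight e)⟩

section WeakDeriv

variable {ρ : Pt m ℓ → ℝ} {e : Pt m ℓ} {u g : Pt m ℓ → ℝ}

/-- Change of variables moves the shift from `u` to `φ`; the weight stays in place because it is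
constant along `e`. -/
theorem integral_diff_mul_eq (hρ : Continuous ρ) (hρe : ∀ z (t : ℝ), ρ (z + t • e) = ρ z)
    (hu : LocallyIntegrable u (volume : Measure (Pt m ℓ))) {φ : Pt m ℓ → ℝ}
    (hφ : ContDiff ℝ ∞ φ) (hs : HasCompactSupport φ) (t : ℝ) :
    ∫ z, ρ z * (u (z + t • e) - u z) * φ z =
      (∫ z, u z * ρ z * φ (z - t • e)) - ∫ z, u z * ρ z * φ (z - (0 : ℝ) • e) := by
  have hf : LocallyIntegrable (fun z => u z * ρ z) (volume : Measure (Pt m ℓ)) :=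
    hu.mul_continuous hρ
  have hint : ∀ s : ℝ, Integrable (fun z => u z * ρ z * φ (z - s • e)) := by
    intro s
    obtain ⟨h1, h2⟩ := test_translate hφ hs (s • e)
    simpa [mul_comm] using hf.integrable_smul_left_of_hasCompactSupport h1.continuous h2
  have h1 : ∫ z, u z * ρ z * φ (z - t • e) = ∫ z, u (z + t • e) * ρ z * φ z := by
    rw [← integral_add_right_eq_self _ (t • e)]
    simp [hρe]
  have h2 : Integrable (fun z => u (z + t • e) * ρ z * φ z) := by
    have := (hint t).comp_add_right (t • e)
    simpa [hρe] using this
  have h3 := hint 0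
  rw [h1]
  simp only [zero_smul, sub_zero] at h3 ⊢
  rw [← integral_sub h2 h3]
  refine integral_congr_ae (ae_of_all _ fun z => ?_)
  simp only
  ring

/-- A translate of `φ` is again a test function with the same $L^2$ norm, so the bound is uniform in
`t`. -/
theorem WeakDeriv.abs_deriv_le
    (hg : MemLp g 2 (volume : Measure (Pt m ℓ)))
    (h : WeakDeriv ρ e u g) {φ : Pt m ℓ → ℝ} (hφ : ContDiff ℝ ∞ φ) (hs : HasCompactSupport φ)
    (t : ℝ) :
    |-∫ z, u z * ρ z * fderiv ℝ φ (z - t • e) e| ≤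
      (eLpNorm g 2 volume).toReal * (eLpNorm φ 2 volume).toReal := by
  obtain ⟨h1, h2⟩ := test_translate hφ hs (t • e)
  have h3 := h _ h1 h2
  have h4 : ∫ z, u z * ρ z * fderiv ℝ φ (z - t • e) e = -∫ z, g z * φ (z - t • e) := by
    rw [← h3]
    refine integral_congr_ae (ae_of_all _ fun z => ?_)
    simp only
    rw [fderiv_comp_sub (𝕜 := ℝ) (f := φ) (t • e)]
    ring
  rw [h4, neg_neg]
  refine (abs_integral_mul_le hg (memLp_test h1.continuous h2)).trans_eq ?_
  congr 2
  simpa [sub_eq_add_neg] using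
    eLpNorm_comp_add (q := 2) hφ.continuous.aestronglyMeasurable (-(t • e))

/-- Duality: the pairing with a test function is controlled by the mean value inequality in `t`, and
the Riesz theorem with the fundamental lemma turns this into a norm bound. The detour is needed
because the weight may be unbounded, so that the difference is at first only locally integrable. -/
theorem WeakDeriv.eLpNorm_translate_sub_le (hρ : Continuous ρ)
    (hρe : ∀ z (t : ℝ), ρ (z + t • e) = ρ z)
    (hu : MemLp u 2 (volume : Measure (Pt m ℓ))) (hg : MemLp g 2 (volume : Measure (Pt m ℓ)))
    (h : WeakDeriv ρ e u g) (t : ℝ) :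
    eLpNorm (fun z => ρ z * (u (z + t • e) - u z)) 2 volume ≤
      ENNReal.ofReal |t| * eLpNorm g 2 volume := by
  have hul := hu.locallyIntegrable (by norm_num)
  have hf : LocallyIntegrable (fun z => u z * ρ z) (volume : Measure (Pt m ℓ)) :=
    hul.mul_continuous hρ
  have hdl : LocallyIntegrable (fun z => ρ z * (u (z + t • e) - u z))
      (volume : Measure (Pt m ℓ)) := by
    have := ((memLp_comp_add hu (t • e)).sub hu).locallyIntegrable (by norm_num)
    exact this.continuous_mul hρ
  set N := (eLpNorm g 2 volume).toReal with hN
  have hb : ∀ φ : Test m ℓ, |∫ z, ρ z * (u (z + t • e) - u z) * φ.1 z| ≤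
      |t| * N * ‖Test.toLp φ‖ := by
    intro φ
    rw [integral_diff_mul_eq hρ hρe hul φ.2.1 φ.2.2 t]
    have := Convex.norm_image_sub_le_of_norm_hasDerivWithin_le
      (f := fun t : ℝ => ∫ z, u z * ρ z * φ.1 (z - t • e)) (s := Set.univ) (x := 0) (y := t)
      (fun s _ => (hasDerivAt_integral_translate hf φ.2.1 φ.2.2 e s).hasDerivWithinAt)
      (fun s _ => h.abs_deriv_le hg φ.2.1 φ.2.2 s) convex_univ trivial trivial
    rw [Test.norm_toLp_eq]
    simp only [sub_zero, Real.norm_eq_abs] at this ⊢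
    linarith
  let L : Test m ℓ →ₗ[ℝ] ℝ :=
    { toFun := fun φ => ∫ z, ρ z * (u (z + t • e) - u z) * φ.1 z
      map_add' := by
        intro φ ψ
        have i1 := hdl.integrable_smul_left_of_hasCompactSupport φ.2.1.continuous φ.2.2
        have i2 := hdl.integrable_smul_left_of_hasCompactSupport ψ.2.1.continuous ψ.2.2
        rw [← integral_add (by simpa [mul_comm] using i1) (by simpa [mul_comm] using i2)]
        simp [mul_add]
      map_smul' := by
        intro c φ
        simp only [RingHom.id_apply, smul_eq_mul]
        rw [← integral_const_mul]
        refine integral_congr_ae (ae_of_all _ fun z => ?_)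
        simp
        ring }
  obtain ⟨G, hG1, hG2⟩ := exists_riesz L (C := |t| * N) (by positivity) hb
  have hae : ∀ᵐ z, ρ z * (u (z + t • e) - u z) = G z := by
    refine ae_eq_of_integral_contDiff_smul_eq hdl
      ((Lp.memLp G).locallyIntegrable (by norm_num)) fun φ h1 h2 => ?_
    have := hG2 ⟨φ, h1, h2⟩
    simpa [L, mul_comm] using this
  rw [eLpNorm_congr_ae hae, ← ENNReal.ofReal_toReal (Lp.eLpNorm_ne_top G), ← Lp.norm_def,
    ← ENNReal.ofReal_toReal hg.eLpNorm_ne_top, ← ENNReal.ofReal_mul (abs_nonneg t)]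
  exact ENNReal.ofReal_le_ofReal hG1

/-- The converse. The functional $\varphi\mapsto-\int u\rho\,\partial_e\varphi$ is the derivative at
$0$ of the pairings with shifts, hence bounded by `C` in $L^2$, and Riesz provides the derivative
with the same constant. -/
theorem exists_weakDeriv (hρ : Continuous ρ) (hρe : ∀ z (t : ℝ), ρ (z + t • e) = ρ z)
    (hu : MemLp u 2 (volume : Measure (Pt m ℓ))) {C : ℝ} (hC : 0 ≤ C)
    (h : ∀ t : ℝ, eLpNorm (fun z => ρ z * (u (z + t • e) - u z)) 2 volume ≤
      ENNReal.ofReal (|t| * C)) :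
    ∃ G : Lp ℝ 2 (volume : Measure (Pt m ℓ)), ‖G‖ ≤ C ∧ WeakDeriv ρ e u G := by
  have hul := hu.locallyIntegrable (by norm_num)
  have hf : LocallyIntegrable (fun z => u z * ρ z) (volume : Measure (Pt m ℓ)) :=
    hul.mul_continuous hρ
  have hint : ∀ φ : Test m ℓ, Integrable fun z => u z * ρ z * fderiv ℝ φ.1 z e := by
    intro φ
    have := hf.integrable_smul_left_of_hasCompactSupport
      ((φ.2.1.continuous_fderiv (by simp)).clm_apply continuous_const) (φ.2.2.fderiv_apply (𝕜 := ℝ) e)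
    simpa [mul_comm] using this
  let L : Test m ℓ →ₗ[ℝ] ℝ :=
    { toFun := fun φ => -∫ z, u z * ρ z * fderiv ℝ φ.1 z e
      map_add' := by
        intro φ ψ
        rw [← neg_add, ← integral_add (hint φ) (hint ψ)]
        congr 1
        refine integral_congr_ae (ae_of_all _ fun z => ?_)
        have : fderiv ℝ (φ + ψ : Test m ℓ).1 z = fderiv ℝ φ.1 z + fderiv ℝ ψ.1 z :=
          fderiv_add (φ.2.1.differentiable (by simp) z) (ψ.2.1.differentiable (by simp) z)
        simp only [this, add_apply, mul_add]
      map_smul' := by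
        intro c φ
        simp only [RingHom.id_apply, smul_eq_mul]
        rw [mul_neg, ← integral_const_mul]
        congr 1
        refine integral_congr_ae (ae_of_all _ fun z => ?_)
        have : fderiv ℝ (c • φ : Test m ℓ).1 z = c • fderiv ℝ φ.1 z :=
          fderiv_const_smul (φ.2.1.differentiable (by simp) z) c
        simp only [this, smul_apply, smul_eq_mul]
        ring }
  have hb : ∀ φ, |L φ| ≤ C * ‖Test.toLp φ‖ := by
    intro φ
    have hd := hasDerivAt_integral_translate hf φ.2.1 φ.2.2 e 0
    simp only [zero_smul, sub_zero] at hd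
    refine hd.le_of_lip' (by positivity) (Eventually.of_forall fun t => ?_)
    have := integral_diff_mul_eq hρ hρe hul φ.2.1 φ.2.2 t
    rw [Real.norm_eq_abs]
    rw [← this, sub_zero]
    have hm : MemLp (fun z => ρ z * (u (z + t • e) - u z)) 2 volume :=
      ⟨hρ.aestronglyMeasurable.mul ((memLp_comp_add hu (t • e)).1.sub hu.1),
        (h t).trans_lt ENNReal.ofReal_lt_top⟩
    refine (abs_integral_mul_le hm (Test.memLp φ)).trans ?_
    rw [Test.norm_toLp_eq]
    have : (eLpNorm (fun z => ρ z * (u (z + t • e) - u z)) 2 volume).toReal ≤ |t| * C :=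
      ENNReal.toReal_le_of_le_ofReal (by positivity) (h t)
    rw [Real.norm_eq_abs]
    nlinarith [ENNReal.toReal_nonneg (a := eLpNorm φ.1 2 (volume : Measure (Pt m ℓ)))]
  obtain ⟨G, hG1, hG2⟩ := exists_riesz L hC hb
  refine ⟨G, hG1, fun φ h1 h2 => ?_⟩
  rw [← hG2 ⟨φ, h1, h2⟩]
  simp [L, mul_assoc]

end WeakDeriv

end

/-! ### The Grushin-Sobolev space as a Hilbert space -/

theorem sq_toReal_eLpNorm {F : Type*} [NormedAddCommGroup F] [InnerProductSpace ℝ F]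
    {f : Pt m ℓ → F} (hf : MemLp f 2 (volume : Measure (Pt m ℓ))) :
    (eLpNorm f 2 volume).toReal ^ 2 = ∫ z, ‖f z‖ ^ 2 := by
  rw [← Lp.norm_toLp f hf, ← real_inner_self_eq_norm_sq, L2.inner_def]
  refine integral_congr_ae ?_
  filter_upwards [hf.coeFn_toLp] with z hz
  rw [hz, real_inner_self_eq_norm_sq]

theorem H1.memLp_fn (u : H1 m ℓ γ) : MemLp (H1.fn u) 2 (volume : Measure (Pt m ℓ)) :=
  Lp.memLp u.1.fst

theorem H1.memLp_grad (u : H1 m ℓ γ) : MemLp (H1.grad u) 2 (volume : Measure (Pt m ℓ)) :=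
  Lp.memLp u.1.snd

theorem H1.isWeakGrad (u : H1 m ℓ γ) : IsWeakGrad γ (H1.fn u) (H1.grad u) := u.2

theorem H1.norm_fst (u : H1 m ℓ γ) :
    ‖u.1.fst‖ = (eLpNorm (H1.fn u) 2 volume).toReal := Lp.norm_def _

theorem H1.norm_snd (u : H1 m ℓ γ) :
    ‖u.1.snd‖ = (eLpNorm (H1.grad u) 2 volume).toReal := Lp.norm_def _

theorem H1.norm_sq (u : H1 m ℓ γ) : ‖u‖ ^ 2 =
    (eLpNorm (H1.fn u) 2 volume).toReal ^ 2 + (eLpNorm (H1.grad u) 2 volume).toReal ^ 2 := by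
  rw [← H1.norm_fst, ← H1.norm_snd, ← WithLp.prod_norm_sq_eq_of_L2]
  rfl

theorem H1.inner_eq (u v : H1 m ℓ γ) : inner ℝ u v =
    ∫ z, (inner ℝ (H1.grad u z) (H1.grad v z) + H1.fn u z * H1.fn v z) := by
  have h1 : inner ℝ u v = inner ℝ u.1.fst v.1.fst + inner ℝ u.1.snd v.1.snd := rfl
  rw [h1, L2.inner_def, L2.inner_def, ← integral_add (L2.integrable_inner (𝕜 := ℝ) _ _)
    (L2.integrable_inner (𝕜 := ℝ) _ _)]
  refine integral_congr_ae (ae_of_all _ fun z => ?_)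
  simp only [H1.grad, H1.fn, RCLike.inner_apply]
  simp
  ring

theorem H1.eLpNorm_fn_le (u : H1 m ℓ γ) :
    eLpNorm (H1.fn u) 2 volume ≤ ENNReal.ofReal ‖u‖ := by
  rw [← ENNReal.ofReal_toReal (H1.memLp_fn u).eLpNorm_ne_top]
  refine ENNReal.ofReal_le_ofReal (le_of_sq_le_sq ?_ (norm_nonneg _))
  rw [H1.norm_sq]
  nlinarith [sq_nonneg (eLpNorm (H1.grad u) 2 volume).toReal]

theorem H1.eLpNorm_grad_le (u : H1 m ℓ γ) :
    eLpNorm (H1.grad u) 2 volume ≤ ENNReal.ofReal ‖u‖ := by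
  rw [← ENNReal.ofReal_toReal (H1.memLp_grad u).eLpNorm_ne_top]
  refine ENNReal.ofReal_le_ofReal (le_of_sq_le_sq ?_ (norm_nonneg _))
  rw [H1.norm_sq]
  nlinarith [sq_nonneg (eLpNorm (H1.fn u) 2 volume).toReal]

theorem H1.fn_add (u v : H1 m ℓ γ) : H1.fn (u + v) =ᵐ[volume] H1.fn u + H1.fn v :=
  Lp.coeFn_add _ _

theorem H1.fn_smul (c : ℝ) (u : H1 m ℓ γ) : H1.fn (c • u) =ᵐ[volume] c • H1.fn u :=
  Lp.coeFn_smul _ _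

theorem H1.fn_zero : H1.fn (0 : H1 m ℓ γ) =ᵐ[volume] 0 :=
  Lp.coeFn_zero _ _ _

theorem IsWeakGrad.congr {u u' : Pt m ℓ → ℝ} {G G' : Pt m ℓ → Vec m ℓ} (h : IsWeakGrad γ u G)
    (hu : u =ᵐ[volume] u') (hG : G =ᵐ[volume] G') : IsWeakGrad γ u' G' := by
  intro φ h1 h2
  refine ⟨fun i => ?_, fun j => ?_⟩
  · rw [← integral_congr_ae (show (fun z => u z * derivX i φ z) =ᵐ[volume] _ from by
        filter_upwards [hu] with z hz; rw [hz]), (h φ h1 h2).1 i]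
    congr 1
    refine integral_congr_ae ?_
    filter_upwards [hG] with z hz; rw [hz]
  · rw [← integral_congr_ae (show (fun z => u z * derivY γ j φ z) =ᵐ[volume] _ from by
        filter_upwards [hu] with z hz; rw [hz]), (h φ h1 h2).2 j]
    congr 1
    refine integral_congr_ae ?_
    filter_upwards [hG] with z hz; rw [hz]

/-- The element of `H^1_γ` with given function and given weak gradient. -/
def H1.mk {f : Pt m ℓ → ℝ} {G : Pt m ℓ → Vec m ℓ} (hf : MemLp f 2 (volume : Measure (Pt m ℓ)))
    (hG : MemLp G 2 (volume : Measure (Pt m ℓ))) (h : IsWeakGrad γ f G) : H1 m ℓ γ :=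
  ⟨WithLp.toLp 2 (hf.toLp, hG.toLp), h.congr hf.coeFn_toLp.symm hG.coeFn_toLp.symm⟩

theorem H1.fn_mk {f : Pt m ℓ → ℝ} {G : Pt m ℓ → Vec m ℓ}
    (hf : MemLp f 2 (volume : Measure (Pt m ℓ)))
    (hG : MemLp G 2 (volume : Measure (Pt m ℓ))) (h : IsWeakGrad γ f G) :
    H1.fn (H1.mk hf hG h) =ᵐ[volume] f := hf.coeFn_toLp

theorem H1.grad_mk {f : Pt m ℓ → ℝ} {G : Pt m ℓ → Vec m ℓ}
    (hf : MemLp f 2 (volume : Measure (Pt m ℓ)))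
    (hG : MemLp G 2 (volume : Measure (Pt m ℓ))) (h : IsWeakGrad γ f G) :
    H1.grad (H1.mk hf hG h) =ᵐ[volume] G := hG.coeFn_toLp

/-! ### The weak gradient through directional derivatives. -/

theorem memLp_inner_fst {G : Pt m ℓ → Vec m ℓ} (hG : MemLp G 2 (volume : Measure (Pt m ℓ)))
    (a : EuclideanSpace ℝ (Fin m)) :
    MemLp (fun z => inner ℝ a (G z).fst) 2 (volume : Measure (Pt m ℓ)) :=
  let L : Vec m ℓ →L[ℝ] ℝ := (innerSL ℝ a).comp (WithLp.fstL 2 ℝ _ _)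
  L.comp_memLp' hG

theorem memLp_inner_snd {G : Pt m ℓ → Vec m ℓ} (hG : MemLp G 2 (volume : Measure (Pt m ℓ)))
    (b : EuclideanSpace ℝ (Fin ℓ)) :
    MemLp (fun z => inner ℝ b (G z).snd) 2 (volume : Measure (Pt m ℓ)) :=
  let L : Vec m ℓ →L[ℝ] ℝ := (innerSL ℝ b).comp (WithLp.sndL 2 ℝ _ _)
  L.comp_memLp' hG

theorem euclidean_eq_sum {n : ℕ} (a : EuclideanSpace ℝ (Fin n)) :
    a = ∑ i, a i • EuclideanSpace.single i (1 : ℝ) := by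
  ext j
  simp [Finset.sum_apply, Pi.single_apply]

theorem memLp_fderiv_weight {φ : Pt m ℓ → ℝ} (h1 : ContDiff ℝ ∞ φ) (h2 : HasCompactSupport φ)
    {ρ : Pt m ℓ → ℝ} (hρ : Continuous ρ) (e : Pt m ℓ) :
    MemLp (fun z => ρ z * fderiv ℝ φ z e) 2 (volume : Measure (Pt m ℓ)) :=
  memLp_test (hρ.mul ((h1.continuous_fderiv (by simp)).clm_apply continuous_const))
    (h2.fderiv_apply (𝕜 := ℝ) e).mul_left

theorem continuous_weight (γ : ℝ≥0) : Continuous fun z : Pt m ℓ => ‖z.1‖ ^ (γ : ℝ) :=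
  continuous_fst.norm.rpow_const fun _ => Or.inr γ.2

theorem WeakDeriv.sum {ι : Type*} (s : Finset ι) {ρ : Pt m ℓ → ℝ} (hρ : Continuous ρ)
    {e : ι → Pt m ℓ} {u : Pt m ℓ → ℝ} {g : ι → Pt m ℓ → ℝ} (c : ι → ℝ)
    (hu : MemLp u 2 (volume : Measure (Pt m ℓ)))
    (hg : ∀ i, MemLp (g i) 2 (volume : Measure (Pt m ℓ)))
    (h : ∀ i ∈ s, WeakDeriv ρ (e i) u (g i)) :
    WeakDeriv ρ (∑ i ∈ s, c i • e i) u fun z => ∑ i ∈ s, c i * g i z := by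
  intro φ h1 h2
  have e1 : ∀ z, u z * (ρ z * fderiv ℝ φ z (∑ i ∈ s, c i • e i)) =
      ∑ i ∈ s, c i * (u z * (ρ z * fderiv ℝ φ z (e i))) := by
    intro z
    simp only [map_sum, map_smul, Finset.mul_sum, smul_eq_mul]
    exact Finset.sum_congr rfl fun i _ => by ring
  have e2 : ∀ z, (∑ i ∈ s, c i * g i z) * φ z = ∑ i ∈ s, c i * (g i z * φ z) := by
    intro z
    rw [Finset.sum_mul]
    exact Finset.sum_congr rfl fun i _ => by ring
  simp_rw [e1, e2]
  have i1 : ∀ i ∈ s, Integrable fun z => c i * (u z * (ρ z * fderiv ℝ φ z (e i))) := fun i _ =>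
    (hu.integrable_mul (memLp_fderiv_weight h1 h2 hρ (e i))).const_mul (c i)
  have i2 : ∀ i ∈ s, Integrable fun z => c i * (g i z * φ z) := fun i _ =>
    ((hg i).integrable_mul (memLp_test h1.continuous h2)).const_mul (c i)
  rw [integral_finsetSum _ i1, integral_finsetSum _ i2, ← Finset.sum_neg_distrib]
  refine Finset.sum_congr rfl fun i hi => ?_
  rw [integral_const_mul, integral_const_mul, h i hi φ h1 h2, mul_neg]

theorem IsWeakGrad.weakDeriv_fst {u : Pt m ℓ → ℝ} {G : Pt m ℓ → Vec m ℓ} (h : IsWeakGrad γ u G)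
    (hu : MemLp u 2 (volume : Measure (Pt m ℓ))) (hG : MemLp G 2 (volume : Measure (Pt m ℓ)))
    (a : EuclideanSpace ℝ (Fin m)) :
    WeakDeriv (fun _ => 1) (a, 0) u fun z => inner ℝ a (G z).fst := by
  have key := WeakDeriv.sum Finset.univ (ρ := fun _ => 1) continuous_const (u := u)
    (e := fun i => ((EuclideanSpace.single i (1 : ℝ), 0) : Pt m ℓ))
    (g := fun i z => inner ℝ (EuclideanSpace.single i (1 : ℝ)) (G z).fst) (fun i => a i) hu
    (fun i => memLp_inner_fst hG _) (by
      intro i _ φ h1 h2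
      have := (h φ h1 h2).1 i
      simpa [derivX, EuclideanSpace.inner_single_left] using this)
  convert key using 1
  · refine Prod.ext ?_ ?_
    · simp only [Prod.fst_sum, Prod.smul_fst]; exact euclidean_eq_sum a
    · simp [Prod.snd_sum]
  · ext z
    conv_lhs => rw [euclidean_eq_sum a]
    simp [sum_inner, inner_smul_left]

theorem IsWeakGrad.weakDeriv_snd {u : Pt m ℓ → ℝ} {G : Pt m ℓ → Vec m ℓ} (h : IsWeakGrad γ u G)
    (hu : MemLp u 2 (volume : Measure (Pt m ℓ))) (hG : MemLp G 2 (volume : Measure (Pt m ℓ)))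
    (b : EuclideanSpace ℝ (Fin ℓ)) :
    WeakDeriv (fun z => ‖z.1‖ ^ (γ : ℝ)) (0, b) u fun z => inner ℝ b (G z).snd := by
  have key := WeakDeriv.sum Finset.univ (continuous_weight γ) (u := u)
    (e := fun i => ((0, EuclideanSpace.single i (1 : ℝ)) : Pt m ℓ))
    (g := fun i z => inner ℝ (EuclideanSpace.single i (1 : ℝ)) (G z).snd) (fun i => b i) hu
    (fun i => memLp_inner_snd hG _) (by
      intro i _ φ h1 h2
      have := (h φ h1 h2).2 i
      simpa [derivY, EuclideanSpace.inner_single_left] using this)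
  convert key using 1
  · refine Prod.ext ?_ ?_
    · simp [Prod.fst_sum]
    · simp only [Prod.snd_sum, Prod.smul_snd]; exact euclidean_eq_sum b
  · ext z
    conv_lhs => rw [euclidean_eq_sum b]
    simp [sum_inner, inner_smul_left]

theorem isWeakGrad_of_weakDeriv {u : Pt m ℓ → ℝ} {G : Pt m ℓ → Vec m ℓ}
    (h1 : ∀ i, WeakDeriv (fun _ => 1) (EuclideanSpace.single i (1 : ℝ), 0) u fun z => (G z).fst i)
    (h2 : ∀ j, WeakDeriv (fun z => ‖z.1‖ ^ (γ : ℝ)) (0, EuclideanSpace.single j (1 : ℝ)) u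
      fun z => (G z).snd j) : IsWeakGrad γ u G := by
  intro φ hφ hs
  refine ⟨fun i => ?_, fun j => ?_⟩
  · simpa [derivX] using h1 i φ hφ hs
  · simpa [derivY] using h2 j φ hφ hs

/-! ### Uniqueness of the weak gradient. -/

/-- The fundamental lemma of the calculus of variations. It lets an element of $H^1_\gamma$ be
identified by its function alone. -/
theorem WeakDeriv.unique {ρ : Pt m ℓ → ℝ} {e : Pt m ℓ} {u u' g g' : Pt m ℓ → ℝ}
    (h : WeakDeriv ρ e u g) (h' : WeakDeriv ρ e u' g') (hu : u =ᵐ[volume] u')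
    (hg : MemLp g 2 (volume : Measure (Pt m ℓ))) (hg' : MemLp g' 2 (volume : Measure (Pt m ℓ))) :
    g =ᵐ[volume] g' := by
  refine ae_eq_of_integral_contDiff_smul_eq (hg.locallyIntegrable (by norm_num))
    (hg'.locallyIntegrable (by norm_num)) fun φ h1 h2 => ?_
  have e1 := h φ h1 h2
  have e2 := h' φ h1 h2
  rw [integral_congr_ae (show (fun z => u z * (ρ z * fderiv ℝ φ z e)) =ᵐ[volume]
    fun z => u' z * (ρ z * fderiv ℝ φ z e) from by filter_upwards [hu] with z hz; rw [hz]), e2] at e1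
  simpa [mul_comm] using (neg_injective e1).symm

theorem H1.grad_congr {u v : H1 m ℓ γ} (h : H1.fn u =ᵐ[volume] H1.fn v) :
    H1.grad u =ᵐ[volume] H1.grad v := by
  have h1 : ∀ᵐ z : Pt m ℓ, ∀ i, (H1.grad u z).fst i = (H1.grad v z).fst i := by
    rw [ae_all_iff]
    intro i
    have := WeakDeriv.unique
      ((H1.isWeakGrad u).weakDeriv_fst (H1.memLp_fn u) (H1.memLp_grad u) (EuclideanSpace.single i 1))
      ((H1.isWeakGrad v).weakDeriv_fst (H1.memLp_fn v) (H1.memLp_grad v) (EuclideanSpace.single i 1)) h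
      (memLp_inner_fst (H1.memLp_grad u) _) (memLp_inner_fst (H1.memLp_grad v) _)
    filter_upwards [this] with z hz
    simpa [EuclideanSpace.inner_single_left] using hz
  have h2 : ∀ᵐ z : Pt m ℓ, ∀ i, (H1.grad u z).snd i = (H1.grad v z).snd i := by
    rw [ae_all_iff]
    intro i
    have := WeakDeriv.unique
      ((H1.isWeakGrad u).weakDeriv_snd (H1.memLp_fn u) (H1.memLp_grad u) (EuclideanSpace.single i 1))
      ((H1.isWeakGrad v).weakDeriv_snd (H1.memLp_fn v) (H1.memLp_grad v) (EuclideanSpace.single i 1)) h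
      (memLp_inner_snd (H1.memLp_grad u) _) (memLp_inner_snd (H1.memLp_grad v) _)
    filter_upwards [this] with z hz
    simpa [EuclideanSpace.inner_single_left] using hz
  filter_upwards [h1, h2] with z z1 z2
  have a1 : (H1.grad u z).fst = (H1.grad v z).fst := by ext i; exact z1 i
  have a2 : (H1.grad u z).snd = (H1.grad v z).snd := by ext i; exact z2 i
  exact WithLp.ofLp_injective 2 (Prod.ext a1 a2)

theorem H1.ext_fn {u v : H1 m ℓ γ} (h : H1.fn u =ᵐ[volume] H1.fn v) : u = v := by
  refine Subtype.ext (WithLp.ofLp_injective 2 (Prod.ext ?_ ?_))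
  · exact Lp.ext h
  · exact Lp.ext (H1.grad_congr h)

/-! ### Completeness. -/

theorem integral_mul_eq_inner {f : Lp ℝ 2 (volume : Measure (Pt m ℓ))} {φ : Pt m ℓ → ℝ}
    (hφ : MemLp φ 2 (volume : Measure (Pt m ℓ))) :
    ∫ z, f z * φ z = inner ℝ hφ.toLp f := by
  rw [L2.inner_def]
  refine integral_congr_ae ?_
  filter_upwards [hφ.coeFn_toLp] with z hz
  simp [hz]

theorem memLp_smul_vec {φ : Pt m ℓ → ℝ} (hφ : MemLp φ 2 (volume : Measure (Pt m ℓ)))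
    (E : Vec m ℓ) : MemLp (fun z => φ z • E) 2 (volume : Measure (Pt m ℓ)) :=
  hφ.of_le_mul (c := ‖E‖) (hφ.1.smul_const E)
    (ae_of_all _ fun z => by rw [norm_smul, mul_comm])

theorem integral_inner_mul_eq {G : Lp (Vec m ℓ) 2 (volume : Measure (Pt m ℓ))} {φ : Pt m ℓ → ℝ}
    (hφ : MemLp φ 2 (volume : Measure (Pt m ℓ))) (E : Vec m ℓ) :
    ∫ z, inner ℝ E (G z) * φ z = inner ℝ (memLp_smul_vec hφ E).toLp G := by
  rw [L2.inner_def]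
  refine integral_congr_ae ?_
  filter_upwards [(memLp_smul_vec hφ E).coeFn_toLp] with z hz
  rw [hz, inner_smul_left]
  simp [mul_comm]

/-- Both sides of each defining identity are inner products with a fixed $L^2$ element, hence
continuous. -/
theorem isClosed_H1 : IsClosed (H1 m ℓ γ : Set (WithLp 2 (Lp ℝ 2 (volume : Measure (Pt m ℓ)) ×
    Lp (Vec m ℓ) 2 (volume : Measure (Pt m ℓ))))) := by
  have hfst : Continuous fun U : WithLp 2 (Lp ℝ 2 (volume : Measure (Pt m ℓ)) ×
    Lp (Vec m ℓ) 2 (volume : Measure (Pt m ℓ))) => U.fst := (WithLp.fstL 2 ℝ _ _).continuous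
  have hsnd : Continuous fun U : WithLp 2 (Lp ℝ 2 (volume : Measure (Pt m ℓ)) ×
    Lp (Vec m ℓ) 2 (volume : Measure (Pt m ℓ))) => U.snd := (WithLp.sndL 2 ℝ _ _).continuous
  have e1 : ∀ (V : Vec m ℓ) i,
      V.fst i = inner ℝ (WithLp.toLp 2 (EuclideanSpace.single i (1 : ℝ), 0) : Vec m ℓ) V := by
    intro V i
    simp [WithLp.prod_inner_apply, EuclideanSpace.inner_single_left]
  have e2 : ∀ (V : Vec m ℓ) i,
      V.snd i = inner ℝ (WithLp.toLp 2 (0, EuclideanSpace.single i (1 : ℝ)) : Vec m ℓ) V := by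
    intro V i
    simp [WithLp.prod_inner_apply, EuclideanSpace.inner_single_left]
  have : (H1 m ℓ γ : Set (WithLp 2 (Lp ℝ 2 (volume : Measure (Pt m ℓ)) ×
      Lp (Vec m ℓ) 2 (volume : Measure (Pt m ℓ))))) = ⋂ φ : Pt m ℓ → ℝ, ⋂ _ : ContDiff ℝ ∞ φ,
      ⋂ _ : HasCompactSupport φ,
      (⋂ i, {U | ∫ z, U.fst z * derivX i φ z = - ∫ z, (U.snd z).fst i * φ z}) ∩
      ⋂ j, {U | ∫ z, U.fst z * derivY γ j φ z = - ∫ z, (U.snd z).snd j * φ z} := by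
    ext U
    simp only [Set.mem_iInter, Set.mem_inter_iff]
    rfl
  rw [this]
  refine isClosed_iInter fun φ => isClosed_iInter fun h1 => isClosed_iInter fun h2 =>
    (isClosed_iInter fun i => ?_).inter (isClosed_iInter fun j => ?_)
  · refine isClosed_eq ?_ (Continuous.neg ?_)
    · simp_rw [integral_mul_eq_inner (memLp_derivX i h1 h2)]
      exact continuous_const.inner hfst
    · simp_rw [e1, integral_inner_mul_eq (memLp_test h1.continuous h2)]
      exact continuous_const.inner hsnd
  · refine isClosed_eq ?_ (Continuous.neg ?_)
    · simp_rw [integral_mul_eq_inner (memLp_derivY γ j h1 h2)]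
      exact continuous_const.inner hfst
    · simp_rw [e2, integral_inner_mul_eq (memLp_test h1.continuous h2)]
      exact continuous_const.inner hsnd

instance : CompleteSpace (H1 m ℓ γ) := isClosed_H1.completeSpace_coe

/-! ### The absolute value of a Sobolev function. -/

theorem Vec.norm_sq (V : Vec m ℓ) : ‖V‖ ^ 2 = (∑ i, V.fst i ^ 2) + ∑ j, V.snd j ^ 2 := by
  rw [WithLp.prod_norm_sq_eq_of_L2, EuclideanSpace.real_norm_sq_eq, EuclideanSpace.real_norm_sq_eq]

theorem memLp_coord_fst {G : Pt m ℓ → Vec m ℓ} (hG : MemLp G 2 (volume : Measure (Pt m ℓ)))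
    (i : Fin m) : MemLp (fun z => (G z).fst i) 2 (volume : Measure (Pt m ℓ)) := by
  simpa [EuclideanSpace.inner_single_left] using memLp_inner_fst hG (EuclideanSpace.single i 1)

theorem memLp_coord_snd {G : Pt m ℓ → Vec m ℓ} (hG : MemLp G 2 (volume : Measure (Pt m ℓ)))
    (j : Fin ℓ) : MemLp (fun z => (G z).snd j) 2 (volume : Measure (Pt m ℓ)) := by
  simpa [EuclideanSpace.inner_single_left] using memLp_inner_snd hG (EuclideanSpace.single j 1)

theorem sq_eLpNorm_vec {G : Pt m ℓ → Vec m ℓ} (hG : MemLp G 2 (volume : Measure (Pt m ℓ))) :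
    (eLpNorm G 2 volume).toReal ^ 2 =
      (∑ i, (eLpNorm (fun z => (G z).fst i) 2 volume).toReal ^ 2) +
        ∑ j, (eLpNorm (fun z => (G z).snd j) 2 volume).toReal ^ 2 := by
  have h1 := fun i => (memLp_coord_fst hG i).integrable_sq
  have h2 := fun j => (memLp_coord_snd hG j).integrable_sq
  rw [sq_toReal_eLpNorm hG]
  simp_rw [Vec.norm_sq]
  rw [integral_add (integrable_finsetSum _ fun i _ => h1 i)
    (integrable_finsetSum _ fun i _ => h2 i),
    integral_finsetSum _ fun i _ => h1 i, integral_finsetSum _ fun i _ => h2 i]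
  congr 1
  · exact Finset.sum_congr rfl fun i _ => by simp [sq_toReal_eLpNorm (memLp_coord_fst hG i)]
  · exact Finset.sum_congr rfl fun i _ => by simp [sq_toReal_eLpNorm (memLp_coord_snd hG i)]

/-- The vector field with given coordinates. -/
def vecOf (g : Fin m → Pt m ℓ → ℝ) (h : Fin ℓ → Pt m ℓ → ℝ) (z : Pt m ℓ) : Vec m ℓ :=
  WithLp.toLp 2 (WithLp.toLp 2 fun i => g i z, WithLp.toLp 2 fun j => h j z)

theorem memLp_vecOf {g : Fin m → Pt m ℓ → ℝ} {h : Fin ℓ → Pt m ℓ → ℝ}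
    (hg : ∀ i, MemLp (g i) 2 (volume : Measure (Pt m ℓ)))
    (hh : ∀ j, MemLp (h j) 2 (volume : Measure (Pt m ℓ))) :
    MemLp (vecOf g h) 2 (volume : Measure (Pt m ℓ)) := by
  have h1 := memLp_finsetSum (Finset.univ : Finset (Fin m)) fun i _ => memLp_smul_vec (hg i)
    (WithLp.toLp 2 (EuclideanSpace.single i (1 : ℝ), 0) : Vec m ℓ)
  have h2 := memLp_finsetSum (Finset.univ : Finset (Fin ℓ)) fun j _ => memLp_smul_vec (hh j)
    (WithLp.toLp 2 (0, EuclideanSpace.single j (1 : ℝ)) : Vec m ℓ)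
  refine (h1.add h2).ae_eq (ae_of_all _ fun z => ?_)
  refine WithLp.ofLp_injective 2 (Prod.ext ?_ ?_)
  · ext i
    simp [vecOf, Prod.fst_sum, Finset.sum_apply, Pi.single_apply]
  · ext i
    simp [vecOf, Prod.snd_sum, Finset.sum_apply, Pi.single_apply]

/-- The reverse triangle inequality passes the difference quotient bound from $u$ to $|u|$ with the
same constant, so no chain rule is needed. -/
theorem WeakDeriv.exists_abs {ρ : Pt m ℓ → ℝ} {e : Pt m ℓ} {u g : Pt m ℓ → ℝ}
    (hρ : Continuous ρ) (hρe : ∀ z (t : ℝ), ρ (z + t • e) = ρ z)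
    (hu : MemLp u 2 (volume : Measure (Pt m ℓ))) (hg : MemLp g 2 (volume : Measure (Pt m ℓ)))
    (h : WeakDeriv ρ e u g) : ∃ g' : Pt m ℓ → ℝ, MemLp g' 2 (volume : Measure (Pt m ℓ)) ∧
      (eLpNorm g' 2 volume).toReal ≤ (eLpNorm g 2 volume).toReal ∧
      WeakDeriv ρ e (fun z => |u z|) g' := by
  have key : ∀ t : ℝ, eLpNorm (fun z => ρ z * (|u (z + t • e)| - |u z|)) 2 volume ≤
      ENNReal.ofReal (|t| * (eLpNorm g 2 volume).toReal) := by
    intro t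
    rw [ENNReal.ofReal_mul (abs_nonneg t), ENNReal.ofReal_toReal hg.eLpNorm_ne_top]
    refine le_trans (eLpNorm_mono fun z => ?_) (h.eLpNorm_translate_sub_le hρ hρe hu hg t)
    rw [norm_mul, norm_mul]
    gcongr
    exact abs_abs_sub_abs_le_abs_sub _ _
  obtain ⟨G, hG, hG'⟩ := exists_weakDeriv hρ hρe (u := fun z => |u z|) hu.abs
    ENNReal.toReal_nonneg key
  exact ⟨G, Lp.memLp G, by rwa [← Lp.norm_def], hG'⟩

theorem H1.exists_abs (u : H1 m ℓ γ) : ∃ v : H1 m ℓ γ,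
    H1.fn v =ᵐ[volume] (fun z => |H1.fn u z|) ∧ ‖v‖ ≤ ‖u‖ := by
  have hu := H1.memLp_fn u
  have hG := H1.memLp_grad u
  have h1 : ∀ i, ∃ g' : Pt m ℓ → ℝ, MemLp g' 2 (volume : Measure (Pt m ℓ)) ∧
      (eLpNorm g' 2 volume).toReal ≤ (eLpNorm (fun z => (H1.grad u z).fst i) 2 volume).toReal ∧
      WeakDeriv (fun _ => 1) (EuclideanSpace.single i (1 : ℝ), 0) (fun z => |H1.fn u z|) g' := by
    intro i
    have := (H1.isWeakGrad u).weakDeriv_fst hu hG (EuclideanSpace.single i 1)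
    simp only [EuclideanSpace.inner_single_left, map_one, one_mul] at this
    exact this.exists_abs continuous_const (fun _ _ => rfl) hu (memLp_coord_fst hG i)
  have h2 : ∀ j, ∃ g' : Pt m ℓ → ℝ, MemLp g' 2 (volume : Measure (Pt m ℓ)) ∧
      (eLpNorm g' 2 volume).toReal ≤ (eLpNorm (fun z => (H1.grad u z).snd j) 2 volume).toReal ∧
      WeakDeriv (fun z => ‖z.1‖ ^ (γ : ℝ)) (0, EuclideanSpace.single j (1 : ℝ))
        (fun z => |H1.fn u z|) g' := by
    intro j
    have := (H1.isWeakGrad u).weakDeriv_snd hu hG (EuclideanSpace.single j 1)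
    simp only [EuclideanSpace.inner_single_left, map_one, one_mul] at this
    exact this.exists_abs (continuous_weight γ) (fun _ _ => by simp) hu (memLp_coord_snd hG j)
  choose g hg1 hg2 hg3 using h1
  choose h hh1 hh2 hh3 using h2
  have hV := memLp_vecOf hg1 hh1
  refine ⟨H1.mk hu.abs hV (isWeakGrad_of_weakDeriv hg3 hh3), H1.fn_mk _ _ _, ?_⟩
  refine le_of_sq_le_sq ?_ (norm_nonneg _)
  rw [H1.norm_sq, H1.norm_sq, eLpNorm_congr_ae (H1.fn_mk _ _ _),
    eLpNorm_congr_ae (H1.grad_mk _ _ _), sq_eLpNorm_vec hV, sq_eLpNorm_vec hG]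
  refine add_le_add (le_of_eq ?_) (add_le_add (Finset.sum_le_sum fun i _ => ?_)
    (Finset.sum_le_sum fun j _ => ?_))
  · congr 2
    exact eLpNorm_norm (H1.fn u)
  · exact pow_le_pow_left₀ ENNReal.toReal_nonneg (hg2 i) 2
  · exact pow_le_pow_left₀ ENNReal.toReal_nonneg (hh2 j) 2

/-! ### Symmetries -/

/-- An affine map `(x, y) ↦ (A x + a, B y + b)` with isometries `A, B` that leaves the weight
`|x|^γ` invariant. -/
structure Sym (m ℓ : ℕ) (γ : ℝ≥0) where
  A : EuclideanSpace ℝ (Fin m) ≃ₗᵢ[ℝ] EuclideanSpace ℝ (Fin m)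
  B : EuclideanSpace ℝ (Fin ℓ) ≃ₗᵢ[ℝ] EuclideanSpace ℝ (Fin ℓ)
  a : EuclideanSpace ℝ (Fin m)
  b : EuclideanSpace ℝ (Fin ℓ)
  weight : ∀ x, ‖A x + a‖ ^ (γ : ℝ) = ‖x‖ ^ (γ : ℝ)

namespace Sym

/-- The linear part. -/
def lin (S : Sym m ℓ γ) (z : Pt m ℓ) : Pt m ℓ := (S.A z.1, S.B z.2)

/-- The map of `ℝ^N` given by a symmetry. -/
def map (S : Sym m ℓ γ) (z : Pt m ℓ) : Pt m ℓ := (S.A z.1 + S.a, S.B z.2 + S.b)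

/-- The inverse map. -/
def inv (S : Sym m ℓ γ) : Sym m ℓ γ where
  A := S.A.symm
  B := S.B.symm
  a := -S.A.symm S.a
  b := -S.B.symm S.b
  weight x := by
    rw [← S.weight]
    simp [← sub_eq_add_neg]

theorem map_inv_map (S : Sym m ℓ γ) (z : Pt m ℓ) : S.map (S.inv.map z) = z := by
  simp [map, inv]

theorem inv_map_map (S : Sym m ℓ γ) (z : Pt m ℓ) : S.inv.map (S.map z) = z := by
  simp [map, inv]

theorem measurePreserving (S : Sym m ℓ γ) : MeasurePreserving S.map := by
  have h1 := (measurePreserving_add_right (volume : Measure (EuclideanSpace ℝ (Fin m))) S.a).comp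
    S.A.measurePreserving
  have h2 := (measurePreserving_add_right (volume : Measure (EuclideanSpace ℝ (Fin ℓ))) S.b).comp
    S.B.measurePreserving
  exact h1.prod h2

/-- A symmetry as a measurable equivalence. -/
def equiv (S : Sym m ℓ γ) : Pt m ℓ ≃ᵐ Pt m ℓ where
  toFun := S.map
  invFun := S.inv.map
  left_inv := S.inv_map_map
  right_inv := S.map_inv_map
  measurable_toFun := S.measurePreserving.measurable
  measurable_invFun := S.inv.measurePreserving.measurable

theorem integral_comp (S : Sym m ℓ γ) {F : Type*} [NormedAddCommGroup F] [NormedSpace ℝ F]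
    (f : Pt m ℓ → F) : ∫ z, f (S.map z) = ∫ z, f z :=
  S.measurePreserving.integral_comp' (f := S.equiv) f

theorem map_sub_map (S : Sym m ℓ γ) (z w : Pt m ℓ) : S.map z - S.map w = S.lin (z - w) := by
  simp [map, lin]

theorem gauge_lin (S : Sym m ℓ γ) (z : Pt m ℓ) : gauge γ (S.lin z) = gauge γ z := by
  simp [gauge, lin]

/-- The gradient of `u ∘ S` in terms of the gradient of `u`. -/
def vec (S : Sym m ℓ γ) (V : Vec m ℓ) : Vec m ℓ :=
  WithLp.toLp 2 (S.A.symm V.fst, S.B.symm V.snd)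

theorem inner_vec (S : Sym m ℓ γ) (V W : Vec m ℓ) : inner ℝ (S.vec V) (S.vec W) = inner ℝ V W := by
  simp [vec, WithLp.prod_inner_apply]

theorem norm_vec (S : Sym m ℓ γ) (V : Vec m ℓ) : ‖S.vec V‖ = ‖V‖ := by
  refine (sq_eq_sq₀ (norm_nonneg _) (norm_nonneg _)).1 ?_
  rw [← real_inner_self_eq_norm_sq, ← real_inner_self_eq_norm_sq, inner_vec]

theorem continuous_vec (S : Sym m ℓ γ) : Continuous S.vec := by
  have h1 : Continuous fun V : Vec m ℓ => V.fst := (WithLp.fstL 2 ℝ _ _).continuous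
  have h2 : Continuous fun V : Vec m ℓ => V.snd := (WithLp.sndL 2 ℝ _ _).continuous
  exact (WithLp.prod_continuous_toLp 2 _ _).comp
    ((S.A.symm.continuous.comp h1).prodMk (S.B.symm.continuous.comp h2))

theorem contDiff_map (S : Sym m ℓ γ) : ContDiff ℝ ∞ S.map :=
  ((S.A.contDiff.comp contDiff_fst).add contDiff_const).prodMk
    ((S.B.contDiff.comp contDiff_snd).add contDiff_const)

theorem hasFDerivAt_map (S : Sym m ℓ γ) (z : Pt m ℓ) :
    HasFDerivAt S.map ((S.A.toContinuousLinearEquiv : _ →L[ℝ] _).prodMap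
      (S.B.toContinuousLinearEquiv : _ →L[ℝ] _)) z :=
  ((S.A.toContinuousLinearEquiv.hasFDerivAt.comp z hasFDerivAt_fst).add_const S.a).prodMk
    ((S.B.toContinuousLinearEquiv.hasFDerivAt.comp z hasFDerivAt_snd).add_const S.b)

theorem test_comp (S : Sym m ℓ γ) {φ : Pt m ℓ → ℝ} (h1 : ContDiff ℝ ∞ φ)
    (h2 : HasCompactSupport φ) :
    ContDiff ℝ ∞ (fun z => φ (S.map z)) ∧ HasCompactSupport fun z => φ (S.map z) :=
  ⟨h1.comp S.contDiff_map, h2.comp_homeomorph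
    { S.equiv.toEquiv with
      continuous_toFun := S.contDiff_map.continuous
      continuous_invFun := S.inv.contDiff_map.continuous }⟩

theorem fderiv_comp (S : Sym m ℓ γ) {φ : Pt m ℓ → ℝ} (h1 : ContDiff ℝ ∞ φ) (z e : Pt m ℓ) :
    fderiv ℝ (fun z => φ (S.map z)) z e = fderiv ℝ φ (S.map z) (S.lin e) := by
  have := ((h1.differentiable (by simp) (S.map z)).hasFDerivAt.comp z (S.hasFDerivAt_map z)).fderiv
  have h : fderiv ℝ (fun z => φ (S.map z)) z = _ := this
  rw [h]
  rfl

theorem isWeakGrad (S : Sym m ℓ γ) {u : Pt m ℓ → ℝ} {G : Pt m ℓ → Vec m ℓ}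
    (h : IsWeakGrad γ u G)
    (hu : MemLp u 2 (volume : Measure (Pt m ℓ))) (hG : MemLp G 2 (volume : Measure (Pt m ℓ))) :
    IsWeakGrad γ (fun z => u (S.map z)) (fun z => S.vec (G (S.map z))) := by
  refine isWeakGrad_of_weakDeriv (fun i φ h1 h2 => ?_) (fun j φ h1 h2 => ?_)
  · obtain ⟨t1, t2⟩ := S.inv.test_comp h1 h2
    -- The given gradient is tested with $\varphi\circ S^{-1}$ in the rotated direction $Ae_i$; the
    -- change of variables by `S` then restores `φ` and $e_i$.
    have key := h.weakDeriv_fst hu hG (S.A (EuclideanSpace.single i 1)) _ t1 t2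
    rw [← S.integral_comp, ← S.integral_comp (fun z => _ * φ (S.inv.map z))] at key
    simp only [S.inv.fderiv_comp h1, inv_map_map] at key
    refine Eq.trans ?_ (key.trans ?_)
    · simp [lin, inv]
    · congr 2
      ext z
      congr 1
      have : inner ℝ (S.A (EuclideanSpace.single i 1)) (G (S.map z)).fst =
          inner ℝ (EuclideanSpace.single i 1) (S.A.symm (G (S.map z)).fst) := by
        rw [← S.A.symm.inner_map_map, S.A.symm_apply_apply]
      rw [this]
      simp [vec, EuclideanSpace.inner_single_left]
  · obtain ⟨t1, t2⟩ := S.inv.test_comp h1 h2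
    have key := h.weakDeriv_snd hu hG (S.B (EuclideanSpace.single j 1)) _ t1 t2
    rw [← S.integral_comp, ← S.integral_comp (fun z => _ * φ (S.inv.map z))] at key
    simp only [S.inv.fderiv_comp h1, inv_map_map] at key
    refine Eq.trans ?_ (key.trans ?_)
    · simp [lin, inv, map, S.weight]
    · congr 2
      ext z
      congr 1
      have : inner ℝ (S.B (EuclideanSpace.single j 1)) (G (S.map z)).snd =
          inner ℝ (EuclideanSpace.single j 1) (S.B.symm (G (S.map z)).snd) := by
        rw [← S.B.symm.inner_map_map, S.B.symm_apply_apply]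
      rw [this]
      simp [vec, EuclideanSpace.inner_single_left]

theorem memLp_vec (S : Sym m ℓ γ) {G : Pt m ℓ → Vec m ℓ}
    (hG : MemLp G 2 (volume : Measure (Pt m ℓ))) :
    MemLp (fun z => S.vec (G (S.map z))) 2 (volume : Measure (Pt m ℓ)) := by
  have h := hG.comp_measurePreserving S.measurePreserving
  exact h.of_le (S.continuous_vec.comp_aestronglyMeasurable h.1)
    (ae_of_all _ fun z => (S.norm_vec _).le)

/-- The composition `u ∘ S`. -/
def pull (S : Sym m ℓ γ) (u : H1 m ℓ γ) : H1 m ℓ γ :=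
  H1.mk ((H1.memLp_fn u).comp_measurePreserving S.measurePreserving)
    (S.memLp_vec (H1.memLp_grad u))
    (S.isWeakGrad (H1.isWeakGrad u) (H1.memLp_fn u) (H1.memLp_grad u))

theorem fn_pull (S : Sym m ℓ γ) (u : H1 m ℓ γ) :
    H1.fn (S.pull u) =ᵐ[volume] fun z => H1.fn u (S.map z) := H1.fn_mk _ _ _

theorem grad_pull (S : Sym m ℓ γ) (u : H1 m ℓ γ) :
    H1.grad (S.pull u) =ᵐ[volume] fun z => S.vec (H1.grad u (S.map z)) := H1.grad_mk _ _ _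

theorem inner_pull (S : Sym m ℓ γ) (u v : H1 m ℓ γ) :
    inner ℝ (S.pull u) (S.pull v) = inner ℝ u v := by
  rw [H1.inner_eq, H1.inner_eq, ← S.integral_comp
    fun z => inner ℝ (H1.grad u z) (H1.grad v z) + H1.fn u z * H1.fn v z]
  refine integral_congr_ae ?_
  filter_upwards [S.fn_pull u, S.fn_pull v, S.grad_pull u, S.grad_pull v] with z h1 h2 h3 h4
  rw [h1, h2, h3, h4, inner_vec]

end Sym

/-! ### Translation estimates -/

theorem H1.measurable_fn (u : H1 m ℓ γ) : Measurable (H1.fn u) :=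
  (Lp.stronglyMeasurable u.1.fst).measurable

theorem norm_fst_le (V : Vec m ℓ) : ‖V.fst‖ ≤ ‖V‖ := by
  refine le_of_sq_le_sq ?_ (norm_nonneg _)
  rw [WithLp.prod_norm_sq_eq_of_L2]
  nlinarith [sq_nonneg ‖V.snd‖]

theorem norm_snd_le (V : Vec m ℓ) : ‖V.snd‖ ≤ ‖V‖ := by
  refine le_of_sq_le_sq ?_ (norm_nonneg _)
  rw [WithLp.prod_norm_sq_eq_of_L2]
  nlinarith [sq_nonneg ‖V.fst‖]

theorem H1.eLpNorm_shift_fst_le (u : H1 m ℓ γ) (a : EuclideanSpace ℝ (Fin m)) :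
    eLpNorm (fun z => H1.fn u (z + (a, 0)) - H1.fn u z) 2 volume ≤
      ENNReal.ofReal (‖a‖ * ‖u‖) := by
  have h := ((H1.isWeakGrad u).weakDeriv_fst (H1.memLp_fn u)
    (H1.memLp_grad u) a).eLpNorm_translate_sub_le continuous_const (fun _ _ => rfl)
    (H1.memLp_fn u) (memLp_inner_fst (H1.memLp_grad u) a) 1
  simp only [one_smul, one_mul, abs_one, ENNReal.ofReal_one] at h
  refine h.trans ?_
  rw [ENNReal.ofReal_mul (norm_nonneg a)]
  refine le_trans (eLpNorm_le_mul_eLpNorm_of_ae_le_mul (g := H1.grad u) (c := ‖a‖)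
    (ae_of_all _ fun z => ?_) 2) (by gcongr; exact H1.eLpNorm_grad_le u)
  exact (abs_real_inner_le_norm _ _).trans (by gcongr; exact norm_fst_le _)

theorem H1.eLpNorm_shift_snd_le (u : H1 m ℓ γ) (b : EuclideanSpace ℝ (Fin ℓ)) :
    eLpNorm (fun z => ‖z.1‖ ^ (γ : ℝ) * (H1.fn u (z + (0, b)) - H1.fn u z)) 2 volume ≤
      ENNReal.ofReal (‖b‖ * ‖u‖) := by
  have h := ((H1.isWeakGrad u).weakDeriv_snd (H1.memLp_fn u)
    (H1.memLp_grad u) b).eLpNorm_translate_sub_le (continuous_weight γ) (fun _ _ => by simp)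
    (H1.memLp_fn u) (memLp_inner_snd (H1.memLp_grad u) b) 1
  simp only [one_smul, one_mul, abs_one, ENNReal.ofReal_one] at h
  refine h.trans ?_
  rw [ENNReal.ofReal_mul (norm_nonneg b)]
  refine le_trans (eLpNorm_le_mul_eLpNorm_of_ae_le_mul (g := H1.grad u) (c := ‖b‖)
    (ae_of_all _ fun z => ?_) 2) (by gcongr; exact H1.eLpNorm_grad_le u)
  exact (abs_real_inner_le_norm _ _).trans (by gcongr; exact norm_snd_le _)

/-- On $|x|\ge\tau$ the weight is at least $\tau^\gamma$ and can be divided out. -/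
theorem H1.eLpNorm_shift_snd_far_le (u : H1 m ℓ γ) (b : EuclideanSpace ℝ (Fin ℓ)) {τ : ℝ}
    (hτ : 0 < τ) :
    eLpNorm ({z : Pt m ℓ | τ ≤ ‖z.1‖}.indicator fun z => H1.fn u (z + (0, b)) - H1.fn u z) 2 volume
      ≤ ENNReal.ofReal (τ ^ (-(γ : ℝ)) * (‖b‖ * ‖u‖)) := by
  rw [ENNReal.ofReal_mul (by positivity)]
  refine le_trans (eLpNorm_le_mul_eLpNorm_of_ae_le_mul
    (g := fun z => ‖z.1‖ ^ (γ : ℝ) * (H1.fn u (z + (0, b)) - H1.fn u z)) (c := τ ^ (-(γ : ℝ)))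
    (ae_of_all _ fun z => ?_) 2) (by gcongr; exact H1.eLpNorm_shift_snd_le u b)
  by_cases hz : z ∈ {z : Pt m ℓ | τ ≤ ‖z.1‖}
  · rw [Set.indicator_of_mem hz, norm_mul, ← mul_assoc]
    refine le_mul_of_one_le_left (norm_nonneg _) ?_
    rw [Real.norm_of_nonneg (by positivity), Real.rpow_neg hτ.le, inv_mul_eq_div,
      one_le_div (by positivity)]
    exact Real.rpow_le_rpow hτ.le hz γ.2
  · rw [Set.indicator_of_notMem hz, norm_zero]
    positivity

/-- A shift by `b` on the set `S` is controlled by the one on the translate `S + k`. -/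
theorem eLpNorm_indicator_shift_le {f : Pt m ℓ → ℝ} (hf : Measurable f) {S : Set (Pt m ℓ)}
    (hS : MeasurableSet S) {b k : Pt m ℓ} (hk : ∀ z ∈ Sᶜ, z + k ∈ S) :
    eLpNorm (Sᶜ.indicator fun z => f (z + b) - f z) 2 volume ≤
      eLpNorm (S.indicator fun z => f (z + b) - f z) 2 volume +
        2 * eLpNorm (fun z => f (z + k) - f z) 2 volume := by
  have sm : ∀ c : Pt m ℓ, Measurable fun z => f (z + c) - f z := fun c =>
    (hf.comp (measurable_id.add_const c)).sub hf
  have m1 : Measurable fun z => S.indicator (fun z => f (z + b) - f z) (z + k) :=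
    ((sm b).indicator hS).comp (measurable_id.add_const _)
  have m2 : Measurable fun z => f (z + b + k) - f (z + b) := (sm k).comp (measurable_id.add_const b)
  have hle : ∀ z, ‖Sᶜ.indicator (fun z => f (z + b) - f z) z‖ ≤
      ‖S.indicator (fun z => f (z + b) - f z) (z + k) - (f (z + b + k) - f (z + b))
        + (f (z + k) - f z)‖ ∨ z ∈ S := by
    intro z
    by_cases hz : z ∈ S
    · exact Or.inr hz
    · left
      rw [Set.indicator_of_mem (show z ∈ Sᶜ from hz), Set.indicator_of_mem (hk z hz),
        add_right_comm z k b]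
      refine le_of_eq ?_
      congr 1
      ring
  have hle' : ∀ z, ‖Sᶜ.indicator (fun z => f (z + b) - f z) z‖ ≤
      ‖S.indicator (fun z => f (z + b) - f z) (z + k) - (f (z + b + k) - f (z + b))
        + (f (z + k) - f z)‖ := by
    intro z
    rcases hle z with h | h
    · exact h
    · rw [Set.indicator_of_notMem (by simpa using h), norm_zero]
      exact norm_nonneg _
  refine (eLpNorm_mono hle').trans ?_
  refine (eLpNorm_add_le (m1.sub m2).aestronglyMeasurable (sm k).aestronglyMeasurable
    (by norm_num)).trans ?_
  rw [two_mul, ← add_assoc]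
  gcongr
  refine (eLpNorm_sub_le m1.aestronglyMeasurable m2.aestronglyMeasurable (by norm_num)).trans ?_
  have e1 := eLpNorm_comp_add (q := 2) ((sm b).indicator hS).aestronglyMeasurable k
  have e2 := eLpNorm_comp_add (q := 2) (sm k).aestronglyMeasurable b
  exact add_le_add e1.le e2.le

/-- The set `S` is the good region. Its complement is carried into it by `k`, which costs two shifts
by `k` in addition to the shift by `b` inside `S`. -/
theorem eLpNorm_shift_le_of_far {f : Pt m ℓ → ℝ} (hf : Measurable f) {b k : Pt m ℓ}
    {S : Set (Pt m ℓ)}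
    (hS : MeasurableSet S) (hk : ∀ z ∈ Sᶜ, z + k ∈ S) {r s : ℝ} (hr : 0 ≤ r) (hs : 0 ≤ s)
    (hfar : eLpNorm (S.indicator fun z => f (z + b) - f z) 2 volume ≤ ENNReal.ofReal r)
    (hsh : eLpNorm (fun z => f (z + k) - f z) 2 volume ≤ ENNReal.ofReal s) :
    eLpNorm (fun z => f (z + b) - f z) 2 volume ≤ ENNReal.ofReal (2 * r + 2 * s) := by
  have hdm : Measurable fun z => f (z + b) - f z := (hf.comp (measurable_id.add_const _)).sub hf
  have hnear := eLpNorm_indicator_shift_le hf hS (b := b) hk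
  rw [← Set.indicator_self_add_compl S fun z => f (z + b) - f z]
  refine (eLpNorm_add_le (hdm.indicator hS).aestronglyMeasurable
    (hdm.indicator hS.compl).aestronglyMeasurable (by norm_num)).trans ?_
  refine (add_le_add hfar (hnear.trans (add_le_add hfar (mul_le_mul_right hsh 2)))).trans ?_
  rw [show (2 : ℝ≥0∞) = ENNReal.ofReal 2 by simp, ← ENNReal.ofReal_mul (by norm_num),
    ← ENNReal.ofReal_add (by positivity) (by positivity),
    ← ENNReal.ofReal_add (by positivity) (by positivity)]
  exact ENNReal.ofReal_le_ofReal (by linarith)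

/-- The weight degenerates at $x=0$, so a shift in $y$ is not controlled there directly. The way
round: move in $x$ by $2\tau$ out of $|x|<\tau$, shift in $y$, and move back. The constant is
$6=2\cdot1+2\cdot2$. -/
theorem H1.eLpNorm_shift_snd_le' (hm : 1 ≤ m) (u : H1 m ℓ γ) (b : EuclideanSpace ℝ (Fin ℓ)) {τ : ℝ}
    (hτ : 0 < τ) (hb : ‖b‖ ≤ τ ^ (1 + (γ : ℝ))) :
    eLpNorm (fun z => H1.fn u (z + (0, b)) - H1.fn u z) 2 volume ≤
      ENNReal.ofReal (6 * τ * ‖u‖) := by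
  obtain ⟨k, hk⟩ : ∃ k : EuclideanSpace ℝ (Fin m), ‖k‖ = 2 * τ :=
    ⟨EuclideanSpace.single ⟨0, hm⟩ (2 * τ), by
      rw [PiLp.norm_single, Real.norm_eq_abs]; exact abs_of_pos (by positivity)⟩
  have hfar : eLpNorm ({z : Pt m ℓ | τ ≤ ‖z.1‖}.indicator
      fun z => H1.fn u (z + (0, b)) - H1.fn u z) 2 volume ≤ ENNReal.ofReal (τ * ‖u‖) := by
    refine (H1.eLpNorm_shift_snd_far_le u b hτ).trans (ENNReal.ofReal_le_ofReal ?_)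
    calc τ ^ (-(γ : ℝ)) * (‖b‖ * ‖u‖) ≤ τ ^ (-(γ : ℝ)) * (τ ^ (1 + (γ : ℝ)) * ‖u‖) := by gcongr
      _ = τ * ‖u‖ := by
        rw [← mul_assoc, ← Real.rpow_add hτ]
        simp
  refine (eLpNorm_shift_le_of_far (H1.measurable_fn u)
    (measurableSet_le measurable_const measurable_fst.norm) ?_ (by positivity) (by positivity)
    hfar (H1.eLpNorm_shift_fst_le u k)).trans (ENNReal.ofReal_le_ofReal ?_)
  · intro z hz
    simp only [Set.mem_compl_iff, Set.mem_ofPred_eq, not_le, Prod.fst_add] at hz ⊢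
    have := norm_sub_norm_le k (-z.1)
    rw [sub_neg_eq_add, norm_neg, add_comm] at this
    linarith
  · rw [hk]
    linarith

theorem eLpNorm_shift_le_of_coords {f : Pt m ℓ → ℝ} (hmeas : Measurable f) (w : Pt m ℓ) {r s : ℝ}
    (hr : 0 ≤ r) (hs : 0 ≤ s)
    (a1 : eLpNorm (fun z => f (z + (w.1, 0)) - f z) 2 volume ≤ ENNReal.ofReal r)
    (a2 : eLpNorm (fun z => f (z + (0, w.2)) - f z) 2 volume ≤ ENNReal.ofReal s) :
    eLpNorm (fun z => f (z + w) - f z) 2 volume ≤ ENNReal.ofReal (r + s) := by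
  have m1 : Measurable fun z : Pt m ℓ => f (z + (0, w.2)) - f z :=
    (hmeas.comp (measurable_id.add_const _)).sub hmeas
  have m2 : Measurable fun z : Pt m ℓ => f (z + (w.1, 0)) - f z :=
    (hmeas.comp (measurable_id.add_const _)).sub hmeas
  have e : (fun z => f (z + w) - f z) =
      (fun z => f (z + (0, w.2) + (w.1, 0)) - f (z + (0, w.2))) + fun z => f (z + (0, w.2)) - f z := by
    ext z
    have : z + w = z + (0, w.2) + (w.1, 0) := by
      rw [add_assoc]; congr 1; ext1 <;> simp
    simp [this]
  rw [e, ENNReal.ofReal_add hr hs]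
  refine (eLpNorm_add_le (m2.comp (measurable_id.add_const (0, w.2))).aestronglyMeasurable
    m1.aestronglyMeasurable (by norm_num)).trans (add_le_add ?_ a2)
  exact (eLpNorm_comp_add (q := 2) m2.aestronglyMeasurable (0, w.2)).trans_le a1

/-- The translation estimate in `L^2`, which reflects the anisotropic scaling of the operator. -/
theorem H1.eLpNorm_shift_le (hm : 1 ≤ m) (u : H1 m ℓ γ) (w : Pt m ℓ) {τ : ℝ}
    (hτ : 0 < τ) (h1 : ‖w.1‖ ≤ τ) (h2 : ‖w.2‖ ≤ τ ^ (1 + (γ : ℝ))) :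
    eLpNorm (fun z => H1.fn u (z + w) - H1.fn u z) 2 volume ≤
      ENNReal.ofReal (7 * τ * ‖u‖) := by
  have a1 := H1.eLpNorm_shift_fst_le u w.1
  have a2 := H1.eLpNorm_shift_snd_le' hm u w.2 hτ h2
  have h0 : 0 ≤ ‖u‖ := norm_nonneg u
  generalize ‖u‖ = L at a1 a2 h0 ⊢
  refine (eLpNorm_shift_le_of_coords (H1.measurable_fn u) w (by positivity) (by positivity) a1
    a2).trans (ENNReal.ofReal_le_ofReal ?_)
  have := mul_le_mul_of_nonneg_right h1 h0
  linarith

section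

/-! ### Averages over anisotropic boxes -/

/-- The product of the balls of radii `τ` and `τ ^ (1 + γ)`, in which `|x|^γ ∇_y` scales as `∇_x`. -/
def box (γ : ℝ≥0) (τ : ℝ) : Set (Pt m ℓ) :=
  Metric.ball 0 τ ×ˢ Metric.ball 0 (τ ^ (1 + (γ : ℝ)))

theorem measurableSet_box (τ : ℝ) : MeasurableSet (box γ τ : Set (Pt m ℓ)) :=
  measurableSet_ball.prod measurableSet_ball

/-- Here the homogeneous dimension enters the embedding: $m$ powers of $\tau$ come from $x$ and
$(1+\gamma)\ell$ from $y$. -/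
theorem volume_box {τ : ℝ} (hτ : 0 < τ) : volume (box γ τ : Set (Pt m ℓ)) =
    ENNReal.ofReal (τ ^ homDim m ℓ γ) * volume (box γ 1 : Set (Pt m ℓ)) := by
  have e (s : ℝ) : volume (box γ s : Set (Pt m ℓ)) =
      volume (Metric.ball (0 : EuclideanSpace ℝ (Fin m)) s) *
        volume (Metric.ball (0 : EuclideanSpace ℝ (Fin ℓ)) (s ^ (1 + (γ : ℝ)))) :=
    Measure.prod_prod _ _
  rw [e, e, Real.one_rpow, Measure.addHaar_ball_of_pos volume _ hτ,
    Measure.addHaar_ball_of_pos volume _ (show 0 < τ ^ (1 + (γ : ℝ)) by positivity),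
    finrank_euclideanSpace_fin, finrank_euclideanSpace_fin, mul_mul_mul_comm,
    ← ENNReal.ofReal_mul (by positivity)]
  congr 2
  rw [homDim, Real.rpow_add hτ (m : ℝ), Real.rpow_natCast τ, Real.rpow_mul hτ.le _ (ℓ : ℝ),
    Real.rpow_natCast (τ ^ (1 + (γ : ℝ)))]

theorem volume_box_pos {τ : ℝ} (hτ : 0 < τ) : 0 < volume (box γ τ : Set (Pt m ℓ)) := by
  have h : IsOpen (box γ τ : Set (Pt m ℓ)) := Metric.isOpen_ball.prod Metric.isOpen_ball
  exact h.measure_pos volume ⟨0, by simp [hτ], by simp; positivity⟩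

theorem volume_box_ne_top (τ : ℝ) : volume (box γ τ : Set (Pt m ℓ)) ≠ ⊤ := by
  rw [show volume (box γ τ : Set (Pt m ℓ)) = _ from Measure.prod_prod _ _]
  exact ENNReal.mul_ne_top measure_ball_lt_top.ne measure_ball_lt_top.ne

/-- The uniform distribution on `box γ τ`. -/
def unif (γ : ℝ≥0) (τ : ℝ) : Measure (Pt m ℓ) :=
  (volume (box γ τ : Set (Pt m ℓ)))⁻¹ • volume.restrict (box γ τ)

theorem isProbabilityMeasure_unif {τ : ℝ} (hτ : 0 < τ) :
    IsProbabilityMeasure (unif γ τ : Measure (Pt m ℓ)) :=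
  ⟨by rw [unif, Measure.smul_apply, Measure.restrict_apply_univ, smul_eq_mul,
    ENNReal.inv_mul_cancel (volume_box_pos hτ).ne' (volume_box_ne_top τ)]⟩

theorem unif_absolutelyContinuous (τ : ℝ) : (unif γ τ : Measure (Pt m ℓ)) ≪ volume :=
  (Measure.absolutelyContinuous_of_le Measure.restrict_le_self).smul_left _

theorem ae_unif {τ : ℝ} : ∀ᵐ w ∂(unif γ τ : Measure (Pt m ℓ)), w ∈ box γ τ :=
  Measure.ae_smul_measure (ae_restrict_mem (measurableSet_box τ)) _

theorem eLpNorm_unif_le (τ : ℝ) (f : Pt m ℓ → ℝ) : eLpNorm f 2 (unif γ τ) ≤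
    (volume (box γ τ : Set (Pt m ℓ)))⁻¹ ^ (1 / 2 : ℝ) * eLpNorm f 2 volume := by
  rw [unif, eLpNorm_smul_measure_of_ne_zero (ENNReal.inv_ne_zero.2 (volume_box_ne_top τ))]
  simp only [one_div, ENNReal.toReal_inv, ENNReal.toReal_ofNat, smul_eq_mul]
  gcongr
  exact Measure.restrict_le_self

/-- The average of `f` over `z + box γ τ`. -/
def avg (γ : ℝ≥0) (τ : ℝ) (f : Pt m ℓ → ℝ) (z : Pt m ℓ) : ℝ := ∫ w, f (z + w) ∂unif γ τ

theorem measurable_avg {τ : ℝ} (hτ : 0 < τ) {f : Pt m ℓ → ℝ} (hf : Measurable f) :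
    Measurable (avg γ τ f) := by
  have := isProbabilityMeasure_unif (m := m) (ℓ := ℓ) (γ := γ) hτ
  exact (StronglyMeasurable.integral_prod_right'
    (f := fun q : Pt m ℓ × Pt m ℓ => f (q.1 + q.2))
    (hf.comp (measurable_fst.add measurable_snd)).stronglyMeasurable).measurable

theorem memLp_comp_add_left {F : Type*} [NormedAddCommGroup F] {u : Pt m ℓ → F} {q : ℝ≥0∞}
    (hu : MemLp u q volume) (z : Pt m ℓ) : MemLp (fun w => u (z + w)) q volume := by
  simpa only [add_comm z] using memLp_comp_add hu z

theorem eLpNorm_comp_add_left {F : Type*} [NormedAddCommGroup F] {u : Pt m ℓ → F} {q : ℝ≥0∞}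
    (hu : AEStronglyMeasurable u volume) (z : Pt m ℓ) :
    eLpNorm (fun w => u (z + w)) q volume = eLpNorm u q volume := by
  simpa only [add_comm z] using eLpNorm_comp_add hu z

theorem memLp_unif {τ : ℝ} (hτ : 0 < τ) {f : Pt m ℓ → ℝ} (hf : MemLp f 2 volume) :
    MemLp f 2 (unif γ τ) :=
  ⟨hf.1.mono_ac (unif_absolutelyContinuous τ), (eLpNorm_unif_le τ f).trans_lt
    (ENNReal.mul_lt_top (ENNReal.rpow_lt_top_of_nonneg (by norm_num)
      (ENNReal.inv_ne_top.2 (volume_box_pos hτ).ne')) hf.2)⟩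

theorem integrable_unif {τ : ℝ} (hτ : 0 < τ) {f : Pt m ℓ → ℝ} (hf : MemLp f 2 volume)
    (z : Pt m ℓ) : Integrable (fun w => f (z + w)) (unif γ τ) := by
  have := isProbabilityMeasure_unif (m := m) (ℓ := ℓ) (γ := γ) hτ
  exact (memLp_unif hτ (memLp_comp_add_left hf z)).integrable (by norm_num)

theorem avg_sub {τ : ℝ} (hτ : 0 < τ) {f g : Pt m ℓ → ℝ} (hf : MemLp f 2 volume)
    (hg : MemLp g 2 volume) : avg γ τ (f - g) = avg γ τ f - avg γ τ g :=
  funext fun z => integral_sub (integrable_unif hτ hf z) (integrable_unif hτ hg z)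

theorem avg_add {τ : ℝ} (hτ : 0 < τ) {f g : Pt m ℓ → ℝ} (hf : MemLp f 2 volume)
    (hg : MemLp g 2 volume) : avg γ τ (f + g) = avg γ τ f + avg γ τ g :=
  funext fun z => integral_add (integrable_unif hτ hf z) (integrable_unif hτ hg z)

theorem avg_congr (τ : ℝ) {f g : Pt m ℓ → ℝ} (h : f =ᵐ[volume] g) : avg γ τ f = avg γ τ g := by
  funext z
  refine integral_congr_ae ((unif_absolutelyContinuous τ).ae_eq ?_)
  exact (measurePreserving_add_left volume z).quasiMeasurePreserving.ae_eq h

theorem enorm_integral_le_eLpNorm_two {α : Type*} [MeasurableSpace α] {ν : Measure α}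
    [IsProbabilityMeasure ν] {f : α → ℝ} (hf : AEStronglyMeasurable f ν) :
    ‖∫ w, f w ∂ν‖ₑ ≤ eLpNorm f 2 ν := by
  refine (enorm_integral_le_lintegral_enorm f).trans ?_
  rw [← eLpNorm_one_eq_lintegral_enorm]
  exact eLpNorm_le_eLpNorm_of_exponent_le (by norm_num) hf

theorem enorm_avg_le {τ : ℝ} (hτ : 0 < τ) {f : Pt m ℓ → ℝ} (hf : MemLp f 2 volume) (z : Pt m ℓ) :
    ‖avg γ τ f z‖ₑ ≤ (volume (box γ τ : Set (Pt m ℓ)))⁻¹ ^ (1 / 2 : ℝ) * eLpNorm f 2 volume := by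
  have := isProbabilityMeasure_unif (m := m) (ℓ := ℓ) (γ := γ) hτ
  refine (enorm_integral_le_eLpNorm_two (integrable_unif hτ hf z).1).trans ?_
  refine (eLpNorm_unif_le τ _).trans_eq ?_
  rw [eLpNorm_comp_add_left hf.1]

theorem abs_avg_le_of_forall {τ : ℝ} (hτ : 0 < τ) {f : Pt m ℓ → ℝ} {S : ℝ} (h : ∀ z, |f z| ≤ S)
    (z : Pt m ℓ) : |avg γ τ f z| ≤ S := by
  have := isProbabilityMeasure_unif (m := m) (ℓ := ℓ) (γ := γ) hτ
  have := norm_integral_le_of_norm_le_const (μ := unif γ τ) (f := fun w => f (z + w)) (C := S)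
    (ae_of_all _ fun w => h _)
  rwa [probReal_univ, mul_one] at this

/-- Jensen's inequality for the probability measure `unif γ τ`, followed by Tonelli. -/
theorem eLpNorm_sub_avg_le {τ : ℝ} (hτ : 0 < τ) {f : Pt m ℓ → ℝ} (hm : Measurable f)
    (hf : MemLp f 2 volume) {C : ℝ≥0∞}
    (h : ∀ w ∈ (box γ τ : Set (Pt m ℓ)), eLpNorm (fun z => f (z + w) - f z) 2 volume ≤ C) :
    eLpNorm (avg γ τ f - f) 2 volume ≤ C := by
  have := isProbabilityMeasure_unif (m := m) (ℓ := ℓ) (γ := γ) hτ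
  have sq : ∀ {ν : Measure (Pt m ℓ)} (g : Pt m ℓ → ℝ),
      eLpNorm g 2 ν ^ (2 : ℝ) = ∫⁻ z, ‖g z‖ₑ ^ (2 : ℝ) ∂ν := by
    intro ν g
    rw [eLpNorm_eq_lintegral_rpow_enorm_toReal (by norm_num) (by norm_num), ← ENNReal.rpow_mul]
    simp
  rw [← ENNReal.rpow_le_rpow_iff (show (0 : ℝ) < 2 by norm_num), sq]
  have hj : Measurable fun q : Pt m ℓ × Pt m ℓ => ‖f (q.1 + q.2) - f q.1‖ₑ ^ (2 : ℝ) :=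
    (((hm.comp (measurable_fst.add measurable_snd)).sub (hm.comp measurable_fst)).enorm).pow_const _
  calc ∫⁻ z, ‖(avg γ τ f - f) z‖ₑ ^ (2 : ℝ)
      ≤ ∫⁻ z, (∫⁻ w, ‖f (z + w) - f z‖ₑ ^ (2 : ℝ) ∂unif γ τ) := by
        refine lintegral_mono fun z => ?_
        have e : (avg γ τ f - f) z = ∫ w, f (z + w) - f z ∂unif γ τ := by
          rw [integral_sub (integrable_unif hτ hf z) (integrable_const _)]
          simp [avg]
        rw [e, ← sq fun w => f (z + w) - f z]
        exact ENNReal.rpow_le_rpow (enorm_integral_le_eLpNorm_two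
          ((integrable_unif hτ hf z).sub (integrable_const _)).1) (by norm_num)
    _ = ∫⁻ w, (∫⁻ z, ‖f (z + w) - f z‖ₑ ^ (2 : ℝ)) ∂unif γ τ :=
        lintegral_lintegral_swap hj.aemeasurable
    _ ≤ ∫⁻ _, C ^ (2 : ℝ) ∂(unif γ τ : Measure (Pt m ℓ)) := by
        refine lintegral_mono_ae ?_
        filter_upwards [ae_unif] with w hw
        rw [← sq fun z => f (z + w) - f z]
        exact ENNReal.rpow_le_rpow (h w hw) (by norm_num)
    _ = C ^ (2 : ℝ) := by simp

/-- Pointwise, $|f|^q\le S^{q-2}|f|^2$. -/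
theorem eLpNorm_interpolate {f : Pt m ℓ → ℝ} {q S L : ℝ} (hq : 2 < q) (hS : 0 ≤ S) (hL : 0 ≤ L)
    (h1 : ∀ z, |f z| ≤ S) (h2 : eLpNorm f 2 volume ≤ ENNReal.ofReal L) :
    eLpNorm f (ENNReal.ofReal q) volume ≤ ENNReal.ofReal (S ^ (1 - 2 / q) * L ^ (2 / q)) := by
  have hq0 : 0 < q := by linarith
  rw [eLpNorm_ofReal_eq hq0]
  have h2' : ∫⁻ z, ‖f z‖ₑ ^ (2 : ℝ) ≤ ENNReal.ofReal L ^ (2 : ℝ) := by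
    have := ENNReal.rpow_le_rpow h2 (show (0 : ℝ) ≤ 2 by norm_num)
    rw [eLpNorm_eq_lintegral_rpow_enorm_toReal (by norm_num) (by norm_num)] at this
    rwa [ENNReal.toReal_ofNat, ← ENNReal.rpow_mul, one_div_mul_cancel (by norm_num),
      ENNReal.rpow_one] at this
  have h1' : ∀ z, ‖f z‖ₑ ≤ ENNReal.ofReal S := fun z => by
    rw [← ofReal_norm]; exact ENNReal.ofReal_le_ofReal (h1 z)
  have key : ∫⁻ z, ‖f z‖ₑ ^ q ≤ ENNReal.ofReal S ^ (q - 2) * ENNReal.ofReal L ^ (2 : ℝ) := by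
    calc ∫⁻ z, ‖f z‖ₑ ^ q ≤ ∫⁻ z, ENNReal.ofReal S ^ (q - 2) * ‖f z‖ₑ ^ (2 : ℝ) := by
          refine lintegral_mono fun z => ?_
          have : ‖f z‖ₑ ^ q = ‖f z‖ₑ ^ (q - 2) * ‖f z‖ₑ ^ (2 : ℝ) := by
            rw [← ENNReal.rpow_add_of_nonneg _ _ (by linarith) (by norm_num)]
            ring_nf
          rw [this]
          exact mul_le_mul_left (ENNReal.rpow_le_rpow (h1' z) (by linarith)) _
      _ = ENNReal.ofReal S ^ (q - 2) * ∫⁻ z, ‖f z‖ₑ ^ (2 : ℝ) :=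
          lintegral_const_mul' _ _ (ENNReal.rpow_ne_top_of_nonneg (by linarith) ENNReal.ofReal_ne_top)
      _ ≤ _ := by gcongr
  calc _ ≤ (ENNReal.ofReal S ^ (q - 2) * ENNReal.ofReal L ^ (2 : ℝ)) ^ (1 / q) := by gcongr
    _ = ENNReal.ofReal (S ^ (1 - 2 / q) * L ^ (2 / q)) := by
      rw [ENNReal.mul_rpow_of_nonneg _ _ (by positivity), ← ENNReal.rpow_mul, ← ENNReal.rpow_mul,
        ENNReal.ofReal_rpow_of_nonneg hS (by
          exact mul_nonneg (by linarith) (by positivity)),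
        ENNReal.ofReal_rpow_of_nonneg hL (by positivity), ← ENNReal.ofReal_mul (by positivity)]
      congr 3 <;> field_simp

/-! ### The Sobolev embedding -/

theorem H1.eLpNorm_avg_sub_le (hm : 1 ≤ m) (u : H1 m ℓ γ) {τ : ℝ} (hτ : 0 < τ) :
    eLpNorm (avg γ τ (H1.fn u) - H1.fn u) 2 volume ≤ ENNReal.ofReal (7 * τ * ‖u‖) := by
  refine eLpNorm_sub_avg_le hτ (H1.measurable_fn u) (H1.memLp_fn u) fun w hw => ?_
  have h1 : ‖w.1‖ < τ := by simpa using hw.1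
  have h2 : ‖w.2‖ < τ ^ (1 + (γ : ℝ)) := by simpa using hw.2
  exact H1.eLpNorm_shift_le hm u w hτ h1.le h2.le

/-- The functions to which the argument for the Sobolev embedding applies, with the norm bounded by
`L`. -/
structure Averaging (γ : ℝ≥0) (f : Pt m ℓ → ℝ) (L : ℝ) : Prop where
  nonneg : 0 ≤ L
  meas : Measurable f
  memLp : MemLp f 2 volume
  le : eLpNorm f 2 volume ≤ ENNReal.ofReal L
  sub_le : ∀ τ : ℝ, 0 < τ → eLpNorm (avg γ τ f - f) 2 volume ≤ ENNReal.ofReal (7 * τ * L)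

theorem H1.averaging (hm : 1 ≤ m) (u : H1 m ℓ γ) : Averaging γ (H1.fn u) ‖u‖ :=
  ⟨norm_nonneg _, H1.measurable_fn u, H1.memLp_fn u, H1.eLpNorm_fn_le u,
    fun _ hτ => H1.eLpNorm_avg_sub_le hm u hτ⟩

/-- The properties of `H^1_γ` on which the existence proof rests. -/
structure Model (m ℓ : ℕ) (γ : ℝ≥0) (E : Type*) [NormedAddCommGroup E] [InnerProductSpace ℝ E] where
  fn : E → Pt m ℓ → ℝ
  averaging : ∀ u, Averaging γ (fn u) ‖u‖
  fn_add : ∀ u v, fn (u + v) =ᵐ[volume] fn u + fn v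
  fn_smul : ∀ (c : ℝ) u, fn (c • u) =ᵐ[volume] c • fn u
  ext_fn : ∀ {u v}, fn u =ᵐ[volume] fn v → u = v
  exists_abs : ∀ u, ∃ v, fn v =ᵐ[volume] (fun z => |fn u z|) ∧ ‖v‖ ≤ ‖u‖
  shift_snd_far_le : ∀ (u) (b : EuclideanSpace ℝ (Fin ℓ)) (τ : ℝ), 0 < τ →
    eLpNorm ({z : Pt m ℓ | τ ≤ ‖z.1‖}.indicator fun z => fn u (z + (0, b)) - fn u z) 2 volume
      ≤ ENNReal.ofReal (τ ^ (-(γ : ℝ)) * (‖b‖ * ‖u‖))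
  pull : Sym m ℓ γ → E → E
  fn_pull : ∀ S u, fn (pull S u) =ᵐ[volume] fun z => fn u (S.map z)
  inner_pull : ∀ S u v, inner ℝ (pull S u) (pull S v) = inner ℝ u v

/-- The space `H^1_γ` itself. -/
def H1.model (hm : 1 ≤ m) : Model m ℓ γ (H1 m ℓ γ) where
  fn := H1.fn
  averaging := H1.averaging hm
  fn_add := H1.fn_add
  fn_smul := H1.fn_smul
  ext_fn := H1.ext_fn
  exists_abs := H1.exists_abs
  shift_snd_far_le u b _ := H1.eLpNorm_shift_snd_far_le u b
  pull S := S.pull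
  fn_pull S := S.fn_pull
  inner_pull S := S.inner_pull

variable {E : Type*} [NormedAddCommGroup E] [InnerProductSpace ℝ E]

namespace Model

theorem memLp_fn (X : Model m ℓ γ E) (u : E) : MemLp (X.fn u) 2 volume := (X.averaging u).memLp

theorem measurable_fn (X : Model m ℓ γ E) (u : E) : Measurable (X.fn u) := (X.averaging u).meas

theorem fn_sub (X : Model m ℓ γ E) (u v : E) : X.fn (u - v) =ᵐ[volume] X.fn u - X.fn v := by
  filter_upwards [X.fn_add u (-1 • v), X.fn_smul (-1) v] with z h1 h2
  rw [neg_one_zsmul, ← sub_eq_add_neg] at h1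
  rw [neg_one_smul] at h2
  rw [h1, Pi.add_apply, h2]
  simp [sub_eq_add_neg]

theorem norm_pull (X : Model m ℓ γ E) (S : Sym m ℓ γ) (u : E) : ‖X.pull S u‖ = ‖u‖ := by
  refine (sq_eq_sq₀ (norm_nonneg _) (norm_nonneg _)).1 ?_
  rw [← real_inner_self_eq_norm_sq, ← real_inner_self_eq_norm_sq, X.inner_pull]

theorem pull_inv_pull (X : Model m ℓ γ E) (S : Sym m ℓ γ) (u : E) :
    X.pull S (X.pull S.inv u) = u := by
  refine X.ext_fn ?_
  filter_upwards [X.fn_pull S (X.pull S.inv u),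
    S.measurePreserving.quasiMeasurePreserving.ae (X.fn_pull S.inv u)] with z h1 h2
  rw [h1, h2, S.inv_map_map]

theorem inner_pull_left (X : Model m ℓ γ E) (S : Sym m ℓ γ) (u v : E) :
    inner ℝ (X.pull S u) v = inner ℝ u (X.pull S.inv v) := by
  rw [← X.inner_pull S u (X.pull S.inv v), X.pull_inv_pull]

end Model

theorem memLp_avg {f : Pt m ℓ → ℝ} {L : ℝ} (u : Averaging γ f L) {τ : ℝ} (hτ : 0 < τ) :
    MemLp (avg γ τ f) 2 volume := by
  have h : MemLp (avg γ τ f - f) 2 volume :=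
    ⟨((measurable_avg hτ u.meas).sub u.meas).aestronglyMeasurable,
      (u.sub_le _ hτ).trans_lt ENNReal.ofReal_lt_top⟩
  simpa using h.add u.memLp

/-- Averages over boxes of size `τ` are bounded by a multiple of `τ ^ (-homDim / 2)`. -/
theorem exists_abs_avg_le (m ℓ : ℕ) (γ : ℝ≥0) : ∃ C : ℝ, 0 < C ∧ ∀ (τ : ℝ), 0 < τ →
    ∀ (f : Pt m ℓ → ℝ) (L : ℝ), 0 ≤ L → MemLp f 2 volume → eLpNorm f 2 volume ≤ ENNReal.ofReal L →
    ∀ z, |avg γ τ f z| ≤ C * τ ^ (-(homDim m ℓ γ / 2)) * L := by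
  set V := (volume (box γ 1 : Set (Pt m ℓ))) with hV
  have hV0 : 0 < V.toReal := ENNReal.toReal_pos (volume_box_pos one_pos).ne' (volume_box_ne_top 1)
  refine ⟨V.toReal ^ (-(1 / 2) : ℝ), by positivity, fun τ hτ f L hL hf h z => ?_⟩
  have h1 := (enorm_avg_le (γ := γ) hτ hf z).trans (mul_le_mul_right h _)
  have e : (volume (box γ τ : Set (Pt m ℓ)))⁻¹ ^ (1 / 2 : ℝ) =
      ENNReal.ofReal (V.toReal ^ (-(1 / 2) : ℝ) * τ ^ (-(homDim m ℓ γ / 2))) := by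
    have hVr : V = ENNReal.ofReal V.toReal := (ENNReal.ofReal_toReal (volume_box_ne_top 1)).symm
    rw [volume_box hτ, ← hV, hVr, ENNReal.toReal_ofReal hV0.le,
      ← ENNReal.ofReal_mul (by positivity), ← ENNReal.ofReal_inv_of_pos (by positivity),
      ENNReal.ofReal_rpow_of_nonneg (by positivity) (by positivity), mul_inv,
      Real.mul_rpow (by positivity) (by positivity), mul_comm]
    congr 2
    · rw [Real.rpow_neg hV0.le, Real.inv_rpow hV0.le]
    · rw [← Real.rpow_neg hτ.le, ← Real.rpow_mul hτ.le]
      congr 1; ring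
  rw [e, ← ENNReal.ofReal_mul (by positivity), ← ofReal_norm] at h1
  exact (ENNReal.ofReal_le_ofReal_iff (by positivity)).1 h1

/-- `avg` over the box of size `2⁻ᵏ`. -/
def dyadic (γ : ℝ≥0) (k : ℕ) (f : Pt m ℓ → ℝ) : Pt m ℓ → ℝ := avg γ ((2 : ℝ)⁻¹ ^ k) f

/-- The gain of a factor $2^{-k}$ over the plain bound $\tau^{-Q/2}$ comes from the gradient.
Averaging the $k$-th average once more cannot raise its supremum, and the remaining term is an
average of `dyadic γ k f - f`, which is of size $2^{-k}$ in $L^2$. As $Q>2$, the increments grow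
geometrically and the last one dominates their sum. -/
theorem exists_abs_dyadic_le (hQ : 2 < homDim m ℓ γ) : ∃ C : ℝ, 0 < C ∧
    ∀ (f : Pt m ℓ → ℝ) (L : ℝ), Averaging γ f L → ∀ (k : ℕ) (z : Pt m ℓ),
      |dyadic γ k f z| ≤ C * ((2 : ℝ) ^ (homDim m ℓ γ / 2 - 1)) ^ k * L := by
  obtain ⟨C, hC, h⟩ := exists_abs_avg_le m ℓ γ
  set Q := homDim m ℓ γ with hQd
  set b := (2 : ℝ) ^ (Q / 2 - 1) with hb
  have hb1 : 1 < b := Real.one_lt_rpow (by norm_num) (by linarith)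
  set C₂ := C * 2 ^ (Q / 2) * 7 with hC₂
  have hC₂0 : 0 < C₂ := by positivity
  have hp : ∀ k : ℕ, ((2 : ℝ)⁻¹ ^ k) ^ (-(Q / 2)) = (2 ^ (Q / 2)) ^ k := by
    intro k
    rw [← Real.rpow_natCast, ← Real.rpow_natCast, ← Real.rpow_mul (by norm_num),
      ← Real.rpow_mul (by norm_num), Real.inv_rpow (by norm_num), ← Real.rpow_neg (by norm_num)]
    congr 1; ring
  have hbk : ∀ k : ℕ, ((2 : ℝ) ^ (Q / 2)) ^ k * (2⁻¹) ^ k = b ^ k := by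
    intro k
    rw [← mul_pow, hb, Real.rpow_sub (by norm_num), Real.rpow_one, ← div_eq_mul_inv _ (2 : ℝ)]
  refine ⟨max C (C₂ / (b - 1)), lt_max_of_lt_left hC, fun f L u k => ?_⟩
  have hL := u.nonneg
  -- The induction closes when $K+C_2\le Kb$.
  have hK : C₂ ≤ max C (C₂ / (b - 1)) * (b - 1) := by
    have := le_max_right C (C₂ / (b - 1))
    rwa [div_le_iff₀ (by linarith)] at this
  set K := max C (C₂ / (b - 1))
  induction k with
  | zero =>
    intro z
    have := h 1 one_pos f L hL u.memLp u.le z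
    rw [Real.one_rpow, mul_one] at this
    rw [dyadic, pow_zero, pow_zero, mul_one]
    exact this.trans (by gcongr; exact le_max_left _ _)
  | succ k ih =>
    intro z
    have hτ : (0 : ℝ) < 2⁻¹ ^ (k + 1) := by positivity
    have hτ' : (0 : ℝ) < 2⁻¹ ^ k := by positivity
    have m1 := memLp_avg u hτ'
    have e1 : dyadic γ (k + 1) f z = avg γ (2⁻¹ ^ (k + 1)) (dyadic γ k f) z -
        avg γ (2⁻¹ ^ (k + 1)) (dyadic γ k f - f) z := by
      have := congrFun (avg_sub (γ := γ) hτ m1 (m1.sub u.memLp)) z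
      rwa [sub_sub_cancel] at this
    have a1 := abs_avg_le_of_forall (γ := γ) hτ ih z
    have a2 := h _ hτ _ _ (by positivity) (m1.sub u.memLp) (u.sub_le _ hτ') z
    rw [e1]
    refine (abs_sub _ _).trans ((add_le_add a1 a2).trans ?_)
    rw [hp]
    have : C * (2 ^ (Q / 2)) ^ (k + 1) * (7 * 2⁻¹ ^ k * L) = C₂ * b ^ k * L := by
      rw [← hbk, hC₂, pow_succ]; ring
    rw [this, ← add_mul, pow_succ]
    gcongr
    have hbp : 0 < b ^ k := by positivity
    nlinarith

/-- The averages converge in `L^q`, for every subcritical exponent `q`, at a uniform rate. -/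
theorem exists_eLpNorm_dyadic_sub_le (hQ : 2 < homDim m ℓ γ) {q : ℝ} (hq : 2 < q)
    (hq' : (homDim m ℓ γ - 2) * q < 2 * homDim m ℓ γ) : ∃ C r : ℝ, 0 < C ∧ 0 < r ∧ r < 1 ∧
    ∀ (f : Pt m ℓ → ℝ) (L : ℝ), Averaging γ f L → ∀ k : ℕ,
      eLpNorm (dyadic γ k f - f) (ENNReal.ofReal q) volume ≤
        ENNReal.ofReal (C * r ^ k * L) := by
  obtain ⟨C, hC, h⟩ := exists_abs_dyadic_le hQ
  set Q := homDim m ℓ γ with hQd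
  set b := (2 : ℝ) ^ (Q / 2 - 1) with hb
  have hb1 : 1 < b := Real.one_lt_rpow (by norm_num) (by linarith)
  have hq0 : 0 < q := by linarith
  have h2q : 0 < 1 - 2 / q := by rw [sub_pos, div_lt_one hq0]; exact hq
  set r := b ^ (1 - 2 / q) * 2⁻¹ ^ (2 / q) with hr
  have hr0 : 0 < r := by positivity
  -- The exponent of $2$ in `r` equals $((Q-2)q-2Q)/(2q)$: geometric decay is exactly subcriticality
  -- of `q`.
  have hr1 : r < 1 := by
    have : r = (2 : ℝ) ^ ((Q / 2 - 1) * (1 - 2 / q) - 2 / q) := by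
      rw [hr, hb, ← Real.rpow_mul (by norm_num), Real.inv_rpow (by norm_num),
        ← Real.rpow_neg (by norm_num), ← Real.rpow_add (by norm_num), ← sub_eq_add_neg]
    rw [this]
    refine Real.rpow_lt_one_of_one_lt_of_neg (by norm_num) ?_
    have : (Q / 2 - 1) * (1 - 2 / q) - 2 / q = ((Q - 2) * q - 2 * Q) / (2 * q) := by
      field_simp; ring
    rw [this]
    exact div_neg_of_neg_of_pos (by linarith) (by positivity)
  set C₃ := (C * b + C) ^ (1 - 2 / q) * 14 ^ (2 / q) with hC₃
  have hC₃0 : 0 < C₃ := by positivity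
  refine ⟨C₃ / (1 - r), r, div_pos hC₃0 (by linarith), hr0, hr1, fun f L u k => ?_⟩
  have hL := u.nonneg
  have meas : ∀ k : ℕ, Measurable (dyadic γ k f) := fun k =>
    measurable_avg (by positivity) u.meas
  have step : ∀ k : ℕ,
      eLpNorm (dyadic γ k f - dyadic γ (k + 1) f) (ENNReal.ofReal q) volume ≤
        ENNReal.ofReal (C₃ * r ^ k * L) := by
    intro k
    have a1 : ∀ z, |(dyadic γ k f - dyadic γ (k + 1) f) z| ≤
        (C * b + C) * b ^ k * L := by
      intro z
      refine (abs_sub _ _).trans ((add_le_add (h f L u k z) (h f L u (k + 1) z)).trans_eq ?_)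
      rw [pow_succ]; ring
    have a2 : eLpNorm (dyadic γ k f - dyadic γ (k + 1) f) 2 volume ≤
        ENNReal.ofReal (14 * 2⁻¹ ^ k * L) := by
      have e : dyadic γ k f - dyadic γ (k + 1) f =
        (dyadic γ k f - f) - (dyadic γ (k + 1) f - f) := by
        rw [sub_sub_sub_cancel_right]
      rw [e]
      refine (eLpNorm_sub_le ((meas k).sub u.meas).aestronglyMeasurable
        ((meas (k + 1)).sub u.meas).aestronglyMeasurable (by norm_num)).trans ?_
      refine (add_le_add (u.sub_le _ (by positivity))
        (u.sub_le _ (by positivity))).trans ?_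
      rw [← ENNReal.ofReal_add (by positivity) (by positivity)]
      refine ENNReal.ofReal_le_ofReal ?_
      rw [← add_mul]
      gcongr
      rw [pow_succ]
      have : (0 : ℝ) < 2⁻¹ ^ k := by positivity
      linarith
    refine (eLpNorm_interpolate hq (by positivity) (by positivity) a1 a2).trans_eq ?_
    congr 1
    have hbk : (0 : ℝ) ≤ b ^ k := by positivity
    rw [Real.mul_rpow (by positivity) hL, Real.mul_rpow (by positivity) hbk,
      Real.mul_rpow (by positivity) hL, Real.mul_rpow (by positivity) (by positivity),
      hC₃, hr, mul_pow, Real.rpow_pow_comm (x := b) (by positivity),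
      Real.rpow_pow_comm (x := (2 : ℝ)⁻¹) (by positivity)]
    have : L ^ (1 - 2 / q) * L ^ (2 / q) = L := by
      rw [← Real.rpow_add_of_nonneg hL h2q.le (by positivity)]
      simp
    calc _ = (C * b + C) ^ (1 - 2 / q) * 14 ^ (2 / q) *
          ((b ^ k) ^ (1 - 2 / q) * (2⁻¹ ^ k) ^ (2 / q)) * (L ^ (1 - 2 / q) * L ^ (2 / q)) := by ring
      _ = _ := by rw [this]
  have tele : ∀ (k n : ℕ),
      eLpNorm (dyadic γ k f - dyadic γ (k + n) f) (ENNReal.ofReal q) volume ≤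
        ENNReal.ofReal (C₃ / (1 - r) * r ^ k * L) := by
    intro k n
    suffices H : eLpNorm (dyadic γ k f - dyadic γ (k + n) f) (ENNReal.ofReal q) volume ≤
        ENNReal.ofReal (C₃ / (1 - r) * (r ^ k - r ^ (k + n)) * L) by
      refine H.trans (ENNReal.ofReal_le_ofReal ?_)
      have : 0 < 1 - r := by linarith
      have : 0 < r ^ (k + n) := by positivity
      gcongr
      linarith
    have h1r : 0 < 1 - r := by linarith
    induction n with
    | zero => simp
    | succ n ih =>
      have e : dyadic γ k f - dyadic γ (k + (n + 1)) f =
        (dyadic γ k f - dyadic γ (k + n) f) +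
          (dyadic γ (k + n) f - dyadic γ (k + n + 1) f) := by
        rw [sub_add_sub_cancel, add_assoc]
      rw [e]
      refine (eLpNorm_add_le ((meas _).sub (meas _)).aestronglyMeasurable
        ((meas _).sub (meas _)).aestronglyMeasurable ?_).trans ?_
      · rw [ENNReal.one_le_ofReal]; linarith
      refine (add_le_add ih (step (k + n))).trans_eq ?_
      have hle : r ^ (k + n) ≤ r ^ k := pow_le_pow_of_le_one hr0.le hr1.le (by omega)
      rw [← ENNReal.ofReal_add (mul_nonneg (mul_nonneg (by positivity) (by linarith))
        hL) (by positivity)]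
      congr 1
      rw [show k + (n + 1) = k + n + 1 by ring, pow_succ r (k + n)]
      field_simp
      ring
  -- The telescoped bound is carried to the limit by Fatou. Beforehand only $L^2$ convergence is
  -- known, which gives convergence almost everywhere along a subsequence.
  have hlim : Tendsto (fun n => eLpNorm (dyadic γ (k + n) f - f) 2 volume) atTop
      (𝓝 0) := by
    have t : Tendsto (fun n : ℕ => ENNReal.ofReal (7 * (2 : ℝ)⁻¹ ^ (k + n) * L)) atTop (𝓝 0) := by
      rw [← ENNReal.ofReal_zero]
      refine ENNReal.tendsto_ofReal ?_
      have := (tendsto_pow_atTop_nhds_zero_of_lt_one (r := (2 : ℝ)⁻¹) (by norm_num)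
        (by norm_num)).comp (tendsto_add_atTop_nat k)
      have := (this.const_mul 7).mul_const L
      simpa [Function.comp_def, add_comm k] using this
    exact tendsto_of_tendsto_of_tendsto_of_le_of_le tendsto_const_nhds t (fun _ => zero_le)
      fun n => u.sub_le _ (by positivity)
  obtain ⟨ns, -, hns⟩ := (tendstoInMeasure_of_tendsto_eLpNorm (by norm_num)
    (fun n => (meas (k + n)).aestronglyMeasurable) u.meas.aestronglyMeasurable
    hlim).exists_seq_tendsto_ae
  refine (Lp.eLpNorm_lim_le_liminf_eLpNorm
    (f := fun i => dyadic γ k f - dyadic γ (k + ns i) f)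
    (fun i => ((meas _).sub (meas _)).aestronglyMeasurable) _ ?_).trans ?_
  · filter_upwards [hns] with z hz
    exact hz.const_sub _
  · refine liminf_le_of_le (by isBoundedDefault) fun c hc => ?_
    obtain ⟨i, hi⟩ := hc.exists
    exact hi.trans (tele k (ns i))

/-- The subcritical Sobolev embedding. -/
theorem Model.exists_eLpNorm_le (X : Model m ℓ γ E) (hQ : 2 < homDim m ℓ γ) {q : ℝ} (hq : 2 < q)
    (hq' : (homDim m ℓ γ - 2) * q < 2 * homDim m ℓ γ) : ∃ C : ℝ, 0 < C ∧
    ∀ u : E, eLpNorm (X.fn u) (ENNReal.ofReal q) volume ≤ ENNReal.ofReal (C * ‖u‖) := by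
  obtain ⟨C, r, hC, hr, hr1, h⟩ := exists_eLpNorm_dyadic_sub_le hQ hq hq'
  obtain ⟨B, hB, hb⟩ := exists_abs_dyadic_le (m := m) (ℓ := ℓ) (γ := γ) hQ
  have hq0 : 0 < q := by linarith
  have h2q : 0 < 1 - 2 / q := by rw [sub_pos, div_lt_one hq0]; exact hq
  suffices H : ∀ (f : Pt m ℓ → ℝ) (L : ℝ), Averaging γ f L →
      eLpNorm f (ENNReal.ofReal q) volume ≤
        ENNReal.ofReal ((C + B ^ (1 - 2 / q) * 8 ^ (2 / q)) * L) from
    ⟨C + B ^ (1 - 2 / q) * 8 ^ (2 / q), by positivity, fun u => H _ _ (X.averaging u)⟩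
  intro f L u
  have hL := u.nonneg
  have meas : Measurable (dyadic γ 0 f) := measurable_avg (by positivity) u.meas
  have a1 := h f L u 0
  -- The constant is $8=7+1$: the averaging error at scale $1$ plus the norm of `f`.
  have a2 : eLpNorm (dyadic γ 0 f) 2 volume ≤ ENNReal.ofReal (8 * L) := by
    have := eLpNorm_add_le (meas.sub u.meas).aestronglyMeasurable u.meas.aestronglyMeasurable
      (p := 2) (μ := volume) (by norm_num)
    rw [sub_add_cancel] at this
    refine this.trans ((add_le_add (u.sub_le _ (by positivity)) u.le).trans_eq ?_)
    rw [pow_zero, ← ENNReal.ofReal_add (by positivity) (by positivity)]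
    ring_nf
  have a3 := eLpNorm_interpolate hq (by positivity) (by positivity) (hb f L u 0) a2
  have e : f = dyadic γ 0 f - (dyadic γ 0 f - f) := by rw [sub_sub_cancel]
  have a4 := eLpNorm_sub_le meas.aestronglyMeasurable (meas.sub u.meas).aestronglyMeasurable
    (p := ENNReal.ofReal q) (μ := volume) (by rw [ENNReal.one_le_ofReal]; linarith)
  rw [← e] at a4
  refine a4.trans ((add_le_add a3 a1).trans_eq ?_)
  rw [pow_zero, pow_zero, mul_one, mul_one, ← ENNReal.ofReal_add (by positivity) (by positivity),
    Real.mul_rpow hB.le hL, Real.mul_rpow (by norm_num) hL]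
  have : L ^ (1 - 2 / q) * L ^ (2 / q) = L := by
    rw [← Real.rpow_add_of_nonneg hL h2q.le (by positivity)]
    simp
  congr 1
  calc _ = B ^ (1 - 2 / q) * 8 ^ (2 / q) * (L ^ (1 - 2 / q) * L ^ (2 / q)) + C * L := by ring
    _ = _ := by rw [this]; ring

/-- If all averages over boxes of a fixed small size are small, so is the norm in `L^q`. -/
theorem Model.exists_eLpNorm_le_of_avg (X : Model m ℓ γ E) (hQ : 2 < homDim m ℓ γ) {q : ℝ}
    (hq : 2 < q)
    (hq' : (homDim m ℓ γ - 2) * q < 2 * homDim m ℓ γ) {L ε : ℝ} (hL : 0 < L) (hε : 0 < ε) :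
    ∃ τ η : ℝ, 0 < τ ∧ 0 < η ∧ ∀ u : E, ‖u‖ ≤ L → (∀ z, |avg γ τ (X.fn u) z| ≤ η) →
      eLpNorm (X.fn u) (ENNReal.ofReal q) volume ≤ ENNReal.ofReal ε := by
  obtain ⟨C, r, hC, hr, hr1, h⟩ := exists_eLpNorm_dyadic_sub_le hQ hq hq'
  have hq0 : 0 < q := by linarith
  have h2q : 0 < 1 - 2 / q := by rw [sub_pos, div_lt_one hq0]; exact hq
  -- This `k` makes the approximation error at most $\varepsilon/2$; the threshold for the averages
  -- is then chosen so that interpolation against the $L^2$ bound $8L$ gives the other half.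
  obtain ⟨k, hk⟩ : ∃ k : ℕ, r ^ k < ε / (2 * C * L) := exists_pow_lt_of_lt_one (by positivity) hr1
  set Y := (8 * L) ^ (2 / q) with hY
  have hY0 : 0 < Y := by positivity
  refine ⟨2⁻¹ ^ k, (ε / (2 * Y)) ^ (1 / (1 - 2 / q)), by positivity, by positivity, fun u hu hz => ?_⟩
  have av := X.averaging u
  have a1 := h _ _ av k
  generalize ‖u‖ = N at *
  generalize X.fn u = f at *
  have hN := av.nonneg
  have hk0 : (0 : ℝ) < 2⁻¹ ^ k := by positivity
  have meas : Measurable (dyadic γ k f) := measurable_avg hk0 av.meas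
  have a2 : eLpNorm (dyadic γ k f) 2 volume ≤ ENNReal.ofReal (8 * L) := by
    have := eLpNorm_add_le (meas.sub av.meas).aestronglyMeasurable av.meas.aestronglyMeasurable
      (p := 2) (μ := volume) (by norm_num)
    rw [sub_add_cancel] at this
    refine this.trans ((add_le_add (av.sub_le _ hk0) av.le).trans ?_)
    rw [← ENNReal.ofReal_add (by positivity) (by positivity)]
    refine ENNReal.ofReal_le_ofReal ?_
    have : (2 : ℝ)⁻¹ ^ k ≤ 1 := pow_le_one₀ (by norm_num) (by norm_num)
    nlinarith
  have a3 := eLpNorm_interpolate hq (by positivity) (by positivity) hz a2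
  have e : f = dyadic γ k f - (dyadic γ k f - f) := by rw [sub_sub_cancel]
  have a4 := eLpNorm_sub_le meas.aestronglyMeasurable (meas.sub av.meas).aestronglyMeasurable
    (p := ENNReal.ofReal q) (μ := volume) (by rw [ENNReal.one_le_ofReal]; linarith)
  rw [← e] at a4
  refine a4.trans ((add_le_add a3 a1).trans ?_)
  rw [← ENNReal.ofReal_add (by positivity) (by positivity), ← hY, ← Real.rpow_mul (by positivity),
    one_div_mul_cancel h2q.ne', Real.rpow_one]
  refine ENNReal.ofReal_le_ofReal ?_
  have b1 : ε / (2 * Y) * Y = ε / 2 := by field_simp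
  have b2 : C * r ^ k * N ≤ ε / 2 := by
    calc C * r ^ k * N ≤ C * (ε / (2 * C * L)) * L := by gcongr
      _ = ε / 2 := by field_simp
  linarith

/-! ### Weak convergence -/

/-- Weak convergence of bounded sequences. -/
structure WeakTo {E : Type*} [NormedAddCommGroup E] [InnerProductSpace ℝ E] (u : ℕ → E) (v : E) :
    Prop where
  bdd : ∃ L, ∀ n, ‖u n‖ ≤ L
  tendsto : ∀ w, Tendsto (fun n => inner ℝ (u n) w) atTop (𝓝 (inner ℝ v w))

theorem WeakTo.sub_const {E : Type*} [NormedAddCommGroup E] [InnerProductSpace ℝ E] {u : ℕ → E}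
    {v : E} (h : WeakTo u v) : WeakTo (fun n => u n - v) 0 := by
  obtain ⟨L, hL⟩ := h.bdd
  refine ⟨⟨L + ‖v‖, fun n => (norm_sub_le _ _).trans (by gcongr; exact hL n)⟩, fun w => ?_⟩
  simp only [inner_sub_left, inner_zero_left]
  simpa using (h.tendsto w).sub_const (inner ℝ v w)

/-- Sequential Banach-Alaoglu in a separable Hilbert space, transported by the Riesz isomorphism. -/
theorem exists_weakTo {E : Type*} [NormedAddCommGroup E] [InnerProductSpace ℝ E] [CompleteSpace E]
    [TopologicalSpace.SeparableSpace E] {u : ℕ → E} {L : ℝ} (h : ∀ n, ‖u n‖ ≤ L) :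
    ∃ v, ∃ ns : ℕ → ℕ, StrictMono ns ∧ WeakTo (u ∘ ns) v := by
  have hc := WeakDual.isSeqCompact_closedBall ℝ E (0 : StrongDual ℝ E) L
  have hmem : ∀ n, StrongDual.toWeakDual (InnerProductSpace.toDual ℝ E (u n)) ∈
      WeakDual.toStrongDual ⁻¹' Metric.closedBall (0 : StrongDual ℝ E) L := by
    intro n
    simpa using h n
  obtain ⟨φ, -, ns, hns, ht⟩ := hc hmem
  refine ⟨(InnerProductSpace.toDual ℝ E).symm (WeakDual.toStrongDual φ), ns, hns, ⟨L, fun n => h _⟩,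
    fun w => ?_⟩
  have := (WeakDual.eval_continuous w).continuousAt.tendsto.comp ht
  simpa [Function.comp_def] using this

end

section

instance : SecondCountableTopology (H1 m ℓ γ) := inferInstance

instance : TopologicalSpace.SeparableSpace (H1 m ℓ γ) := inferInstance

variable {E : Type*} [NormedAddCommGroup E] [InnerProductSpace ℝ E]

/-! ### Local compactness -/

/-- For fixed `z` the average is a bounded linear functional of `u`. -/
theorem Model.tendsto_avg [CompleteSpace E] (X : Model m ℓ γ E) {τ : ℝ} (hτ : 0 < τ) {u : ℕ → E}
    (h : WeakTo u 0)
    (z : Pt m ℓ) : Tendsto (fun n => avg γ τ (X.fn (u n)) z) atTop (𝓝 0) := by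
  obtain ⟨C, hC, hb⟩ := exists_abs_avg_le m ℓ γ
  let T : E →ₗ[ℝ] ℝ :=
    { toFun := fun u => avg γ τ (X.fn u) z
      map_add' := fun u v => by
        rw [avg_congr τ (X.fn_add u v), avg_add hτ (X.memLp_fn u) (X.memLp_fn v)]
        rfl
      map_smul' := fun c u => by
        rw [avg_congr τ (X.fn_smul c u)]
        simp only [avg, Pi.smul_apply, smul_eq_mul, RingHom.id_apply]
        exact integral_const_mul _ _ }
  let T' : E →L[ℝ] ℝ := T.mkContinuous (C * τ ^ (-(homDim m ℓ γ / 2))) fun u =>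
    hb τ hτ _ _ (norm_nonneg _) (X.memLp_fn u) (X.averaging u).le z
  have := h.tendsto ((InnerProductSpace.toDual ℝ (E)).symm T')
  simp only [inner_zero_left] at this
  refine this.congr fun n => ?_
  rw [real_inner_comm, InnerProductSpace.toDual_symm_apply]
  rfl

/-- A local Rellich theorem. For fixed `k` the dyadic averages tend to $0$ pointwise and are
uniformly bounded, so dominated convergence applies on a set of finite volume; replacing a function
by its `k`-th average costs $Cr^kL$, uniformly along the sequence. -/
theorem Model.tendsto_eLpNorm_indicator [CompleteSpace E] (X : Model m ℓ γ E)
    (hQ : 2 < homDim m ℓ γ) {q : ℝ} (hq : 2 < q)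
    (hq' : (homDim m ℓ γ - 2) * q < 2 * homDim m ℓ γ) {u : ℕ → E} (h : WeakTo u 0)
    {K : Set (Pt m ℓ)} (hK : MeasurableSet K) (hK' : volume K ≠ ⊤) :
    Tendsto (fun n => eLpNorm (K.indicator (X.fn (u n))) (ENNReal.ofReal q) volume) atTop (𝓝 0) := by
  obtain ⟨C, r, hC, hr, hr1, hd⟩ := exists_eLpNorm_dyadic_sub_le hQ hq hq'
  obtain ⟨B, hB, hb⟩ := exists_abs_dyadic_le (m := m) (ℓ := ℓ) (γ := γ) hQ
  obtain ⟨L, hL⟩ := h.bdd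
  have hL0 : 0 ≤ L := (norm_nonneg _).trans (hL 0)
  have hq0 : 0 < q := by linarith
  have av := fun n => X.averaging (u n)
  have meas : ∀ k n, Measurable (dyadic γ k (X.fn (u n))) := fun k n =>
    measurable_avg (by positivity) (av n).meas
  have loc : ∀ k, Tendsto (fun n => eLpNorm (K.indicator (dyadic γ k (X.fn (u n))))
      (ENNReal.ofReal q) volume) atTop (𝓝 0) := by
    intro k
    simp_rw [eLpNorm_indicator_eq_eLpNorm_restrict hK, eLpNorm_ofReal_eq hq0]
    have : (0 : ℝ≥0∞) = 0 ^ (1 / q) := by rw [ENNReal.zero_rpow_of_pos (by positivity)]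
    rw [this]
    refine ((ENNReal.continuous_rpow_const (y := 1 / q)).tendsto 0).comp ?_
    set M : ℝ := B * (2 ^ (homDim m ℓ γ / 2 - 1)) ^ k * L with hM
    have t := tendsto_lintegral_of_dominated_convergence (μ := volume.restrict K)
      (F := fun n z => ‖dyadic γ k (X.fn (u n)) z‖ₑ ^ q) (f := fun _ => 0)
      (fun _ => ENNReal.ofReal M ^ q)
      (fun n => (meas k n).enorm.pow_const _) (fun n => ae_of_all _ fun z => ?_) ?_
      (ae_of_all _ fun z => ?_)
    · simpa using t
    · refine ENNReal.rpow_le_rpow ?_ hq0.le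
      rw [← ofReal_norm]
      refine ENNReal.ofReal_le_ofReal ((hb _ _ (av n) k z).trans ?_)
      rw [hM]
      gcongr
      exact hL n
    · rw [lintegral_const, Measure.restrict_apply_univ]
      exact ENNReal.mul_ne_top (ENNReal.rpow_ne_top_of_nonneg hq0.le ENNReal.ofReal_ne_top) hK'
    · have t := (X.tendsto_avg (τ := 2⁻¹ ^ k) (by positivity) h z).enorm
      rw [enorm_zero] at t
      have t' := ((ENNReal.continuous_rpow_const (y := q)).tendsto 0).comp t
      rw [ENNReal.zero_rpow_of_pos hq0] at t'
      exact t'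
  rw [ENNReal.tendsto_nhds_zero]
  intro ε hε
  have ht : Tendsto (fun k : ℕ => ENNReal.ofReal (C * r ^ k * L)) atTop (𝓝 0) := by
    rw [← ENNReal.ofReal_zero]
    refine ENNReal.tendsto_ofReal ?_
    simpa using ((tendsto_pow_atTop_nhds_zero_of_lt_one hr.le hr1).const_mul C).mul_const L
  have hε2 : 0 < ε / 2 := ENNReal.half_pos hε.ne'
  obtain ⟨k, hk⟩ := ((ENNReal.tendsto_nhds_zero.1 ht) _ hε2).exists
  filter_upwards [(ENNReal.tendsto_nhds_zero.1 (loc k)) _ hε2] with n hn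
  have e : K.indicator (X.fn (u n)) = K.indicator (dyadic γ k (X.fn (u n))) -
      K.indicator (dyadic γ k (X.fn (u n)) - X.fn (u n)) := by
    rw [← Set.indicator_sub', sub_sub_cancel]
  rw [e]
  refine (eLpNorm_sub_le ((meas k n).indicator hK).aestronglyMeasurable
    (((meas k n).sub (av n).meas).indicator hK).aestronglyMeasurable ?_).trans ?_
  · rw [ENNReal.one_le_ofReal]; linarith
  refine (add_le_add hn ((eLpNorm_indicator_le _).trans ((hd _ _ (av n) k).trans ?_))).trans_eq
    (ENNReal.add_halves ε)
  refine le_trans (ENNReal.ofReal_le_ofReal ?_) hk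
  gcongr
  exact hL n

/-! ### Elementary inequalities -/

/-- The function `|s|^{p-2} s`. -/
def psi (p s : ℝ) : ℝ := |s| ^ (p - 2) * s

theorem abs_psi {p : ℝ} (hp : 1 < p) (s : ℝ) : |psi p s| = |s| ^ (p - 1) := by
  rw [psi, abs_mul, abs_of_nonneg (by positivity)]
  rcases eq_or_ne s 0 with rfl | hs
  · simp [Real.zero_rpow (show p - 1 ≠ 0 by linarith)]
  · rw [← Real.rpow_add_one (by simpa using hs)]
    ring_nf

theorem psi_mul_self {p : ℝ} (hp : 1 < p) (s : ℝ) : psi p s * s = |s| ^ p := by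
  have h : psi p s * s = |s| ^ (p - 2) * |s| ^ (2 : ℝ) := by
    rw [psi, mul_assoc, Real.rpow_two, sq_abs, sq]
  rcases eq_or_ne s 0 with rfl | hs
  · simp [Real.zero_rpow (show p ≠ 0 by linarith)]
  · rw [h, ← Real.rpow_add (by simpa using hs)]
    ring_nf

theorem hasDerivAt_abs_rpow' {p : ℝ} (hp : 1 < p) (s : ℝ) :
    HasDerivAt (fun s : ℝ => |s| ^ p) (p * psi p s) s := by
  have := hasDerivAt_abs_rpow s hp
  rwa [mul_assoc] at this

theorem measurable_psi (p : ℝ) : Measurable (psi p) :=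
  (measurable_id.abs.pow_const _).mul measurable_id

theorem psi_neg (p s : ℝ) : psi p (-s) = -psi p s := by simp [psi]

theorem psi_of_pos {p s : ℝ} (hs : 0 < s) : psi p s = s ^ (p - 1) := by
  rw [psi, abs_of_pos hs, ← Real.rpow_add_one hs.ne']
  ring_nf

/-- One form for both regimes: Hölder continuity of order $p-1$ when $p\le2$, and a local Lipschitz
bound with growth when $p\ge2$. If $|a|\le2|b|$ each term is bounded separately; otherwise the mean
value inequality applies. -/
theorem abs_psi_add_sub_le {p : ℝ} (hp : 1 < p) (a b : ℝ) :
    |psi p (a + b) - psi p a| ≤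
      (6 + p) * (|b| ^ (min p 2 - 1) * (|a| + |b|) ^ (p - min p 2)) := by
  have hq1 : 1 < min p 2 := lt_min hp (by norm_num)
  have hqp : min p 2 ≤ p := min_le_left _ _
  have hq2 : min p 2 ≤ 2 := min_le_right _ _
  rcases eq_or_ne b 0 with rfl | hb
  · simp [Real.zero_rpow (show min p 2 - 1 ≠ 0 by linarith)]
  have hb0 : 0 < |b| := abs_pos.2 hb
  have hX : 0 ≤ |b| ^ (min p 2 - 1) * (|a| + |b|) ^ (p - min p 2) := by positivity
  rcases le_or_gt |a| (2 * |b|) with hab | hab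
  · have h1 : |psi p (a + b) - psi p a| ≤ 2 * (|a| + |b|) ^ (p - 1) := by
      refine (abs_sub _ _).trans ?_
      rw [abs_psi hp, abs_psi hp, two_mul]
      gcongr
      · exact abs_add_le a b
      · linarith
    have h2 : (|a| + |b|) ^ (p - 1) =
        (|a| + |b|) ^ (min p 2 - 1) * (|a| + |b|) ^ (p - min p 2) := by
      rw [← Real.rpow_add (by positivity)]
      ring_nf
    have h3 : (|a| + |b|) ^ (min p 2 - 1) ≤ 3 * |b| ^ (min p 2 - 1) := by
      calc (|a| + |b|) ^ (min p 2 - 1) ≤ (3 * |b|) ^ (min p 2 - 1) := by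
            gcongr
            linarith
        _ = 3 ^ (min p 2 - 1) * |b| ^ (min p 2 - 1) := Real.mul_rpow (by norm_num) hb0.le
        _ ≤ 3 ^ (1 : ℝ) * |b| ^ (min p 2 - 1) := by
            gcongr
            · norm_num
            · linarith
        _ = _ := by rw [Real.rpow_one]
    calc |psi p (a + b) - psi p a| ≤
        2 * ((3 * |b| ^ (min p 2 - 1)) * (|a| + |b|) ^ (p - min p 2)) := by
          refine h1.trans ?_
          rw [h2]
          gcongr
      _ = 6 * (|b| ^ (min p 2 - 1) * (|a| + |b|) ^ (p - min p 2)) := by ring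
      _ ≤ _ := by gcongr; linarith
  · -- the segment stays away from the origin
    have key : ∀ a b : ℝ, 0 < a → b ≠ 0 → 2 * |b| < a → |psi p (a + b) - psi p a| ≤
        p * (|b| ^ (min p 2 - 1) * (a + |b|) ^ (p - min p 2)) := by
      intro a b ha hb hab
      have hb0 : 0 < |b| := abs_pos.2 hb
      have hbb := abs_le.1 (le_refl |b|)
      rw [psi_of_pos (by linarith), psi_of_pos ha]
      have hder : ∀ x ∈ Set.Icc (a - |b|) (a + |b|),
          HasDerivWithinAt (fun x : ℝ => x ^ (p - 1)) ((p - 1) * x ^ (p - 1 - 1))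
            (Set.Icc (a - |b|) (a + |b|)) x := fun x hx =>
        (Real.hasDerivAt_rpow_const
          (Or.inl (show 0 < x by linarith [hx.1]).ne')).hasDerivWithinAt
      have hbd : ∀ x ∈ Set.Icc (a - |b|) (a + |b|), ‖(p - 1) * x ^ (p - 1 - 1)‖ ≤
          p * (|b| ^ (min p 2 - 2) * (a + |b|) ^ (p - min p 2)) := by
        intro x hx
        have hx0 : 0 < x := by linarith [hx.1]
        rw [Real.norm_of_nonneg (mul_nonneg (by linarith) (by positivity))]
        refine mul_le_mul (by linarith) ?_ (by positivity) (by linarith)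
        rcases le_total p 2 with h2 | h2
        · rw [min_eq_left h2, sub_self, Real.rpow_zero, mul_one, sub_sub, one_add_one_eq_two]
          exact Real.rpow_le_rpow_of_nonpos hb0 (by linarith [hx.1]) (by linarith)
        · rw [min_eq_right h2, sub_self, Real.rpow_zero, one_mul, sub_sub, one_add_one_eq_two]
          exact Real.rpow_le_rpow hx0.le hx.2 (by linarith)
      have := (convex_Icc (a - |b|) (a + |b|)).norm_image_sub_le_of_norm_hasDerivWithin_le hder hbd
        (x := a) (y := a + b) ⟨by linarith, by linarith⟩ ⟨by linarith, by linarith⟩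
      rw [add_sub_cancel_left, Real.norm_eq_abs, Real.norm_eq_abs] at this
      refine this.trans_eq ?_
      have : |b| ^ (min p 2 - 1) = |b| ^ (min p 2 - 2) * |b| := by
        rw [← Real.rpow_add_one hb0.ne']
        ring_nf
      rw [this]
      ring
    have main : |psi p (a + b) - psi p a| ≤
        p * (|b| ^ (min p 2 - 1) * (|a| + |b|) ^ (p - min p 2)) := by
      rcases lt_trichotomy a 0 with ha | rfl | ha
      · have := key (-a) (-b) (by linarith) (neg_ne_zero.2 hb) (by
          rw [abs_of_neg ha] at hab; rwa [abs_neg])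
        rwa [← neg_add, psi_neg, psi_neg, ← neg_sub', abs_neg, abs_neg, ← abs_of_neg ha] at this
      · rw [abs_zero] at hab
        linarith
      · have := key a b ha hb (by rwa [abs_of_pos ha] at hab)
        rwa [abs_of_pos ha]
    refine main.trans ?_
    gcongr
    linarith

theorem abs_rpow_add_sub_le {p : ℝ} (hp : 1 < p) (a b : ℝ) :
    |(|a + b| ^ p - |a| ^ p)| ≤ p * (|b| ^ (1 : ℝ) * (|a| + |b|) ^ (p - 1)) := by
  have hder : ∀ t ∈ Set.Icc (0 : ℝ) 1, HasDerivWithinAt (fun t : ℝ => |a + t * b| ^ p)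
      (p * psi p (a + t * b) * b) (Set.Icc (0 : ℝ) 1) t := fun t _ =>
    ((hasDerivAt_abs_rpow' hp _).comp t
      (by simpa using ((hasDerivAt_id t).mul_const b).const_add a)).hasDerivWithinAt
  have hbd : ∀ t ∈ Set.Icc (0 : ℝ) 1, ‖p * psi p (a + t * b) * b‖ ≤
      p * (|b| ^ (1 : ℝ) * (|a| + |b|) ^ (p - 1)) := by
    intro t ht
    rw [Real.norm_eq_abs, abs_mul, abs_mul, abs_psi hp, abs_of_pos (by linarith), Real.rpow_one,
      mul_assoc, mul_comm (_ ^ _)]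
    gcongr
    · refine (abs_add_le _ _).trans ?_
      rw [abs_mul, abs_of_nonneg ht.1]
      gcongr
      exact mul_le_of_le_one_left (abs_nonneg b) ht.2
  have := (convex_Icc (0 : ℝ) 1).norm_image_sub_le_of_norm_hasDerivWithin_le hder hbd
    (x := 0) (y := 1) (by simp) (by simp)
  simpa using this

/-- The mean value inequality for $t\mapsto|a+tb|^p-tp\,\psi(a)b$, whose derivative is estimated by
`abs_psi_add_sub_le`. The order $\min(p,2)>1$ of the remainder yields differentiability of the
energy. -/
theorem abs_rpow_taylor_le {p : ℝ} (hp : 1 < p) (a b : ℝ) :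
    |(|a + b| ^ p - |a| ^ p - p * (psi p a * b))| ≤
      p * (6 + p) * (|b| ^ min p 2 * (|a| + |b|) ^ (p - min p 2)) := by
  have hq1 : 1 < min p 2 := lt_min hp (by norm_num)
  have hqp : min p 2 ≤ p := min_le_left _ _
  have hder : ∀ t ∈ Set.Icc (0 : ℝ) 1,
      HasDerivWithinAt (fun t : ℝ => |a + t * b| ^ p - t * (p * (psi p a * b)))
      (p * psi p (a + t * b) * b - p * (psi p a * b)) (Set.Icc (0 : ℝ) 1) t := fun t _ =>
    (((hasDerivAt_abs_rpow' hp _).comp t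
      (by simpa using ((hasDerivAt_id t).mul_const b).const_add a)).sub
      (by simpa using (hasDerivAt_id t).mul_const (p * (psi p a * b)))).hasDerivWithinAt
  have hbd : ∀ t ∈ Set.Icc (0 : ℝ) 1, ‖p * psi p (a + t * b) * b - p * (psi p a * b)‖ ≤
      p * (6 + p) * (|b| ^ min p 2 * (|a| + |b|) ^ (p - min p 2)) := by
    intro t ht
    have htb : |t * b| ≤ |b| := by
      rw [abs_mul, abs_of_nonneg ht.1]
      exact mul_le_of_le_one_left (abs_nonneg b) ht.2
    have e : p * psi p (a + t * b) * b - p * (psi p a * b) =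
      p * ((psi p (a + t * b) - psi p a) * b) := by ring
    have e2 : |b| ^ min p 2 = |b| ^ (min p 2 - 1) * |b| := by
      rcases eq_or_ne b 0 with rfl | hb
      · simp [Real.zero_rpow (show min p 2 ≠ 0 by linarith)]
      · rw [← Real.rpow_add_one (by simpa using hb)]
        ring_nf
    rw [e, Real.norm_eq_abs, abs_mul, abs_mul, abs_of_pos (by linarith), mul_assoc p, e2]
    have h1 : |psi p (a + t * b) - psi p a| ≤
        (6 + p) * (|b| ^ (min p 2 - 1) * (|a| + |b|) ^ (p - min p 2)) := by
      refine (abs_psi_add_sub_le hp a (t * b)).trans ?_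
      gcongr
    calc p * (|psi p (a + t * b) - psi p a| * |b|) ≤
        p * ((6 + p) * (|b| ^ (min p 2 - 1) * (|a| + |b|) ^ (p - min p 2)) * |b|) := by gcongr
      _ = _ := by ring
  have := (convex_Icc (0 : ℝ) 1).norm_image_sub_le_of_norm_hasDerivWithin_le hder hbd
    (x := 0) (y := 1) (by simp) (by simp)
  rw [Real.norm_eq_abs] at this
  simp only [one_mul, zero_mul, add_zero, sub_zero, norm_one, mul_one] at this
  rwa [sub_right_comm] at this

end

section

/-! ### The nonlocal bilinear form -/

/-- `f` has norms at most `A` in `L^{p t₁}` and in `L^{p t₂}`. -/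
structure LBound (p t₁ t₂ : ℝ) (f : Pt m ℓ → ℝ) (A : ℝ) : Prop where
  nonneg : 0 ≤ A
  meas : AEStronglyMeasurable f volume
  le₁ : eLpNorm f (ENNReal.ofReal (p * t₁)) volume ≤ ENNReal.ofReal A
  le₂ : eLpNorm f (ENNReal.ofReal (p * t₂)) volume ≤ ENNReal.ofReal A

/-- `f` has norms with sum at most `A` in `L^{t₁}` and in `L^{t₂}`. -/
structure XBound (t₁ t₂ : ℝ) (f : Pt m ℓ → ℝ) (A : ℝ) : Prop where
  nonneg : 0 ≤ A
  meas : AEStronglyMeasurable f volume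
  le : nX t₁ t₂ f ≤ ENNReal.ofReal A

variable {μ p t₁ t₂ : ℝ} {E : Type*} [NormedAddCommGroup E] [InnerProductSpace ℝ E]

theorem LBound.mono {f g : Pt m ℓ → ℝ} {A : ℝ} (h : LBound p t₁ t₂ f A)
    (hg : AEStronglyMeasurable g volume) (hfg : ∀ z, |g z| ≤ |f z|) : LBound p t₁ t₂ g A :=
  ⟨h.nonneg, hg, (eLpNorm_mono hfg).trans h.le₁, (eLpNorm_mono hfg).trans h.le₂⟩

theorem LBound.abs {f : Pt m ℓ → ℝ} {A : ℝ} (h : LBound p t₁ t₂ f A) :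
    LBound p t₁ t₂ (fun z => |f z|) A :=
  h.mono h.meas.norm fun _ => (abs_abs _).le

theorem LBound.indicator {f : Pt m ℓ → ℝ} {A : ℝ} (h : LBound p t₁ t₂ f A) {K : Set (Pt m ℓ)}
    (hK : MeasurableSet K) : LBound p t₁ t₂ (K.indicator f) A :=
  ⟨h.nonneg, h.meas.indicator hK, (eLpNorm_indicator_le _).trans h.le₁,
    (eLpNorm_indicator_le _).trans h.le₂⟩

theorem LBound.congr {f g : Pt m ℓ → ℝ} {A : ℝ} (h : LBound p t₁ t₂ f A) (hfg : f =ᵐ[volume] g) :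
    LBound p t₁ t₂ g A :=
  ⟨h.nonneg, h.meas.congr hfg, (eLpNorm_congr_ae hfg).symm.trans_le h.le₁,
    (eLpNorm_congr_ae hfg).symm.trans_le h.le₂⟩

theorem Exps.p_pos (h : Exps m ℓ γ μ p t₁ t₂) : 0 < p := by linarith [h.p_gt]

theorem Exps.lbound_add (h : Exps m ℓ γ μ p t₁ t₂) {f g : Pt m ℓ → ℝ} {A B : ℝ}
    (hf : LBound p t₁ t₂ f A) (hg : LBound p t₁ t₂ g B) :
    LBound p t₁ t₂ (fun z => f z + g z) (A + B) := by
  have h1 := h.lo₁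
  have h2 := h.lo₂
  refine ⟨add_nonneg hf.nonneg hg.nonneg, hf.meas.add hg.meas, ?_, ?_⟩
  · rw [ENNReal.ofReal_add hf.nonneg hg.nonneg]
    exact (eLpNorm_add_le hf.meas hg.meas (by rw [ENNReal.one_le_ofReal]; linarith)).trans
      (add_le_add hf.le₁ hg.le₁)
  · rw [ENNReal.ofReal_add hf.nonneg hg.nonneg]
    exact (eLpNorm_add_le hf.meas hg.meas (by rw [ENNReal.one_le_ofReal]; linarith)).trans
      (add_le_add hf.le₂ hg.le₂)

/-- The Sobolev embedding into the two spaces that occur in `LBound`. -/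
theorem Exps.exists_lbound (h : Exps m ℓ γ μ p t₁ t₂) (X : Model m ℓ γ E) : ∃ S : ℝ, 0 < S ∧
    ∀ u : E, LBound p t₁ t₂ (X.fn u) (S * ‖u‖) := by
  obtain ⟨C₁, hC₁, h₁⟩ := X.exists_eLpNorm_le h.dim h.lo₁ h.hi₁
  obtain ⟨C₂, hC₂, h₂⟩ := X.exists_eLpNorm_le h.dim h.lo₂ h.hi₂
  refine ⟨C₁ + C₂, by positivity, fun u => ⟨by positivity, (X.memLp_fn u).1, ?_, ?_⟩⟩
  · refine (h₁ u).trans (ENNReal.ofReal_le_ofReal ?_)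
    gcongr
    linarith
  · refine (h₂ u).trans (ENNReal.ofReal_le_ofReal ?_)
    gcongr
    linarith

/-- Converts Sobolev bounds on the functions into bounds on products of degree `p`, the admissible
arguments of the bilinear form. The factor $2$ sums the two exponents. -/
theorem Exps.xbound_mul (h : Exps m ℓ γ μ p t₁ t₂) {f g : Pt m ℓ → ℝ} {A B r : ℝ}
    (hf : LBound p t₁ t₂ f A) (hg : LBound p t₁ t₂ g B) (hr : 0 ≤ r) (hrp : r ≤ p) :
    XBound t₁ t₂ (fun z => |f z| ^ r * |g z| ^ (p - r)) (2 * (A ^ r * B ^ (p - r))) := by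
  have hA := hf.nonneg
  have hB := hg.nonneg
  have hp := h.p_pos
  have ht₁ : 0 < t₁ := by linarith [h.t₁_gt]
  have ht₂ : 0 < t₂ := by linarith [h.t₂_gt]
  have hpr : 0 ≤ p - r := by linarith
  refine ⟨by positivity, ?_, ?_⟩
  · exact ((hf.meas.norm.aemeasurable.pow_const r).mul
      (hg.meas.norm.aemeasurable.pow_const (p - r))).aestronglyMeasurable
  · rw [two_mul, ENNReal.ofReal_add (by positivity) (by positivity),
      ENNReal.ofReal_mul (by positivity), ← ENNReal.ofReal_rpow_of_nonneg hA hr,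
      ← ENNReal.ofReal_rpow_of_nonneg hB hpr]
    refine add_le_add ?_ ?_
    · refine (eLpNorm_rpow_mul_rpow_le hf.meas hg.meas hp hr hrp ht₁).trans ?_
      gcongr
      · exact hf.le₁
      · exact hg.le₁
    · refine (eLpNorm_rpow_mul_rpow_le hf.meas hg.meas hp hr hrp ht₂).trans ?_
      gcongr
      · exact hf.le₂
      · exact hg.le₂

theorem XBound.of_le {f g : Pt m ℓ → ℝ} {A c : ℝ} (hf : XBound t₁ t₂ f A)
    (hg : AEStronglyMeasurable g volume) (hc : 0 ≤ c) (h : ∀ z, |g z| ≤ c * |f z|) :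
    XBound t₁ t₂ g (c * A) := by
  refine ⟨mul_nonneg hc hf.nonneg, hg, ?_⟩
  rw [ENNReal.ofReal_mul hc]
  refine le_trans ?_ (mul_le_mul_right hf.le _)
  rw [nX, nX, mul_add]
  exact add_le_add (eLpNorm_le_mul_eLpNorm_of_ae_le_mul (ae_of_all _ h) _)
    (eLpNorm_le_mul_eLpNorm_of_ae_le_mul (ae_of_all _ h) _)

theorem Exps.xbound_rpow (h : Exps m ℓ γ μ p t₁ t₂) {f : Pt m ℓ → ℝ} {A : ℝ}
    (hf : LBound p t₁ t₂ f A) : XBound t₁ t₂ (fun z => |f z| ^ p) (2 * A ^ p) := by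
  simpa using h.xbound_mul hf hf h.p_pos.le le_rfl

theorem Exps.xbound_psi (h : Exps m ℓ γ μ p t₁ t₂) {f g : Pt m ℓ → ℝ} {A B : ℝ}
    (hf : LBound p t₁ t₂ f A) (hg : LBound p t₁ t₂ g B) :
    XBound t₁ t₂ (fun z => psi p (f z) * g z) (2 * (B * A ^ (p - 1))) := by
  have := (h.xbound_mul hg hf zero_le_one h.p_gt.le).of_le
    (g := fun z => psi p (f z) * g z) (c := 1)
    (((measurable_psi p).comp_aemeasurable hf.meas.aemeasurable).aestronglyMeasurable.mul hg.meas)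
    zero_le_one fun z => by
      rw [one_mul, abs_mul, abs_psi h.p_gt, Real.rpow_one, abs_mul, abs_abs,
        abs_of_nonneg (by positivity : 0 ≤ |f z| ^ (p - 1)), mul_comm]
  simpa using this

theorem Exps.xbound_rpow_sub (h : Exps m ℓ γ μ p t₁ t₂) {f g : Pt m ℓ → ℝ} {A B : ℝ}
    (hf : LBound p t₁ t₂ f A) (hg : LBound p t₁ t₂ g B) :
    XBound t₁ t₂ (fun z => |f z + g z| ^ p - |f z| ^ p) (p * (2 * (B * (A + B) ^ (p - 1)))) := by
  have key := h.xbound_mul hg (h.lbound_add hf.abs hg.abs) zero_le_one h.p_gt.le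
  rw [Real.rpow_one] at key
  refine key.of_le ?_ h.p_pos.le fun z => ?_
  · exact (((hf.meas.add hg.meas).norm.aemeasurable.pow_const p).sub
      (hf.meas.norm.aemeasurable.pow_const p)).aestronglyMeasurable
  · refine (abs_rpow_add_sub_le h.p_gt (f z) (g z)).trans_eq ?_
    rw [abs_of_nonneg (by positivity : 0 ≤ |g z| ^ (1 : ℝ) * |(|f z| + |g z|)| ^ (p - 1)),
      abs_of_nonneg (by positivity : 0 ≤ |f z| + |g z|)]

theorem Exps.xbound_taylor (h : Exps m ℓ γ μ p t₁ t₂) {f g : Pt m ℓ → ℝ} {A B : ℝ}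
    (hf : LBound p t₁ t₂ f A) (hg : LBound p t₁ t₂ g B) :
    XBound t₁ t₂ (fun z => |f z + g z| ^ p - |f z| ^ p - p * (psi p (f z) * g z))
      (p * (6 + p) * (2 * (B ^ min p 2 * (A + B) ^ (p - min p 2)))) := by
  have hp := h.p_pos
  refine (h.xbound_mul hg (h.lbound_add hf.abs hg.abs) (le_min hp.le zero_le_two)
    (min_le_left _ _)).of_le ?_ (by positivity) fun z => ?_
  · exact (((hf.meas.add hg.meas).norm.aemeasurable.pow_const p).sub
      (hf.meas.norm.aemeasurable.pow_const p)).aestronglyMeasurable.sub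
      ((((measurable_psi p).comp_aemeasurable hf.meas.aemeasurable).aestronglyMeasurable.mul
        hg.meas).const_mul p)
  · refine (abs_rpow_taylor_le h.p_gt (f z) (g z)).trans_eq ?_
    rw [abs_of_nonneg (by positivity : 0 ≤ |g z| ^ min p 2 * |(|f z| + |g z|)| ^ (p - min p 2)),
      abs_of_nonneg (by positivity : 0 ≤ |f z| + |g z|)]

/-- The integrand of the bilinear form. -/
def ker2 (γ : ℝ≥0) (μ : ℝ) (f g : Pt m ℓ → ℝ) (q : Pt m ℓ × Pt m ℓ) : ℝ :=
  gauge γ (q.1 - q.2) ^ (-μ) * f q.2 * g q.1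

/-- The bilinear form `∬ d(z - w)^{-μ} f(w) g(z) dw dz`. -/
def bil (γ : ℝ≥0) (μ : ℝ) (f g : Pt m ℓ → ℝ) : ℝ := ∫ q, ker2 γ μ f g q

theorem enorm_ker2 (f g : Pt m ℓ → ℝ) (q : Pt m ℓ × Pt m ℓ) :
    ‖ker2 γ μ f g q‖ₑ = kern γ μ (q.1 - q.2) * ‖f q.2‖ₑ * ‖g q.1‖ₑ := by
  rw [ker2, enorm_mul, enorm_mul, kern, Real.enorm_of_nonneg (Real.rpow_nonneg (gauge_nonneg _) _)]

theorem aestronglyMeasurable_ker2 {f g : Pt m ℓ → ℝ} (hf : AEStronglyMeasurable f volume)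
    (hg : AEStronglyMeasurable g volume) : AEStronglyMeasurable (ker2 γ μ f g) volume :=
  (((measurable_gauge_rpow (-μ)).comp
    (measurable_fst.sub measurable_snd)).aestronglyMeasurable.mul hf.comp_snd).mul hg.comp_fst

theorem bil_congr {f f' g g' : Pt m ℓ → ℝ} (hf : f =ᵐ[volume] f') (hg : g =ᵐ[volume] g') :
    bil γ μ f g = bil γ μ f' g' := by
  refine integral_congr_ae ?_
  have h1 : (fun q : Pt m ℓ × Pt m ℓ => f q.2) =ᵐ[volume] fun q => f' q.2 :=
    Measure.quasiMeasurePreserving_snd.ae_eq hf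
  have h2 : (fun q : Pt m ℓ × Pt m ℓ => g q.1) =ᵐ[volume] fun q => g' q.1 :=
    Measure.quasiMeasurePreserving_fst.ae_eq hg
  filter_upwards [h1, h2] with q h1 h2
  rw [ker2, ker2, h1, h2]

theorem Exps.integrable_ker2 (h : Exps m ℓ γ μ p t₁ t₂) {f g : Pt m ℓ → ℝ} {A B : ℝ}
    (hf : XBound t₁ t₂ f A) (hg : XBound t₁ t₂ g B) : Integrable (ker2 γ μ f g) := by
  obtain ⟨C, hC, hle⟩ := h.double_le
  refine ⟨aestronglyMeasurable_ker2 hf.meas hg.meas, ?_⟩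
  rw [HasFiniteIntegral]
  simp_rw [enorm_ker2]
  refine (hle f g hf.meas hg.meas).trans_lt (ENNReal.mul_lt_top hC.lt_top (ENNReal.mul_lt_top ?_ ?_))
  · exact hf.le.trans_lt ENNReal.ofReal_lt_top
  · exact hg.le.trans_lt ENNReal.ofReal_lt_top

theorem Exps.exists_abs_bil_le (h : Exps m ℓ γ μ p t₁ t₂) : ∃ C : ℝ, 0 < C ∧
    ∀ (f g : Pt m ℓ → ℝ) (A B : ℝ), XBound t₁ t₂ f A → XBound t₁ t₂ g B →
      |bil γ μ f g| ≤ C * (A * B) := by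
  obtain ⟨C, hC, hle⟩ := h.double_le
  refine ⟨C.toReal + 1, by positivity, fun f g A B hf hg => ?_⟩
  have hA := hf.nonneg
  have hB := hg.nonneg
  have key : ‖bil γ μ f g‖ₑ ≤ ENNReal.ofReal (C.toReal * (A * B)) := by
    refine (enorm_integral_le_lintegral_enorm _).trans ?_
    simp_rw [enorm_ker2]
    refine (hle f g hf.meas hg.meas).trans ?_
    rw [ENNReal.ofReal_mul (by positivity), ENNReal.ofReal_mul hA, ENNReal.ofReal_toReal hC]
    gcongr
    · exact hf.le
    · exact hg.le
  rw [← ofReal_norm, ENNReal.ofReal_le_ofReal_iff (by positivity)] at key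
  refine key.trans ?_
  gcongr
  linarith

theorem Exps.bil_add_left (h : Exps m ℓ γ μ p t₁ t₂) {f f' g : Pt m ℓ → ℝ} {A A' B : ℝ}
    (hf : XBound t₁ t₂ f A) (hf' : XBound t₁ t₂ f' A') (hg : XBound t₁ t₂ g B) :
    bil γ μ (fun z => f z + f' z) g = bil γ μ f g + bil γ μ f' g := by
  rw [bil, bil, bil, ← integral_add (h.integrable_ker2 hf hg) (h.integrable_ker2 hf' hg)]
  congr 1 with q
  simp only [ker2]; ring

theorem Exps.bil_add_right (h : Exps m ℓ γ μ p t₁ t₂) {f g g' : Pt m ℓ → ℝ} {A B B' : ℝ}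
    (hf : XBound t₁ t₂ f A) (hg : XBound t₁ t₂ g B) (hg' : XBound t₁ t₂ g' B') :
    bil γ μ f (fun z => g z + g' z) = bil γ μ f g + bil γ μ f g' := by
  rw [bil, bil, bil, ← integral_add (h.integrable_ker2 hf hg) (h.integrable_ker2 hf hg')]
  congr 1 with q
  simp only [ker2]; ring

theorem bil_const_mul_right (f g : Pt m ℓ → ℝ) (c : ℝ) :
    bil γ μ f (fun z => c * g z) = c * bil γ μ f g := by
  rw [bil, bil, ← integral_const_mul]
  congr 1 with q
  simp only [ker2]; ring

theorem bil_const_mul_left (f g : Pt m ℓ → ℝ) (c : ℝ) :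
    bil γ μ (fun z => c * f z) g = c * bil γ μ f g := by
  rw [bil, bil, ← integral_const_mul]
  congr 1 with q
  simp only [ker2]; ring

theorem bil_comm (f g : Pt m ℓ → ℝ) : bil γ μ f g = bil γ μ g f := by
  rw [bil, bil]
  refine (integral_prod_swap (μ := (volume : Measure (Pt m ℓ))) (ν := (volume : Measure (Pt m ℓ)))
    (ker2 γ μ f g)).symm.trans (integral_congr_ae (ae_of_all _ fun q => ?_))
  simp only [ker2, Prod.fst_swap, Prod.snd_swap]
  rw [gauge_sub_comm]
  ring

/-- The kernel depends only on the gauge of $z-w$, and a difference is moved only by the linear part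
of a symmetry, which preserves the gauge. -/
theorem bil_comp (S : Sym m ℓ γ) (f g : Pt m ℓ → ℝ) :
    bil γ μ (fun z => f (S.map z)) (fun z => g (S.map z)) = bil γ μ f g := by
  have h := S.measurePreserving.prod S.measurePreserving
  have e : ∀ q, ker2 γ μ (fun z => f (S.map z)) (fun z => g (S.map z)) q =
      ker2 γ μ f g (Prod.map S.map S.map q) := by
    intro q
    simp only [ker2, Prod.map_fst, Prod.map_snd]
    rw [S.map_sub_map, S.gauge_lin]
  rw [bil, bil]
  simp_rw [e]
  exact MeasurePreserving.integral_comp' (f := MeasurableEquiv.prodCongr S.equiv S.equiv) h _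

theorem bil_nonneg {f g : Pt m ℓ → ℝ} (hf : ∀ z, 0 ≤ f z) (hg : ∀ z, 0 ≤ g z) :
    0 ≤ bil γ μ f g :=
  integral_nonneg fun _ => mul_nonneg (mul_nonneg (Real.rpow_nonneg (gauge_nonneg _) _) (hf _)) (hg _)

end

section

variable {μ p t₁ t₂ : ℝ} {E : Type*} [NormedAddCommGroup E] [InnerProductSpace ℝ E]
  (X : Model m ℓ γ E)

/-! ### The nonlocal part of the energy -/

/-- The double integral `∫ (d^{-μ} ∗ |u|^p) |u|^p`. -/
def Model.dfun (μ p : ℝ) (u : E) : ℝ :=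
  bil γ μ (fun z => |X.fn u z| ^ p) (fun z => |X.fn u z| ^ p)

theorem Model.dfun_nonneg (u : E) : 0 ≤ X.dfun μ p u :=
  bil_nonneg (fun _ => by positivity) fun _ => by positivity

theorem Model.dfun_congr_abs {u v : E} (h : ∀ᵐ z, |X.fn u z| = |X.fn v z|) :
    X.dfun μ p u = X.dfun μ p v := by
  have : (fun z => |X.fn u z| ^ p) =ᵐ[volume] fun z => |X.fn v z| ^ p := by
    filter_upwards [h] with z hz
    rw [hz]
  exact bil_congr this this

theorem Model.dfun_smul (c : ℝ) (u : E) : X.dfun μ p (c • u) = (|c| ^ p) ^ 2 * X.dfun μ p u := by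
  have : (fun z => |X.fn (c • u) z| ^ p) =ᵐ[volume] fun z => |c| ^ p * |X.fn u z| ^ p := by
    filter_upwards [X.fn_smul c u] with z hz
    rw [hz, Pi.smul_apply, smul_eq_mul, abs_mul, Real.mul_rpow (abs_nonneg _) (abs_nonneg _)]
  rw [Model.dfun, bil_congr this this, bil_const_mul_right, bil_const_mul_left, Model.dfun]
  ring

theorem Model.dfun_pull (S : Sym m ℓ γ) (u : E) : X.dfun μ p (X.pull S u) = X.dfun μ p u := by
  have : (fun z => |X.fn (X.pull S u) z| ^ p) =ᵐ[volume] fun z => |X.fn u (S.map z)| ^ p := by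
    filter_upwards [X.fn_pull S u] with z hz
    rw [hz]
  rw [Model.dfun, bil_congr this this,
    bil_comp S (fun z => |X.fn u z| ^ p) fun z => |X.fn u z| ^ p, Model.dfun]

theorem Exps.exists_dfun_le_of_lbound (h : Exps m ℓ γ μ p t₁ t₂) : ∃ C : ℝ, 0 < C ∧
    ∀ (u : E) (A : ℝ), LBound p t₁ t₂ (X.fn u) A → X.dfun μ p u ≤ C * (A ^ p) ^ 2 := by
  obtain ⟨C, hC, hb⟩ := h.exists_abs_bil_le
  refine ⟨4 * C, by positivity, fun u A hA => ?_⟩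
  refine (le_abs_self _).trans ((hb _ _ _ _ (h.xbound_rpow hA) (h.xbound_rpow hA)).trans_eq ?_)
  ring

theorem Exps.exists_dfun_le (h : Exps m ℓ γ μ p t₁ t₂) : ∃ C : ℝ, 0 < C ∧
    ∀ u : E, X.dfun μ p u ≤ C * (‖u‖ ^ p) ^ 2 := by
  obtain ⟨C, hC, hb⟩ := h.exists_dfun_le_of_lbound X
  obtain ⟨S, hS, hs⟩ := h.exists_lbound X
  refine ⟨C * (S ^ p) ^ 2, by positivity, fun u => (hb u _ (hs u)).trans_eq ?_⟩
  rw [Real.mul_rpow hS.le (norm_nonneg _), mul_pow, mul_assoc]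

variable [CompleteSpace E]

/-- The functional `φ ↦ ∫ (d^{-μ} ∗ |u|^p) |u|^{p-2} u φ` is represented by an element of `H^1_γ`. -/
theorem Exps.exists_nonlin (h : Exps m ℓ γ μ p t₁ t₂) (u : E) : ∃ N : E,
    ∀ φ : E, inner ℝ N φ =
      bil γ μ (fun z => |X.fn u z| ^ p) (fun z => psi p (X.fn u z) * X.fn φ z) := by
  obtain ⟨C, hC, hb⟩ := h.exists_abs_bil_le
  obtain ⟨S, hS, hs⟩ := h.exists_lbound X
  have hP := h.xbound_rpow (hs u)
  have hψ := fun φ => h.xbound_psi (hs u) (hs φ)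
  obtain ⟨K, hK⟩ : ∃ K, ∀ φ : E,
      |bil γ μ (fun z => |X.fn u z| ^ p) fun z => psi p (X.fn u z) * X.fn φ z| ≤ K * ‖φ‖ := by
    refine ⟨C * (2 * (S * ‖u‖) ^ p * (2 * (S * (S * ‖u‖) ^ (p - 1)))), fun φ =>
      (hb _ _ _ _ hP (hψ φ)).trans_eq ?_⟩
    generalize ‖φ‖ = b
    generalize S * ‖u‖ = a
    ring
  let T : E →ₗ[ℝ] ℝ :=
    { toFun := fun φ => bil γ μ (fun z => |X.fn u z| ^ p) fun z => psi p (X.fn u z) * X.fn φ z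
      map_add' := fun φ χ => by
        rw [← h.bil_add_right hP (hψ φ) (hψ χ)]
        refine bil_congr (ae_eq_refl _) ?_
        filter_upwards [X.fn_add φ χ] with z hz
        rw [hz, Pi.add_apply, mul_add]
      map_smul' := fun c φ => by
        rw [RingHom.id_apply, smul_eq_mul, ← bil_const_mul_right]
        refine bil_congr (ae_eq_refl _) ?_
        filter_upwards [X.fn_smul c φ] with z hz
        rw [hz, Pi.smul_apply, smul_eq_mul]
        ring }
  let T' : E →L[ℝ] ℝ := T.mkContinuous K hK
  refine ⟨(InnerProductSpace.toDual ℝ (E)).symm T', fun φ => ?_⟩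
  rw [InnerProductSpace.toDual_symm_apply]
  rfl

/-- The Riesz representative of `φ ↦ ∫ (d^{-μ} ∗ |u|^p) |u|^{p-2} u φ`. -/
def Exps.nonlin (h : Exps m ℓ γ μ p t₁ t₂) (u : E) : E := (h.exists_nonlin X u).choose

theorem Exps.inner_nonlin (h : Exps m ℓ γ μ p t₁ t₂) (u φ : E) :
    inner ℝ (h.nonlin X u) φ =
      bil γ μ (fun z => |X.fn u z| ^ p) (fun z => psi p (X.fn u z) * X.fn φ z) :=
  (h.exists_nonlin X u).choose_spec φ

theorem Exps.inner_nonlin_self (h : Exps m ℓ γ μ p t₁ t₂) (u : E) :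
    inner ℝ (h.nonlin X u) u = X.dfun μ p u := by
  rw [h.inner_nonlin X, Model.dfun]
  simp_rw [psi_mul_self h.p_gt]

/-- Test the representative with itself and divide by its norm. -/
theorem Exps.exists_norm_nonlin_le (h : Exps m ℓ γ μ p t₁ t₂) : ∃ C : ℝ, 0 < C ∧
    ∀ u : E, ‖h.nonlin X u‖ ≤ C * (‖u‖ ^ p * ‖u‖ ^ (p - 1)) := by
  obtain ⟨C, hC, hb⟩ := h.exists_abs_bil_le
  obtain ⟨S, hS, hs⟩ := h.exists_lbound X
  refine ⟨C * (2 * S ^ p * (2 * (S * S ^ (p - 1)))), by positivity, fun u => ?_⟩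
  rcases eq_or_ne (h.nonlin X u) 0 with h0 | h0
  · rw [h0, norm_zero]; positivity
  have key := hb _ _ _ _ (h.xbound_rpow (hs u)) (h.xbound_psi (hs u) (hs (h.nonlin X u)))
  rw [← h.inner_nonlin X, real_inner_self_eq_norm_sq, abs_of_nonneg (sq_nonneg _), sq,
    Real.mul_rpow hS.le (norm_nonneg _), Real.mul_rpow hS.le (norm_nonneg _)] at key
  have hpos : 0 < ‖h.nonlin X u‖ := norm_pos_iff.2 h0
  generalize ‖h.nonlin X u‖ = b at *
  generalize ‖u‖ = a at *
  refine le_of_mul_le_mul_right (key.trans_eq ?_) hpos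
  ring

/-- Equivariance plays the part of the principle of symmetric criticality: the gradient of the
energy at an invariant element is invariant. -/
theorem Exps.nonlin_pull (h : Exps m ℓ γ μ p t₁ t₂) (S : Sym m ℓ γ) (u : E) :
    h.nonlin X (X.pull S u) = X.pull S (h.nonlin X u) := by
  refine ext_inner_right ℝ fun φ => ?_
  rw [X.inner_pull_left, h.inner_nonlin X, h.inner_nonlin X,
    ← bil_comp S fun z => |X.fn u z| ^ p]
  refine bil_congr ?_ ?_
  · filter_upwards [X.fn_pull S u] with z hz
    rw [hz]
  · filter_upwards [X.fn_pull S u,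
      S.measurePreserving.quasiMeasurePreserving.ae (X.fn_pull S.inv φ)] with z h1 h2
    rw [h1, h2, S.inv_map_map]

theorem Exps.nonlin_smul (h : Exps m ℓ γ μ p t₁ t₂) {c : ℝ} (hc : 0 < c) (u : E) :
    h.nonlin X (c • u) = (c ^ p * c ^ (p - 1)) • h.nonlin X u := by
  refine ext_inner_right ℝ fun φ => ?_
  rw [real_inner_smul_left, h.inner_nonlin X, h.inner_nonlin X, mul_assoc,
    ← bil_const_mul_right, ← bil_const_mul_left]
  refine bil_congr ?_ ?_
  · filter_upwards [X.fn_smul c u] with z hz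
    rw [hz, Pi.smul_apply, smul_eq_mul, abs_mul, Real.mul_rpow (abs_nonneg _) (abs_nonneg _),
      abs_of_pos hc]
  · filter_upwards [X.fn_smul c u] with z hz
    rw [hz, Pi.smul_apply, smul_eq_mul, psi, abs_mul, Real.mul_rpow (abs_nonneg _) (abs_nonneg _),
      abs_of_pos hc, psi, show p - 1 = p - 2 + 1 by ring, Real.rpow_add_one hc.ne']
    ring

/-- First order expansion of the nonlocal part of the energy. -/
theorem Exps.exists_dfun_expansion (h : Exps m ℓ γ μ p t₁ t₂) {L : ℝ} (hL : 0 < L) :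
    ∃ C : ℝ, 0 < C ∧ ∀ u v : E, ‖u‖ ≤ L → ‖v‖ ≤ L →
      |X.dfun μ p (u + v) - X.dfun μ p u - 2 * p * inner ℝ (h.nonlin X u) v| ≤ C * ‖v‖ ^ min p 2 := by
  obtain ⟨C, hC, hb⟩ := h.exists_abs_bil_le
  obtain ⟨S, hS, hs⟩ := h.exists_lbound X
  have hp := h.p_pos
  have hp1 := h.p_gt
  have hqp : min p 2 ≤ p := min_le_left _ _
  have hq2 : min p 2 ≤ 2 := min_le_right _ _
  have hq0 : 0 < min p 2 := lt_min hp two_pos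
  set T := S * L with hT
  have hT0 : 0 < T := by positivity
  set K := 2 * C * (2 * T ^ p) * (p * (6 + p) * (2 * (2 * T) ^ (p - min p 2))) +
    C * (p * (2 * (2 * T) ^ (p - 1))) ^ 2 * T ^ (2 - min p 2) with hK
  have hK0 : 0 < K := by positivity
  refine ⟨K * S ^ min p 2, by positivity, fun u v hu hv => ?_⟩
  have lu := hs u
  have lv := hs v
  have hA : S * ‖u‖ ≤ T := mul_le_mul_of_nonneg_left hu hS.le
  have hB : S * ‖v‖ ≤ T := mul_le_mul_of_nonneg_left hv hS.le
  have hfin : K * S ^ min p 2 * ‖v‖ ^ min p 2 = K * (S * ‖v‖) ^ min p 2 := by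
    rw [Real.mul_rpow hS.le (norm_nonneg _), mul_assoc]
  rw [hfin, h.inner_nonlin X, Model.dfun, Model.dfun]
  have e0 : (fun z => |X.fn (u + v) z| ^ p) =ᵐ[volume]
      fun z => |X.fn u z| ^ p + (|X.fn u z + X.fn v z| ^ p - |X.fn u z| ^ p) := by
    filter_upwards [X.fn_add u v] with z hz
    rw [hz, Pi.add_apply]; ring
  rw [bil_congr e0 e0]
  clear hu hv hfin e0
  generalize S * ‖u‖ = A at *
  generalize S * ‖v‖ = B at *
  generalize X.fn u = f at *
  generalize X.fn v = g at *
  have hA0 := lu.nonneg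
  have hB0 := lv.nonneg
  have xP := h.xbound_rpow lu
  have xδ := h.xbound_rpow_sub lu lv
  have xR := h.xbound_taylor lu lv
  have xψ := h.xbound_psi lu lv
  have xψ' := xψ.of_le (g := fun z => p * (psi p (f z) * g z)) (c := p) (xψ.meas.const_mul p) hp.le
    fun z => by rw [abs_mul, abs_of_pos hp]
  have xPδ : XBound t₁ t₂ (fun z => |f z| ^ p + (|f z + g z| ^ p - |f z| ^ p)) (2 * (A + B) ^ p) := by
    simpa using h.xbound_rpow (h.lbound_add lu lv)
  have e1 : bil γ μ (fun z => |f z| ^ p) (fun z => |f z + g z| ^ p - |f z| ^ p) =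
      p * bil γ μ (fun z => |f z| ^ p) (fun z => psi p (f z) * g z) +
      bil γ μ (fun z => |f z| ^ p)
        (fun z => |f z + g z| ^ p - |f z| ^ p - p * (psi p (f z) * g z)) := by
    rw [← bil_const_mul_right, ← h.bil_add_right xP xψ' xR]
    congr 1 with z
    ring
  -- With $P=|f|^p$ and $\delta=|f+g|^p-|f|^p$, the symmetric form expands as
  -- $B(P+\delta,P+\delta)-B(P,P)=2B(P,\delta)+B(\delta,\delta)$; only the Taylor remainder of
  -- $\delta$ is left in the first term once the linear part is removed.
  have e2 : bil γ μ (fun z => |f z| ^ p + (|f z + g z| ^ p - |f z| ^ p))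
      (fun z => |f z| ^ p + (|f z + g z| ^ p - |f z| ^ p)) - bil γ μ (fun z => |f z| ^ p)
        (fun z => |f z| ^ p) - 2 * p * bil γ μ (fun z => |f z| ^ p) (fun z => psi p (f z) * g z) =
      2 * bil γ μ (fun z => |f z| ^ p)
        (fun z => |f z + g z| ^ p - |f z| ^ p - p * (psi p (f z) * g z)) +
      bil γ μ (fun z => |f z + g z| ^ p - |f z| ^ p) (fun z => |f z + g z| ^ p - |f z| ^ p) := by
    rw [h.bil_add_left xP xδ xPδ, h.bil_add_right xP xP xδ, h.bil_add_right xδ xP xδ,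
      bil_comm (fun z => |f z + g z| ^ p - |f z| ^ p) (fun z => |f z| ^ p), e1]
    ring
  rw [e2]
  have b1 := hb _ _ _ _ xP xR
  have b2 := hb _ _ _ _ xδ xδ
  refine (abs_add_le _ _).trans ?_
  rw [abs_mul, abs_two]
  have hAB : A + B ≤ 2 * T := by linarith
  -- The term $B(\delta,\delta)$ is of second order; as $B\le T$, it can be bounded by the weaker
  -- power $\min(p,2)$.
  have hBq : B ^ 2 ≤ B ^ min p 2 * T ^ (2 - min p 2) := by
    rw [← Real.rpow_two]
    have : B ^ (2 : ℝ) = B ^ min p 2 * B ^ (2 - min p 2) := by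
      rw [← Real.rpow_add_of_nonneg hB0 hq0.le (by linarith)]
      ring_nf
    rw [this]
    gcongr
  calc _ ≤ 2 * (C * (2 * A ^ p * (p * (6 + p) * (2 * (B ^ min p 2 * (A + B) ^ (p - min p 2)))))) +
        C * (p * (2 * (B * (A + B) ^ (p - 1))) * (p * (2 * (B * (A + B) ^ (p - 1))))) := by gcongr
    _ = 2 * (C * (2 * A ^ p * (p * (6 + p) * (2 * (B ^ min p 2 * (A + B) ^ (p - min p 2)))))) +
        C * (p * (2 * (A + B) ^ (p - 1))) ^ 2 * B ^ 2 := by ring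
    _ ≤ 2 * (C * (2 * T ^ p * (p * (6 + p) * (2 * (B ^ min p 2 * (2 * T) ^ (p - min p 2)))))) +
        C * (p * (2 * (2 * T) ^ (p - 1))) ^ 2 * (B ^ min p 2 * T ^ (2 - min p 2)) := by
        have : 0 ≤ p - min p 2 := by linarith
        have : 0 ≤ p - 1 := by linarith
        gcongr
    _ = K * B ^ min p 2 := by rw [hK]; ring

theorem hasFDerivAt_of_abs_sub_le {E : Type*} [NormedAddCommGroup E] [NormedSpace ℝ E] {f : E → ℝ}
    {f' : E →L[ℝ] ℝ} {u : E} {C q : ℝ} (hq : 1 < q)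
    (h : ∀ v, ‖v‖ ≤ 1 → |f (u + v) - f u - f' v| ≤ C * ‖v‖ ^ q) : HasFDerivAt f f' u := by
  rw [hasFDerivAt_iff_isLittleO_nhds_zero]
  refine Asymptotics.IsBigO.trans_isLittleO (g := fun v : E => ‖v‖ ^ q) ?_ ?_
  · refine Asymptotics.IsBigO.of_bound C ?_
    filter_upwards [Metric.ball_mem_nhds (0 : E) one_pos] with v hv
    rw [Real.norm_of_nonneg (r := ‖v‖ ^ q) (by positivity)]
    rw [mem_ball_zero_iff] at hv
    simpa using h v hv.le
  · rw [← Asymptotics.isLittleO_norm_right]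
    have t : Tendsto (fun v : E => ‖v‖) (𝓝 0) (𝓝 0) := by
      simpa using (continuous_norm (E := E)).tendsto 0
    refine (Asymptotics.isLittleO_iff_tendsto' (l := 𝓝 (0 : E))
      (f := fun v => ‖v‖ ^ q) (g := fun v => ‖v‖) ?_).2 ?_
    · filter_upwards with v hv
      rw [hv, Real.zero_rpow (by linarith)]
    · have t2 : Tendsto (fun v : E => ‖v‖ ^ (q - 1)) (𝓝 0) (𝓝 0) := by
        have := t.rpow_const (p := q - 1) (Or.inr (by linarith))
        rwa [Real.zero_rpow (by linarith)] at this
      refine t2.congr fun v => ?_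
      rcases eq_or_ne (‖v‖) 0 with h0 | h0
      · rw [h0, Real.zero_rpow (by linarith), div_zero]
      · rw [Real.rpow_sub_one h0]

theorem Exps.hasFDerivAt_dfun (h : Exps m ℓ γ μ p t₁ t₂) (u : E) :
    HasFDerivAt (X.dfun μ p) ((2 * p) • innerSL ℝ (h.nonlin X u)) u := by
  obtain ⟨C, hC, hb⟩ := h.exists_dfun_expansion X (L := ‖u‖ + 1)
    (add_pos_of_nonneg_of_pos (norm_nonneg u) one_pos)
  exact hasFDerivAt_of_abs_sub_le (lt_min h.p_gt one_lt_two) fun v hv =>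
    hb u v (le_add_of_nonneg_right zero_le_one) (hv.trans (le_add_of_nonneg_left (norm_nonneg u)))

end

section

variable {μ p t₁ t₂ : ℝ} {E : Type*} [NormedAddCommGroup E] [InnerProductSpace ℝ E]
  [CompleteSpace E] (X : Model m ℓ γ E)

/-! ### Weak continuity -/

theorem Exps.exists_tendsto_lbound_indicator (h : Exps m ℓ γ μ p t₁ t₂) {u : ℕ → E}
    (hu : WeakTo u 0) {K : Set (Pt m ℓ)} (hK : MeasurableSet K) (hK' : volume K ≠ ⊤) :
    ∃ δ : ℕ → ℝ, Tendsto δ atTop (𝓝 0) ∧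
      ∀ n, LBound p t₁ t₂ (K.indicator (X.fn (u n))) (δ n) := by
  obtain ⟨S, hS, hs⟩ := h.exists_lbound X
  have a1 := X.tendsto_eLpNorm_indicator h.dim h.lo₁ h.hi₁ hu hK hK'
  have a2 := X.tendsto_eLpNorm_indicator h.dim h.lo₂ h.hi₂ hu hK hK'
  refine ⟨fun n => (eLpNorm (K.indicator (X.fn (u n))) (ENNReal.ofReal (p * t₁)) volume).toReal +
    (eLpNorm (K.indicator (X.fn (u n))) (ENNReal.ofReal (p * t₂)) volume).toReal, ?_, fun n => ?_⟩
  · simpa using ((ENNReal.tendsto_toReal ENNReal.zero_ne_top).comp a1).add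
      ((ENNReal.tendsto_toReal ENNReal.zero_ne_top).comp a2)
  · have b := (hs (u n)).indicator hK
    have f1 := b.le₁.trans_lt ENNReal.ofReal_lt_top
    have f2 := b.le₂.trans_lt ENNReal.ofReal_lt_top
    refine ⟨by positivity, b.meas, ?_, ?_⟩
    · rw [ENNReal.ofReal_add (by positivity) (by positivity), ENNReal.ofReal_toReal f1.ne]
      exact le_self_add
    · rw [ENNReal.ofReal_add (by positivity) (by positivity), ENNReal.ofReal_toReal f2.ne]
      exact le_add_self

theorem tendsto_eLpNorm_indicator_compl_closedBall {f : Pt m ℓ → ℝ} {q : ℝ} (hq : 0 < q)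
    (hf : AEStronglyMeasurable f volume) (h : eLpNorm f (ENNReal.ofReal q) volume ≠ ⊤) :
    Tendsto (fun n : ℕ => eLpNorm ((Metric.closedBall (0 : Pt m ℓ) n)ᶜ.indicator f)
      (ENNReal.ofReal q) volume) atTop (𝓝 0) := by
  simp_rw [eLpNorm_ofReal_eq hq] at h ⊢
  have : (0 : ℝ≥0∞) = 0 ^ (1 / q) := by rw [ENNReal.zero_rpow_of_pos (by positivity)]
  rw [this]
  refine ((ENNReal.continuous_rpow_const (y := 1 / q)).tendsto 0).comp ?_
  have t := tendsto_lintegral_of_dominated_convergence' (μ := volume)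
    (F := fun (n : ℕ) z => ‖(Metric.closedBall (0 : Pt m ℓ) n)ᶜ.indicator f z‖ₑ ^ q)
    (f := fun _ => 0) (fun z => ‖f z‖ₑ ^ q)
    (fun n => (hf.indicator Metric.isClosed_closedBall.measurableSet.compl).enorm.pow_const _)
    (fun n => ae_of_all _ fun z => ?_) ?_ (ae_of_all _ fun z => ?_)
  · simpa using t
  · exact ENNReal.rpow_le_rpow (enorm_indicator_le_enorm_self _ _) hq.le
  · intro h'
    rw [h', ENNReal.top_rpow_of_pos (by positivity)] at h
    exact h rfl
  · refine tendsto_const_nhds.congr' ?_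
    filter_upwards [(tendsto_natCast_atTop_atTop (R := ℝ)).eventually_ge_atTop ‖z‖] with n hn
    rw [Set.indicator_of_notMem (by simpa using hn), enorm_zero, ENNReal.zero_rpow_of_pos hq]

theorem Exps.exists_lbound_compl_le (h : Exps m ℓ γ μ p t₁ t₂) {f : Pt m ℓ → ℝ} {A : ℝ}
    (hf : LBound p t₁ t₂ f A) {ε : ℝ} (hε : 0 < ε) : ∃ R : ℝ,
      LBound p t₁ t₂ ((Metric.closedBall (0 : Pt m ℓ) R)ᶜ.indicator f) ε := by
  have a1 := tendsto_eLpNorm_indicator_compl_closedBall (by linarith [h.lo₁]) hf.meas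
    (hf.le₁.trans_lt ENNReal.ofReal_lt_top).ne
  have a2 := tendsto_eLpNorm_indicator_compl_closedBall (by linarith [h.lo₂]) hf.meas
    (hf.le₂.trans_lt ENNReal.ofReal_lt_top).ne
  have hε' : 0 < ENNReal.ofReal ε := ENNReal.ofReal_pos.2 hε
  obtain ⟨n, h1, h2⟩ := ((ENNReal.tendsto_nhds_zero.1 a1 _ hε').and
    (ENNReal.tendsto_nhds_zero.1 a2 _ hε')).exists
  exact ⟨n, hε.le, hf.meas.indicator Metric.isClosed_closedBall.measurableSet.compl, h1, h2⟩

/-- The bilinear form is local, up to an error that is small compared with the norms. -/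
theorem Exps.exists_abs_bil_le_local (h : Exps m ℓ γ μ p t₁ t₂) : ∃ C : ℝ, 0 < C ∧
    ∀ ε : ℝ, 0 < ε → ∃ M : ℝ, ∀ (R : ℝ) (f g : Pt m ℓ → ℝ) (A A' B : ℝ), XBound t₁ t₂ f A →
      XBound t₁ t₂ g B → (∀ z, z ∉ Metric.closedBall (0 : Pt m ℓ) R → g z = 0) →
      XBound t₁ t₂ ((Metric.closedBall (0 : Pt m ℓ) (R + M)).indicator f) A' →
      |bil γ μ f g| ≤ ε * (A * B) + C * (A' * B) := by
  obtain ⟨C, hC, hle⟩ := h.double_le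
  refine ⟨C.toReal + 1, by positivity, fun ε hε => ?_⟩
  obtain ⟨M, hM⟩ := h.tail_le (ENNReal.ofReal_pos.2 hε)
  -- A gauge at most `M` bounds $|x|$ by $M$ and $|y|$ by $M^{1+\gamma}$; the balls are those of the
  -- maximum norm of the product.
  refine ⟨max M (M ^ (1 + (γ : ℝ))), fun R f g A A' B hf hg h0 hf' => ?_⟩
  set K := Metric.closedBall (0 : Pt m ℓ) (R + max M (M ^ (1 + (γ : ℝ)))) with hK
  have hA := hf.nonneg
  have hA' := hf'.nonneg
  have hB := hg.nonneg
  have key : ‖bil γ μ f g‖ₑ ≤ ENNReal.ofReal (ε * (A * B) + C.toReal * (A' * B)) := by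
    refine (enorm_integral_le_lintegral_enorm _).trans ?_
    have pt : ∀ q : Pt m ℓ × Pt m ℓ, ‖ker2 γ μ f g q‖ₑ ≤
        {z : Pt m ℓ | M < gauge γ z}.indicator (kern γ μ) (q.1 - q.2) * ‖f q.2‖ₑ * ‖g q.1‖ₑ +
          kern γ μ (q.1 - q.2) * ‖K.indicator f q.2‖ₑ * ‖g q.1‖ₑ := by
      intro q
      rw [enorm_ker2]
      by_cases hq : q.1 - q.2 ∈ {z : Pt m ℓ | M < gauge γ z}
      · rw [Set.indicator_of_mem hq]
        exact le_self_add
      · by_cases hz : q.1 ∈ Metric.closedBall (0 : Pt m ℓ) R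
        · have hq' : gauge γ (q.1 - q.2) ≤ M := not_lt.1 hq
          have hmem : q.2 ∈ K := by
            rw [hK, mem_closedBall_zero_iff]
            rw [mem_closedBall_zero_iff] at hz
            have b1 : ‖(q.1 - q.2).1‖ ≤ max M (M ^ (1 + (γ : ℝ))) :=
              ((norm_fst_le_gauge _).trans hq').trans (le_max_left _ _)
            have b2 : ‖(q.1 - q.2).2‖ ≤ max M (M ^ (1 + (γ : ℝ))) :=
              ((norm_snd_le_gauge _).trans (Real.rpow_le_rpow (gauge_nonneg _) hq'
                (by positivity))).trans (le_max_right _ _)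
            have b3 : ‖q.1 - q.2‖ ≤ max M (M ^ (1 + (γ : ℝ))) := max_le b1 b2
            calc ‖q.2‖ = ‖q.1 - (q.1 - q.2)‖ := by rw [sub_sub_cancel]
              _ ≤ ‖q.1‖ + ‖q.1 - q.2‖ := norm_sub_le _ _
              _ ≤ _ := add_le_add hz b3
          rw [Set.indicator_of_mem hmem]
          exact le_add_self
        · rw [h0 _ hz, enorm_zero, mul_zero]
          exact zero_le
    refine (lintegral_mono pt).trans ?_
    have hm1 : AEMeasurable (fun q : Pt m ℓ × Pt m ℓ =>
        {z : Pt m ℓ | M < gauge γ z}.indicator (kern γ μ) (q.1 - q.2) * ‖f q.2‖ₑ * ‖g q.1‖ₑ)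
        volume :=
      ((((measurable_kern μ).indicator (measurableSet_lt_gauge M)).comp
        (measurable_fst.sub measurable_snd)).aemeasurable.mul hf.meas.comp_snd.enorm).mul
        hg.meas.comp_fst.enorm
    rw [lintegral_add_left' hm1]
    refine (add_le_add (hM f g hf.meas hg.meas) (hle _ g hf'.meas hg.meas)).trans ?_
    rw [ENNReal.ofReal_add (by positivity) (by positivity), ENNReal.ofReal_mul hε.le,
      ENNReal.ofReal_mul hA, ENNReal.ofReal_mul (p := C.toReal) (by positivity),
      ENNReal.ofReal_mul hA', ENNReal.ofReal_toReal hC]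
    gcongr
    · exact hf.le
    · exact hg.le
    · exact hf'.le
    · exact hg.le
  rw [← ofReal_norm, ENNReal.ofReal_le_ofReal_iff (by positivity)] at key
  refine key.trans ?_
  gcongr
  linarith

/-- The small factor `d` keeps the power $\min(p,2)-1>0$, and the other two functions are merged
into one, so the whole tends to $0$ with `D`. -/
theorem Exps.xbound_psi_sub (h : Exps m ℓ γ μ p t₁ t₂) {f d w : Pt m ℓ → ℝ} {A D B : ℝ}
    (hf : LBound p t₁ t₂ f A) (hd : LBound p t₁ t₂ d D) (hw : LBound p t₁ t₂ w B) :
    XBound t₁ t₂ (fun z => (psi p (f z + d z) - psi p (f z)) * w z)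
      ((6 + p) * (2 * (D ^ (min p 2 - 1) * (A + D + B) ^ (p - (min p 2 - 1))))) := by
  have hp := h.p_pos
  have hq : 1 < min p 2 := lt_min h.p_gt one_lt_two
  have hqp : min p 2 ≤ p := min_le_left _ _
  refine (h.xbound_mul hd (h.lbound_add (h.lbound_add hf.abs hd.abs) hw.abs) (by linarith)
    (by linarith)).of_le ?_ (by positivity) fun z => ?_
  · have m1 := ((measurable_psi p).comp_aemeasurable
      (hf.meas.add hd.meas).aemeasurable).aestronglyMeasurable
    exact (m1.sub ((measurable_psi p).comp_aemeasurable hf.meas.aemeasurable).aestronglyMeasurable).mul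
      hw.meas
  · have c0 : 0 ≤ |f z| + |d z| + |w z| := by positivity
    rw [abs_mul, abs_mul, abs_of_nonneg (by positivity : 0 ≤ |d z| ^ (min p 2 - 1)),
      abs_of_nonneg c0,
      abs_of_nonneg (by positivity : 0 ≤ (|f z| + |d z| + |w z|) ^ (p - (min p 2 - 1)))]
    have e : (|f z| + |d z| + |w z|) ^ (p - (min p 2 - 1)) =
        (|f z| + |d z| + |w z|) ^ (p - min p 2) * (|f z| + |d z| + |w z|) := by
      rw [show p - (min p 2 - 1) = p - min p 2 + 1 by ring,
        Real.rpow_add_of_nonneg c0 (by linarith) zero_le_one, Real.rpow_one]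
    rw [e]
    calc |psi p (f z + d z) - psi p (f z)| * |w z|
        ≤ ((6 + p) * (|d z| ^ (min p 2 - 1) * (|f z| + |d z|) ^ (p - min p 2))) * |w z| := by
          gcongr
          exact abs_psi_add_sub_le h.p_gt _ _
      _ ≤ ((6 + p) * (|d z| ^ (min p 2 - 1) * (|f z| + |d z| + |w z|) ^ (p - min p 2))) *
          (|f z| + |d z| + |w z|) := by
          have r1 : (|f z| + |d z|) ^ (p - min p 2) ≤ (|f z| + |d z| + |w z|) ^ (p - min p 2) :=
            Real.rpow_le_rpow (by positivity) (le_add_of_nonneg_right (abs_nonneg _)) (by linarith)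
          have r2 : |w z| ≤ |f z| + |d z| + |w z| := le_add_of_nonneg_left (by positivity)
          have r3 : 0 ≤ 6 + p := by linarith
          exact mul_le_mul (mul_le_mul_of_nonneg_left (mul_le_mul_of_nonneg_left r1 (by positivity))
            r3) r2 (abs_nonneg _) (by positivity)
      _ = _ := by ring

theorem tendsto_of_forall_eventually_le {a : ℕ → ℝ} {b K : ℝ} (hK : 0 ≤ K)
    (h : ∀ ε : ℝ, 0 < ε → ∀ᶠ n in atTop, |a n - b| ≤ K * ε) : Tendsto a atTop (𝓝 b) := by
  rw [Metric.tendsto_nhds]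
  intro ε hε
  filter_upwards [h (ε / (K + 1)) (by positivity)] with n hn
  rw [Real.dist_eq]
  refine hn.trans_lt ?_
  rw [mul_div_assoc', div_lt_iff₀ (by positivity)]
  nlinarith

theorem LBound.weaken {f : Pt m ℓ → ℝ} {A A' : ℝ} (h : LBound p t₁ t₂ f A) (hA : A ≤ A') :
    LBound p t₁ t₂ f A' :=
  ⟨h.nonneg.trans hA, h.meas, h.le₁.trans (ENNReal.ofReal_le_ofReal hA),
    h.le₂.trans (ENNReal.ofReal_le_ofReal hA)⟩

/-- In the application `w` is the part of the test function in a ball and `w'` its tail. The tail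
terms are small by themselves; the other two isolate the change of $|f|^p$ and the change of
$\psi(f)$, both tested against `w`. -/
theorem Exps.bil_sub_bil (h : Exps m ℓ γ μ p t₁ t₂) {f f' w w' : Pt m ℓ → ℝ} {A B D : ℝ}
    (hf : LBound p t₁ t₂ f A) (hf' : LBound p t₁ t₂ f' D) (hw : LBound p t₁ t₂ w B)
    (hw' : LBound p t₁ t₂ w' B) :
    bil γ μ (fun z => |f z| ^ p) (fun z => psi p (f z) * (w z + w' z)) -
      bil γ μ (fun z => |f' z| ^ p) (fun z => psi p (f' z) * (w z + w' z)) =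
    bil γ μ (fun z => |f z| ^ p) (fun z => psi p (f z) * w' z) -
      bil γ μ (fun z => |f' z| ^ p) (fun z => psi p (f' z) * w' z) +
    (bil γ μ (fun z => |f z| ^ p - |f' z| ^ p) (fun z => psi p (f z) * w z) +
      bil γ μ (fun z => |f' z| ^ p) (fun z => (psi p (f z) - psi p (f' z)) * w z)) := by
  have P := h.xbound_rpow hf
  have P' := h.xbound_rpow hf'
  have x1 := h.xbound_psi hf hw
  have x2 := h.xbound_psi hf hw'
  have x1' := h.xbound_psi hf' hw
  have x2' := h.xbound_psi hf' hw'
  simp_rw [mul_add]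
  rw [h.bil_add_right P x1 x2, h.bil_add_right P' x1' x2']
  have i1 : bil γ μ (fun z => |f z| ^ p - |f' z| ^ p) (fun z => psi p (f z) * w z) =
      bil γ μ (fun z => |f z| ^ p) (fun z => psi p (f z) * w z) -
        bil γ μ (fun z => |f' z| ^ p) (fun z => psi p (f z) * w z) := by
    rw [bil, bil, bil, ← integral_sub (h.integrable_ker2 P x1) (h.integrable_ker2 P' x1)]
    congr 1 with q
    simp only [ker2]; ring
  have i2 : bil γ μ (fun z => |f' z| ^ p) (fun z => (psi p (f z) - psi p (f' z)) * w z) =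
      bil γ μ (fun z => |f' z| ^ p) (fun z => psi p (f z) * w z) -
        bil γ μ (fun z => |f' z| ^ p) (fun z => psi p (f' z) * w z) := by
    rw [bil, bil, bil, ← integral_sub (h.integrable_ker2 P' x1) (h.integrable_ker2 P' x1')]
    congr 1 with q
    simp only [ker2]; ring
  rw [i1, i2]
  ring

/-- Split the test function into a part in a large ball and a small tail. On the ball the change of
$\psi(u_n)$ is small by local compactness. The change of $|u_n|^p$ enters through the convolution,
but by `Exps.exists_abs_bil_le_local` only its restriction to a larger ball matters, up to
$\varepsilon$. -/
theorem Exps.tendsto_inner_nonlin (h : Exps m ℓ γ μ p t₁ t₂) {u : ℕ → E} {v : E}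
    (hu : WeakTo u v) (φ : E) :
    Tendsto (fun n => inner ℝ (h.nonlin X (u n)) φ) atTop (𝓝 (inner ℝ (h.nonlin X v) φ)) := by
  obtain ⟨S, hS, hs⟩ := h.exists_lbound X
  obtain ⟨L, hL⟩ := hu.bdd
  obtain ⟨C, hC, hb⟩ := h.exists_abs_bil_le
  obtain ⟨C', hC', hloc⟩ := h.exists_abs_bil_le_local
  have hp := h.p_pos
  have hp1 := h.p_gt
  have hq1 : 1 < min p 2 := lt_min hp1 one_lt_two
  have hqp : min p 2 ≤ p := min_le_left _ _
  have hL0 : 0 ≤ L := (norm_nonneg _).trans (hL 0)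
  set A := S * (L + ‖v‖) with hA
  have hA0 : 0 ≤ A := by positivity
  set B := S * ‖φ‖ with hB
  have hB0 : 0 ≤ B := by positivity
  have lv : LBound p t₁ t₂ (X.fn v) A := (hs v).weaken (by rw [hA]; gcongr; linarith)
  have lφ : LBound p t₁ t₂ (X.fn φ) B := hs φ
  have ld : ∀ n, LBound p t₁ t₂ (X.fn (u n - v)) A := fun n => (hs _).weaken (by
    rw [hA]; gcongr; exact (norm_sub_le _ _).trans (by gcongr; exact hL n))
  have eu : ∀ n, X.fn (u n) =ᵐ[volume] fun z => X.fn v z + X.fn (u n - v) z := by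
    intro n
    filter_upwards [X.fn_sub (u n) v] with z hz
    rw [hz, Pi.sub_apply]; ring
  have lF : ∀ n, LBound p t₁ t₂ (fun z => X.fn v z + X.fn (u n - v) z) A := fun n =>
    ((hs (u n)).congr (eu n)).weaken (by
      rw [hA]; gcongr; linarith [hL n, norm_nonneg v])
  set X₁ := p * (2 * (A * (A + A) ^ (p - 1))) with hX₁
  set X₂ := 2 * (B * A ^ (p - 1)) with hX₂
  have hX₂0 : 0 ≤ X₂ := by positivity
  refine tendsto_of_forall_eventually_le
    (K := 2 * (C * (2 * A ^ p * (2 * A ^ (p - 1)))) + X₁ * X₂ + 2) (by positivity) fun ε hε => ?_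
  obtain ⟨R, hR⟩ := h.exists_lbound_compl_le lφ hε
  obtain ⟨M, hM⟩ := hloc ε hε
  set K := Metric.closedBall (0 : Pt m ℓ) R with hK
  set K' := Metric.closedBall (0 : Pt m ℓ) (R + M) with hK'
  have mK : MeasurableSet K := Metric.isClosed_closedBall.measurableSet
  have mK' : MeasurableSet K' := Metric.isClosed_closedBall.measurableSet
  obtain ⟨δ, hδ, hδb⟩ := h.exists_tendsto_lbound_indicator X hu.sub_const mK
    measure_closedBall_lt_top.ne
  obtain ⟨δ', hδ', hδb'⟩ := h.exists_tendsto_lbound_indicator X hu.sub_const mK'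
    measure_closedBall_lt_top.ne
  have hc : LBound p t₁ t₂ (K.indicator (X.fn φ)) B := lφ.indicator mK
  have lim1 : Tendsto (fun n => C' * (p * (2 * (δ' n * (A + δ' n) ^ (p - 1))) * X₂)) atTop (𝓝 0) := by
    have t : Tendsto (fun n => (A + δ' n) ^ (p - 1)) atTop (𝓝 ((A + 0) ^ (p - 1))) :=
      (hδ'.const_add A).rpow_const (Or.inr (by linarith))
    simpa using ((((hδ'.mul t).const_mul 2).const_mul p).mul_const X₂).const_mul C'
  have lim2 : Tendsto (fun n => C * (2 * A ^ p * ((6 + p) *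
      (2 * (δ n ^ (min p 2 - 1) * (A + δ n + B) ^ (p - (min p 2 - 1))))))) atTop (𝓝 0) := by
    have t : Tendsto (fun n => (A + δ n + B) ^ (p - (min p 2 - 1))) atTop
        (𝓝 ((A + 0 + B) ^ (p - (min p 2 - 1)))) :=
      ((hδ.const_add A).add_const B).rpow_const (Or.inr (by linarith))
    have t' : Tendsto (fun n => δ n ^ (min p 2 - 1)) atTop (𝓝 0) := by
      have := hδ.rpow_const (p := min p 2 - 1) (Or.inr (by linarith))
      rwa [Real.zero_rpow (by linarith)] at this
    simpa using ((((t'.mul t).const_mul 2).const_mul (6 + p)).const_mul (2 * A ^ p)).const_mul C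
  filter_upwards [lim1.eventually_le_const hε, lim2.eventually_le_const hε] with n h1 h2
  have eP : (fun z => |X.fn (u n) z| ^ p) =ᵐ[volume] fun z => |X.fn v z + X.fn (u n - v) z| ^ p := by
    filter_upwards [eu n] with z hz
    rw [hz]
  have eψ : (fun z => psi p (X.fn (u n) z) * X.fn φ z) =ᵐ[volume]
      fun z => psi p (X.fn v z + X.fn (u n - v) z) * X.fn φ z := by
    filter_upwards [eu n] with z hz
    rw [hz]
  rw [h.inner_nonlin X, h.inner_nonlin X, bil_congr eP eψ]
  have sp : ∀ z, X.fn φ z = K.indicator (X.fn φ) z + Kᶜ.indicator (X.fn φ) z := fun z =>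
    (congrFun (Set.indicator_self_add_compl K (X.fn φ)) z).symm
  simp_rw [sp]
  have ldn := ld n
  have lFn := lF n
  have hδn := hδb n
  have hδn' := hδb' n
  generalize X.fn (u n - v) = d at *
  generalize X.fn φ = w at *
  generalize X.fn v = g at *
  clear_value K K'
  rw [h.bil_sub_bil lFn lv hc (lφ.indicator mK.compl)]
  have b1 := hb _ _ _ _ (h.xbound_rpow lFn) (h.xbound_psi lFn hR)
  have b2 := hb _ _ _ _ (h.xbound_rpow lv) (h.xbound_psi lv hR)
  -- Cutting off the difference of powers amounts to cutting off `d`, because the difference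
  -- vanishes where `d` does.
  have x3 : XBound t₁ t₂ (K'.indicator fun z => |g z + d z| ^ p - |g z| ^ p)
      (p * (2 * (δ' n * (A + δ' n) ^ (p - 1)))) := by
    have e : (K'.indicator fun z => |g z + d z| ^ p - |g z| ^ p) =
        fun z => |g z + K'.indicator d z| ^ p - |g z| ^ p := by
      funext z
      by_cases hz : z ∈ K'
      · rw [Set.indicator_of_mem hz, Set.indicator_of_mem hz]
      · rw [Set.indicator_of_notMem hz, Set.indicator_of_notMem hz, add_zero, sub_self]
    rw [e]
    exact h.xbound_rpow_sub lv hδn'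
  have b3 := hM R _ (fun z => psi p (g z + d z) * K.indicator w z) _ _ _
    (h.xbound_rpow_sub lv ldn) (h.xbound_psi lFn hc) (fun z hz => by
      rw [← hK] at hz
      rw [Set.indicator_of_notMem hz, mul_zero]) (by rw [← hK']; exact x3)
  have e4 : (fun z => (psi p (g z + d z) - psi p (g z)) * K.indicator w z) =
      fun z => (psi p (g z + K.indicator d z) - psi p (g z)) * K.indicator w z := by
    funext z
    by_cases hz : z ∈ K
    · rw [Set.indicator_of_mem hz, Set.indicator_of_mem hz]
    · rw [Set.indicator_of_notMem hz, mul_zero, mul_zero]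
  have b4 := hb _ _ _ _ (h.xbound_rpow lv) (h.xbound_psi_sub lv hδn hc)
  rw [← e4] at b4
  rw [← hX₁, ← hX₂] at b3
  refine (abs_add_le _ _).trans ((add_le_add (abs_sub _ _) (abs_add_le _ _)).trans ?_)
  calc _ ≤ C * (2 * A ^ p * (2 * (ε * A ^ (p - 1)))) + C * (2 * A ^ p * (2 * (ε * A ^ (p - 1)))) +
        ((ε * (X₁ * X₂) + ε) + ε) := by
        refine add_le_add (add_le_add b1 b2) (add_le_add (b3.trans ?_) (b4.trans h2))
        exact add_le_add_right h1 _
    _ = _ := by ring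

end

section

variable {μ p t₁ t₂ : ℝ} {E : Type*} [NormedAddCommGroup E] [InnerProductSpace ℝ E]

/-! ### Functions that are invariant under rotations -/

/-- The symmetry `(x, y) ↦ (A x, B y)`. -/
def Sym.rot (γ : ℝ≥0) (A : EuclideanSpace ℝ (Fin m) ≃ₗᵢ[ℝ] EuclideanSpace ℝ (Fin m))
    (B : EuclideanSpace ℝ (Fin ℓ) ≃ₗᵢ[ℝ] EuclideanSpace ℝ (Fin ℓ)) : Sym m ℓ γ :=
  ⟨A, B, 0, 0, fun x => by rw [add_zero, A.norm_map]⟩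

theorem Sym.rot_map (A : EuclideanSpace ℝ (Fin m) ≃ₗᵢ[ℝ] EuclideanSpace ℝ (Fin m))
    (B : EuclideanSpace ℝ (Fin ℓ) ≃ₗᵢ[ℝ] EuclideanSpace ℝ (Fin ℓ)) (z : Pt m ℓ) :
    (Sym.rot γ A B).map z = (A z.1, B z.2) := by
  simp [Sym.map, Sym.rot]

theorem Sym.ae_comp (S : Sym m ℓ γ) {f g : Pt m ℓ → ℝ} (h : f =ᵐ[volume] g) :
    (fun z => f (S.map z)) =ᵐ[volume] fun z => g (S.map z) :=
  S.measurePreserving.quasiMeasurePreserving.ae_eq h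

namespace Model

variable (X : Model m ℓ γ E)

/-- The action of a symmetry, as an isometry of `E`. -/
def pullL (S : Sym m ℓ γ) : E →ₗᵢ[ℝ] E where
  toFun := X.pull S
  map_add' u v := X.ext_fn (by
    filter_upwards [X.fn_pull S (u + v), S.ae_comp (X.fn_add u v), X.fn_add (X.pull S u) (X.pull S v),
      X.fn_pull S u, X.fn_pull S v] with z h1 h2 h3 h4 h5
    rw [h1, h2, h3, Pi.add_apply, Pi.add_apply, h4, h5])
  map_smul' c u := X.ext_fn (by
    filter_upwards [X.fn_pull S (c • u), S.ae_comp (X.fn_smul c u), X.fn_smul c (X.pull S u),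
      X.fn_pull S u] with z h1 h2 h3 h4
    rw [h1, h2, RingHom.id_apply, h3, Pi.smul_apply, Pi.smul_apply, h4])
  norm_map' := X.norm_pull S

theorem pull_add (S : Sym m ℓ γ) (u v : E) : X.pull S (u + v) = X.pull S u + X.pull S v :=
  map_add (X.pullL S) u v

theorem pull_sub (S : Sym m ℓ γ) (u v : E) : X.pull S (u - v) = X.pull S u - X.pull S v :=
  map_sub (X.pullL S) u v

theorem pull_smul (S : Sym m ℓ γ) (c : ℝ) (u : E) : X.pull S (c • u) = c • X.pull S u :=
  map_smul (X.pullL S) c u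

theorem pull_pull {S S' S'' : Sym m ℓ γ} (h : ∀ z, S''.map z = S'.map (S.map z)) (u : E) :
    X.pull S (X.pull S' u) = X.pull S'' u := by
  refine X.ext_fn ?_
  filter_upwards [X.fn_pull S (X.pull S' u), S.ae_comp (X.fn_pull S' u), X.fn_pull S'' u]
    with z h1 h2 h3
  rw [h1, h2, h3, h]

theorem pull_congr {S S' : Sym m ℓ γ} (h : ∀ z, S.map z = S'.map z) (u : E) :
    X.pull S u = X.pull S' u := by
  refine X.ext_fn ?_
  filter_upwards [X.fn_pull S u, X.fn_pull S' u] with z h1 h2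
  rw [h1, h2, h]

/-- The elements that are invariant under rotations of `x` and of `y`. -/
def rad : Submodule ℝ E where
  carrier := {u | ∀ A B, X.pull (Sym.rot γ A B) u = u}
  zero_mem' A B := map_zero (X.pullL (Sym.rot γ A B))
  add_mem' hu hv A B := by rw [X.pull_add, hu, hv]
  smul_mem' c u hu A B := by rw [X.pull_smul, hu]

theorem mem_rad_of_weakTo {u : ℕ → E} {v : E} (h : WeakTo u v) (hu : ∀ n, u n ∈ X.rad) :
    v ∈ X.rad := by
  intro A B
  refine ext_inner_right ℝ fun w => ?_
  have h1 := h.tendsto (X.pull (Sym.rot γ A B).inv w)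
  rw [← X.inner_pull_left] at h1
  refine tendsto_nhds_unique h1 ((h.tendsto w).congr fun n => ?_)
  rw [← X.inner_pull_left, hu n A B]

theorem ae_pos_of_ne_zero {u : E} (hu : u ≠ 0) : ¬ X.fn u =ᵐ[volume] 0 := by
  intro h
  refine hu (X.ext_fn (h.trans ?_))
  filter_upwards [X.fn_smul 0 u] with z hz
  rw [zero_smul] at hz
  rw [hz]
  simp

end Model

variable (X : Model m ℓ γ E)

/-- The kernel is positive off the diagonal: if the double integral vanishes, then $u(z)\ne0$ at one
generic point forces $u=0$ almost everywhere. -/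
theorem Exps.dfun_pos (h : Exps m ℓ γ μ p t₁ t₂) {u : E} (hu : u ≠ 0) : 0 < X.dfun μ p u := by
  refine lt_of_le_of_ne (X.dfun_nonneg u) fun h0 => X.ae_pos_of_ne_zero hu ?_
  obtain ⟨S, hS, hs⟩ := h.exists_lbound X
  have hint := h.integrable_ker2 (h.xbound_rpow (hs u)) (h.xbound_rpow (hs u))
  have hz := (integral_eq_zero_iff_of_nonneg (fun q => by
    have := gauge_nonneg (γ := γ) (q.1 - q.2)
    simp only [ker2, Pi.zero_apply]
    positivity) hint).1 h0.symm
  have hz' := Measure.ae_ae_of_ae_prod (μ := (volume : Measure (Pt m ℓ)))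
    (ν := (volume : Measure (Pt m ℓ))) hz
  by_contra hne
  obtain ⟨z, hz1, hz2⟩ : ∃ z, X.fn u z ≠ 0 ∧ ∀ᵐ w, ker2 γ μ (fun z => |X.fn u z| ^ p)
      (fun z => |X.fn u z| ^ p) (z, w) = 0 := by
    have hf : ∃ᶠ z in ae volume, X.fn u z ≠ 0 := by
      rw [Filter.frequently_iff]
      intro U hU
      by_contra hc
      push Not at hc
      exact hne (Filter.mem_of_superset hU fun z hz => hc z hz)
    exact (hf.and_eventually hz').exists
  have : Nontrivial (EuclideanSpace ℝ (Fin m)) := by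
    have : Nonempty (Fin m) := ⟨⟨0, h.hm⟩⟩
    infer_instance
  have : NullSingletonClass (volume : Measure (Pt m ℓ)) :=
    inferInstanceAs (NullSingletonClass ((volume : Measure (EuclideanSpace ℝ (Fin m))).prod
      (volume : Measure (EuclideanSpace ℝ (Fin ℓ)))))
  refine hne ?_
  filter_upwards [hz2, Measure.ae_ne volume z] with w h1 h2
  have hp := h.p_pos
  have g0 : 0 < gauge γ (z - w) := gauge_pos (sub_ne_zero.2 (Ne.symm h2))
  simp only [ker2, mul_eq_zero] at h1
  rcases h1 with (h1 | h1) | h1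
  · exact absurd h1 (Real.rpow_pos_of_pos g0 _).ne'
  · rw [Real.rpow_eq_zero (abs_nonneg _) hp.ne', abs_eq_zero] at h1
    exact h1
  · rw [Real.rpow_eq_zero (abs_nonneg _) hp.ne', abs_eq_zero] at h1
    exact absurd h1 hz1

/-! ### Minimising sequences -/

/-- With $\kappa=1-1/p$, Bernoulli gives $(1-e)^\kappa\le1-\kappa e$, and
$(1-e)^{1/p}=(1-e)/(1-e)^\kappa$. -/
theorem sub_sq_le_rpow {p e : ℝ} (hp : 1 < p) (he : |e| ≤ 1 / 2) :
    1 - e / p - e ^ 2 ≤ (1 - e) ^ (1 / p) := by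
  have h1 := (abs_le.1 he).1
  have h2 := (abs_le.1 he).2
  have hp0 : 0 < p := by linarith
  set κ := 1 - 1 / p with hκ
  have hκ0 : 0 < κ := by
    rw [hκ, sub_pos, div_lt_one hp0]; exact hp
  have hκ1 : κ < 1 := by
    have : 0 < 1 / p := by positivity
    linarith
  have hpos : 0 < 1 - e := by linarith
  have b := rpow_one_add_le_one_add_mul_self (s := -e) (by linarith) hκ0.le hκ1.le
  rw [← sub_eq_add_neg] at b
  have hm : (1 - e) ^ (1 / p) * (1 - e) ^ κ = 1 - e := by
    rw [← Real.rpow_add hpos, hκ, add_sub_cancel, Real.rpow_one]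
  have hx : 0 < (1 - e) ^ (1 / p) := by positivity
  have hden : 0 < 1 + κ * -e := by nlinarith
  have key : 1 - e ≤ (1 - e) ^ (1 / p) * (1 + κ * -e) := by
    calc 1 - e = (1 - e) ^ (1 / p) * (1 - e) ^ κ := hm.symm
      _ ≤ _ := by gcongr
  have e1 : e / p = (1 - κ) * e := by rw [hκ]; field_simp; ring
  rw [e1]
  have : (1 - (1 - κ) * e - e ^ 2) * (1 + κ * -e) ≤ 1 - e := by
    have : 0 ≤ e ^ 2 * (1 - κ * e - κ * (1 - κ)) := by
      refine mul_nonneg (sq_nonneg e) ?_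
      nlinarith [sq_nonneg (κ - 3 / 4)]
    nlinarith
  exact le_of_mul_le_mul_right (this.trans key) hden

theorem Exps.nonlin_mem_rad [CompleteSpace E] (h : Exps m ℓ γ μ p t₁ t₂) {u : E} (hu : u ∈ X.rad) :
    h.nonlin X u ∈ X.rad := by
  intro A B
  rw [← h.nonlin_pull, hu A B]

/-- `u` is a minimising sequence for `‖u‖²` among the invariant elements with `D(u) = 1`, and
`I > 0` is the infimum. -/
structure Model.Minimizing (μ p I : ℝ) (u : ℕ → E) : Prop where
  pos : 0 < I
  le : ∀ w ∈ X.rad, I * X.dfun μ p w ^ (1 / p) ≤ ‖w‖ ^ 2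
  mem : ∀ n, u n ∈ X.rad
  dfun_eq : ∀ n, X.dfun μ p (u n) = 1
  tendsto : Tendsto (fun n => ‖u n‖ ^ 2) atTop (𝓝 I)

theorem Exps.exists_smul_dfun_eq_one (h : Exps m ℓ γ μ p t₁ t₂) {u : E} (hu : 0 < X.dfun μ p u) :
    ∃ c : ℝ, 0 < c ∧ c ^ 2 = (X.dfun μ p u ^ (1 / p))⁻¹ ∧ X.dfun μ p (c • u) = 1 := by
  have hp := h.p_pos
  refine ⟨(X.dfun μ p u ^ (1 / (2 * p)))⁻¹, by positivity, ?_, ?_⟩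
  · rw [inv_pow, ← Real.rpow_natCast, ← Real.rpow_mul hu.le]
    congr 2
    push_cast
    field_simp
  · rw [X.dfun_smul, abs_of_pos (by positivity), ← Real.inv_rpow hu.le, ← Real.rpow_natCast,
      ← Real.rpow_mul (by positivity), ← Real.rpow_mul (by positivity)]
    rw [show 1 / (2 * p) * (p * ((2 : ℕ) : ℝ)) = 1 by push_cast; field_simp, Real.rpow_one,
      inv_mul_cancel₀ hu.ne']

/-- The bound $D(u)\le C\|u\|^{2p}$ keeps the infimum positive, and homogeneity of degree $2p$
extends the inequality from $D=1$ to all invariant elements. -/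
theorem Exps.exists_minimizing (h : Exps m ℓ γ μ p t₁ t₂) {u₀ : E} (hu₀ : u₀ ∈ X.rad)
    (hne : u₀ ≠ 0) : ∃ (I : ℝ) (u : ℕ → E), X.Minimizing μ p I u := by
  have hp := h.p_pos
  set S : Set ℝ := {s | ∃ u ∈ X.rad, X.dfun μ p u = 1 ∧ ‖u‖ ^ 2 = s} with hS
  have hS0 : BddBelow S := ⟨0, by rintro s ⟨u, -, -, rfl⟩; positivity⟩
  have hSne : S.Nonempty := by
    obtain ⟨c, -, -, hc⟩ := h.exists_smul_dfun_eq_one X (h.dfun_pos X hne)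
    exact ⟨_, c • u₀, X.rad.smul_mem c hu₀, hc, rfl⟩
  obtain ⟨C, hC, hD⟩ := h.exists_dfun_le X
  have hlow : ∀ s ∈ S, C⁻¹ ^ (1 / p) ≤ s := by
    rintro s ⟨u, -, hu, rfl⟩
    have h1 := hD u
    rw [hu] at h1
    have h2 : C⁻¹ ≤ (‖u‖ ^ 2) ^ p := by
      rw [inv_le_iff_one_le_mul₀ hC, ← Real.rpow_natCast, ← Real.rpow_mul (norm_nonneg _),
        mul_comm ((2 : ℕ) : ℝ) p, Real.rpow_mul (norm_nonneg _), Real.rpow_natCast, mul_comm]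
      exact h1
    calc C⁻¹ ^ (1 / p) ≤ ((‖u‖ ^ 2) ^ p) ^ (1 / p) := by gcongr
      _ = ‖u‖ ^ 2 := by
        rw [← Real.rpow_mul (by positivity), mul_one_div_cancel hp.ne', Real.rpow_one]
  have hI : 0 < sInf S := lt_of_lt_of_le (by positivity) (le_csInf hSne hlow)
  have hseq : ∀ n : ℕ, ∃ u : E, u ∈ X.rad ∧ X.dfun μ p u = 1 ∧ ‖u‖ ^ 2 < sInf S + 1 / (n + 1) := by
    intro n
    obtain ⟨s, ⟨u, h1, h2, rfl⟩, h3⟩ := exists_lt_of_csInf_lt hSne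
      (show sInf S < sInf S + 1 / ((n : ℝ) + 1) by
        have : 0 < 1 / ((n : ℝ) + 1) := by positivity
        linarith)
    exact ⟨u, h1, h2, h3⟩
  choose u h1 h2 h3 using hseq
  refine ⟨sInf S, u, hI, fun w hw => ?_, h1, h2, ?_⟩
  · by_cases hw0 : X.dfun μ p w = 0
    · rw [hw0, Real.zero_rpow (by positivity), mul_zero]
      positivity
    · have hw1 : 0 < X.dfun μ p w := lt_of_le_of_ne (X.dfun_nonneg w) (Ne.symm hw0)
      obtain ⟨c, hc, hc2, hc1⟩ := h.exists_smul_dfun_eq_one X hw1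
      have := csInf_le hS0 ⟨c • w, X.rad.smul_mem c hw, hc1, rfl⟩
      rw [norm_smul, mul_pow, Real.norm_of_nonneg hc.le, hc2] at this
      have hx : 0 < X.dfun μ p w ^ (1 / p) := by positivity
      calc sInf S * X.dfun μ p w ^ (1 / p)
          ≤ (X.dfun μ p w ^ (1 / p))⁻¹ * ‖w‖ ^ 2 * X.dfun μ p w ^ (1 / p) := by gcongr
        _ = ‖w‖ ^ 2 := by field_simp
  · refine tendsto_of_tendsto_of_tendsto_of_le_of_le tendsto_const_nhds (h := fun n : ℕ =>
      sInf S + 1 / ((n : ℝ) + 1)) ?_ (fun n => csInf_le hS0 ⟨u n, h1 n, h2 n, rfl⟩)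
      fun n => (h3 n).le
    simpa using tendsto_one_div_add_atTop_nhds_zero_nat.const_add (sInf S)

/-- The scalar part of the variation $u-tr$: `s` and `s'` stand for $\|r\|^2$ and $\|u\|^2$, `a` for
$\langle N(u),r\rangle$, `b` for $\langle u,r\rangle$, `d` for $D(u-tr)$. In the variational
inequality the linear terms combine to $-2t(b-Ia)=-2ts$. -/
theorem residual_bound {p q I a b s s' d t C₁ C₂ L A M : ℝ} (hp1 : 1 < p) (hI : 0 < I)
    (ht : 0 < t) (hC₁0 : 0 ≤ C₁) (htq : t ^ q ≤ t) (ht2 : t ^ 2 ≤ t ^ q)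
    (hC₂ : C₂ = C₁ + 2 * p * A) (htC : C₂ * t ≤ 1 / 2)
    (hM : M = I * C₁ / p + I * C₂ ^ 2 + L ^ 2)
    (e8 : |d - 1 - 2 * p * -(t * a)| ≤ C₁ * t ^ q) (e5 : |a| ≤ A) (e7 : s ≤ L ^ 2)
    (e4 : s = b - I * a) (e2 : I * d ^ (1 / p) ≤ s' - 2 * t * b + t ^ 2 * s) :
    2 * t * s ≤ s' - I + M * t ^ q := by
  have hp : 0 < p := by linarith
  set e := 1 - d with he
  have f1 : |e - 2 * p * (t * a)| ≤ C₁ * t ^ q := by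
    rw [← abs_neg, show -(e - 2 * p * (t * a)) = d - 1 - 2 * p * -(t * a) by rw [he]; ring]
    exact e8
  have f2 : |e| ≤ C₂ * t := by
    have h1 : |2 * p * (t * a)| ≤ 2 * p * A * t := by
      rw [abs_mul, abs_of_pos (show 0 < 2 * p by positivity), abs_mul, abs_of_pos ht]
      calc 2 * p * (t * |a|) ≤ 2 * p * (t * A) := by gcongr
        _ = _ := by ring
    have h2 : C₁ * t ^ q ≤ C₁ * t := by gcongr
    have h3 := abs_add_le (e - 2 * p * (t * a)) (2 * p * (t * a))
    rw [sub_add_cancel] at h3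
    rw [hC₂, add_mul]
    linarith
  have f3 : e ^ 2 ≤ C₂ ^ 2 * t ^ q := by
    rw [← sq_abs]
    calc |e| ^ 2 ≤ (C₂ * t) ^ 2 := by gcongr
      _ = C₂ ^ 2 * t ^ 2 := by ring
      _ ≤ _ := by gcongr
  have f4 := sub_sq_le_rpow hp1 (f2.trans htC)
  rw [show 1 - e = d by rw [he]; ring] at f4
  have f5 : e / p ≤ 2 * (t * a) + C₁ * t ^ q / p := by
    rw [div_le_iff₀ hp, add_mul, div_mul_cancel₀ _ hp.ne']
    have := (abs_le.1 f1).2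
    linarith
  have f6 : I * (1 - (2 * (t * a) + C₁ * t ^ q / p) - C₂ ^ 2 * t ^ q) ≤ I * d ^ (1 / p) :=
    mul_le_mul_of_nonneg_left (by linarith) hI.le
  have f7 : t ^ 2 * s ≤ t ^ q * L ^ 2 := by
    calc t ^ 2 * s ≤ t ^ 2 * L ^ 2 := by gcongr
      _ ≤ _ := by gcongr
  have f8 := f6.trans e2
  have e9 : I * (1 - (2 * (t * a) + C₁ * t ^ q / p) - C₂ ^ 2 * t ^ q) =
    I - 2 * t * (I * a) - (I * C₁ / p + I * C₂ ^ 2) * t ^ q := by ring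
  have e10 : 2 * t * s = 2 * t * b - 2 * t * (I * a) := by rw [e4]; ring
  have e11 : M * t ^ q = (I * C₁ / p + I * C₂ ^ 2) * t ^ q + t ^ q * L ^ 2 := by rw [hM]; ring
  rw [e9] at f8
  rw [e10, e11]
  linarith

/-- Along a minimising sequence the Euler-Lagrange equation holds in the limit. -/
theorem Model.Minimizing.tendsto_residual [CompleteSpace E] {X : Model m ℓ γ E} {I : ℝ} {u : ℕ → E}
    (hu : X.Minimizing μ p I u) (h : Exps m ℓ γ μ p t₁ t₂) :
    Tendsto (fun n => ‖u n - I • h.nonlin X (u n)‖) atTop (𝓝 0) := by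
  have hp := h.p_pos
  obtain ⟨L₀, hL₀⟩ : ∃ L, ∀ n, ‖u n‖ ≤ L := by
    obtain ⟨B, hB⟩ := hu.tendsto.bddAbove_range
    exact ⟨√B, fun n => Real.le_sqrt_of_sq_le (hB ⟨n, rfl⟩)⟩
  have hL₀0 : 0 ≤ L₀ := (norm_nonneg _).trans (hL₀ 0)
  obtain ⟨C₀, hC₀, hN⟩ := h.exists_norm_nonlin_le X
  set K := C₀ * (L₀ ^ p * L₀ ^ (p - 1)) with hK
  have hN' : ∀ n, ‖h.nonlin X (u n)‖ ≤ K := by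
    intro n
    refine (hN _).trans ?_
    have := h.p_gt
    have h1 := Real.rpow_le_rpow (norm_nonneg _) (hL₀ n) hp.le
    have h2 := Real.rpow_le_rpow (norm_nonneg _) (hL₀ n) (sub_nonneg.2 this.le)
    exact mul_le_mul_of_nonneg_left (mul_le_mul h1 h2 (by positivity) (by positivity)) hC₀.le
  have hK0 : 0 ≤ K := (norm_nonneg _).trans (hN' 0)
  have hI := hu.pos
  set L := L₀ + I * K + 1 with hL
  have hIK : 0 ≤ I * K := by positivity
  have hL0 : 0 < L := by linarith
  set r : ℕ → E := fun n => u n - I • h.nonlin X (u n) with hr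
  have hrL : ∀ n, ‖r n‖ ≤ L := by
    intro n
    refine (norm_sub_le _ _).trans ?_
    rw [norm_smul, Real.norm_of_nonneg hI.le]
    have := hL₀ n
    have := mul_le_mul_of_nonneg_left (hN' n) hI.le
    linarith
  obtain ⟨C, hC, hexp⟩ := h.exists_dfun_expansion X hL0
  set q := min p 2 with hq
  have hq1 : 1 < q := lt_min h.p_gt (by norm_num)
  have hq2 : q ≤ 2 := min_le_right _ _
  set C₁ := C * L ^ q with hC₁
  set C₂ := C₁ + 2 * p * (K * L) with hC₂
  have hKL : 0 ≤ 2 * p * (K * L) := by positivity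
  have hC₁0 : 0 < C₁ := by positivity
  have hC₂0 : 0 < C₂ := by linarith
  set M := I * C₁ / p + I * C₂ ^ 2 + L ^ 2 with hM
  have key : ∀ n (t : ℝ), 0 < t → t ≤ 1 → C₂ * t ≤ 1 / 2 →
      2 * t * ‖r n‖ ^ 2 ≤ (‖u n‖ ^ 2 - I) + M * t ^ q := by
    intro n t ht ht1 htC
    have htq : t ^ q ≤ t := by
      calc t ^ q ≤ t ^ (1 : ℝ) := Real.rpow_le_rpow_of_exponent_ge ht ht1 hq1.le
        _ = t := Real.rpow_one t
    have ht2 : t ^ 2 ≤ t ^ q := by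
      rw [← Real.rpow_natCast]
      exact Real.rpow_le_rpow_of_exponent_ge ht ht1 (by exact_mod_cast hq2)
    -- The variation stays in the invariant class because $N$ preserves it, so minimality may be
    -- used although it is known only there.
    have hmem : r n ∈ X.rad :=
      X.rad.sub_mem (hu.mem n) (X.rad.smul_mem I (h.nonlin_mem_rad X (hu.mem n)))
    have e1 := hexp (u n) (-(t • r n)) ((hL₀ n).trans (by linarith)) (by
      rw [norm_neg, norm_smul, Real.norm_of_nonneg ht.le]
      calc t * ‖r n‖ ≤ 1 * L := by gcongr; exact hrL n
        _ = L := one_mul L)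
    have e2 := hu.le (u n + -(t • r n))
      (X.rad.add_mem (hu.mem n) (X.rad.neg_mem (X.rad.smul_mem t hmem)))
    have e3 : ‖u n + -(t • r n)‖ ^ 2 =
        ‖u n‖ ^ 2 - 2 * t * inner ℝ (u n) (r n) + t ^ 2 * ‖r n‖ ^ 2 := by
      rw [← sub_eq_add_neg, norm_sub_sq_real, inner_smul_right, norm_smul,
        Real.norm_of_nonneg ht.le]
      ring
    have e4 : ‖r n‖ ^ 2 = inner ℝ (u n) (r n) - I * inner ℝ (h.nonlin X (u n)) (r n) := by
      rw [← real_inner_self_eq_norm_sq]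
      nth_rewrite 1 [hr]
      rw [inner_sub_left, inner_smul_left]
      rfl
    have e5 : |inner ℝ (h.nonlin X (u n)) (r n)| ≤ K * L :=
      (abs_real_inner_le_norm _ _).trans (mul_le_mul (hN' n) (hrL n) (norm_nonneg _) hK0)
    have e6 : C * ‖-(t • r n)‖ ^ q ≤ C₁ * t ^ q := by
      rw [norm_neg, norm_smul, Real.norm_of_nonneg ht.le, Real.mul_rpow ht.le (norm_nonneg _), hC₁,
        mul_assoc, mul_comm (L ^ q)]
      gcongr
      exact hrL n
    have e7 : ‖r n‖ ^ 2 ≤ L ^ 2 := by gcongr; exact hrL n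
    rw [hu.dfun_eq n, inner_neg_right, inner_smul_right] at e1
    have e8 := e1.trans e6
    rw [e3] at e2
    generalize inner ℝ (h.nonlin X (u n)) (r n) = a at *
    generalize inner ℝ (u n) (r n) = b at *
    generalize X.dfun μ p (u n + -(t • r n)) = d at *
    generalize ‖r n‖ ^ 2 = s at *
    generalize ‖u n‖ ^ 2 = s' at *
    exact residual_bound h.p_gt hI ht hC₁0.le htq ht2 hC₂ htC hM e8 e5 e7 e4 e2
  have hM0 : 0 < M := by positivity
  have hsq : Tendsto (fun n => ‖r n‖ ^ 2) atTop (𝓝 0) := by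
    -- Divide `key` by $t$. First fix $t$ with $Mt^{q-1}\le\varepsilon$, possible as $q>1$; then let
    -- $n$ be so large that $\|u_n\|^2-I\le\varepsilon t$.
    refine tendsto_of_forall_eventually_le zero_le_one fun ε hε => ?_
    have t1 : Tendsto (fun t : ℝ => M * t ^ (q - 1)) (𝓝[>] 0) (𝓝 0) := by
      have := ((Real.continuous_rpow_const (q := q - 1) (by linarith)).tendsto 0).const_mul M
      rw [Real.zero_rpow (by linarith), mul_zero] at this
      exact this.mono_left nhdsWithin_le_nhds
    have t2 : Tendsto (fun t : ℝ => C₂ * t) (𝓝[>] 0) (𝓝 0) := by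
      have := (tendsto_id (α := ℝ) (x := 𝓝 0)).const_mul C₂
      rw [mul_zero] at this
      exact this.mono_left nhdsWithin_le_nhds
    have t3 : ∀ᶠ t : ℝ in 𝓝[>] 0, t < 1 := nhdsWithin_le_nhds (Iio_mem_nhds one_pos)
    obtain ⟨t, ⟨⟨h1, h2⟩, h3⟩, h4⟩ := (((t1.eventually_le_const hε).and
      (t2.eventually_le_const (by norm_num : (0 : ℝ) < 1 / 2))).and t3 |>.and
        self_mem_nhdsWithin).exists
    have h4 : 0 < t := h4
    have hδ := hu.tendsto.eventually_le_const (show I < I + ε * t by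
      have : 0 < ε * t := by positivity
      linarith)
    filter_upwards [hδ] with n hn
    have hk := key n t h4 h3.le h2
    have hs : t ^ q = t ^ (q - 1) * t := by
      rw [← Real.rpow_add_one h4.ne', sub_add_cancel]
    rw [hs, ← mul_assoc] at hk
    have h5 : M * t ^ (q - 1) * t ≤ ε * t := by gcongr
    rw [sub_zero, abs_of_nonneg (by positivity), one_mul]
    have : t * ‖r n‖ ^ 2 ≤ t * ε := by linarith
    exact le_of_mul_le_mul_left this h4
  have := hsq.sqrt
  simpa using this

end

section

variable {μ p t₁ t₂ : ℝ} {E : Type*} [NormedAddCommGroup E] [InnerProductSpace ℝ E]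
  (X : Model m ℓ γ E)

/-! ### Concentration of mass in a ball -/

theorem avg_indicator_closedBall {τ ρ : ℝ} (h1 : τ ≤ ρ) (h2 : τ ^ (1 + (γ : ℝ)) ≤ ρ)
    (f : Pt m ℓ → ℝ) (z : Pt m ℓ) :
    avg γ τ ((Metric.closedBall z ρ).indicator f) z = avg γ τ f z := by
  refine integral_congr_ae ?_
  filter_upwards [ae_unif (γ := γ) (τ := τ)] with w hw
  rw [Set.indicator_of_mem]
  rw [Metric.mem_closedBall, dist_self_add_left]
  obtain ⟨hw1, hw2⟩ := hw
  rw [mem_ball_zero_iff] at hw1 hw2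
  exact max_le (hw1.le.trans h1) (hw2.le.trans h2)

/-- The average at `z` sees only the ball around `z`, and it is bounded by a multiple of the $L^2$
norm there. -/
theorem exists_le_eLpNorm_closedBall {τ η ρ : ℝ} (hτ : 0 < τ) (hη : 0 < η) (h1 : τ ≤ ρ)
    (h2 : τ ^ (1 + (γ : ℝ)) ≤ ρ) : ∃ η' : ℝ, 0 < η' ∧ ∀ (f : Pt m ℓ → ℝ) (z : Pt m ℓ),
      MemLp f 2 volume → η < |avg γ τ f z| →
      ENNReal.ofReal η' ≤ eLpNorm ((Metric.closedBall z ρ).indicator f) 2 volume := by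
  obtain ⟨C, hC, hle⟩ := exists_abs_avg_le m ℓ γ
  set c := C * τ ^ (-(homDim m ℓ γ / 2)) with hc
  have hc0 : 0 < c := by positivity
  refine ⟨η / c, by positivity, fun f z hf hz => ?_⟩
  by_contra hlt
  have := hle τ hτ _ (η / c) (by positivity) (hf.indicator Metric.isClosed_closedBall.measurableSet)
    (not_le.1 hlt).le z
  rw [avg_indicator_closedBall h1 h2, ← hc, mul_div_cancel₀ _ hc0.ne'] at this
  exact absurd this (not_le.2 hz)

/-- If no ball carried mass, the averages at two fixed scales would be uniformly small, hence so
would both $L^{pt_i}$ norms, and $D(u)$ could not be $1$. -/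
theorem Exps.exists_concentration (h : Exps m ℓ γ μ p t₁ t₂) {L : ℝ} (hL : 0 < L) :
    ∃ ρ η : ℝ, 0 < ρ ∧ 0 < η ∧ ∀ u : E, ‖u‖ ≤ L → X.dfun μ p u = 1 → ∃ z,
      ENNReal.ofReal η ≤ eLpNorm ((Metric.closedBall z ρ).indicator (X.fn u)) 2 volume := by
  have hp := h.p_pos
  obtain ⟨C, hC, hD⟩ := h.exists_dfun_le_of_lbound X
  -- Chosen so that $C\varepsilon^{2p}=1/2$.
  set ε : ℝ := (1 / (2 * C)) ^ (1 / (2 * p)) with hε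
  have hε0 : 0 < ε := by positivity
  have hCε : C * (ε ^ p) ^ 2 < 1 := by
    rw [hε, ← Real.rpow_natCast, ← Real.rpow_mul (by positivity), ← Real.rpow_mul (by positivity),
      show 1 / (2 * p) * (p * ((2 : ℕ) : ℝ)) = 1 by push_cast; field_simp, Real.rpow_one]
    field_simp
    norm_num
  obtain ⟨τ₁, η₁, hτ₁, hη₁, h1⟩ := X.exists_eLpNorm_le_of_avg h.dim h.lo₁ h.hi₁ hL hε0
  obtain ⟨τ₂, η₂, hτ₂, hη₂, h2⟩ := X.exists_eLpNorm_le_of_avg h.dim h.lo₂ h.hi₂ hL hε0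
  set ρ := max (max τ₁ (τ₁ ^ (1 + (γ : ℝ)))) (max τ₂ (τ₂ ^ (1 + (γ : ℝ)))) with hρ
  obtain ⟨δ₁, hδ₁, k1⟩ := exists_le_eLpNorm_closedBall (m := m) (ℓ := ℓ) (γ := γ) (ρ := ρ) hτ₁ hη₁
    ((le_max_left _ _).trans (le_max_left _ _)) ((le_max_right _ _).trans (le_max_left _ _))
  obtain ⟨δ₂, hδ₂, k2⟩ := exists_le_eLpNorm_closedBall (m := m) (ℓ := ℓ) (γ := γ) (ρ := ρ) hτ₂ hη₂
    ((le_max_left _ _).trans (le_max_right _ _)) ((le_max_right _ _).trans (le_max_right _ _))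
  refine ⟨ρ, min δ₁ δ₂, lt_of_lt_of_le hτ₁ ((le_max_left _ _).trans (le_max_left _ _)),
    lt_min hδ₁ hδ₂, fun u hu hu1 => ?_⟩
  by_contra! hcon
  have c1 : ∀ z, |avg γ τ₁ (X.fn u) z| ≤ η₁ := fun z => not_lt.1 fun hz =>
    absurd ((ENNReal.ofReal_le_ofReal (min_le_left _ _)).trans (k1 _ z (X.memLp_fn u) hz))
      (not_le.2 (hcon z))
  have c2 : ∀ z, |avg γ τ₂ (X.fn u) z| ≤ η₂ := fun z => not_lt.1 fun hz =>
    absurd ((ENNReal.ofReal_le_ofReal (min_le_right _ _)).trans (k2 _ z (X.memLp_fn u) hz))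
      (not_le.2 (hcon z))
  have := hD u ε ⟨hε0.le, (X.measurable_fn u).aestronglyMeasurable, h1 u hu c1, h2 u hu c2⟩
  rw [hu1] at this
  linarith

theorem Exps.tendsto_eLpNorm_two_indicator [CompleteSpace E] (h : Exps m ℓ γ μ p t₁ t₂)
    {u : ℕ → E} (hu : WeakTo u 0) {K : Set (Pt m ℓ)} (hK : MeasurableSet K) (hK' : volume K ≠ ⊤) :
    Tendsto (fun n => eLpNorm (K.indicator (X.fn (u n))) 2 volume) atTop (𝓝 0) := by
  have hq := h.lo₁
  have h1 := X.tendsto_eLpNorm_indicator h.dim h.lo₁ h.hi₁ hu hK hK'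
  have hc : volume K ^ (1 / (2 : ℝ≥0∞).toReal - 1 / (ENNReal.ofReal (p * t₁)).toReal) ≠ ⊤ := by
    refine ENNReal.rpow_ne_top_of_nonneg ?_ hK'
    rw [ENNReal.toReal_ofReal (by linarith), sub_nonneg]
    exact one_div_le_one_div_of_le (by norm_num) (by simpa using hq.le)
  have h2 := ENNReal.Tendsto.mul_const h1 (Or.inr hc)
  rw [zero_mul] at h2
  refine tendsto_of_tendsto_of_tendsto_of_le_of_le tendsto_const_nhds h2 (fun _ => zero_le) fun n => ?_
  have h3 := eLpNorm_le_eLpNorm_mul_rpow_measure_univ (μ := volume.restrict K)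
    (p := 2) (q := ENNReal.ofReal (p * t₁)) (by
      rw [show (2 : ℝ≥0∞) = ENNReal.ofReal 2 by simp]
      exact ENNReal.ofReal_le_ofReal hq.le) (X.measurable_fn (u n)).aestronglyMeasurable
  simp only [eLpNorm_indicator_eq_eLpNorm_restrict hK]
  rwa [Measure.restrict_apply_univ] at h3

/-! ### Where the mass of an invariant function can be -/

/-- The measure with density `f²`. -/
def sqMass (f : Pt m ℓ → ℝ) : Measure (Pt m ℓ) := volume.withDensity fun z => ‖f z‖ₑ ^ 2

theorem sqMass_apply (f : Pt m ℓ → ℝ) {K : Set (Pt m ℓ)} (hK : MeasurableSet K) :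
    sqMass f K = eLpNorm (K.indicator f) 2 volume ^ 2 := by
  have h := eLpNorm_ofReal_eq (f := f) (ν := volume.restrict K) (t := 2) (by norm_num)
  rw [ENNReal.ofReal_ofNat] at h
  rw [sqMass, withDensity_apply _ hK, eLpNorm_indicator_eq_eLpNorm_restrict hK, h,
    ← ENNReal.rpow_natCast, ← ENNReal.rpow_mul]
  norm_num

theorem sqMass_univ_le {f : Pt m ℓ → ℝ} {L : ℝ} (h : Averaging γ f L) :
    sqMass f Set.univ ≤ ENNReal.ofReal L ^ 2 := by
  rw [sqMass_apply f MeasurableSet.univ, Set.indicator_univ]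
  gcongr
  exact h.le

theorem card_mul_le_of_separated {α : Type*} [PseudoMetricSpace α] [MeasurableSpace α]
    [OpensMeasurableSpace α] (ν : Measure α) {k : ℕ} {z : Fin k → α} {ρ : ℝ} {η : ℝ≥0∞}
    (hz : ∀ i j, i ≠ j → 2 * ρ < dist (z i) (z j))
    (h : ∀ i, η ≤ ν (Metric.closedBall (z i) ρ)) : k * η ≤ ν Set.univ := by
  have h1 : ∑ i, ν (Metric.closedBall (z i) ρ) ≤ ν Set.univ := by
    rw [← tsum_fintype (L := .unconditional _)]
    refine tsum_measure_le_measure_univ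
      (fun i => Metric.isClosed_closedBall.measurableSet.nullMeasurableSet) fun i j hij => ?_
    refine (Metric.closedBall_disjoint_closedBall ?_).aedisjoint
    rw [← two_mul]
    exact hz i j hij
  calc (k : ℝ≥0∞) * η = ∑ _i : Fin k, η := by simp
    _ ≤ _ := (Finset.sum_le_sum fun i _ => h i).trans h1

/-- In dimension at least two the unit sphere is connected and nontrivial, hence infinite. Fix `k`
points on it; a reflection carries `x` to the multiple by $\|x\|$ of each of them, and their
distances grow with $\|x\|$. -/
theorem exists_separating_isometries {n : ℕ} (hn : 2 ≤ n) (k : ℕ) (ρ : ℝ) :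
    ∃ B : ℝ, ∀ x : EuclideanSpace ℝ (Fin n), B < ‖x‖ →
      ∃ A : Fin k → (EuclideanSpace ℝ (Fin n) ≃ₗᵢ[ℝ] EuclideanSpace ℝ (Fin n)),
        ∀ i j, i ≠ j → 2 * ρ < dist (A i x) (A j x) := by
  have hfr : Module.finrank ℝ (EuclideanSpace ℝ (Fin n)) = n := by simp
  have hrank : 1 < Module.rank ℝ (EuclideanSpace ℝ (Fin n)) := by
    rw [← Module.finrank_eq_rank, hfr]
    exact_mod_cast hn
  have hnt : (Metric.sphere (0 : EuclideanSpace ℝ (Fin n)) 1).Nontrivial := by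
    refine ⟨EuclideanSpace.single ⟨0, by omega⟩ 1, by simp,
      EuclideanSpace.single ⟨1, by omega⟩ 1, by simp, fun he => ?_⟩
    have := congrArg (fun v : EuclideanSpace ℝ (Fin n) => v ⟨0, by omega⟩) he
    simp at this
  have hinf := (isPreconnected_sphere hrank 0 1).infinite_of_nontrivial hnt
  have := hinf.to_subtype
  obtain ⟨e⟩ : Nonempty (Fin k ↪ Metric.sphere (0 : EuclideanSpace ℝ (Fin n)) 1) :=
    ⟨(Fin.valEmbedding).trans (Infinite.natEmbedding _)⟩
  obtain ⟨δ, hδ, hsep⟩ : ∃ δ : ℝ, 0 < δ ∧ ∀ i j, i ≠ j → δ ≤ dist (e i) (e j) := by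
    by_cases hne : (Finset.univ.offDiag : Finset (Fin k × Fin k)).Nonempty
    · obtain ⟨q, hq, hmin⟩ := Finset.exists_min_image _ (fun q : Fin k × Fin k => dist (e q.1) (e q.2)) hne
      refine ⟨dist (e q.1) (e q.2), dist_pos.2 fun h => ?_, fun i j hij => hmin (i, j) (by simpa using hij)⟩
      exact (Finset.mem_offDiag.1 hq).2.2 (e.injective h)
    · exact ⟨1, one_pos, fun i j hij => absurd ⟨(i, j), by simpa using hij⟩ hne⟩
  refine ⟨max 0 (2 * ρ / δ), fun x hx => ?_⟩
  have hx0 : 0 < ‖x‖ := (le_max_left _ _).trans_lt hx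
  have hx1 : 2 * ρ < ‖x‖ * δ := (div_lt_iff₀ hδ).1 ((le_max_right _ _).trans_lt hx)
  have hA : ∀ i, ∃ A : EuclideanSpace ℝ (Fin n) ≃ₗᵢ[ℝ] EuclideanSpace ℝ (Fin n),
      A x = ‖x‖ • (e i : EuclideanSpace ℝ (Fin n)) := fun i =>
    ⟨_, Submodule.reflection_sub (by
      rw [norm_smul, norm_norm, mem_sphere_zero_iff_norm.1 (e i).2, mul_one])⟩
  choose A hA using hA
  refine ⟨A, fun i j hij => hx1.trans_le ?_⟩
  rw [hA, hA, dist_smul₀, norm_norm]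
  exact mul_le_mul_of_nonneg_left (hsep i j hij) hx0.le

theorem Sym.dist_rot (A : EuclideanSpace ℝ (Fin m) ≃ₗᵢ[ℝ] EuclideanSpace ℝ (Fin m))
    (B : EuclideanSpace ℝ (Fin ℓ) ≃ₗᵢ[ℝ] EuclideanSpace ℝ (Fin ℓ)) (z w : Pt m ℓ) :
    dist ((Sym.rot γ A B).map z) ((Sym.rot γ A B).map w) = dist z w := by
  rw [Sym.rot_map, Sym.rot_map, Prod.dist_eq, Prod.dist_eq, A.dist_map, B.dist_map]

theorem eLpNorm_indicator_preimage (S : Sym m ℓ γ) {f : Pt m ℓ → ℝ} (hf : AEStronglyMeasurable f)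
    {K : Set (Pt m ℓ)} (hK : MeasurableSet K) :
    eLpNorm ((S.map ⁻¹' K).indicator fun z => f (S.map z)) 2 volume =
      eLpNorm (K.indicator f) 2 volume := by
  rw [← eLpNorm_comp_measurePreserving (p := 2) (hf.indicator hK) S.measurePreserving]
  exact congrArg (fun f => eLpNorm f 2 volume) (funext fun w => rfl)

theorem Model.eLpNorm_indicator_closedBall_rot {u : E} (hu : u ∈ X.rad)
    (A : EuclideanSpace ℝ (Fin m) ≃ₗᵢ[ℝ] EuclideanSpace ℝ (Fin m))
    (B : EuclideanSpace ℝ (Fin ℓ) ≃ₗᵢ[ℝ] EuclideanSpace ℝ (Fin ℓ)) (z : Pt m ℓ) (ρ : ℝ) :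
    eLpNorm ((Metric.closedBall ((Sym.rot γ A B).map z) ρ).indicator (X.fn u)) 2 volume =
      eLpNorm ((Metric.closedBall z ρ).indicator (X.fn u)) 2 volume := by
  rw [← eLpNorm_indicator_preimage (Sym.rot γ A B) (X.measurable_fn u).aestronglyMeasurable
    Metric.isClosed_closedBall.measurableSet]
  have hpre : (Sym.rot γ A B).map ⁻¹' Metric.closedBall ((Sym.rot γ A B).map z) ρ =
      Metric.closedBall z ρ := by
    ext w
    simp only [Set.mem_preimage, Metric.mem_closedBall, Sym.dist_rot]
  rw [hpre]
  refine eLpNorm_congr_ae ?_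
  have h1 := X.fn_pull (Sym.rot γ A B) u
  rw [hu A B] at h1
  filter_upwards [h1] with w hw
  by_cases hw' : w ∈ Metric.closedBall z ρ
  · rw [Set.indicator_of_mem hw', Set.indicator_of_mem hw', hw]
  · rw [Set.indicator_of_notMem hw', Set.indicator_of_notMem hw']

theorem exists_nat_mul_sq_gt (L : ℝ) {η : ℝ} (hη : 0 < η) :
    ∃ k : ℕ, ENNReal.ofReal L ^ 2 < k * ENNReal.ofReal η ^ 2 := by
  obtain ⟨k, hk⟩ := ENNReal.exists_nat_mul_gt (a := ENNReal.ofReal η ^ 2) (b := ENNReal.ofReal L ^ 2)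
    (by simpa using hη) (by finiteness)
  exact ⟨k, hk⟩

/-- By invariance each rotated ball carries the same mass $\eta^2$; `k` disjoint ones exceed the
total mass $L^2$. -/
theorem Model.sqMass_rot_lt {u : E} (hu : u ∈ X.rad) {L : ℝ} (huL : ‖u‖ ≤ L) {k : ℕ} {η ρ : ℝ}
    (hk : ENNReal.ofReal L ^ 2 < k * ENNReal.ofReal η ^ 2) {z : Pt m ℓ}
    (hz : ENNReal.ofReal η ≤ eLpNorm ((Metric.closedBall z ρ).indicator (X.fn u)) 2 volume)
    (A : Fin k → (EuclideanSpace ℝ (Fin m) ≃ₗᵢ[ℝ] EuclideanSpace ℝ (Fin m)))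
    (B : Fin k → (EuclideanSpace ℝ (Fin ℓ) ≃ₗᵢ[ℝ] EuclideanSpace ℝ (Fin ℓ)))
    (hsep : ∀ i j, i ≠ j → 2 * ρ < max (dist (A i z.1) (A j z.1)) (dist (B i z.2) (B j z.2))) :
    False := by
  have h1 := card_mul_le_of_separated (sqMass (X.fn u))
    (z := fun i => (Sym.rot γ (A i) (B i)).map z) (ρ := ρ) (η := ENNReal.ofReal η ^ 2)
    (fun i j hij => by
      rw [Sym.rot_map, Sym.rot_map, Prod.dist_eq]
      exact hsep i j hij) fun i => by
      rw [sqMass_apply _ Metric.isClosed_closedBall.measurableSet,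
        X.eLpNorm_indicator_closedBall_rot hu]
      gcongr
  have h2 := h1.trans (sqMass_univ_le (X.averaging u))
  have h3 : ENNReal.ofReal ‖u‖ ^ 2 ≤ ENNReal.ofReal L ^ 2 := by gcongr
  exact absurd (hk.trans_le (h2.trans h3)) (lt_irrefl _)

theorem Model.exists_norm_fst_le (hm : 2 ≤ m) (L ρ : ℝ) {η : ℝ} (hη : 0 < η) : ∃ B : ℝ,
    ∀ u ∈ X.rad, ‖u‖ ≤ L → ∀ z : Pt m ℓ,
      ENNReal.ofReal η ≤ eLpNorm ((Metric.closedBall z ρ).indicator (X.fn u)) 2 volume →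
      ‖z.1‖ ≤ B := by
  obtain ⟨k, hk⟩ := exists_nat_mul_sq_gt L hη
  obtain ⟨B, hB⟩ := exists_separating_isometries hm k ρ
  refine ⟨B, fun u hu huL z hz => not_lt.1 fun hlt => ?_⟩
  obtain ⟨A, hA⟩ := hB z.1 hlt
  exact X.sqMass_rot_lt hu huL hk hz A (fun _ => .refl ℝ _) fun i j hij =>
    lt_max_of_lt_left (hA i j hij)

theorem Model.exists_norm_snd_le (hℓ : 2 ≤ ℓ) (L ρ : ℝ) {η : ℝ} (hη : 0 < η) : ∃ B : ℝ,
    ∀ u ∈ X.rad, ‖u‖ ≤ L → ∀ z : Pt m ℓ,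
      ENNReal.ofReal η ≤ eLpNorm ((Metric.closedBall z ρ).indicator (X.fn u)) 2 volume →
      ‖z.2‖ ≤ B := by
  obtain ⟨k, hk⟩ := exists_nat_mul_sq_gt L hη
  obtain ⟨B, hB⟩ := exists_separating_isometries hℓ k ρ
  refine ⟨B, fun u hu huL z hz => not_lt.1 fun hlt => ?_⟩
  obtain ⟨A, hA⟩ := hB z.2 hlt
  exact X.sqMass_rot_lt hu huL hk hz (fun _ => .refl ℝ _) A fun i j hij =>
    lt_max_of_lt_right (hA i j hij)

/-- If `γ > 0` then mass far out in the `x` direction would be shared by many translates in `y`. -/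
theorem Model.exists_norm_fst_le_of_pos (hγ : 0 < γ) (hℓ : 1 ≤ ℓ) {L ρ : ℝ}
    (hρ : 0 < ρ) {η : ℝ} (hη : 0 < η) : ∃ B : ℝ, ∀ u : E, ‖u‖ ≤ L → ∀ z : Pt m ℓ,
      ENNReal.ofReal η ≤ eLpNorm ((Metric.closedBall z ρ).indicator (X.fn u)) 2 volume →
      ‖z.1‖ ≤ B := by
  obtain ⟨k, hk⟩ := exists_nat_mul_sq_gt L (half_pos hη)
  -- So far out that a shift in $y$ by up to $3\rho k$ changes the $L^2$ norm on the ball by at most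
  -- $\eta/2$. This is where $\gamma>0$ is needed.
  obtain ⟨τ, hτ, hτ1⟩ : ∃ τ : ℝ, 0 < τ ∧ τ ^ (-(γ : ℝ)) * (3 * ρ * k * L) ≤ η / 2 := by
    have h1 := ((tendsto_rpow_neg_atTop (y := (γ : ℝ)) (by exact_mod_cast hγ)).mul_const
      (3 * ρ * k * L))
    rw [zero_mul] at h1
    obtain ⟨τ, h2, h3⟩ := ((h1.eventually_le_const (half_pos hη)).and (eventually_gt_atTop 0)).exists
    exact ⟨τ, h3, h2⟩
  refine ⟨τ + ρ, fun u huL z hz => not_lt.1 fun hlt => ?_⟩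
  set e : EuclideanSpace ℝ (Fin ℓ) := EuclideanSpace.single ⟨0, hℓ⟩ 1 with he
  have he1 : ‖e‖ = 1 := by simp [he]
  -- The spacing $3\rho>2\rho$ makes the shifted balls disjoint.
  set b : Fin k → EuclideanSpace ℝ (Fin ℓ) := fun i => (3 * ρ * (i : ℝ)) • e with hb
  have hbn : ∀ i, ‖b i‖ ≤ 3 * ρ * k := by
    intro i
    rw [hb, norm_smul, he1, mul_one, Real.norm_of_nonneg (by positivity)]
    have : (i : ℝ) ≤ k := by exact_mod_cast i.2.le
    gcongr
  have hfm := (X.measurable_fn u).aestronglyMeasurable (μ := volume)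
  have hball := (Metric.isClosed_closedBall (x := z) (ε := ρ)).measurableSet
  have hlow : ∀ i, ENNReal.ofReal (η / 2) ≤
      eLpNorm ((Metric.closedBall (z + (0, b i)) ρ).indicator (X.fn u)) 2 volume := by
    intro i
    have h1 : eLpNorm ((Metric.closedBall z ρ).indicator fun w => X.fn u (w + (0, b i)) - X.fn u w) 2
        volume ≤ ENNReal.ofReal (η / 2) := by
      refine le_trans (eLpNorm_mono fun w => ?_) ((X.shift_snd_far_le u (b i) τ hτ).trans
        (ENNReal.ofReal_le_ofReal (le_trans ?_ hτ1)))
      · by_cases hw : w ∈ Metric.closedBall z ρ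
        · have hw' : w ∈ {w : Pt m ℓ | τ ≤ ‖w.1‖} := by
            have h2 : dist w.1 z.1 ≤ ρ := (le_max_left _ _).trans (Metric.mem_closedBall.1 hw)
            rw [dist_eq_norm] at h2
            have h3 := norm_sub_norm_le z.1 w.1
            rw [norm_sub_rev] at h3
            simp only [Set.mem_ofPred_eq]
            linarith
          rw [Set.indicator_of_mem hw, Set.indicator_of_mem hw']
        · rw [Set.indicator_of_notMem hw, norm_zero]
          exact norm_nonneg _
      · gcongr
        exact hbn i
    have h2 : eLpNorm ((Metric.closedBall z ρ).indicator fun w => X.fn u (w + (0, b i))) 2 volume =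
        eLpNorm ((Metric.closedBall (z + (0, b i)) ρ).indicator (X.fn u)) 2 volume := by
      rw [← eLpNorm_comp_add (hfm.indicator Metric.isClosed_closedBall.measurableSet) (0, b i)]
      refine congrArg (fun f => eLpNorm f 2 volume) (funext fun w => ?_)
      have hmem : w + (0, b i) ∈ Metric.closedBall (z + (0, b i)) ρ ↔ w ∈ Metric.closedBall z ρ := by
        rw [Metric.mem_closedBall, Metric.mem_closedBall, dist_add_right]
      by_cases hw : w ∈ Metric.closedBall z ρ
      · rw [Set.indicator_of_mem hw, Set.indicator_of_mem (hmem.2 hw)]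
      · rw [Set.indicator_of_notMem hw, Set.indicator_of_notMem (mt hmem.1 hw)]
    have h3 : eLpNorm ((Metric.closedBall z ρ).indicator (X.fn u)) 2 volume ≤
        eLpNorm ((Metric.closedBall z ρ).indicator fun w => X.fn u (w + (0, b i))) 2 volume +
        eLpNorm ((Metric.closedBall z ρ).indicator
          fun w => X.fn u (w + (0, b i)) - X.fn u w) 2 volume := by
      have hms : AEStronglyMeasurable (fun w => X.fn u (w + (0, b i))) volume :=
        ((X.measurable_fn u).comp (measurable_add_const _)).aestronglyMeasurable
      have := eLpNorm_sub_le (hms.indicator hball) ((hms.sub hfm).indicator hball)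
        (p := 2) (by norm_num)
      refine le_trans (le_of_eq ?_) this
      refine congrArg (fun f => eLpNorm f 2 volume) (funext fun w => ?_)
      by_cases hw : w ∈ Metric.closedBall z ρ <;> simp [hw]
    rw [h2] at h3
    have h4 := (hz.trans h3).trans (add_le_add le_rfl h1)
    have h5 : ENNReal.ofReal η = ENNReal.ofReal (η / 2) + ENNReal.ofReal (η / 2) := by
      rw [← ENNReal.ofReal_add (by positivity) (by positivity), add_halves]
    rw [h5] at h4
    exact (ENNReal.add_le_add_iff_right ENNReal.ofReal_ne_top).1 h4
  have h1 := card_mul_le_of_separated (sqMass (X.fn u)) (z := fun i => z + (0, b i)) (ρ := ρ)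
    (η := ENNReal.ofReal (η / 2) ^ 2) (fun i j hij => by
      rw [dist_add_left]
      refine lt_max_of_lt_right ?_
      simp only [hb]
      rw [dist_eq_norm, ← sub_smul, norm_smul, he1, mul_one, ← mul_sub, norm_mul,
        Real.norm_of_nonneg (by positivity), Real.norm_eq_abs]
      have : (1 : ℝ) ≤ |(i : ℝ) - j| := by
        have : (1 : ℤ) ≤ |(i : ℤ) - j| := Int.one_le_abs (by
          rw [sub_ne_zero]; exact_mod_cast fun h => hij (Fin.ext h))
        exact_mod_cast this
      nlinarith) fun i => by
      rw [sqMass_apply _ Metric.isClosed_closedBall.measurableSet]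
      have := hlow i
      gcongr
  have h2 := h1.trans (sqMass_univ_le (X.averaging u))
  have h3 : ENNReal.ofReal ‖u‖ ^ 2 ≤ ENNReal.ofReal L ^ 2 := by gcongr
  exact absurd (hk.trans_le (h2.trans h3)) (lt_irrefl _)

end

section

variable {μ p t₁ t₂ : ℝ} {E : Type*} [NormedAddCommGroup E] [InnerProductSpace ℝ E]

/-! ### Weak limits of minimising sequences -/

/-- `v` minimises `‖v‖²` among the invariant elements with `D(v) = 1`. -/
structure Exps.Extremal [CompleteSpace E] (h : Exps m ℓ γ μ p t₁ t₂) (X : Model m ℓ γ E) (I : ℝ)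
    (v : E) : Prop where
  pos : 0 < I
  mem : v ∈ X.rad
  dfun_eq : X.dfun μ p v = 1
  norm_sq : ‖v‖ ^ 2 = I
  eq : I • h.nonlin X v = v
  le : ∀ w ∈ X.rad, I * X.dfun μ p w ^ (1 / p) ≤ ‖w‖ ^ 2

theorem WeakTo.norm_sq_le {u : ℕ → E} {v : E} {I : ℝ} (h : WeakTo u v)
    (hu : Tendsto (fun n => ‖u n‖ ^ 2) atTop (𝓝 I)) : ‖v‖ ^ 2 ≤ I := by
  have h1 := (h.tendsto v).const_mul 2
  rw [real_inner_self_eq_norm_sq] at h1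
  have h2 := (hu.sub h1).add_const (‖v‖ ^ 2)
  have h3 : 0 ≤ I - 2 * ‖v‖ ^ 2 + ‖v‖ ^ 2 := ge_of_tendsto' h2 fun n => by
    have := norm_sub_sq_real (u n) v
    have h4 : 0 ≤ ‖u n - v‖ ^ 2 := by positivity
    linarith
  linarith

namespace Model.Minimizing

variable {X : Model m ℓ γ E} {I : ℝ} {u : ℕ → E}

theorem comp_strictMono (hu : X.Minimizing μ p I u) {ns : ℕ → ℕ} (hns : StrictMono ns) :
    X.Minimizing μ p I (u ∘ ns) :=
  ⟨hu.pos, hu.le, fun _ => hu.mem _, fun _ => hu.dfun_eq _, hu.tendsto.comp hns.tendsto_atTop⟩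

theorem exists_norm_le (hu : X.Minimizing μ p I u) : ∃ L : ℝ, 0 < L ∧ ∀ n, ‖u n‖ ≤ L := by
  obtain ⟨B, hB⟩ := hu.tendsto.bddAbove_range
  exact ⟨√B + 1, by positivity, fun n => (Real.le_sqrt_of_sq_le (hB ⟨n, rfl⟩)).trans (by linarith)⟩

/-- The residual keeps its norm under symmetries and $N$ commutes with them, so moving each $u_n$ by
its own symmetry does not affect the limit equation. -/
theorem smul_nonlin_eq [CompleteSpace E] (hu : X.Minimizing μ p I u)
    (h : Exps m ℓ γ μ p t₁ t₂) {S : ℕ → Sym m ℓ γ} {v : E}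
    (hv : WeakTo (fun n => X.pull (S n) (u n)) v) : I • h.nonlin X v = v := by
  refine ext_inner_right ℝ fun φ => ?_
  have h1 := (h.tendsto_inner_nonlin X hv φ).const_mul I
  have h2 := hv.tendsto φ
  have h3 : Tendsto (fun n => inner ℝ (X.pull (S n) (u n - I • h.nonlin X (u n))) φ) atTop (𝓝 0) := by
    have h4 := (hu.tendsto_residual h).mul_const ‖φ‖
    rw [zero_mul] at h4
    refine squeeze_zero_norm (fun n => ?_) h4
    refine (norm_inner_le_norm _ _).trans ?_
    rw [X.norm_pull]
  have h4 := h2.sub h1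
  rw [inner_smul_left]
  have h5 := tendsto_nhds_unique h4 (h3.congr fun n => by
    rw [X.pull_sub, X.pull_smul, h.nonlin_pull, inner_sub_left, inner_smul_left]
    rfl)
  rw [sub_eq_zero] at h5
  exact h5.symm

theorem norm_sq_eq [CompleteSpace E] (h : Exps m ℓ γ μ p t₁ t₂) {v : E}
    (hv : I • h.nonlin X v = v) : ‖v‖ ^ 2 = I * X.dfun μ p v := by
  rw [← real_inner_self_eq_norm_sq]
  nth_rewrite 1 [← hv]
  rw [inner_smul_left, h.inner_nonlin_self]
  rfl

/-- No compact embedding is used. The limit equation gives $\|v\|^2=I\,D(v)$; lower semicontinuity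
then forces $D(v)\le1$, and $D(v)^{1/p}\le D(v)$ with $p>1$ forces $D(v)\ge1$. -/
theorem extremal [CompleteSpace E] (hu : X.Minimizing μ p I u)
    (h : Exps m ℓ γ μ p t₁ t₂) {v : E} (hv : WeakTo u v) (hv0 : v ≠ 0) : h.Extremal X I v := by
  have hp := h.p_gt
  have hI := hu.pos
  have hmem := X.mem_rad_of_weakTo hv hu.mem
  have heq : I • h.nonlin X v = v := by
    refine hu.smul_nonlin_eq h (S := fun _ => Sym.rot γ (.refl ℝ _) (.refl ℝ _)) ?_
    simpa only [hu.mem _ _ _] using hv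
  have h1 := norm_sq_eq h heq
  have h2 := hv.norm_sq_le hu.tendsto
  have h3 := hu.le v hmem
  have hpos := h.dfun_pos X hv0
  rw [h1] at h2 h3
  have h4 : X.dfun μ p v ^ (1 / p) ≤ X.dfun μ p v := le_of_mul_le_mul_left h3 hI
  have h5 : X.dfun μ p v = 1 := by
    refine le_antisymm ?_ (not_lt.1 fun hlt => ?_)
    · nlinarith
    · have := Real.rpow_lt_rpow_of_exponent_gt hpos hlt (show 1 / p < 1 by
        rw [div_lt_one (by linarith)]; exact hp)
      rw [Real.rpow_one] at this
      linarith
  exact ⟨hI, hmem, h5, by rw [h1, h5, mul_one], heq, hu.le⟩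

end Model.Minimizing

/-- All the balls lie in one fixed ball, on which a weakly null sequence would tend to $0$ in $L^2$.
-/
theorem Exps.ne_zero_of_weakTo [CompleteSpace E] (h : Exps m ℓ γ μ p t₁ t₂) (X : Model m ℓ γ E)
    {u : ℕ → E} {v : E} (hv : WeakTo u v) {z : ℕ → Pt m ℓ} {B ρ η : ℝ} (hz : ∀ n, ‖z n‖ ≤ B)
    (hη : 0 < η) (hm : ∀ n, ENNReal.ofReal η ≤
      eLpNorm ((Metric.closedBall (z n) ρ).indicator (X.fn (u n))) 2 volume) : v ≠ 0 := by
  rintro rfl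
  have h1 := h.tendsto_eLpNorm_two_indicator X hv
    (K := Metric.closedBall 0 (B + ρ)) Metric.isClosed_closedBall.measurableSet
    Metric.isBounded_closedBall.measure_lt_top.ne
  have h2 : ENNReal.ofReal η ≤ 0 := ge_of_tendsto' h1 fun n => (hm n).trans (by
    refine eLpNorm_mono fun w => ?_
    refine norm_indicator_le_of_subset (Metric.closedBall_subset_closedBall' ?_) _ _
    rw [dist_zero_right]
    linarith [hz n])
  simp only [nonpos_iff_eq_zero, ENNReal.ofReal_eq_zero] at h2
  linarith

theorem Exps.exists_extremal_of_bounded [CompleteSpace E] [TopologicalSpace.SeparableSpace E]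
    (h : Exps m ℓ γ μ p t₁ t₂) {X : Model m ℓ γ E} {I : ℝ} {u : ℕ → E}
    (hu : X.Minimizing μ p I u) {z : ℕ → Pt m ℓ} {B ρ η : ℝ} (hz : ∀ n, ‖z n‖ ≤ B)
    (hη : 0 < η) (hm : ∀ n, ENNReal.ofReal η ≤
      eLpNorm ((Metric.closedBall (z n) ρ).indicator (X.fn (u n))) 2 volume) :
    ∃ v, h.Extremal X I v := by
  obtain ⟨L, -, hL⟩ := hu.exists_norm_le
  obtain ⟨v, ns, hns, hv⟩ := exists_weakTo hL
  exact ⟨v, (hu.comp_strictMono hns).extremal h hv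
    (h.ne_zero_of_weakTo X hv (fun n => hz (ns n)) hη fun n => hm (ns n))⟩

/-! ### Maximum and minimum -/

theorem max_eq_half_mul (a b : ℝ) : max a b = 2⁻¹ * (a + b + |a - b|) := by
  linarith [max_sub_min_eq_abs' a b, max_add_min a b]

theorem min_eq_half_mul (a b : ℝ) : min a b = 2⁻¹ * (a + b - |a - b|) := by
  linarith [max_sub_min_eq_abs' a b, max_add_min a b]

/-- Maximum and minimum are $\frac12(a+b\pm|a-b|)$. The parallelogram law is used twice, with
$\||a-b|\|\le\|a-b\|$ in between. -/
theorem Model.exists_max_min (X : Model m ℓ γ E) (a b : E) : ∃ M N : E,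
    X.fn M =ᵐ[volume] (fun z => max (X.fn a z) (X.fn b z)) ∧
    X.fn N =ᵐ[volume] (fun z => min (X.fn a z) (X.fn b z)) ∧
    ‖M‖ ^ 2 + ‖N‖ ^ 2 ≤ ‖a‖ ^ 2 + ‖b‖ ^ 2 := by
  obtain ⟨c, hc, hcn⟩ := X.exists_abs (a - b)
  refine ⟨(2 : ℝ)⁻¹ • (a + b + c), (2 : ℝ)⁻¹ • (a + b - c), ?_, ?_, ?_⟩
  · filter_upwards [hc, X.fn_sub a b, X.fn_add a b, X.fn_add (a + b) c,
      X.fn_smul (2 : ℝ)⁻¹ (a + b + c)] with z h1 h2 h3 h4 h5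
    rw [h5, Pi.smul_apply, h4, Pi.add_apply, h3, h1, h2, Pi.add_apply, Pi.sub_apply,
      max_eq_half_mul, smul_eq_mul]
  · filter_upwards [hc, X.fn_sub a b, X.fn_add a b, X.fn_sub (a + b) c,
      X.fn_smul (2 : ℝ)⁻¹ (a + b - c)] with z h1 h2 h3 h4 h5
    rw [h5, Pi.smul_apply, h4, Pi.sub_apply, h3, h1, h2, Pi.add_apply, Pi.sub_apply,
      min_eq_half_mul, smul_eq_mul]
  · rw [norm_smul, norm_smul, mul_pow, mul_pow, Real.norm_of_nonneg (by norm_num)]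
    have h1 := parallelogram_law_with_norm ℝ (a + b) c
    have h2 := parallelogram_law_with_norm ℝ a b
    have h3 : ‖c‖ ^ 2 ≤ ‖a - b‖ ^ 2 := by gcongr
    nlinarith

theorem max_mul_max_add_min_mul_min_ge (a b c d : ℝ) :
    a * c + b * d ≤ max a b * max c d + min a b * min c d := by
  rcases le_total a b with h1 | h1 <;> rcases le_total c d with h2 | h2 <;>
    simp only [h1, h2, max_eq_left, max_eq_right, min_eq_left, min_eq_right] <;>
    nlinarith [mul_nonneg (sub_nonneg.2 h1) (sub_nonneg.2 h2)]

/-- Supermodularity: a two-point rearrangement inequality under the integral sign, with nonnegative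
kernel. The power $s^p$ is increasing, hence commutes with maximum and minimum. -/
theorem Exps.dfun_add_le_max_min (h : Exps m ℓ γ μ p t₁ t₂) (X : Model m ℓ γ E) {a b M N : E}
    (ha : ∀ᵐ z, 0 ≤ X.fn a z) (hb : ∀ᵐ z, 0 ≤ X.fn b z)
    (hM : X.fn M =ᵐ[volume] fun z => max (X.fn a z) (X.fn b z))
    (hN : X.fn N =ᵐ[volume] fun z => min (X.fn a z) (X.fn b z)) :
    X.dfun μ p a + X.dfun μ p b ≤ X.dfun μ p M + X.dfun μ p N := by
  obtain ⟨S, hS, hs⟩ := h.exists_lbound X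
  have hp := h.p_pos
  have hint (u : E) := h.integrable_ker2 (h.xbound_rpow (hs u)) (h.xbound_rpow (hs u))
  unfold Model.dfun bil
  rw [← integral_add (hint a) (hint b), ← integral_add (hint M) (hint N)]
  refine integral_mono_ae ((hint a).add (hint b)) ((hint M).add (hint N)) ?_
  have hall : ∀ᵐ z : Pt m ℓ, |X.fn M z| ^ p = max (|X.fn a z| ^ p) (|X.fn b z| ^ p) ∧
      |X.fn N z| ^ p = min (|X.fn a z| ^ p) (|X.fn b z| ^ p) := by
    filter_upwards [ha, hb, hM, hN] with z h1 h2 h3 h4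
    rw [h3, h4, abs_of_nonneg h1, abs_of_nonneg h2, abs_of_nonneg (le_max_of_le_left h1),
      abs_of_nonneg (le_min h1 h2)]
    rcases le_total (X.fn a z) (X.fn b z) with hle | hle
    · have := Real.rpow_le_rpow h1 hle hp.le
      simp [hle, this]
    · have := Real.rpow_le_rpow h2 hle hp.le
      simp [hle, this]
  have q1 := (Measure.quasiMeasurePreserving_fst (μ := (volume : Measure (Pt m ℓ)))
    (ν := (volume : Measure (Pt m ℓ)))).ae hall
  have q2 := (Measure.quasiMeasurePreserving_snd (μ := (volume : Measure (Pt m ℓ)))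
    (ν := (volume : Measure (Pt m ℓ)))).ae hall
  filter_upwards [q1, q2] with q h1 h2
  have hg : 0 ≤ gauge γ (q.1 - q.2) ^ (-μ) := Real.rpow_nonneg (gauge_nonneg _) _
  have := mul_le_mul_of_nonneg_left (max_mul_max_add_min_mul_min_ge (|X.fn a q.2| ^ p)
    (|X.fn b q.2| ^ p) (|X.fn a q.1| ^ p) (|X.fn b q.1| ^ p)) hg
  simp only [ker2, h1.1, h1.2, h2.1, h2.2]
  linarith

theorem Model.pull_eq_of_comm (X : Model m ℓ γ E) {op : ℝ → ℝ → ℝ} (hop : ∀ s t, op s t = op t s)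
    {S : Sym m ℓ γ} {a b M : E} (hM : X.fn M =ᵐ[volume] fun z => op (X.fn a z) (X.fn b z))
    (hS : X.pull S a = a ∧ X.pull S b = b ∨ X.pull S a = b ∧ X.pull S b = a) : X.pull S M = M := by
  refine X.ext_fn ?_
  have ha := X.fn_pull S a
  have hb := X.fn_pull S b
  rcases hS with ⟨h1, h2⟩ | ⟨h1, h2⟩
  · rw [h1] at ha
    rw [h2] at hb
    filter_upwards [X.fn_pull S M, S.ae_comp hM, hM, ha, hb] with z k1 k2 k3 k4 k5
    rw [k1, k2, k3, k4, k5]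
  · rw [h1] at ha
    rw [h2] at hb
    filter_upwards [X.fn_pull S M, S.ae_comp hM, hM, ha, hb] with z k1 k2 k3 k4 k5
    rw [k1, k2, k3, k4, k5, hop]

theorem Model.pull_eq_of_weakTo (X : Model m ℓ γ E) (S : Sym m ℓ γ) {u : ℕ → E} {v : E}
    (h : WeakTo u v) (hu : ∀ n, X.pull S (u n) = u n) : X.pull S v = v := by
  refine ext_inner_right ℝ fun w => ?_
  have h1 := h.tendsto (X.pull S.inv w)
  rw [← X.inner_pull_left] at h1
  refine tendsto_nhds_unique h1 ((h.tendsto w).congr fun n => ?_)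
  rw [← X.inner_pull_left, hu n]

end

section

variable {μ p t₁ t₂ : ℝ} {E : Type*} [NormedAddCommGroup E] [InnerProductSpace ℝ E]

/-! ### A direction in which compactness fails -/

/-- A one-dimensional direction along which all translations are symmetries. Every rotation either
commutes with these translations or does so after the composition with the reflection. -/
structure Direction (m ℓ : ℕ) (γ : ℝ≥0) where
  e : Pt m ℓ
  e_ne : e ≠ 0
  T : ℝ → Sym m ℓ γ
  T_map : ∀ h z, (T h).map z = z + h • e
  A : EuclideanSpace ℝ (Fin m) ≃ₗᵢ[ℝ] EuclideanSpace ℝ (Fin m)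
  B : EuclideanSpace ℝ (Fin ℓ) ≃ₗᵢ[ℝ] EuclideanSpace ℝ (Fin ℓ)
  refl_add : ∀ z (h : ℝ), (Sym.rot γ A B).map (z + h • e) = (Sym.rot γ A B).map z - h • e
  refl_line : ∀ z, ∃ c : ℝ, (Sym.rot γ A B).map z = z + c • e
  cover : ∀ A' B', ∃ A'' B'', (∀ z (h : ℝ),
      (Sym.rot γ A'' B'').map (z + h • e) = (Sym.rot γ A'' B'').map z + h • e) ∧
    (∀ z, (Sym.rot γ A'' B'').map ((Sym.rot γ A B).map z) =
      (Sym.rot γ A B).map ((Sym.rot γ A'' B'').map z)) ∧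
    ((∀ z, (Sym.rot γ A' B').map z = (Sym.rot γ A'' B'').map z) ∨
      ∀ z, (Sym.rot γ A' B').map z = (Sym.rot γ A B).map ((Sym.rot γ A'' B'').map z))

namespace Direction

variable (Δ : Direction m ℓ γ)

/-- The reflection. -/
def R : Sym m ℓ γ := Sym.rot γ Δ.A Δ.B

theorem R_add (z : Pt m ℓ) (h : ℝ) : Δ.R.map (z + h • Δ.e) = Δ.R.map z - h • Δ.e := Δ.refl_add z h

theorem R_line (z : Pt m ℓ) : ∃ c : ℝ, Δ.R.map z = z + c • Δ.e := Δ.refl_line z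

theorem R_R (z : Pt m ℓ) : Δ.R.map (Δ.R.map z) = z := by
  obtain ⟨c, hc⟩ := Δ.R_line z
  rw [hc, Δ.R_add, hc, add_sub_cancel_right]

/-- Any weak subsequential limit is, on each ball, the local $L^q$ limit of the translates; these
tend to $0$ there because they show only the tail of $v$. Hence every such limit is zero. -/
theorem tendsto_inner_translate [CompleteSpace E] [TopologicalSpace.SeparableSpace E]
    (h : Exps m ℓ γ μ p t₁ t₂) (X : Model m ℓ γ E) {t : ℕ → ℝ}
    (ht : Tendsto (fun n => |t n|) atTop atTop) (v w : E) :
    Tendsto (fun n => inner ℝ (X.pull (Δ.T (t n)) v) w) atTop (𝓝 0) := by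
  refine tendsto_of_subseq_tendsto fun ns hns => ?_
  obtain ⟨g, ms, hms, hg⟩ := exists_weakTo (u := fun n => X.pull (Δ.T (t (ns n))) v) (L := ‖v‖)
    fun n => (X.norm_pull _ _).le
  refine ⟨ms, ?_⟩
  have hg0 : g = 0 := by
    have ht' : Tendsto (fun n => |t (ns (ms n))|) atTop atTop :=
      (ht.comp hns).comp hms.tendsto_atTop
    set q := p * t₁ with hq
    have hq2 : 2 < q := h.lo₁
    have hq0 : 0 < q := by linarith
    obtain ⟨S, hS, hs⟩ := h.exists_lbound X
    have hvq : eLpNorm (X.fn v) (ENNReal.ofReal q) volume ≠ ⊤ :=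
      ((hs v).le₁.trans_lt ENNReal.ofReal_lt_top).ne
    have hvm := (X.measurable_fn v).aestronglyMeasurable (μ := volume)
    have hball (k : ℕ) : (Metric.closedBall (0 : Pt m ℓ) k).indicator (X.fn g) =ᵐ[volume] 0 := by
      set K := Metric.closedBall (0 : Pt m ℓ) k with hK
      have hKm : MeasurableSet K := Metric.isClosed_closedBall.measurableSet
      have c1 := X.tendsto_eLpNorm_indicator h.dim hq2 h.hi₁ hg.sub_const hKm
        Metric.isBounded_closedBall.measure_lt_top.ne
      have c2 : Tendsto (fun n => eLpNorm (K.indicator (X.fn (X.pull (Δ.T (t (ns (ms n)))) v)))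
          (ENNReal.ofReal q) volume) atTop (𝓝 0) := by
        rw [ENNReal.tendsto_nhds_zero]
        intro ε hε
        obtain ⟨M, hM⟩ := ((ENNReal.tendsto_nhds_zero.1
          (tendsto_eLpNorm_indicator_compl_closedBall hq0 hvm hvq)) ε hε).exists
        have he := norm_pos_iff.2 Δ.e_ne
        filter_upwards [(ht'.atTop_mul_const he).eventually_gt_atTop (M + k)] with n hn
        refine le_trans ?_ hM
        rw [← eLpNorm_comp_add ((hvm.indicator Metric.isClosed_closedBall.measurableSet.compl))
          (t (ns (ms n)) • Δ.e)]
        refine eLpNorm_mono_ae ?_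
        filter_upwards [X.fn_pull (Δ.T (t (ns (ms n)))) v] with z hz
        by_cases hzK : z ∈ K
        · have hz' : z + t (ns (ms n)) • Δ.e ∈ (Metric.closedBall (0 : Pt m ℓ) M)ᶜ := by
            rw [Set.mem_compl_iff, mem_closedBall_zero_iff, not_le]
            rw [hK, mem_closedBall_zero_iff] at hzK
            have h1 := norm_sub_norm_le (t (ns (ms n)) • Δ.e) (-z)
            rw [sub_neg_eq_add, norm_neg, norm_smul, Real.norm_eq_abs, add_comm _ z] at h1
            linarith
          rw [Set.indicator_of_mem hzK, hz, Δ.T_map, Set.indicator_of_mem hz']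
        · rw [Set.indicator_of_notMem hzK, norm_zero]
          exact norm_nonneg _
      have c3 := c2.add c1
      rw [add_zero] at c3
      have c4 : eLpNorm (K.indicator (X.fn g)) (ENNReal.ofReal q) volume ≤ 0 :=
        ge_of_tendsto' c3 fun n => by
        set w := X.pull (Δ.T (t (ns (ms n)))) v with hw
        have h1 := eLpNorm_sub_le ((X.measurable_fn w).aestronglyMeasurable.indicator hKm)
          ((X.measurable_fn (w - g)).aestronglyMeasurable.indicator hKm) (μ := volume)
          (p := ENNReal.ofReal q) (by rw [ENNReal.one_le_ofReal]; linarith)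
        refine le_trans (le_of_eq (eLpNorm_congr_ae ?_)) h1
        filter_upwards [X.fn_sub w g] with z hz
        by_cases hzK : z ∈ K
        · simp [hzK, hz]
        · simp [hzK]
      exact (eLpNorm_eq_zero_iff ((X.measurable_fn g).aestronglyMeasurable.indicator hKm)
        (by simpa using hq0)).1 (nonpos_iff_eq_zero.1 c4)
    by_contra hne
    refine X.ae_pos_of_ne_zero hne ?_
    filter_upwards [ae_all_iff.2 hball] with z hz
    obtain ⟨k, hk⟩ := exists_nat_ge ‖z‖
    have := hz k
    rwa [Set.indicator_of_mem (by rwa [mem_closedBall_zero_iff])] at this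
  have := hg.tendsto w
  rwa [hg0, inner_zero_left] at this

theorem pull_T_T (X : Model m ℓ γ E) (s t : ℝ) (u : E) :
    X.pull (Δ.T s) (X.pull (Δ.T t) u) = X.pull (Δ.T (s + t)) u :=
  X.pull_pull (fun z => by rw [Δ.T_map, Δ.T_map, Δ.T_map, add_smul, add_assoc]) u

theorem pull_T_zero (X : Model m ℓ γ E) (u : E) : X.pull (Δ.T 0) u = u := by
  refine X.ext_fn ?_
  filter_upwards [X.fn_pull (Δ.T 0) u] with z hz
  rw [hz, Δ.T_map, zero_smul, add_zero]

theorem inner_pull_T (X : Model m ℓ γ E) (s : ℝ) (u v : E) :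
    inner ℝ (X.pull (Δ.T s) u) v = inner ℝ u (X.pull (Δ.T (-s)) v) := by
  rw [← X.inner_pull (Δ.T (-s)) (X.pull (Δ.T s) u) v, Δ.pull_T_T, neg_add_cancel, Δ.pull_T_zero]

theorem pull_R_R (X : Model m ℓ γ E) (u : E) : X.pull Δ.R (X.pull Δ.R u) = u := by
  refine X.ext_fn ?_
  filter_upwards [X.fn_pull Δ.R (X.pull Δ.R u), Δ.R.ae_comp (X.fn_pull Δ.R u)] with z h1 h2
  rw [h1, h2, Δ.R_R]

theorem pull_R_T (X : Model m ℓ γ E) (s : ℝ) (u : E) :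
    X.pull Δ.R (X.pull (Δ.T s) u) = X.pull (Δ.T (-s)) (X.pull Δ.R u) := by
  refine X.ext_fn ?_
  filter_upwards [X.fn_pull Δ.R (X.pull (Δ.T s) u), Δ.R.ae_comp (X.fn_pull (Δ.T s) u),
    X.fn_pull (Δ.T (-s)) (X.pull Δ.R u), (Δ.T (-s)).ae_comp (X.fn_pull Δ.R u)] with z h1 h2 h3 h4
  rw [h1, h2, h3, h4, Δ.T_map, Δ.T_map, Δ.R_add, neg_smul, sub_neg_eq_add]

/-- Two bumps that move apart cost at least `2 ‖v‖²`. -/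
theorem two_mul_norm_sq_le [CompleteSpace E] [TopologicalSpace.SeparableSpace E]
    (h : Exps m ℓ γ μ p t₁ t₂) {X : Model m ℓ γ E} {I : ℝ} {u : ℕ → E}
    (hu : X.Minimizing μ p I u) {t : ℕ → ℝ} (ht : Tendsto (fun n => |t n|) atTop atTop) {v : E}
    (hv : WeakTo (fun n => X.pull (Δ.T (t n)) (u n)) v) : 2 * ‖v‖ ^ 2 ≤ I := by
  have h1 : Tendsto (fun n => inner ℝ (u n) (X.pull (Δ.T (-t n)) v)) atTop (𝓝 (‖v‖ ^ 2)) := by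
    rw [← real_inner_self_eq_norm_sq]
    exact (hv.tendsto v).congr fun n => Δ.inner_pull_T X _ _ _
  have h2 : Tendsto (fun n => inner ℝ (u n) (X.pull (Δ.T (t n)) (X.pull Δ.R v))) atTop
      (𝓝 (‖v‖ ^ 2)) := by
    refine h1.congr fun n => ?_
    rw [← X.inner_pull Δ.R, Δ.pull_R_T, neg_neg]
    congr 1
    exact hu.mem n Δ.A Δ.B
  -- The two bumps are asymptotically orthogonal, since their relative displacement is $2t_n$.
  have h3 : Tendsto (fun n => inner ℝ (X.pull (Δ.T (-t n)) v) (X.pull (Δ.T (t n)) (X.pull Δ.R v)))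
      atTop (𝓝 0) := by
    have ht2 : Tendsto (fun n => |-(2 * t n)|) atTop atTop := by
      simp only [abs_neg, abs_mul, abs_two]
      exact ht.const_mul_atTop (by norm_num)
    refine (Δ.tendsto_inner_translate h X ht2 v (X.pull Δ.R v)).congr fun n => ?_
    rw [← neg_neg (t n), ← Δ.inner_pull_T, neg_neg, Δ.pull_T_T]
    congr 3
    ring
  have h4 := ((hu.tendsto.sub ((h1.add h2).const_mul 2)).add (h3.const_mul 2)).add_const
    (2 * ‖v‖ ^ 2)
  -- The limit of the squared distance from $u_n$ to the sum of the two bumps.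
  have h5 : 0 ≤ I - 2 * (‖v‖ ^ 2 + ‖v‖ ^ 2) + 2 * 0 + 2 * ‖v‖ ^ 2 := ge_of_tendsto' h4 fun n => by
    have k1 := norm_sub_sq_real (u n) (X.pull (Δ.T (-t n)) v + X.pull (Δ.T (t n)) (X.pull Δ.R v))
    have k2 := norm_add_sq_real (X.pull (Δ.T (-t n)) v) (X.pull (Δ.T (t n)) (X.pull Δ.R v))
    rw [k2, inner_add_right, X.norm_pull, X.norm_pull, X.norm_pull] at k1
    have k3 : 0 ≤ ‖u n - (X.pull (Δ.T (-t n)) v + X.pull (Δ.T (t n)) (X.pull Δ.R v))‖ ^ 2 := by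
      positivity
    linarith
  linarith

end Direction

/-! ### Sets that are disjoint from the translates of their reflection -/

/-- Fubini along the lines parallel to `e`: on almost every line, a non-null set of zeros of neither
kind is possible, as a generic point where `f` is nonzero makes `f` vanish almost everywhere on its
line. -/
theorem ae_eq_zero_of_ae_line {f : Pt m ℓ → ℝ} (hf : Measurable f) {e : Pt m ℓ}
    (h : ∀ᵐ z, f z ≠ 0 → ∀ᵐ t : ℝ, f (z + t • e) = 0) : f =ᵐ[volume] 0 := by
  obtain ⟨s, hs, hsm, hsp⟩ := h.exists_measurable_mem
  have hmeas : Measurable fun q : Pt m ℓ × ℝ => q.1 + q.2 • e := by fun_prop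
  have h1 : ∀ᵐ t : ℝ, ∀ᵐ z : Pt m ℓ, z + t • e ∈ s := by
    refine Eventually.of_forall fun t => ?_
    exact (measurePreserving_add (t • e)).quasiMeasurePreserving.ae hs
  have h2 := (Measure.ae_ae_comm (μ := (volume : Measure (Pt m ℓ))) (ν := (volume : Measure ℝ))
    (p := fun z t => z + t • e ∈ s) (hmeas hsm)).2 h1
  have h3 : ∀ᵐ z : Pt m ℓ, ∀ᵐ t : ℝ, f (z + t • e) = 0 := by
    filter_upwards [h2] with z hz
    by_contra hne
    obtain ⟨t, ht1, ht2⟩ : ∃ t, f (z + t • e) ≠ 0 ∧ z + t • e ∈ s :=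
      ((Filter.not_eventually.1 hne).and_eventually hz).exists
    have h4 := hsp _ ht2 ht1
    refine hne ?_
    have h5 := (measurePreserving_sub_right (volume : Measure ℝ) t).quasiMeasurePreserving.ae h4
    filter_upwards [h5] with t' ht'
    rwa [add_assoc, ← add_smul, add_sub_cancel] at ht'
  have h4 := (Measure.ae_ae_comm (μ := (volume : Measure (Pt m ℓ))) (ν := (volume : Measure ℝ))
    (p := fun z t => f (z + t • e) = 0) ((hf.comp hmeas) (measurableSet_singleton 0))).1 h3
  obtain ⟨t, ht⟩ := h4.exists
  have h5 := (measurePreserving_add (m := m) (ℓ := ℓ) (-(t • e))).quasiMeasurePreserving.ae ht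
  filter_upwards [h5] with z hz
  rwa [neg_add_cancel_right] at hz

/-- The reflection maps each line parallel to `e` to itself, so the points `Δ.R.map z + s • Δ.e`
sweep out the line through `z`. -/
theorem Direction.ae_eq_zero (Δ : Direction m ℓ γ) {f : Pt m ℓ → ℝ} (hf : Measurable f)
    (h : ∀ s : ℝ, ∀ᵐ z, f z = 0 ∨ f (Δ.R.map z + s • Δ.e) = 0) : f =ᵐ[volume] 0 := by
  have hR : Measurable Δ.R.map := Δ.R.measurePreserving.measurable
  have hm : Measurable fun q : Pt m ℓ × ℝ => Δ.R.map q.1 + q.2 • Δ.e := by fun_prop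
  have h1 := (Measure.ae_ae_comm (μ := (volume : Measure (Pt m ℓ))) (ν := (volume : Measure ℝ))
    (p := fun z s => f z = 0 ∨ f (Δ.R.map z + s • Δ.e) = 0)
    (((hf.comp measurable_fst) (measurableSet_singleton 0)).union
      ((hf.comp hm) (measurableSet_singleton 0)))).2 (Eventually.of_forall h)
  refine ae_eq_zero_of_ae_line hf (e := Δ.e) ?_
  filter_upwards [h1] with z hz hne
  obtain ⟨c, hc⟩ := Δ.R_line z
  have h2 : ∀ᵐ s : ℝ, f (z + (c + s) • Δ.e) = 0 := by
    filter_upwards [hz] with s hs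
    rw [add_smul, ← add_assoc, ← hc]
    exact hs.resolve_left hne
  have h3 := (measurePreserving_sub_right (volume : Measure ℝ) c).quasiMeasurePreserving.ae h2
  filter_upwards [h3] with s hs
  rwa [add_sub_cancel] at hs

end

section

variable {μ p t₁ t₂ : ℝ} {E : Type*} [NormedAddCommGroup E] [InnerProductSpace ℝ E]

/-! ### Minimising sequences do not escape to infinity -/

/-- Here `α`, `β` are the values of $D$ at maximum and minimum. From
$\alpha^{1/p}+\beta^{1/p}\le2D\le1$ both powers are below $1$, so $s<s^{1/p}$ is strict for both,
against $2D\le\alpha+\beta$. -/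
theorem false_of_rpow_le {p I D V α β : ℝ} (hp : 1 < p) (hI : 0 < I) (hα : 0 < α) (hβ : 0 < β)
    (hV : V = I * D) (hV2 : 2 * V ≤ I) (h1 : I * α ^ (1 / p) + I * β ^ (1 / p) ≤ 2 * V)
    (h2 : 2 * D ≤ α + β) : False := by
  have hp0 : 0 < p := by linarith
  have hD : 2 * D ≤ 1 := by
    rw [hV] at hV2
    nlinarith
  have h3 : α ^ (1 / p) + β ^ (1 / p) ≤ 2 * D := by
    rw [hV] at h1
    refine le_of_mul_le_mul_left ?_ hI
    linarith
  have hα' : 0 < α ^ (1 / p) := by positivity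
  have hβ' : 0 < β ^ (1 / p) := by positivity
  have key : ∀ s : ℝ, 0 < s → s ^ (1 / p) < 1 → s < s ^ (1 / p) := by
    intro s hs hs1
    have hlt : s < 1 := by
      by_contra hge
      exact absurd (Real.one_le_rpow (not_lt.1 hge) (by positivity)) (not_le.2 hs1)
    have := Real.rpow_lt_rpow_of_exponent_gt hs hlt (show 1 / p < 1 by
      rw [div_lt_one hp0]; exact hp)
    rwa [Real.rpow_one] at this
  have k1 := key α hα (by linarith)
  have k2 := key β hβ (by linarith)
  linarith

namespace Direction

variable (Δ : Direction m ℓ γ)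

/-- By `cover`, every rotation is one that commutes with the translations, or such a one followed by
the reflection. The former fix `a` and `b`, and the reflection exchanges them; a symmetric operation
does not notice the exchange. -/
theorem mem_rad (X : Model m ℓ γ E) {op : ℝ → ℝ → ℝ} (hop : ∀ s t, op s t = op t s) {a b M : E}
    (hM : X.fn M =ᵐ[volume] fun z => op (X.fn a z) (X.fn b z)) (hb : X.pull Δ.R a = b)
    (ha : ∀ G : Sym m ℓ γ, (∃ A B, G = Sym.rot γ A B) →
      (∀ z (h : ℝ), G.map (z + h • Δ.e) = G.map z + h • Δ.e) → X.pull G a = a) : M ∈ X.rad := by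
  intro A' B'
  obtain ⟨A'', B'', h1, h2, h3⟩ := Δ.cover A' B'
  have hG := ha _ ⟨A'', B'', rfl⟩ h1
  have hGb : X.pull (Sym.rot γ A'' B'') b = b := by
    rw [← hb]
    refine Eq.trans (Eq.symm ?_) (congrArg (X.pull Δ.R) hG)
    refine X.ext_fn ?_
    filter_upwards [X.fn_pull Δ.R (X.pull (Sym.rot γ A'' B'') a),
      Δ.R.ae_comp (X.fn_pull (Sym.rot γ A'' B'') a),
      X.fn_pull (Sym.rot γ A'' B'') (X.pull Δ.R a),
      (Sym.rot γ A'' B'').ae_comp (X.fn_pull Δ.R a)] with z k1 k2 k3 k4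
    rw [k1, k2, k3, k4]
    exact congrArg (X.fn a) (h2 z)
  have hGM := X.pull_eq_of_comm hop hM (Or.inl ⟨hG, hGb⟩)
  have hRM := X.pull_eq_of_comm hop hM (Or.inr ⟨hb, by rw [← hb, Δ.pull_R_R]⟩)
  rcases h3 with h3 | h3
  · rw [X.pull_congr h3, hGM]
  · rw [← X.pull_pull (S := Sym.rot γ A'' B'') (S' := Δ.R) h3, hRM, hGM]

/-- Two distant bumps are never optimal: maximum and minimum of a translate of $|v|$ and its
reflection are invariant competitors with no more norm and no less $D$ in total. -/
theorem not_tendsto_atTop [CompleteSpace E] [TopologicalSpace.SeparableSpace E]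
    (h : Exps m ℓ γ μ p t₁ t₂) {X : Model m ℓ γ E} {I : ℝ} {u : ℕ → E}
    (hu : X.Minimizing μ p I u) {t : ℕ → ℝ} (ht : Tendsto (fun n => |t n|) atTop atTop) {v : E}
    (hv : WeakTo (fun n => X.pull (Δ.T (t n)) (u n)) v) (hv0 : v ≠ 0) : False := by
  have hnorm := Model.Minimizing.norm_sq_eq h (hu.smul_nonlin_eq h hv)
  have htwo := Δ.two_mul_norm_sq_le h hu ht hv
  have hgood : ∀ G : Sym m ℓ γ, (∃ A B, G = Sym.rot γ A B) →
      (∀ z (s : ℝ), G.map (z + s • Δ.e) = G.map z + s • Δ.e) → X.pull G v = v := by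
    rintro _ ⟨A, B, rfl⟩ hG
    refine X.pull_eq_of_weakTo _ hv fun n => ?_
    rw [← hu.mem n A B, hu.mem n A B]
    refine Eq.trans ?_ (congrArg (X.pull (Δ.T (t n))) (hu.mem n A B))
    refine X.ext_fn ?_
    filter_upwards [X.fn_pull (Sym.rot γ A B) (X.pull (Δ.T (t n)) (u n)),
      (Sym.rot γ A B).ae_comp (X.fn_pull (Δ.T (t n)) (u n)),
      X.fn_pull (Δ.T (t n)) (X.pull (Sym.rot γ A B) (u n)),
      (Δ.T (t n)).ae_comp (X.fn_pull (Sym.rot γ A B) (u n))] with z k1 k2 k3 k4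
    rw [k1, k2, k3, k4, Δ.T_map, Δ.T_map, hG]
  -- A shift for which $v$ and the translate of its reflection overlap on a non-null set; without
  -- one $v$ would vanish. Moving by $s/2$ before reflecting produces the relative shift $s$, so the
  -- minimum below is not zero.
  obtain ⟨s, hs⟩ : ∃ s : ℝ, ¬ ∀ᵐ z, X.fn v z = 0 ∨ X.fn v (Δ.R.map z + s • Δ.e) = 0 := by
    by_contra! hcon
    exact X.ae_pos_of_ne_zero hv0 (Δ.ae_eq_zero (X.measurable_fn v) hcon)
  obtain ⟨a, ha, han⟩ := X.exists_abs (X.pull (Δ.T (s / 2)) v)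
  rw [X.norm_pull] at han
  have ha' : X.fn a =ᵐ[volume] fun z => |X.fn v (z + (s / 2) • Δ.e)| := by
    filter_upwards [ha, X.fn_pull (Δ.T (s / 2)) v] with z h1 h2
    rw [h1, h2, Δ.T_map]
  set b := X.pull Δ.R a with hb
  have hb' : X.fn b =ᵐ[volume] fun z => |X.fn v (Δ.R.map z + (s / 2) • Δ.e)| := by
    filter_upwards [X.fn_pull Δ.R a, Δ.R.ae_comp ha'] with z h1 h2
    rw [h1, h2]
  have haG : ∀ G : Sym m ℓ γ, (∃ A B, G = Sym.rot γ A B) →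
      (∀ z (s : ℝ), G.map (z + s • Δ.e) = G.map z + s • Δ.e) → X.pull G a = a := by
    intro G hG1 hG2
    refine X.ext_fn ?_
    have hvG := X.fn_pull G v
    rw [hgood G hG1 hG2] at hvG
    filter_upwards [X.fn_pull G a, G.ae_comp ha', ha', (Δ.T (s / 2)).ae_comp hvG] with z h1 h2 h3 h4
    rw [Δ.T_map, hG2] at h4
    rw [h1, h2, h3, h4]
  obtain ⟨M, N, hM, hN, hMN⟩ := X.exists_max_min a b
  have hMr := Δ.mem_rad X max_comm hM rfl haG
  have hNr := Δ.mem_rad X min_comm hN rfl haG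
  have hN0 : N ≠ 0 := by
    rintro rfl
    refine hs ?_
    have h0 : X.fn (0 : E) =ᵐ[volume] 0 := by
      filter_upwards [X.fn_smul 0 (0 : E)] with z hz
      rw [smul_zero] at hz
      rw [hz]
      simp
    have h1 : ∀ᵐ z, min |X.fn v (z + (s / 2) • Δ.e)| |X.fn v (Δ.R.map z + (s / 2) • Δ.e)| = 0 := by
      filter_upwards [h0, hN, ha', hb'] with z k1 k2 k3 k4
      rw [← k3, ← k4, ← k2, k1]
      rfl
    have h2 := (Δ.T (-(s / 2))).measurePreserving.quasiMeasurePreserving.ae h1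
    filter_upwards [h2] with z hz
    rw [Δ.T_map, Δ.R_add, neg_smul, neg_add_cancel_right, sub_neg_eq_add, add_assoc, ← add_smul,
      add_halves] at hz
    rcases min_choice |X.fn v z| |X.fn v (Δ.R.map z + s • Δ.e)| with h3 | h3
    · rw [h3] at hz
      exact Or.inl (abs_eq_zero.1 hz)
    · rw [h3] at hz
      exact Or.inr (abs_eq_zero.1 hz)
  have hab : ∀ᵐ z, 0 ≤ X.fn a z ∧ 0 ≤ X.fn b z := by
    filter_upwards [ha', hb'] with z h1 h2
    rw [h1, h2]
    exact ⟨abs_nonneg _, abs_nonneg _⟩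
  have hM0 : M ≠ 0 := by
    rintro rfl
    refine hN0 (X.ext_fn ?_)
    filter_upwards [hM, hN, hab, X.fn_smul 0 (0 : E)] with z h1 h2 h3 h4
    rw [smul_zero] at h4
    have h5 : X.fn (0 : E) z = 0 := by rw [h4]; simp
    rw [h5] at h1
    rw [h2, h5]
    refine le_antisymm ?_ (le_min h3.1 h3.2)
    rw [h1]
    exact min_le_max
  have hDa : X.dfun μ p a = X.dfun μ p v := by
    rw [← X.dfun_pull (Δ.T (s / 2)) v]
    refine X.dfun_congr_abs ?_
    filter_upwards [ha] with z hz
    rw [hz, abs_abs]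
  have hDb : X.dfun μ p b = X.dfun μ p v := by rw [hb, X.dfun_pull, hDa]
  have hD := h.dfun_add_le_max_min X (hab.mono fun z hz => hz.1) (hab.mono fun z hz => hz.2) hM hN
  rw [hDa, hDb] at hD
  have hbn : ‖b‖ = ‖a‖ := X.norm_pull _ _
  have hsq : ‖a‖ ^ 2 ≤ ‖v‖ ^ 2 := by gcongr
  rw [hbn] at hMN
  have k1 := hu.le M hMr
  have k2 := hu.le N hNr
  exact false_of_rpow_le h.p_gt hu.pos (h.dfun_pos X hM0) (h.dfun_pos X hN0) hnorm htwo
    (by linarith) (by linarith)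

/-- Either the displacement tends to infinity, which is excluded, or it stays bounded along a
subsequence, and then so do the centres. -/
theorem exists_extremal [CompleteSpace E] [TopologicalSpace.SeparableSpace E]
    (h : Exps m ℓ γ μ p t₁ t₂) {X : Model m ℓ γ E} {I : ℝ} {u : ℕ → E}
    (hu : X.Minimizing μ p I u) {z : ℕ → Pt m ℓ} {t : ℕ → ℝ} {B ρ η : ℝ} (hz : ∀ n, ‖z n‖ ≤ B)
    (hη : 0 < η) (hm : ∀ n, ENNReal.ofReal η ≤
      eLpNorm ((Metric.closedBall (z n + t n • Δ.e) ρ).indicator (X.fn (u n))) 2 volume) :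
    ∃ v, h.Extremal X I v := by
  by_cases ht : Tendsto (fun n => |t n|) atTop atTop
  · exfalso
    obtain ⟨L, -, hL⟩ := hu.exists_norm_le
    obtain ⟨v, ns, hns, hv⟩ := exists_weakTo (u := fun n => X.pull (Δ.T (t n)) (u n)) (L := L)
      fun n => (X.norm_pull _ _).trans_le (hL n)
    refine Δ.not_tendsto_atTop h (hu.comp_strictMono hns) (ht.comp hns.tendsto_atTop) hv
      (h.ne_zero_of_weakTo X hv (ρ := ρ) (fun n => hz (ns n)) hη fun n => (hm (ns n)).trans (le_of_eq ?_))
    rw [← eLpNorm_indicator_preimage (Δ.T (t (ns n))) (X.measurable_fn _).aestronglyMeasurable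
      Metric.isClosed_closedBall.measurableSet]
    refine eLpNorm_congr_ae ?_
    filter_upwards [X.fn_pull (Δ.T (t (ns n))) (u (ns n))] with w hw
    have hmem : w ∈ (Δ.T (t (ns n))).map ⁻¹' Metric.closedBall (z (ns n) + t (ns n) • Δ.e) ρ ↔
        w ∈ Metric.closedBall (z (ns n)) ρ := by
      rw [Set.mem_preimage, Δ.T_map, Metric.mem_closedBall, Metric.mem_closedBall, dist_add_right]
    by_cases hw' : w ∈ Metric.closedBall (z (ns n)) ρ
    · rw [Set.indicator_of_mem hw', Set.indicator_of_mem (hmem.2 hw')]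
      exact hw.symm
    · rw [Set.indicator_of_notMem hw', Set.indicator_of_notMem (mt hmem.1 hw')]
  · rw [tendsto_atTop] at ht
    push Not at ht
    obtain ⟨b, hb⟩ := ht
    obtain ⟨ns, hns, hnb⟩ := extraction_of_frequently_atTop hb
    refine h.exists_extremal_of_bounded (hu.comp_strictMono hns) (B := B + b * ‖Δ.e‖)
      (fun n => (norm_add_le _ _).trans (add_le_add (hz (ns n)) ?_)) hη fun n => hm (ns n)
    rw [norm_smul, Real.norm_eq_abs]
    have := hnb n
    gcongr

end Direction

/-! ### The two exceptional directions -/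

theorem fin_one_eq_smul (y : EuclideanSpace ℝ (Fin 1)) : y = y 0 • EuclideanSpace.single 0 1 := by
  ext i
  rw [Subsingleton.elim i 0]
  simp

theorem eq_or_eq_neg_of_fin_one (B : EuclideanSpace ℝ (Fin 1) ≃ₗᵢ[ℝ] EuclideanSpace ℝ (Fin 1)) :
    (∀ y, B y = y) ∨ ∀ y, B y = -y := by
  set e : EuclideanSpace ℝ (Fin 1) := EuclideanSpace.single 0 1 with he
  obtain ⟨c, hc⟩ : ∃ c : ℝ, B e = c • e := ⟨_, fin_one_eq_smul _⟩
  have h1 : |c| = 1 := by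
    have h : ‖B e‖ = 1 := by simp [he]
    rw [hc, norm_smul] at h
    simpa [he] using h
  have h2 (y : EuclideanSpace ℝ (Fin 1)) : B y = c • y := by
    obtain ⟨a, rfl⟩ : ∃ a : ℝ, y = a • e := ⟨_, fin_one_eq_smul y⟩
    rw [map_smul, hc, smul_comm]
  rcases eq_or_eq_neg_of_abs_eq h1 with h3 | h3
  · exact Or.inl fun y => by rw [h2, h3, one_smul]
  · exact Or.inr fun y => by rw [h2, h3, neg_one_smul]

/-- The direction of `y`, if `y` is one-dimensional. -/
def Direction.snd (m : ℕ) (γ : ℝ≥0) : Direction m 1 γ where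
  e := (0, EuclideanSpace.single 0 1)
  e_ne h := by simpa using congrArg Prod.snd h
  T t := ⟨.refl ℝ _, .refl ℝ _, 0, t • EuclideanSpace.single 0 1, fun x => by simp⟩
  T_map t z := by ext <;> simp [Sym.map]
  A := .refl ℝ _
  B := .neg ℝ
  refl_add z t := by
    rw [Sym.rot_map, Sym.rot_map]
    ext <;> simp
    ring
  refl_line z := ⟨-2 * z.2 0, by
    rw [Sym.rot_map]
    refine Prod.ext (by simp) ?_
    ext i
    rw [Subsingleton.elim i 0]
    simp
    ring⟩
  cover A' B' := by
    refine ⟨A', .refl ℝ _, fun z t => ?_, fun z => ?_, ?_⟩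
    · rw [Sym.rot_map, Sym.rot_map]
      ext <;> simp
    · simp only [Sym.rot_map]
      ext <;> simp
    · simp only [Sym.rot_map]
      refine (eq_or_eq_neg_of_fin_one B').imp (fun h z => ?_) fun h z => ?_
      · rw [h]; rfl
      · rw [h]; rfl

/-- The direction of `x`, if `x` is one-dimensional and `γ = 0`. -/
def Direction.fst (ℓ : ℕ) : Direction 1 ℓ 0 where
  e := (EuclideanSpace.single 0 1, 0)
  e_ne h := by simpa using congrArg Prod.fst h
  T t := ⟨.refl ℝ _, .refl ℝ _, t • EuclideanSpace.single 0 1, 0, fun x => by simp⟩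
  T_map t z := by ext <;> simp [Sym.map]
  A := .neg ℝ
  B := .refl ℝ _
  refl_add z t := by
    rw [Sym.rot_map, Sym.rot_map]
    ext <;> simp
    ring
  refl_line z := ⟨-2 * z.1 0, by
    rw [Sym.rot_map]
    refine Prod.ext ?_ (by simp)
    ext i
    rw [Subsingleton.elim i 0]
    simp
    ring⟩
  cover A' B' := by
    refine ⟨.refl ℝ _, B', fun z t => ?_, fun z => ?_, ?_⟩
    · rw [Sym.rot_map, Sym.rot_map]
      ext <;> simp
    · simp only [Sym.rot_map]
      ext <;> simp
    · simp only [Sym.rot_map]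
      refine (eq_or_eq_neg_of_fin_one A').imp (fun h z => ?_) fun h z => ?_
      · rw [h]; rfl
      · rw [h]; rfl

/-- For $\ell\ge2$ with $m\ge2$ or $\gamma>0$ the centres are bounded. For $\ell\ge2$, $m=1$,
$\gamma=0$ only $x$ is free; for $\ell=1$ only $y$ is free, as $N\ge3$ gives $m\ge2$. -/
theorem Exps.exists_extremal [CompleteSpace E] [TopologicalSpace.SeparableSpace E]
    (h : Exps m ℓ γ μ p t₁ t₂) (hN : 3 ≤ m + ℓ) (X : Model m ℓ γ E) {u₀ : E} (hu₀ : u₀ ∈ X.rad)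
    (hne : u₀ ≠ 0) : ∃ I v, h.Extremal X I v := by
  obtain ⟨I, u, hu⟩ := h.exists_minimizing X hu₀ hne
  refine ⟨I, ?_⟩
  obtain ⟨L, hL0, hL⟩ := hu.exists_norm_le
  obtain ⟨ρ, η, hρ, hη, hcon⟩ := h.exists_concentration X hL0
  choose z hz using fun n => hcon (u n) (hL n) (hu.dfun_eq n)
  have hfst : 2 ≤ m ∨ 0 < γ → ∃ B : ℝ, ∀ n, ‖(z n).1‖ ≤ B := by
    rintro (hm | hγ)
    · obtain ⟨B, hB⟩ := X.exists_norm_fst_le hm L ρ hη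
      exact ⟨B, fun n => hB (u n) (hu.mem n) (hL n) (z n) (hz n)⟩
    · obtain ⟨B, hB⟩ := X.exists_norm_fst_le_of_pos hγ h.hℓ (L := L) hρ hη
      exact ⟨B, fun n => hB (u n) (hL n) (z n) (hz n)⟩
  have hsnd : 2 ≤ ℓ → ∃ B : ℝ, ∀ n, ‖(z n).2‖ ≤ B := by
    intro hℓ
    obtain ⟨B, hB⟩ := X.exists_norm_snd_le hℓ L ρ hη
    exact ⟨B, fun n => hB (u n) (hu.mem n) (hL n) (z n) (hz n)⟩
  have hm := h.hm
  have hℓ := h.hℓ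
  by_cases hℓ2 : 2 ≤ ℓ
  · obtain ⟨B₂, hB₂⟩ := hsnd hℓ2
    by_cases hm2 : 2 ≤ m ∨ 0 < γ
    · obtain ⟨B₁, hB₁⟩ := hfst hm2
      exact h.exists_extremal_of_bounded hu
        (fun n => max_le_max (hB₁ n) (hB₂ n)) hη hz
    · push Not at hm2
      obtain ⟨hm2, hγ⟩ := hm2
      obtain rfl : m = 1 := by omega
      obtain rfl : γ = 0 := nonpos_iff_eq_zero.1 hγ
      refine (Direction.fst ℓ).exists_extremal h hu (z := fun n => (0, (z n).2))
        (t := fun n => (z n).1 0) (B := B₂) (fun n => ?_) hη (ρ := ρ) fun n => ?_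
      · rw [Prod.norm_def, norm_zero]
        exact max_le ((norm_nonneg _).trans (hB₂ n)) (hB₂ n)
      · have : ((0, (z n).2) : Pt 1 ℓ) + (z n).1 0 • (Direction.fst ℓ).e = z n := by
          refine Prod.ext ?_ (by simp [Direction.fst])
          rw [fin_one_eq_smul (z n).1]
          simp [Direction.fst]
        rw [this]
        exact hz n
  · obtain rfl : ℓ = 1 := by omega
    obtain ⟨B₁, hB₁⟩ := hfst (Or.inl (by omega))
    refine (Direction.snd m γ).exists_extremal h hu (z := fun n => ((z n).1, 0))
      (t := fun n => (z n).2 0) (B := B₁) (fun n => ?_) hη (ρ := ρ) fun n => ?_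
    · rw [Prod.norm_def, norm_zero]
      exact max_le (hB₁ n) ((norm_nonneg _).trans (hB₁ n))
    · have : ((z n).1, 0) + (z n).2 0 • (Direction.snd m γ).e = z n := by
        refine Prod.ext (by simp [Direction.snd]) ?_
        rw [fin_one_eq_smul (z n).2]
        simp [Direction.snd]
      rw [this]
      exact hz n

end

section

variable {μ p t₁ t₂ : ℝ} {E : Type*} [NormedAddCommGroup E] [InnerProductSpace ℝ E]
  [CompleteSpace E]

/-! ### The mountain pass -/

/-- Bernoulli's inequality for $(r^2)^p$, with equality at $r=1$; it locates the maximum of the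
energy on a ray. -/
theorem sq_sub_rpow_le {p r : ℝ} (hp : 1 < p) :
    1 / 2 * r ^ 2 - 1 / (2 * p) * (|r| ^ p) ^ 2 ≤ 1 / 2 - 1 / (2 * p) := by
  have hp0 : 0 < p := by linarith
  have h1 := one_add_mul_self_le_rpow_one_add (s := r ^ 2 - 1) (by nlinarith [sq_nonneg r]) hp.le
  rw [add_sub_cancel, ← sq_abs, ← Real.rpow_natCast, ← Real.rpow_mul (abs_nonneg r),
    mul_comm _ p, Real.rpow_mul (abs_nonneg r), Real.rpow_natCast, Real.rpow_natCast, sq_abs] at h1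
  have h2 : 1 / (2 * p) * (1 + p * (r ^ 2 - 1)) ≤ 1 / (2 * p) * (|r| ^ p) ^ 2 := by gcongr
  have h3 : 1 / (2 * p) * (1 + p * (r ^ 2 - 1)) = 1 / (2 * p) + 1 / 2 * (r ^ 2 - 1) := by
    field_simp
  linarith

/-- A multiple of an extremal element solves the equation. -/
theorem Exps.Extremal.exists_fixed {h : Exps m ℓ γ μ p t₁ t₂} {X : Model m ℓ γ E} {I : ℝ} {v : E}
    (hv : h.Extremal X I v) : ∃ u ∈ X.rad, 0 < ‖u‖ ∧ h.nonlin X u = u ∧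
      X.dfun μ p u = ‖u‖ ^ 2 ∧ ∀ w ∈ X.rad, ‖w‖ = ‖u‖ → X.dfun μ p w ≤ ‖u‖ ^ 2 := by
  have hp := h.p_gt
  have hI := hv.pos
  -- Since $N(\tau v)=\tau^{2p-1}N(v)$ and $I\,N(v)=v$, the equation for $\tau v$ requires
  -- $\tau^{2p-2}=I$.
  set τ := I ^ (1 / (2 * p - 2)) with hτ
  have hτ0 : 0 < τ := by positivity
  have hτI : τ ^ (2 * p - 2) = I := by
    rw [hτ, ← Real.rpow_mul hI.le, one_div_mul_cancel (by linarith), Real.rpow_one]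
  have hτ2 : (τ ^ p) ^ 2 = I * τ ^ 2 := by
    rw [← hτI, ← Real.rpow_natCast, ← Real.rpow_natCast, ← Real.rpow_mul hτ0.le,
      ← Real.rpow_add hτ0]
    congr 1
    push_cast
    ring
  have hn : ‖τ • v‖ ^ 2 = I * τ ^ 2 := by
    rw [norm_smul, mul_pow, hv.norm_sq, Real.norm_of_nonneg hτ0.le, mul_comm]
  have hv0 : v ≠ 0 := by
    rintro rfl
    have := hv.norm_sq
    rw [norm_zero] at this
    norm_num at this
    linarith
  refine ⟨τ • v, X.rad.smul_mem _ hv.mem, norm_pos_iff.2 (smul_ne_zero hτ0.ne' hv0), ?_, ?_, ?_⟩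
  · rw [h.nonlin_smul X hτ0]
    nth_rewrite 2 [← hv.eq]
    rw [smul_smul, ← Real.rpow_add hτ0, ← hτI, ← Real.rpow_one_add' hτ0.le (by linarith)]
    congr 2
    ring
  · rw [X.dfun_smul, hv.dfun_eq, mul_one, abs_of_pos hτ0, hτ2, hn]
  · intro w hw hwn
    have h1 := hv.le w hw
    rw [hwn, hn] at h1
    rw [hn]
    have h2 := le_of_mul_le_mul_left h1 hI
    have h3 := Real.rpow_le_rpow (Real.rpow_nonneg (X.dfun_nonneg w) _) h2 h.p_pos.le
    rw [← Real.rpow_mul (X.dfun_nonneg w), one_div_mul_cancel h.p_pos.ne', Real.rpow_one] at h3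
    refine h3.trans (le_of_eq ?_)
    rw [← hτ2, ← Real.rpow_natCast, ← Real.rpow_natCast, ← Real.rpow_mul hτ0.le,
      ← Real.rpow_mul hτ0.le, mul_comm]

/-- The sphere is taken through the solution itself, with `a` its energy. Extremality makes the
energy on the sphere at least `a`, and the segment to a far multiple of `u` never exceeds it, so the
infimum is attained and no deformation argument is needed. -/
theorem Exps.Extremal.mountain_pass {h : Exps m ℓ γ μ p t₁ t₂} {X : Model m ℓ γ E} {I : ℝ} {v : E}
    (hv : h.Extremal X I v) {V : Submodule ℝ E} (hV : V = X.rad) {J : E → ℝ}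
    (hJ : ∀ u, J u = 1 / 2 * ‖u‖ ^ 2 - 1 / (2 * p) * X.dfun μ p u) :
    ∃ R : ℝ, 0 < R ∧ ∃ a : ℝ, 0 < a ∧ ∃ v : V, (∀ w : V, ‖w‖ = R → a ≤ J w) ∧ R < ‖v‖ ∧ J v < 0 ∧
      ∃ u : E, u ≠ 0 ∧ h.nonlin X u = u ∧ u ∈ V ∧ HasFDerivAt J (0 : E →L[ℝ] ℝ) u ∧
        IsGLB {M : ℝ | ∃ σ : Path (0 : V) v, IsGreatest (Set.range fun t => J (σ t : E)) M} (J u) ∧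
        a ≤ J u := by
  have hp := h.p_gt
  have hp0 := h.p_pos
  obtain ⟨u, hu, hR, hN, hD, hmax⟩ := hv.exists_fixed
  subst hV
  set R := ‖u‖ with hRdef
  have hJu (r : ℝ) : J (r • u) = R ^ 2 * (1 / 2 * r ^ 2 - 1 / (2 * p) * (|r| ^ p) ^ 2) := by
    rw [hJ, X.dfun_smul, hD, norm_smul, mul_pow, Real.norm_eq_abs, sq_abs]
    ring
  have hJ1 : J u = R ^ 2 * (1 / 2 - 1 / (2 * p)) := by
    have := hJu 1
    simpa using this
  have hc : 0 < 1 / 2 - 1 / (2 * p) := by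
    rw [sub_pos]
    exact one_div_lt_one_div_of_lt (by norm_num) (by linarith)
  have hlow : ∀ w ∈ X.rad, ‖w‖ = R → J u ≤ J w := by
    intro w hw hwR
    rw [hJ u, hJ w, hD, hwR]
    have : 1 / (2 * p) * X.dfun μ p w ≤ 1 / (2 * p) * R ^ 2 := by
      gcongr
      exact hmax w hw hwR
    linarith
  -- Makes $J(su)=-R^2s^2/(2p)$, which is negative.
  set s := (p + 1) ^ (1 / (2 * p - 2)) with hs
  have hs0 : 0 < s := by positivity
  have hs1 : 1 < s := Real.one_lt_rpow (by linarith) (one_div_pos.2 (by linarith))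
  have hsp : (|s| ^ p) ^ 2 = (p + 1) * s ^ 2 := by
    have : s ^ (2 * p - 2) = p + 1 := by
      rw [hs, ← Real.rpow_mul (by linarith), one_div_mul_cancel (by linarith), Real.rpow_one]
    rw [abs_of_pos hs0, ← this, ← Real.rpow_natCast, ← Real.rpow_natCast, ← Real.rpow_mul hs0.le,
      ← Real.rpow_add hs0]
    congr 1
    push_cast
    ring
  have hsR : R < ‖s • u‖ := by
    rw [norm_smul, Real.norm_of_nonneg hs0.le]
    nlinarith
  refine ⟨R, hR, J u, by rw [hJ1]; positivity, ⟨s • u, X.rad.smul_mem s hu⟩,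
    fun w hw => hlow w w.2 hw, hsR, ?_, u, norm_pos_iff.1 hR, hN, hu, ?_, ?_, le_rfl⟩
  · have : 1 / 2 * s ^ 2 - 1 / (2 * p) * ((p + 1) * s ^ 2) = -(s ^ 2 / (2 * p)) := by
      field_simp
      ring
    change J (s • u) < 0
    rw [hJu, hsp, this]
    have h1 : 0 < R ^ 2 * (s ^ 2 / (2 * p)) := by positivity
    linarith
  · have h1 := (((hasStrictFDerivAt_norm_sq u).hasFDerivAt.const_mul (1 / 2)).sub
      ((h.hasFDerivAt_dfun X u).const_mul (1 / (2 * p))))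
    have h2 : ((1 / 2 : ℝ) • (2 • innerSL ℝ u) - (1 / (2 * p)) • ((2 * p) • innerSL ℝ (h.nonlin X u)) :
        E →L[ℝ] ℝ) = 0 := by
      rw [hN, smul_smul, one_div_mul_cancel (by positivity), one_smul, ← Nat.cast_smul_eq_nsmul ℝ,
        smul_smul]
      norm_num
    rw [h2] at h1
    exact h1.congr_of_eventuallyEq (Eventually.of_forall hJ)
  · refine IsLeast.isGLB ⟨?_, ?_⟩
    · refine ⟨⟨⟨fun t => (t : ℝ) • ⟨s • u, X.rad.smul_mem s hu⟩, by fun_prop⟩, by simp, by simp⟩,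
        ⟨⟨⟨s⁻¹, by positivity, inv_le_one_of_one_le₀ hs1.le⟩, ?_⟩, ?_⟩⟩
      · change J (s⁻¹ • s • u) = J u
        rw [smul_smul, inv_mul_cancel₀ hs0.ne', one_smul]
      · rintro _ ⟨t, rfl⟩
        change J ((t : ℝ) • s • u) ≤ J u
        rw [smul_smul, hJu, hJ1]
        have := sq_sub_rpow_le (r := t * s) hp
        gcongr
    · rintro M ⟨σ, -, hM⟩
      obtain ⟨t, -, ht⟩ : R ∈ (fun t => ‖σ t‖) '' Set.univ := by
        refine isPreconnected_univ.intermediate_value (Set.mem_univ 0) (Set.mem_univ 1)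
          σ.continuous.norm.continuousOn ⟨?_, ?_⟩
        · rw [σ.source, norm_zero]
          exact hR.le
        · rw [σ.target]
          exact hsR.le
      exact (hlow _ (σ t).2 ht).trans (hM ⟨t, rfl⟩)

theorem Exps.exists_mountain_pass [TopologicalSpace.SeparableSpace E]
    (h : Exps m ℓ γ μ p t₁ t₂) (hN : 3 ≤ m + ℓ) (X : Model m ℓ γ E) {V : Submodule ℝ E}
    (hV : V = X.rad) (hne : ∃ u ∈ V, u ≠ 0) {J : E → ℝ}
    (hJ : ∀ u, J u = 1 / 2 * ‖u‖ ^ 2 - 1 / (2 * p) * X.dfun μ p u) {P : E → Prop}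
    (hP : ∀ u, h.nonlin X u = u → P u) :
    ∃ R : ℝ, 0 < R ∧ ∃ a : ℝ, 0 < a ∧ ∃ v : V, (∀ w : V, ‖w‖ = R → a ≤ J w) ∧ R < ‖v‖ ∧ J v < 0 ∧
      ∃ u : E, ¬ (X.fn u =ᵐ[volume] 0) ∧ P u ∧ u ∈ V ∧ HasFDerivAt J (0 : E →L[ℝ] ℝ) u ∧
        IsGLB {M : ℝ | ∃ σ : Path (0 : V) v, IsGreatest (Set.range fun t => J (σ t : E)) M} (J u) ∧
        a ≤ J u := by
  obtain ⟨u₀, hu₀, hne⟩ := hne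
  obtain ⟨I, w, hw⟩ := h.exists_extremal hN X (hV ▸ hu₀) hne
  obtain ⟨R, hR, a, ha, v, h1, h2, h3, u, h4, h5, h6⟩ := hw.mountain_pass hV hJ
  exact ⟨R, hR, a, ha, v, h1, h2, h3, u, X.ae_pos_of_ne_zero h4, hP u h5, h6⟩

end

section

/-! ### Functions of `(|x|, |y|)` -/

theorem avg_rot (τ : ℝ) (f : Pt m ℓ → ℝ)
    (A : EuclideanSpace ℝ (Fin m) ≃ₗᵢ[ℝ] EuclideanSpace ℝ (Fin m))
    (B : EuclideanSpace ℝ (Fin ℓ) ≃ₗᵢ[ℝ] EuclideanSpace ℝ (Fin ℓ)) (z : Pt m ℓ) :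
    avg γ τ f ((Sym.rot γ A B).map z) = avg γ τ (fun z => f ((Sym.rot γ A B).map z)) z := by
  set S := Sym.rot γ A B with hS
  have hpre : S.map ⁻¹' (box γ τ : Set (Pt m ℓ)) = box γ τ := by
    ext w
    simp [box, hS, Sym.rot_map]
  have h1 := S.measurePreserving.restrict_preimage (measurableSet_box (γ := γ) τ)
  rw [hpre] at h1
  have hadd (w : Pt m ℓ) : S.map (z + w) = S.map z + S.map w := by
    simp [hS, Sym.rot_map]
  unfold avg unif
  rw [integral_smul_measure, integral_smul_measure]
  simp only [hadd]
  rw [h1.integral_comp S.equiv.measurableEmbedding (fun w => f (S.map z + w))]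

theorem exists_rot_eq (z w : Pt m ℓ) (h1 : ‖z.1‖ = ‖w.1‖) (h2 : ‖z.2‖ = ‖w.2‖) :
    ∃ A B, (Sym.rot γ A B).map z = w :=
  ⟨_, _, (Sym.rot_map _ _ z).trans
    (Prod.ext (Submodule.reflection_sub h1) (Submodule.reflection_sub h2))⟩

/-- Invariance holds only almost everywhere, with a null set depending on the rotation. Averages
over boxes are invariant at every point, and they converge to `f` almost everywhere along a
subsequence; so `g` is the limit of their values at one representative of each orbit. -/
theorem exists_eq_norm_of_rot (hm : 1 ≤ m) (hℓ : 1 ≤ ℓ) {f : Pt m ℓ → ℝ} {L : ℝ}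
    (hf : Averaging γ f L)
    (h : ∀ A B, (fun z => f ((Sym.rot γ A B).map z)) =ᵐ[volume] f) :
    ∃ g : ℝ → ℝ → ℝ, ∀ᵐ z : Pt m ℓ, f z = g ‖z.1‖ ‖z.2‖ := by
  set τ : ℕ → ℝ := fun n => 1 / ((n : ℝ) + 1) with hτ
  have hτ0 (n : ℕ) : 0 < τ n := by positivity
  have hlim : Tendsto (fun n => eLpNorm (avg γ (τ n) f - f) 2 volume) atTop (𝓝 0) := by
    have h1 : Tendsto (fun n => ENNReal.ofReal (7 * τ n * L)) atTop (𝓝 0) := by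
      have := ENNReal.tendsto_ofReal
        ((tendsto_one_div_add_atTop_nhds_zero_nat.const_mul (7 : ℝ)).mul_const L)
      simpa [hτ] using this
    exact tendsto_of_tendsto_of_tendsto_of_le_of_le tendsto_const_nhds h1 (fun _ => zero_le)
      fun n => hf.sub_le (τ n) (hτ0 n)
  obtain ⟨ns, -, hns⟩ := (tendstoInMeasure_of_tendsto_eLpNorm (by norm_num)
    (fun n => (measurable_avg (hτ0 n) hf.meas).aestronglyMeasurable)
    hf.meas.aestronglyMeasurable hlim).exists_seq_tendsto_ae
  set e₁ : EuclideanSpace ℝ (Fin m) := EuclideanSpace.single ⟨0, hm⟩ 1 with he₁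
  set e₂ : EuclideanSpace ℝ (Fin ℓ) := EuclideanSpace.single ⟨0, hℓ⟩ 1 with he₂
  refine ⟨fun s t => limUnder atTop fun k => avg γ (τ (ns k)) f (s • e₁, t • e₂), ?_⟩
  filter_upwards [hns] with z hz
  refine (Tendsto.limUnder_eq (hz.congr fun k => ?_)).symm
  obtain ⟨A, B, hAB⟩ := exists_rot_eq (γ := γ) z (‖z.1‖ • e₁, ‖z.2‖ • e₂)
    (by simp [norm_smul, he₁]) (by simp [norm_smul, he₂])
  rw [← hAB, avg_rot, avg_congr _ (h A B)]

theorem H1rad_eq_rad (hm : 1 ≤ m) (hℓ : 1 ≤ ℓ) : H1rad m ℓ γ = (H1.model hm).rad := by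
  refine le_antisymm ?_ ?_
  · rintro u ⟨g, hg⟩ A B
    refine (H1.model hm).ext_fn ?_
    have h1 := (Sym.rot γ A B).measurePreserving.quasiMeasurePreserving.ae hg
    have h2 : ∀ᵐ z, (H1.model hm).fn u ((Sym.rot γ A B).map z) = (H1.model hm).fn u z := by
      filter_upwards [h1, hg] with z k1 k2
      rw [Sym.rot_map, A.norm_map, B.norm_map] at k1
      refine (Eq.trans ?_ k1).trans k2.symm
      rw [Sym.rot_map]
      rfl
    exact ((H1.model hm).fn_pull _ u).trans h2
  · intro u hu
    refine exists_eq_norm_of_rot hm hℓ ((H1.model hm).averaging u) fun A B => ?_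
    have h1 := (H1.model hm).fn_pull (Sym.rot γ A B) u
    rw [hu A B] at h1
    exact h1.symm

/-! ### A test function -/

/-- Integration by parts from translation invariance: $\int\rho\,(\varphi\psi)(\cdot-te)$ does not
depend on $t$, because the weight is constant along `e`. -/
theorem weakDeriv_test {ρ : Pt m ℓ → ℝ} (hρ : Continuous ρ) {e : Pt m ℓ}
    (hρe : ∀ z (t : ℝ), ρ (z + t • e) = ρ z) {φ : Pt m ℓ → ℝ} (h1 : ContDiff ℝ ∞ φ)
    (h2 : HasCompactSupport φ) : WeakDeriv ρ e φ fun z => ρ z * fderiv ℝ φ z e := by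
  intro ψ k1 k2
  have hd := hasDerivAt_integral_translate (f := ρ) (hρ.locallyIntegrable) (h1.mul k1)
    (h2.mul_right) e 0
  have hconst : (fun t : ℝ => ∫ z, ρ z * (φ (z - t • e) * ψ (z - t • e))) =
      fun _ => ∫ z, ρ z * (φ z * ψ z) := by
    funext t
    have := integral_sub_right_eq_self (μ := (volume : Measure (Pt m ℓ)))
      (fun z => ρ z * (φ z * ψ z)) (t • e)
    rw [← this]
    refine integral_congr_ae (Eventually.of_forall fun z => ?_)
    have h := hρe (z - t • e) t
    rw [sub_add_cancel] at h
    simp only [h]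
  have h0 := (hd.congr_of_eventuallyEq (f₁ := fun _ => ∫ z, ρ z * (φ z * ψ z))
    (Eventually.of_forall fun t => (congrFun hconst t).symm)).unique (hasDerivAt_const _ _)
  have i1 : Integrable fun z => φ z * (ρ z * fderiv ℝ ψ z e) :=
    (memLp_test h1.continuous h2).integrable_mul (memLp_fderiv_weight k1 k2 hρ e)
  have i2 : Integrable fun z => ρ z * fderiv ℝ φ z e * ψ z :=
    (memLp_fderiv_weight h1 h2 hρ e).integrable_mul (memLp_test k1.continuous k2)
  rw [eq_neg_iff_add_eq_zero, ← integral_add i1 i2, ← neg_eq_zero, ← h0]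
  refine congrArg _ (integral_congr_ae (Eventually.of_forall fun z => ?_))
  have hφ := (h1.differentiable (by simp)) z
  have hψ := (k1.differentiable (by simp)) z
  simp only [zero_smul, sub_zero]
  rw [fderiv_fun_mul hφ hψ]
  simp only [add_apply, smul_apply, smul_eq_mul]
  ring

theorem exists_radial_test (m ℓ : ℕ) : ∃ χ : ℝ → ℝ, χ 0 = 1 ∧
    ContDiff ℝ ∞ (fun z : Pt m ℓ => χ ‖z.1‖ * χ ‖z.2‖) ∧
    HasCompactSupport fun z : Pt m ℓ => χ ‖z.1‖ * χ ‖z.2‖ := by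
  refine ⟨fun s => Real.smoothTransition (2 - s ^ 2),
    Real.smoothTransition.one_of_one_le (by norm_num), ?_, ?_⟩
  · refine ContDiff.mul ?_ ?_
    · exact Real.smoothTransition.contDiff.comp (contDiff_const.sub (contDiff_fst.norm_sq ℝ))
    · exact Real.smoothTransition.contDiff.comp (contDiff_const.sub (contDiff_snd.norm_sq ℝ))
  · have hχ (s : ℝ) (hs : 2 < s) : Real.smoothTransition (2 - s ^ 2) = 0 :=
      Real.smoothTransition.zero_of_nonpos (by nlinarith)
    refine HasCompactSupport.intro (isCompact_closedBall (0 : Pt m ℓ) 2) fun z hz => ?_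
    rw [mem_closedBall_zero_iff, not_le, Prod.norm_def, lt_max_iff] at hz
    rcases hz with hz | hz
    · simp only [hχ _ hz, zero_mul]
    · simp only [hχ _ hz, mul_zero]

theorem isWeakGrad_test {φ : Pt m ℓ → ℝ} (h1 : ContDiff ℝ ∞ φ) (h2 : HasCompactSupport φ) :
    IsWeakGrad γ φ (vecOf (fun i => derivX i φ) fun j => derivY γ j φ) := by
  refine isWeakGrad_of_weakDeriv (fun i => ?_) fun j => ?_
  · have := weakDeriv_test (ρ := fun _ : Pt m ℓ => 1) continuous_const
      (e := (EuclideanSpace.single i (1 : ℝ), 0)) (fun _ _ => rfl) h1 h2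
    simpa [vecOf, derivX] using this
  · have := weakDeriv_test (continuous_weight (m := m) (ℓ := ℓ) γ)
      (e := (0, EuclideanSpace.single j (1 : ℝ))) (fun z t => by simp) h1 h2
    simpa [vecOf, derivY] using this

theorem H1.exists_fn_eq_test {φ : Pt m ℓ → ℝ} (h1 : ContDiff ℝ ∞ φ) (h2 : HasCompactSupport φ) :
    ∃ u : H1 m ℓ γ, H1.fn u =ᵐ[volume] φ :=
  ⟨_, H1.fn_mk (memLp_test h1.continuous h2)
    (memLp_vecOf (fun i => memLp_derivX i h1 h2) fun j => memLp_derivY γ j h1 h2)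
    (isWeakGrad_test h1 h2)⟩

theorem exists_ne_zero_mem_H1rad (m ℓ : ℕ) (γ : ℝ≥0) : ∃ u ∈ H1rad m ℓ γ, u ≠ 0 := by
  obtain ⟨χ, hχ, h1, h2⟩ := exists_radial_test m ℓ
  obtain ⟨u, hu⟩ := H1.exists_fn_eq_test (γ := γ) h1 h2
  refine ⟨u, ⟨fun s t => χ s * χ t, hu⟩, ?_⟩
  rintro rfl
  have h3 := (Continuous.ae_eq_iff_eq volume h1.continuous (continuous_const (y := (0 : ℝ)))).1
    (hu.symm.trans H1.fn_zero)
  have h4 := congrFun h3 0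
  simp [hχ] at h4

/-! ### The energy -/

variable {μ p t₁ t₂ : ℝ}

theorem Exps.integrable_ker2_fn (h : Exps m ℓ γ μ p t₁ t₂) (u : H1 m ℓ γ) :
    Integrable (ker2 γ μ (fun z => |H1.fn u z| ^ p) fun z => |H1.fn u z| ^ p) := by
  obtain ⟨S, hS, hs⟩ := h.exists_lbound (H1.model h.hm)
  exact h.integrable_ker2 (h.xbound_rpow (hs u)) (h.xbound_rpow (hs u))

theorem Exps.finiteEnergy (h : Exps m ℓ γ μ p t₁ t₂) (u : H1 m ℓ γ) : FiniteEnergy μ p u :=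
  h.integrable_ker2_fn u

theorem bil_eq_integral_choquard {f g : Pt m ℓ → ℝ}
    (hi : Integrable (ker2 γ μ (fun z => |f z| ^ p) g)) :
    Integrable (fun z => choquard γ μ p f z * g z) ∧
      ∫ z, choquard γ μ p f z * g z = bil γ μ (fun z => |f z| ^ p) g := by
  have h1 (z : Pt m ℓ) : ∫ w, ker2 γ μ (fun z => |f z| ^ p) g (z, w) = choquard γ μ p f z * g z := by
    rw [choquard, ← integral_mul_const]
    rfl
  refine ⟨?_, ?_⟩
  · have := hi.integral_prod_left
    simpa only [h1] using this
  · refine Eq.trans ?_ (integral_prod _ hi).symm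
    simp only [h1]

theorem H1.integral_norm_sq (u : H1 m ℓ γ) :
    ∫ z, (‖H1.grad u z‖ ^ 2 + |H1.fn u z| ^ 2) = ‖u‖ ^ 2 := by
  rw [← real_inner_self_eq_norm_sq, H1.inner_eq]
  refine integral_congr_ae (Eventually.of_forall fun z => ?_)
  simp only [real_inner_self_eq_norm_sq, sq_abs]
  ring

theorem Exps.energy_eq (h : Exps m ℓ γ μ p t₁ t₂) (u : H1 m ℓ γ) :
    energy μ p u = 1 / 2 * ‖u‖ ^ 2 - 1 / (2 * p) * (H1.model h.hm).dfun μ p u := by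
  rw [energy, H1.integral_norm_sq, (bil_eq_integral_choquard (h.integrable_ker2_fn u)).2]
  rfl

/-- The weak formulation is the identity $\langle N(u),v\rangle=\langle u,v\rangle$ read through
Fubini. Finiteness of the convolution is a separate matter, since $u$ may vanish on a large set;
pairing with indicators of balls settles it. -/
theorem Exps.isWeakSolution (h : Exps m ℓ γ μ p t₁ t₂) {u : H1 m ℓ γ}
    (hu : h.nonlin (H1.model h.hm) u = u) : IsWeakSolution μ p u := by
  obtain ⟨S, hS, hs⟩ := h.exists_lbound (H1.model h.hm)
  refine ⟨?_, fun v => ?_⟩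
  · have hball (n : ℕ) : ∀ᵐ z : Pt m ℓ, z ∈ Metric.closedBall (0 : Pt m ℓ) n →
        Integrable fun w => gauge γ (z - w) ^ (-μ) * |H1.fn u w| ^ p := by
      set K := Metric.closedBall (0 : Pt m ℓ) n with hK
      have hKm : MeasurableSet K := Metric.isClosed_closedBall.measurableSet
      have hm1 (t : ℝ) : MemLp (K.indicator fun _ => (1 : ℝ)) (ENNReal.ofReal t)
          (volume : Measure (Pt m ℓ)) :=
        memLp_indicator_const _ hKm 1 (Or.inr Metric.isBounded_closedBall.measure_lt_top.ne)
      have hX : XBound t₁ t₂ (K.indicator fun _ => (1 : ℝ))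
          (nX t₁ t₂ (K.indicator fun _ => (1 : ℝ))).toReal := by
        refine ⟨ENNReal.toReal_nonneg, (hm1 1).1, (ENNReal.ofReal_toReal ?_).ge⟩
        exact ENNReal.add_ne_top.2 ⟨(hm1 _).2.ne, (hm1 _).2.ne⟩
      have hi := (h.integrable_ker2 (h.xbound_rpow (hs u)) hX).prod_right_ae
      filter_upwards [hi] with z hz hzK
      refine hz.congr (Eventually.of_forall fun w => ?_)
      simp only [ker2, Set.indicator_of_mem hzK, mul_one]
      rfl
    filter_upwards [ae_all_iff.2 hball] with z hz
    obtain ⟨k, hk⟩ := exists_nat_ge ‖z‖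
    exact hz k (by rwa [mem_closedBall_zero_iff])
  · have hi := h.integrable_ker2 (h.xbound_rpow (hs u)) (h.xbound_psi (hs u) (hs v))
    obtain ⟨h1, h2⟩ := bil_eq_integral_choquard hi
    have h3 (z : Pt m ℓ) : choquard γ μ p (H1.fn u) z * |H1.fn u z| ^ (p - 2) * H1.fn u z *
        H1.fn v z = choquard γ μ p (H1.fn u) z * (psi p (H1.fn u z) * H1.fn v z) := by
      rw [psi]
      ring
    simp only [h3]
    refine ⟨h1, ?_⟩
    rw [← H1.inner_eq, sub_eq_zero]
    refine Eq.trans ?_ h2.symm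
    rw [← h.inner_nonlin (H1.model h.hm) u v, hu]

end

end Grushin

/-! ### The theorem. -/

theorem mainTheorem1 (m ℓ : ℕ) (hm : 1 ≤ m) (hℓ : 1 ≤ ℓ) (hN : 3 ≤ m + ℓ)
    (γ : ℝ≥0) (μ p : ℝ) (hμ0 : 0 < μ) (hμ : μ < Grushin.homDim m ℓ γ)
    (hp1 : (Grushin.homDim m ℓ γ - 2) / (2 * Grushin.homDim m ℓ γ - μ) < 1 / p)
    (hp2 : 1 / p < Grushin.homDim m ℓ γ / (2 * Grushin.homDim m ℓ γ - μ)) :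
    (∀ w : Grushin.H1 m ℓ γ, Grushin.FiniteEnergy μ p w) ∧
    ∃ R : ℝ, 0 < R ∧ ∃ a : ℝ, 0 < a ∧ ∃ v : Grushin.H1rad m ℓ γ,
      (∀ w : Grushin.H1rad m ℓ γ, ‖w‖ = R → a ≤ Grushin.energy μ p (w : Grushin.H1 m ℓ γ)) ∧
      R < ‖v‖ ∧ Grushin.energy μ p (v : Grushin.H1 m ℓ γ) < 0 ∧
      ∃ u : Grushin.H1 m ℓ γ,
        ¬ (Grushin.H1.fn u =ᵐ[volume] 0) ∧
        Grushin.IsWeakSolution μ p u ∧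
        u ∈ Grushin.H1rad m ℓ γ ∧
        HasFDerivAt (Grushin.energy μ p) (0 : Grushin.H1 m ℓ γ →L[ℝ] ℝ) u ∧
        Grushin.IsMountainPassLevel μ p v (Grushin.energy μ p u) ∧
        a ≤ Grushin.energy μ p u := by
  refine (Grushin.exists_exps hm hℓ hN hμ0 hμ hp1 hp2).elim fun t₁ h => h.elim fun t₂ h => ?_
  have hrad := Grushin.H1rad_eq_rad (γ := γ) hm hℓ
  have hne := Grushin.exists_ne_zero_mem_H1rad m ℓ γ
  exact ⟨h.finiteEnergy, h.exists_mountain_pass hN (Grushin.H1.model hm) (V := Grushin.H1rad m ℓ γ)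
    hrad hne (J := Grushin.energy μ p) h.energy_eq (P := Grushin.IsWeakSolution μ p)
    fun _ hu => h.isWeakSolution hu⟩
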